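/- **Lemma (obliviousness of the recursive three-server ORAM).** Let $N=2^D$ with $D\ge 0$, let data blocks have any fixed length, and let the contents of blocks (dummies, keyed blocks, pointers, permutation values) be written by any fixed injective encoding as bit strings of one common length. The recursive three-server ORAM described below is *perfectly oblivious against a semi-honest adversary corrupting a single server*: for every set $A$ of at most one of the servers $S_0,S_1,S_2$ and any two sequences $R_0,R_1$ of equal length of logical requests $(\mathsf{read},a)$, $(\mathsf{write},a,v)$ with $a\in\{0,\dots,N-1\}$, the random variables $\mathsf{view}^A(R_0)$ and $\mathsf{view}^A(R_1)$ are identically distributed. The client is trusted and the servers are passive memories without input and randomness. One block is exchanged per round. $\mathsf{view}^A(R)$ is the transcript, ordered by rounds, in which for a corrupt server each message it receives appears in full (kind, address, and block if it is a write) and for an honest server only the fact that the client fetches a block from it or sends one to it. *Sharing.* Server indices are mod 3. An abstract array $T=T_0\oplus T_1\oplus T_2$ is stored with $T_b$ on $S_b$ and $S_{b-1}$. To *secretly write* an entry, store fresh uniform XOR shares of it; to *reconstruct* an entry, read its $b$-th share from $S_b$, for all $b$. A *permuted layout* has uniform independent permutations $\pi_0,\pi_1,\pi_2$, with $\pi_{b+1}$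 written on $S_b$ and entry $i$ of share $b$ at place $\pi_b(i)$. $\mathsf{Permute}$ and $\mathsf{Unpermute}$ convert between unpermuted and permuted layouts: $S_b$ holds share $b+1$ and $\pi_{b+1}$, permutes the share (or undoes this), fresh masks with XOR zero are applied to the unpermuted shares, and the result is sent to $S_{b+1}$ in the order of places. *$\mathsf{StableCompact}$ and $\mathsf{Merge}$.* The first moves dummies to the end, keeping the order of real blocks; the second merges two lists sorted by key (dummies anywhere) into a sorted list with dummies last, ties in favour of the first list. Both draw fresh permutations, secretly link in a reverse scan every real (dummy) entry to the permuted places of the next real (dummy) entry of the same list, $\mathsf{Permute}$ entries and links, then traverse the linked lists (reals first, then dummies), reconstructing each entry once and secretly writing the output. $\mathsf{Merge}$ first fetches one entry of each list, then after each output fetches exactly one further entry while any remains: from the list just output, or from the other list if that one is used up. *One-time memory.* $\mathsf{Build}$ on a sorted list of length $n$ appends $n$ special dummies, draws permutations of $2n$ places, secretly links the special dummies into a list and secretly writes its head, secretly writes a list $U$ of pairs (key, tuple of its three permuted places) in sorted order, and $\mathsf{Permute}$s entries and links. $\mathsf{Lookup}$ reconstructs the dummy head, reconstructs entry and link at the supplied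 places (for a dummy request: at the head), and secretly rewrites the head, which is replaced by the link for a dummy request. $\mathsf{Getall}$ $\mathsf{Unpermute}$s and returns the first $n$ entries. *Position-based ORAMs.* For $0\le d\le D$, $\mathsf{ORAM}_d$ has levels $0,\dots,d$; level $j$ is empty or a one-time memory with $n=2^j$. Initially all are empty. $\mathsf{ORAM}_D$ stores data blocks; for $d<D$ the block at a $d$-bit address $a$ in $\mathsf{ORAM}_d$ stores the position labels (level and place tuple) of the children $a\|0$, $a\|1$ in $\mathsf{ORAM}_{d+1}$. $\mathsf{Lookup}$ makes one request to each nonempty level, a real one at the level named by the label and dummy ones elsewhere. $\mathsf{Shuffle}_d$ for level $l$ applies $\mathsf{Getall}$ to the size-one memory of the fetched block and to the nonempty levels $\le l$, merges them successively in this order, keeps the first entry of each key and turns the others into dummies, compacts, and keeps $2^l$ entries; if $d<D$ it merges the result with the update array $U^d$, combines entries of equal key (new labels where present, old ones otherwise), compacts and keeps $2^l$ entries; then it builds level $l$, which gives $U$. Levels below $l$ become empty. $\mathsf{Convert}$ turns $U$ (depth $d$) into $U^{d-1}$ by one scan with neighbours: an entry with sibling to its right becomes (parent, both labels), one with sibling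 to its left a dummy, any other real entry (parent, its label for its side, no update for the other side), a dummy a dummy. *A request.* For $d=0,\dots,D$: look up the $d$-bit prefix of $a$ in $\mathsf{ORAM}_d$ with the label found at depth $d-1$ (at depth 0, where a single block is stored, its places $\pi_b(0)$ are read from the servers $S_{b-1}$); a block never accessed before has no label, is looked up by dummy requests at all nonempty levels, and has content $0$, respectively no child labels; place the block (with the new value for a write, at depth $D$) in a one-time memory of size one. Then let $l^D$ be the smallest empty level of $\mathsf{ORAM}_D$ ($D$ if there is none); for $d=D,\dots,0$ run $\mathsf{Shuffle}_d$ for level $\min(d,l^D)$ and, if $d\ge1$, $U^{d-1}:=\mathsf{Convert}(U)$. The client outputs the old content of the block. -/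

import Mathlib

namespace RecORAM

/-! ## Passive-server protocols with three servers -/

/-- Bit strings of length `w`; addition is bitwise XOR. -/
abbrev Bits (w : ℕ) : Type := Fin w → ZMod 2

/-- A memory address on a server. Every server keeps three banks of cells: bank `b` is the place
for the objects that carry the index `b` (the `b`-th share `T_b` or the permutation `π_b`). -/
structure Addr where
  bank : Fin 3
  cell : ℕ
  deriving DecidableEq

/-- A program of the trusted client. The servers are passive memories holding blocks of `w` bits:
the client asks server `s` for the block at an address, or asks it to store a block; it draws a
uniform block or a uniform permutation; and it reserves `n` consecutive unused cells
(the same cells on all servers). -/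
inductive Client (w : ℕ) (α : Type) : Type where
  | done (a : α) : Client w α
  | readThen (s : Fin 3) (a : Addr) (k : Bits w → Client w α) : Client w α
  | writeThen (s : Fin 3) (a : Addr) (v : Bits w) (k : Client w α) : Client w α
  | coinsThen (k : Bits w → Client w α) : Client w α
  | permThen (n : ℕ) (k : Equiv.Perm (Fin n) → Client w α) : Client w α
  | reserveThen (n : ℕ) (k : ℕ → Client w α) : Client w α

namespace Client

variable {w : ℕ} {α β : Type}

def andThen : Client w α → (α → Client w β) → Client w β
  | done a, f => f a
  | readThen s a k, f => readThen s a fun x => (k x).andThen f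
  | writeThen s a v k, f => writeThen s a v (k.andThen f)
  | coinsThen k, f => coinsThen fun x => (k x).andThen f
  | permThen n k, f => permThen n fun x => (k x).andThen f
  | reserveThen n k, f => reserveThen n fun x => (k x).andThen f

instance : Monad (Client w) where
  pure := done
  bind := andThen

def read (s : Fin 3) (a : Addr) : Client w (Bits w) := readThen s a done
def write (s : Fin 3) (a : Addr) (v : Bits w) : Client w Unit := writeThen s a v (done ())
def coins : Client w (Bits w) := coinsThen done
def perm (n : ℕ) : Client w (Equiv.Perm (Fin n)) := permThen n done
def reserve (n : ℕ) : Client w ℕ := reserveThen n done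

end Client

/-- One message of the client to a server (for a read, followed by the server's answer).
Exactly one such exchange takes place per round, so the round is the position in the transcript. -/
inductive Message (w : ℕ) : Type where
  | read (s : Fin 3) (a : Addr) : Message w
  | write (s : Fin 3) (a : Addr) (v : Bits w) : Message w

def Message.server {w : ℕ} : Message w → Fin 3
  | .read s _ => s
  | .write s _ _ => s

def Message.isWrite {w : ℕ} : Message w → Bool
  | .read _ _ => false
  | .write _ _ _ => true

/-- The memories of the three servers, and the first cell that is not yet reserved. -/
structure Memory (w : ℕ) : Type where
  block : Fin 3 → Addr → Bits w
  next : ℕ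

def Memory.blank (w : ℕ) : Memory w := ⟨fun _ _ => 0, 0⟩

def Memory.set {w : ℕ} (m : Memory w) (s : Fin 3) (a : Addr) (v : Bits w) : Memory w :=
  { m with block := Function.update m.block s (Function.update (m.block s) a v) }

/-- The joint distribution of transcript, result and final memories of an execution. -/
noncomputable def Client.run {w : ℕ} {α : Type} :
    Client w α → Memory w → PMF (List (Message w) × α × Memory w)
  | .done a, m => PMF.pure ([], a, m)
  | .readThen s a k, m =>
      ((k (m.block s a)).run m).map fun r => (Message.read s a :: r.1, r.2)
  | .writeThen s a v k, m =>
      (k.run (m.set s a v)).map fun r => (Message.write s a v :: r.1, r.2)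
  | .coinsThen k, m => (PMF.uniformOfFintype (Bits w)).bind fun x => (k x).run m
  | .permThen n k, m => (PMF.uniformOfFintype (Equiv.Perm (Fin n))).bind fun x => (k x).run m
  | .reserveThen n k, m => (k m.next).run { m with next := m.next + n }

/-- What the adversary sees of a message: all of it if it goes to a corrupt server, otherwise only
which honest server the client talks to and whether blocks are sent or fetched. The servers have
no input and use no randomness. -/
def observe {w : ℕ} (A : Finset (Fin 3)) (e : Message w) : Message w ⊕ (Fin 3 × Bool) :=
  if e.server ∈ A then Sum.inl e else Sum.inr (e.server, e.isWrite)

/-- A logical memory request for `2 ^ D` addresses holding blocks of `B` bits. -/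
inductive Request (D B : ℕ) : Type where
  | read (addr : Fin (2 ^ D)) : Request D B
  | write (addr : Fin (2 ^ D)) (v : Bits B) : Request D B

/-- A three-server ORAM with passive servers: between requests the client keeps a state of type
`State`; each request is answered by a client program. -/
structure Scheme (D B : ℕ) : Type 1 where
  width : ℕ
  State : Type
  start : State
  access : State → Request D B → Client width (Bits B × State)

/-- Serve a request sequence, returning the client's outputs. -/
def Scheme.serve {D B : ℕ} (S : Scheme D B) :
    S.State → List (Request D B) → Client S.width (List (Bits B))
  | _, [] => pure []
  | st, r :: rs => do
      let (v, st') ← S.access st r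
      let vs ← S.serve st' rs
      pure (v :: vs)

/-- The distribution of the view of an adversary corrupting the servers in `A`. -/
noncomputable def Scheme.view {D B : ℕ} (S : Scheme D B) (A : Finset (Fin 3))
    (R : List (Request D B)) : PMF (List (Message S.width ⊕ (Fin 3 × Bool))) :=
  ((S.serve S.start R).run (Memory.blank S.width)).map fun r => r.1.map (observe A)

/-- Perfect obliviousness against a semi-honest adversary corrupting up to `t` servers. -/
def Scheme.PerfectlyOblivious {D B : ℕ} (S : Scheme D B) (t : ℕ) : Prop :=
  ∀ A : Finset (Fin 3), A.card ≤ t → ∀ R₀ R₁ : List (Request D B), R₀.length = R₁.length →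
    S.view A R₀ = S.view A R₁

/-! ## Contents of blocks -/

/-- A tuple `(pos_0, pos_1, pos_2)` of positions. -/
abbrev Pos (D : ℕ) : Type := Fin 3 → Fin (2 ^ (D + 1))

/-- A position label: a level, and a position tuple inside the one-time memory of that level. -/
structure Label (D : ℕ) : Type where
  level : Fin (D + 1)
  pos : Pos D
  deriving Fintype

/-- Everything that is stored in a block. Logical addresses at depth `d ≤ D` are numbers `< 2 ^ d`,
the children of `a` being `2 a` and `2 a + 1`. -/
inductive Item (D B : ℕ) : Type where
  /-- the dummy `⊥` -/
  | dummy : Item D B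
  /-- the special dummies appended to a one-time memory -/
  | special (i : Fin (2 ^ D)) : Item D B
  /-- a real block of depth `D` -/
  | data (key : Fin (2 ^ D)) (v : Bits B) : Item D B
  /-- a real block of depth `d < D` with the labels of its two children (`none`: the child has
  never been accessed), or an entry of an update array (`none`: no update) -/
  | labels (key : Fin (2 ^ D)) (left right : Option (Label D)) : Item D B
  /-- an entry of a key-position map -/
  | place (key : Fin (2 ^ D)) (p : Pos D) : Item D B
  /-- a pointer of a linked list -/
  | link (p : Option (Pos D)) : Item D B
  /-- a value of a permutation -/
  | index (i : Fin (2 ^ (D + 1))) : Item D B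
  deriving Fintype

namespace Item

variable {D B : ℕ}

def key? : Item D B → Option (Fin (2 ^ D))
  | data k _ => some k
  | labels k _ _ => some k
  | place k _ => some k
  | _ => none

def isReal (x : Item D B) : Bool := x.key?.isSome

def asIndex : Item D B → Fin (2 ^ (D + 1))
  | index i => i
  | _ => 0

def asLink : Item D B → Option (Pos D)
  | link p => p
  | _ => none

/-- `x` goes before `y` in a sorted list: by address, dummies last, ties in favour of `x`. -/
def before (x y : Item D B) : Bool :=
  match x.key?, y.key? with
  | some a, some b => decide (a ≤ b)
  | some _, none => true
  | none, some _ => false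
  | none, none => true

/-- Take the new labels where there are some and the old ones elsewhere. -/
def update : Item D B → Item D B → Item D B
  | labels k l r, labels _ l' r' => labels k (l' <|> l) (r' <|> r)
  | x, _ => x

/-- The label of the left (`b = 0`) or right (`b = 1`) child. -/
def childLabel (x : Item D B) (b : ℕ) : Option (Label D) :=
  match x with
  | labels _ l r => if b = 0 then l else r
  | _ => none

def value : Item D B → Bits B
  | data _ v => v
  | _ => 0

end Item

/-- A way to write the contents of a block as a bit string of some fixed length. -/
structure BlockFormat (D B : ℕ) : Type where
  width : ℕ
  encode : Item D B → Bits width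
  decode : Bits width → Item D B
  decode_encode : ∀ x, decode (encode x) = x

/-- Formats exist, for every length `w` with enough bit strings. -/
theorem BlockFormat.exists_width (D B w : ℕ) (h : Fintype.card (Item D B) ≤ 2 ^ w) :
    ∃ F : BlockFormat D B, F.width = w := by
  have hc : Fintype.card (Item D B) ≤ Fintype.card (Bits w) := by simpa [ZMod.card] using h
  obtain ⟨f⟩ := Function.Embedding.nonempty_of_card_le hc
  have : Nonempty (Item D B) := ⟨.dummy⟩
  exact ⟨⟨w, f, Function.invFun f, Function.leftInverse_invFun f.injective⟩, rfl⟩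

/-! ## Arrays, secret writes, reconstruction -/

/-- An array of known length; entry `i` lies in cell `cell i`. For an abstract array `T` the
`b`-th share `T_b[i]` lies in bank `b` on the servers `b` and `b - 1`; for a triple of
permutations `π_b(i)` lies in bank `b` on server `b - 1`. -/
structure Arr : Type where
  len : ℕ
  cell : ℕ → ℕ

def Arr.take (T : Arr) (n : ℕ) : Arr := { T with len := min n T.len }

def Arr.append (S T : Arr) : Arr :=
  ⟨S.len + T.len, fun i => if i < S.len then S.cell i else T.cell (i - S.len)⟩

section Protocols

variable {D B : ℕ} (F : BlockFormat D B)

def newArr {w : ℕ} (n : ℕ) : Client w Arr := do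
  let base ← Client.reserve n
  pure ⟨n, fun i => base + i⟩

/-- Perform an action for `b = 0, 1, 2` and collect the results. -/
def collect {w : ℕ} {α : Type} (f : Fin 3 → Client w α) : Client w (Fin 3 → α) := do
  let x ← f 0
  let y ← f 1
  let z ← f 2
  pure ![x, y, z]

def forServers {w : ℕ} (f : Fin 3 → Client w Unit) : Client w Unit := do
  f 0
  f 1
  f 2

/-- Write fresh XOR-shares of `x` to entry `i` of `T`. -/
def secretWrite (T : Arr) (i : ℕ) (x : Item D B) : Client F.width Unit := do
  let r ← Client.coins
  let r' ← Client.coins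
  let share : Fin 3 → Bits F.width := ![r, r', F.encode x + r + r']
  forServers fun b => do
    Client.write b ⟨b, T.cell i⟩ (share b)
    Client.write (b - 1) ⟨b, T.cell i⟩ (share b)

/-- Read share `b` at position `p b` from its storage server `b`. -/
def reconstruct (T : Arr) (p : Fin 3 → ℕ) : Client F.width (Item D B) := do
  let x ← collect fun b => Client.read b ⟨b, T.cell (p b)⟩
  pure (F.decode (x 0 + x 1 + x 2))

/-- Reconstruct entry `i` of an unpermuted array. -/
def reconstructAt (T : Arr) (i : ℕ) : Client F.width (Item D B) := reconstruct F T fun _ => i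

/-- Recover entry `i` of an unpermuted array, reading share `b + 1` from server `b`. -/
def scanAt (T : Arr) (i : ℕ) : Client F.width (Item D B) := do
  let x ← collect fun b => Client.read (b - 1) ⟨b, T.cell i⟩
  pure (F.decode (x 0 + x 1 + x 2))

/-- Draw independent uniform permutations `π_0, π_1, π_2` and write `π_(b+1)` to server `b`. -/
def genPerms (n : ℕ) : Client F.width Arr := do
  let P ← newArr n
  forServers fun b => do
    let π ← Client.perm n
    (List.finRange n).forM fun i =>
      Client.write b ⟨b + 1, P.cell i⟩ (F.encode (.index (Fin.ofNat _ (π i).val)))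
  pure P

/-- The tuple `(π_0(i), π_1(i), π_2(i))`, read from the permutation servers. -/
def readPos (P : Arr) (i : ℕ) : Client F.width (Pos D) :=
  collect fun b => do
    let x ← Client.read (b - 1) ⟨b, P.cell i⟩
    pure (F.decode x).asIndex

/-! ## Permute and unpermute -/

/-- Random masks with sum zero are applied to all shares of all entries of `S`; server `b` handles
share `b + 1`, the results going to `T`. -/
def maskShares (S T : Arr) : Client F.width Unit :=
  (List.range S.len).forM fun i => do
    let r ← Client.coins
    let r' ← Client.coins
    let mask : Fin 3 → Bits F.width := ![r, r', r + r']
    forServers fun b => do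
      let x ← Client.read b ⟨b + 1, S.cell i⟩
      Client.write b ⟨b + 1, T.cell i⟩ (x + mask (b + 1))

/-- Send share `b + 1` of `T` from server `b` to server `b + 1`, entry by entry. -/
def sendShares (T : Arr) : Client F.width Unit :=
  forServers fun b =>
    (List.range T.len).forM fun i => do
      let x ← Client.read b ⟨b + 1, T.cell i⟩
      Client.write (b + 1) ⟨b + 1, T.cell i⟩ x

/-- `Permute`: the entry at `i` moves to `π_b(i)` in the `b`-th share of the result. -/
def permute (P T : Arr) : Client F.width Arr := do
  let M ← newArr T.len
  let R ← newArr T.len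
  maskShares F T M
  forServers fun b =>
    (List.range T.len).forM fun i => do
      let j ← Client.read b ⟨b + 1, P.cell i⟩
      let x ← Client.read b ⟨b + 1, M.cell i⟩
      Client.write b ⟨b + 1, R.cell (F.decode j).asIndex⟩ x
  sendShares F R
  pure R

/-- `Unpermute`: the inverse operation. -/
def unpermute (P T : Arr) : Client F.width Arr := do
  let M ← newArr T.len
  let R ← newArr T.len
  forServers fun b =>
    (List.range T.len).forM fun i => do
      let j ← Client.read b ⟨b + 1, P.cell i⟩
      let x ← Client.read b ⟨b + 1, T.cell (F.decode j).asIndex⟩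
      Client.write b ⟨b + 1, M.cell i⟩ x
  maskShares F M R
  sendShares F R
  pure R

/-! ## Stable compaction and merging -/

/-- Reverse scan that secretly links every entry of `T` to the next one of its class. The class of
an entry tells whether its index is `≥ n₁` and whether it is real. The result holds the
positions of the first entries of all classes, and the array of links. -/
def linkScan (T P : Arr) (n₁ : ℕ) :
    Client F.width ((Bool → Bool → Option (Pos D)) × Arr) := do
  let L ← newArr T.len
  let heads ← (List.range T.len).reverse.foldlM (init := fun _ _ => none)
    fun (heads : Bool → Bool → Option (Pos D)) i => do
      let x ← scanAt F T i
      let p ← readPos F P i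
      let c : Bool := decide (n₁ ≤ i)
      secretWrite F L i (.link (heads c x.isReal))
      pure (Function.update heads c (Function.update (heads c) x.isReal (some p)))
  pure (heads, L)

/-- State of a traversal of a list of reals followed by a list of dummies: the position of the next
entry, and the head of the dummies while the reals are being traversed. -/
structure Cursor (D : ℕ) : Type where
  current : Option (Pos D)
  later : Option (Pos D)

/-- Continue with `p`, or with `q` if `p` marks the end of a list. -/
def Cursor.goTo {D : ℕ} (p q : Option (Pos D)) : Cursor D :=
  match p with
  | some p => ⟨some p, q⟩
  | none => ⟨q, none⟩

/-- Reconstruct an entry and its link. -/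
def fetchEntry (T L : Arr) (p : Pos D) : Client F.width (Item D B × Option (Pos D)) := do
  let x ← reconstruct F T fun b => p b
  let y ← reconstruct F L fun b => p b
  pure (x, y.asLink)

/-- `StableCompact`: all dummies move to the end. -/
def stableCompact (T : Arr) : Client F.width Arr := do
  let P ← genPerms F T.len
  let (heads, L) ← linkScan F T P T.len
  let T' ← permute F P T
  let L' ← permute F P L
  let R ← newArr T.len
  let _ ← (List.range T.len).foldlM (init := Cursor.goTo (heads false true) (heads false false))
    fun (c : Cursor D) k =>
      match c.current with
      | none => pure c
      | some p => do
          let (x, next) ← fetchEntry F T' L' p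
          secretWrite F R k x
          pure (Cursor.goTo next c.later)
  pure R

/-- State of a merge: for both lists (`false` the first, `true` the second) a cursor and the
entries that are fetched and not yet output. -/
structure MergeState (D B : ℕ) : Type where
  cursor : Bool → Cursor D
  held : Bool → List (Item D B)

/-- Fetch one further entry: of list `s` or, when this is used up, of the other list. Thus
the client fetches exactly one entry after each output while any remains, and holds at most two. -/
def MergeState.fetch (T L : Arr) (s : Bool) (st : MergeState D B) :
    Client F.width (MergeState D B) :=
  let s' : Bool := if (st.cursor s).current.isSome then s else !s
  match (st.cursor s').current with
  | none => pure st
  | some p => do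
      let (x, next) ← fetchEntry F T L p
      pure ⟨Function.update st.cursor s' (Cursor.goTo next (st.cursor s').later),
        Function.update st.held s' (st.held s' ++ [x])⟩

/-- The list whose head is output next; ties go to the first list. -/
def MergeState.choose (st : MergeState D B) : Bool :=
  match st.held false, st.held true with
  | x :: _, y :: _ => !(x.before y)
  | _ :: _, [] => false
  | [], _ => true

/-- `Merge`: the sorted list of all entries of two semi-sorted lists, dummies last, ties in favour
of the first list. -/
def merge (T₁ T₂ : Arr) : Client F.width Arr := do
  let U := T₁.append T₂
  let P ← genPerms F U.len
  let (heads, L) ← linkScan F U P T₁.len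
  let U' ← permute F P U
  let L' ← permute F P L
  let R ← newArr U.len
  let st₀ : MergeState D B := ⟨fun s => Cursor.goTo (heads s true) (heads s false), fun _ => []⟩
  let st₁ ← st₀.fetch F U' L' false
  let st₂ ← st₁.fetch F U' L' true
  let _ ← (List.range U.len).foldlM (init := st₂) fun (st : MergeState D B) k =>
    let s := st.choose
    match st.held s with
    | [] => pure st
    | x :: xs => do
        secretWrite F R k x
        MergeState.fetch F U' L' s { st with held := Function.update st.held s xs }
  pure R

/-! ## One-time oblivious memory -/

/-- The permutations, the permuted entries and links, and the shared head of the dummy list. -/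
structure OTM : Type where
  P : Arr
  T : Arr
  L : Arr
  dpos : Arr

/-- `Build`: returns the data structure and the key-position map. -/
def build (T : Arr) : Client F.width (OTM × Arr) := do
  let n := T.len
  let T' ← newArr (2 * n)
  (List.range n).forM fun i => do
    let x ← reconstructAt F T i
    secretWrite F T' i x
  (List.range n).forM fun i => secretWrite F T' (n + i) (.special (Fin.ofNat _ i))
  let P ← genPerms F (2 * n)
  let L ← newArr (2 * n)
  secretWrite F L (2 * n - 1) (.link none)
  (List.range (n - 1)).reverse.forM fun i => do
    let p ← readPos F P (n + i + 1)
    secretWrite F L (n + i) (.link (some p))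
  (List.range n).forM fun i => secretWrite F L i (.link none)
  let dpos ← newArr 1
  let p ← readPos F P n
  secretWrite F dpos 0 (.link (some p))
  let U ← newArr n
  (List.range n).forM fun i => do
    let x ← reconstructAt F T' i
    let p ← readPos F P i
    secretWrite F U i (match x.key? with
      | some k => .place k p
      | none => .dummy)
  let T'' ← permute F P T'
  let L'' ← permute F P L
  pure (⟨P, T'', L'', dpos⟩, U)

/-- `Lookup` in a one-time memory; `none` is a dummy request. -/
def OTM.lookup (o : OTM) (q : Option (Pos D)) : Client F.width (Item D B) := do
  let h ← reconstructAt F o.dpos 0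
  let pos : Pos D := match q with
    | some p => p
    | none => h.asLink.getD 0
  let (v, next) ← fetchEntry F o.T o.L pos
  secretWrite F o.dpos 0 (.link (match q with
    | some _ => h.asLink
    | none => next))
  pure v

/-- `Getall`: the unpermuted list from which the memory was built. -/
def OTM.getall (o : OTM) : Client F.width Arr := do
  let T ← unpermute F o.P o.T
  let _ ← unpermute F o.P o.L
  pure (T.take (T.len / 2))

/-! ## Position-based ORAM -/

/-- The levels of a position-based ORAM; `none` means that the level is empty. -/
abbrev Levels : Type := ℕ → Option OTM

/-- `Lookup` in the position-based ORAM of depth `d`, given the position label of the block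
(`none` if there is no such block): the one-time memory named in the label gets the real
request and all other nonempty levels get a dummy request. -/
def posLookup (d : ℕ) (levels : Levels) (lab : Option (Label D)) : Client F.width (Item D B) :=
  (List.range (d + 1)).foldlM (init := .dummy) fun (v : Item D B) j =>
    match levels j with
    | none => pure v
    | some o =>
        match lab.filter fun lb => lb.level.val == j with
        | some lb => o.lookup F (some lb.pos)
        | none => do
            let _ ← o.lookup F none
            pure v

/-- In one pass over a sorted list keep the first entry of each address and turn the others
into dummies. -/
def markDuplicates (T : Arr) : Client F.width Unit := do
  let _ ← (List.range T.len).foldlM (init := none) fun (last : Option (Fin (2 ^ D))) i => do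
    let x ← reconstructAt F T i
    secretWrite F T i (if x.isReal && x.key? == last then .dummy else x)
    pure x.key?
  pure ()

/-- In one pass over the adjacent pairs of a sorted list combine entries of the same address. -/
def scanUpdate (A : Arr) : Client F.width Unit :=
  (List.range (A.len - 1)).forM fun i => do
    let x ← reconstructAt F A i
    let y ← reconstructAt F A (i + 1)
    let same : Bool := x.isReal && x.key? == y.key?
    secretWrite F A i (if same then x.update y else x)
    secretWrite F A (i + 1) (if same then .dummy else y)

/-- `Shuffle`: build level `l` from the levels `0, …, l`, the freshly fetched block and the update
array (`none` at depth `D`, where the update step is skipped). -/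
def shuffle (levels : Levels) (fetched : OTM) (upd : Option Arr) (l : ℕ) :
    Client F.width (OTM × Arr) := do
  let lists ← ((List.range (l + 1)).filterMap levels).mapM fun o => o.getall F
  let T₀ ← fetched.getall F
  let T ← lists.foldlM (fun T S => merge F T S) T₀
  markDuplicates F T
  let T' ← stableCompact F T
  let T'' := T'.take (2 ^ l)
  match upd with
  | none => build F T''
  | some U => do
      let A ← merge F T'' U
      scanUpdate F A
      let A' ← stableCompact F A
      build F (A'.take (2 ^ l))

/-! ## The recursive ORAM -/

def parent (k : Fin (2 ^ D)) : Fin (2 ^ D) := ⟨k.val / 2, (Nat.div_le_self _ _).trans_lt k.isLt⟩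

/-- The entry of the update array made from an entry `x` of the key-position map of level `l` and
its neighbours. -/
def convertEntry (l : ℕ) (left x right : Item D B) : Item D B :=
  let label (p : Pos D) : Option (Label D) := some ⟨Fin.ofNat _ l, p⟩
  match x with
  | .place k p =>
      if k.val % 2 = 0 then
        match right with
        | .place k' p' =>
            if k'.val = k.val + 1 then .labels (parent k) (label p) (label p')
            else .labels (parent k) (label p) none
        | _ => .labels (parent k) (label p) none
      else
        match left with
        | .place k' _ =>
            if k'.val + 1 = k.val then .dummy else .labels (parent k) none (label p)
        | _ => .labels (parent k) none (label p)
  | _ => .dummy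

/-- `Convert`: from the key-position map of the rebuilt level `l` to the update array of the
preceding depth. -/
def convert (U : Arr) (l : ℕ) : Client F.width Arr := do
  let V ← newArr U.len
  (List.range U.len).forM fun i => do
    let left ← if i = 0 then pure .dummy else reconstructAt F U (i - 1)
    let x ← reconstructAt F U i
    let right ← if i + 1 < U.len then reconstructAt F U (i + 1) else pure .dummy
    secretWrite F V i (convertEntry l left x right)
  pure V

/-- The depth-`d` truncation of an address: the number formed by its `d` leading bits. -/
def truncate (addr : Fin (2 ^ D)) (d : ℕ) : Fin (2 ^ D) :=
  ⟨addr.val / 2 ^ (D - d), (Nat.div_le_self _ _).trans_lt addr.isLt⟩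

/-- The position of the only block of depth `0`, which is entry `0` of its list. -/
def rootLabel (levels : Levels) : Client F.width (Option (Label D)) :=
  match levels 0 with
  | none => pure none
  | some o => do
      let p ← readPos F o.P 0
      pure (some ⟨0, p⟩)

def Request.addr : Request D B → Fin (2 ^ D)
  | .read a => a
  | .write a _ => a

/-- The content of the requested block after the request. -/
def Request.newValue : Request D B → Bits B → Bits B
  | .read _, old => old
  | .write _ v, _ => v

/-- The fetch phase: the old content of the requested block, and the one-time memories of size one
with the fetched block of every depth. A block that was never accessed has content `0`, or no
labels of children. -/
def fetchPhase (st : ℕ → Levels) (r : Request D B) : Client F.width (Bits B × Levels) := do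
  let (last, fetched) ← (List.range (D + 1)).foldlM (init := (.dummy, fun _ => none))
    fun (s : Item D B × Levels) d => do
      let key := truncate r.addr d
      let lab ← if d = 0 then rootLabel F (st 0) else pure (s.1.childLabel (key.val % 2))
      let x ← posLookup F d (st d) lab
      let found : Item D B :=
        if x.isReal then x else if d < D then .labels key none none else .data key 0
      let stored : Item D B :=
        if d < D then found else .data key (r.newValue found.value)
      let T ← newArr 1
      secretWrite F T 0 stored
      let (o, _) ← build F T
      pure (found, Function.update s.2 d (some o))
  pure (last.value, fetched)

/-- The smallest empty level of depth `D`, or `D` if all levels are full. -/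
def emptyLevel (D : ℕ) (st : ℕ → Levels) : ℕ :=
  ((List.range (D + 1)).find? fun j => (st D j).isNone).getD D

/-- The maintain phase, from depth `D` to depth `0`. -/
def maintainPhase (st : ℕ → Levels) (fetched : Levels) : Client F.width (ℕ → Levels) := do
  let lD := emptyLevel D st
  let (st', _) ← (List.range (D + 1)).reverse.foldlM (init := (st, none))
    fun (s : (ℕ → Levels) × Option Arr) d =>
      let l := if d < lD then d else lD
      match fetched d with
      | none => pure s
      | some f => do
          let (o, U) ← shuffle F (s.1 d) f s.2 l
          let levels : Levels := fun j =>
            if j < l then none else if j = l then some o else s.1 d j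
          let upd ← if 1 ≤ d then some <$> convert F U l else pure none
          pure (Function.update s.1 d levels, upd)
  pure st'

/-- The recursive ORAM. The state consists of the (public) places of all one-time memories;
initially all levels are empty. The answer to a request is the old content of the block. -/
def recursiveORAM : Scheme D B where
  width := F.width
  State := ℕ → Levels
  start := fun _ _ => none
  access := fun st r => do
    let (old, fetched) ← fetchPhase F st r
    let st' ← maintainPhase F st fetched
    pure (old, st')

end Protocols

end RecORAM

namespace RecORAM

open scoped ENNReal

/-! ## Program logics -/

namespace Client

variable {w : ℕ} {α β γ δ : Type}

/-! Fix one corrupt server `s`. It holds the shares `s` and `s + 1` of every array and the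
permutation for share `s + 1`; share `s + 2` and the permutation `π_s` are hidden from it. Two
executions on request sequences of equal length are coupled so that server `s` observes the same
transcript in both. Three bijections of coins achieve this. In a secret write the difference of the
two secrets is moved to the share that `s` does not hold (`obl_secretWrite`). When permutations are
drawn, `π_s` is matched with `π_s * σ⁻¹`, so that entry `i` of one run and entry `σ i` of the other
lie at the same place of share `s` (`rel_genPerms`). When an array is permuted, the masks of share
`s` are rearranged and shifted so that the masked share arriving at `s` is the same block by block
(`rel_maskShares`, `rel_permute`).

A reconstruction shows to `s` only the place of share `s`. So a permuted structure leaks nothing if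
no entry is visited twice and the visited entries of the two runs are paired by `σ`. The pairing has
to be fixed when the permutation is drawn, before the visits. This is possible because the visited
entries, as opposed to their places, are determined by the data present at that moment and by the
requests to come. In a compaction they are `order`, in a merge the order of fetching
`IndexMerge.vis`, in both cases a permutation of all indices.

For the one-time memories the visits depend on later requests. `Model` records, without any coins,
which keys lie in which level and how many special dummies are used up. Lists are sorted by key, so
the set of keys determines the index of a key (`KeyList`). `Model.future` lists the entries of a
level that are visited until the level is destroyed. By `Model.Inv.future_spec` none is repeated: a
key that was found moves to a lower level, and the lower levels form a binary counter which shows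
that the special dummies do not run out. By `Model.length_future` the number of visits depends on
the number of requests only. `Matched` says that the permutations for share `s` agree on these
lists, and `Matched.step` carries this through a request.

Obliviousness needs correctness as well, since a wrong label would lead to a wrong place. Hence the
shuffles and `convert` are shown to produce the sorted lists of the freshest entries with the
correct labels of the children (`LabelsAt`). The recursion over depths works because a child that is
moved has a parent that is moved (`Model.Inv.parent_newKeys`).

The formal tools are a logic `Sure` for single runs and a relational logic `Rel`. `Rel` is a
coupling in dual form: an inequality between expectations for all pairs of functions with `f ≤ g` on
related outcomes, so that no joint distribution has to be constructed. Equality of the views follows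
by using the inequality in both directions (`view_singleton`). -/

theorem andThen_assoc (c : Client w α) (f : α → Client w β) (g : β → Client w γ) :
    (c.andThen f).andThen g = c.andThen fun x => (f x).andThen g := by
  induction c with
  | done a => rfl
  | readThen s a k ih => simp only [andThen, ih]
  | writeThen s a v k ih => simp only [andThen, ih]
  | coinsThen k ih => simp only [andThen, ih]
  | permThen n k ih => simp only [andThen, ih]
  | reserveThen n k ih => simp only [andThen, ih]

theorem andThen_done (c : Client w α) : c.andThen done = c := by
  induction c with
  | done a => rfl
  | readThen s a k ih => simp only [andThen, ih]
  | writeThen s a v k ih => simp only [andThen, ih]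
  | coinsThen k ih => simp only [andThen, ih]
  | permThen n k ih => simp only [andThen, ih]
  | reserveThen n k ih => simp only [andThen, ih]

/-- The monad laws allow programs to be regrouped into named pieces that are analysed separately. -/
instance : LawfulMonad (Client w) := LawfulMonad.mk'
  (id_map := fun c => andThen_done c)
  (pure_bind := fun _ _ => rfl)
  (bind_assoc := fun c f g => andThen_assoc c f g)

/-- Every execution from `m` ends with a result and a memory that satisfy `P`. -/
def Sure : Client w α → Memory w → (α → Memory w → Prop) → Prop
  | done a, m, P => P a m
  | readThen s a k, m, P => (k (m.block s a)).Sure m P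
  | writeThen s a v k, m, P => k.Sure (m.set s a v) P
  | coinsThen k, m, P => ∀ x, (k x).Sure m P
  | permThen _ k, m, P => ∀ x, (k x).Sure m P
  | reserveThen n k, m, P => (k m.next).Sure { m with next := m.next + n } P

theorem Sure.mono {c : Client w α} {m : Memory w} {P Q : α → Memory w → Prop}
    (h : c.Sure m P) (hPQ : ∀ a m', P a m' → Q a m') : c.Sure m Q := by
  induction c generalizing m with
  | done a => exact hPQ _ _ h
  | readThen s a k ih => exact ih _ h
  | writeThen s a v k ih => exact ih h
  | coinsThen k ih => exact fun x => ih x (h x)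
  | permThen n k ih => exact fun x => ih x (h x)
  | reserveThen n k ih => exact ih _ h

theorem Sure.andThen {c : Client w α} {f : α → Client w β} {m : Memory w}
    {P : β → Memory w → Prop} (h : c.Sure m fun a m' => (f a).Sure m' P) :
    (c.andThen f).Sure m P := by
  induction c generalizing m with
  | done a => exact h
  | readThen s a k ih => exact ih _ h
  | writeThen s a v k ih => exact ih h
  | coinsThen k ih => exact fun x => ih x (h x)
  | permThen n k ih => exact fun x => ih x (h x)
  | reserveThen n k ih => exact ih _ h

theorem Sure.bind {c : Client w α} {f : α → Client w β} {m : Memory w}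
    {Q : α → Memory w → Prop} {P : β → Memory w → Prop} (h : c.Sure m Q)
    (hf : ∀ a m', Q a m' → (f a).Sure m' P) : (c >>= f).Sure m P :=
  Sure.andThen (h.mono hf)

theorem Sure.pure {a : α} {m : Memory w} {P : α → Memory w → Prop} (h : P a m) :
    (Pure.pure a : Client w α).Sure m P := h

/-- The expectation of a function of the observed transcript, the result and the final memory. -/
noncomputable def wp (s : Fin 3) : Client w α → Memory w →
    (List (Message w ⊕ (Fin 3 × Bool)) → α → Memory w → ℝ≥0∞) → ℝ≥0∞
  | done a, m, f => f [] a m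
  | readThen t a k, m, f =>
      (k (m.block t a)).wp s m fun tr => f (observe {s} (Message.read t a) :: tr)
  | writeThen t a v k, m, f =>
      k.wp s (m.set t a v) fun tr => f (observe {s} (Message.write t a v) :: tr)
  | coinsThen k, m, f => ∑ x, (Fintype.card (Bits w) : ℝ≥0∞)⁻¹ * (k x).wp s m f
  | permThen n k, m, f => ∑ x, (Fintype.card (Equiv.Perm (Fin n)) : ℝ≥0∞)⁻¹ * (k x).wp s m f
  | reserveThen n k, m, f => (k m.next).wp s { m with next := m.next + n } f

theorem wp_andThen (s : Fin 3) (c : Client w α) (g : α → Client w β) (m : Memory w)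
    (f : List (Message w ⊕ (Fin 3 × Bool)) → β → Memory w → ℝ≥0∞) :
    (c.andThen g).wp s m f = c.wp s m fun tr a m' => (g a).wp s m' fun tr' => f (tr ++ tr') := by
  induction c generalizing m f with
  | done a => rfl
  | readThen t a k ih => simp only [andThen, wp, ih, List.cons_append]
  | writeThen t a v k ih => simp only [andThen, wp, ih, List.cons_append]
  | coinsThen k ih => simp only [andThen, wp, ih]
  | permThen n k ih => simp only [andThen, wp, ih]
  | reserveThen n k ih => simp only [andThen, wp, ih]

theorem wp_congr {s : Fin 3} {c : Client w α} {m : Memory w} {P : α → Memory w → Prop}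
    {f g : List (Message w ⊕ (Fin 3 × Bool)) → α → Memory w → ℝ≥0∞} (h : c.Sure m P)
    (hfg : ∀ tr a m', P a m' → f tr a m' = g tr a m') : c.wp s m f = c.wp s m g := by
  induction c generalizing m f g with
  | done a => exact hfg _ _ _ h
  | readThen t a k ih => exact ih _ h fun tr a m' hP => hfg _ _ _ hP
  | writeThen t a v k ih => exact ih h fun tr a m' hP => hfg _ _ _ hP
  | coinsThen k ih =>
    exact Finset.sum_congr rfl fun x _ => by rw [ih x (h x) hfg]
  | permThen n k ih =>
    exact Finset.sum_congr rfl fun x _ => by rw [ih x (h x) hfg]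
  | reserveThen n k ih => exact ih _ h hfg

theorem tsum_map_mul {X Y : Type} (p : PMF X) (h : X → Y) (f : Y → ℝ≥0∞) :
    ∑' y, p.map h y * f y = ∑' x, p x * f (h x) := by
  classical
  simp only [PMF.map_apply, ← ENNReal.tsum_mul_right]
  rw [ENNReal.tsum_comm]
  refine tsum_congr fun x => ?_
  rw [tsum_eq_single (h x)]
  · simp
  · intro y hy
    simp [hy]

theorem tsum_bind_mul {X Y : Type} (p : PMF X) (h : X → PMF Y) (f : Y → ℝ≥0∞) :
    ∑' y, p.bind h y * f y = ∑' x, p x * ∑' y, h x y * f y := by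
  simp only [PMF.bind_apply, ← ENNReal.tsum_mul_right, ← ENNReal.tsum_mul_left]
  rw [ENNReal.tsum_comm]
  simp only [mul_assoc]

/-- This ties the recursive expectation to the distribution `run` in which the claim is stated; all
couplings are built with `wp` alone. -/
theorem wp_eq_tsum (s : Fin 3) (c : Client w α) (m : Memory w)
    (f : List (Message w ⊕ (Fin 3 × Bool)) → α → Memory w → ℝ≥0∞) :
    c.wp s m f = ∑' r, c.run m r * f (r.1.map (observe {s})) r.2.1 r.2.2 := by
  induction c generalizing m f with
  | done a =>
    rw [run, tsum_eq_single ([], a, m)]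
    · simp [wp]
    · intro r hr
      simp [hr]
  | readThen t a k ih =>
    rw [wp, run, tsum_map_mul, ih]; rfl
  | writeThen t a v k ih =>
    rw [wp, run, tsum_map_mul, ih]; rfl
  | coinsThen k ih =>
    rw [wp, run, tsum_bind_mul, tsum_fintype]
    simp only [ih, PMF.uniformOfFintype_apply]
  | permThen n k ih =>
    rw [wp, run, tsum_bind_mul, tsum_fintype]
    simp only [ih, PMF.uniformOfFintype_apply]
  | reserveThen n k ih => rw [wp, run, ih]

/-- The executions of two programs can be coupled so that server `s` observes the same and the
results and memories satisfy `Q`. -/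
def Rel (s : Fin 3) (c : Client w α) (m : Memory w) (c' : Client w β) (m' : Memory w)
    (Q : α → Memory w → β → Memory w → Prop) : Prop :=
  ∀ f g, (∀ tr a n a' n', Q a n a' n' → f tr a n ≤ g tr a' n') → c.wp s m f ≤ c'.wp s m' g

variable {s : Fin 3} {m m' : Memory w}

theorem Rel.mono {c : Client w α} {c' : Client w β} {P Q : α → Memory w → β → Memory w → Prop}
    (h : Rel s c m c' m' P) (hPQ : ∀ a n a' n', P a n a' n' → Q a n a' n') :
    Rel s c m c' m' Q :=
  fun f g hfg => h f g fun tr _ _ _ _ hP => hfg tr _ _ _ _ (hPQ _ _ _ _ hP)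

theorem Rel.pure {a : α} {a' : β} {Q : α → Memory w → β → Memory w → Prop} (h : Q a m a' m') :
    Rel s (Pure.pure a) m (Pure.pure a') m' Q :=
  fun _ _ hfg => hfg [] _ _ _ _ h

theorem Rel.bind {c : Client w α} {c' : Client w β} {k : α → Client w γ} {k' : β → Client w δ}
    {P : α → Memory w → β → Memory w → Prop} {Q : γ → Memory w → δ → Memory w → Prop}
    (h : Rel s c m c' m' P) (hk : ∀ a n a' n', P a n a' n' → Rel s (k a) n (k' a') n' Q) :
    Rel s (c >>= k) m (c' >>= k') m' Q := by
  intro f g hfg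
  change (c.andThen k).wp s m f ≤ (c'.andThen k').wp s m' g
  rw [wp_andThen, wp_andThen]
  exact h _ _ fun tr a n a' n' hP => hk _ _ _ _ hP _ _ fun tr' _ _ _ _ hQ => hfg _ _ _ _ _ hQ

/-- Facts about each run separately may be added to a coupling: replacing `f` by `0` off `P` and `g`
by `⊤` off `P'` changes neither expectation, and makes `f ≤ g` trivial wherever one of the facts
fails. -/
theorem Rel.and_sure {c : Client w α} {c' : Client w β}
    {Q : α → Memory w → β → Memory w → Prop} {P : α → Memory w → Prop} {P' : β → Memory w → Prop}
    (h : Rel s c m c' m' Q) (hP : c.Sure m P) (hP' : c'.Sure m' P') :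
    Rel s c m c' m' fun a n a' n' => Q a n a' n' ∧ P a n ∧ P' a' n' := by
  classical
  intro f g hfg
  rw [wp_congr (g := fun tr a n => if P a n then f tr a n else 0) hP
      fun tr a n h => by simp [h],
    wp_congr (g := fun tr a n => if P' a n then g tr a n else ⊤) hP' fun tr a n h => by simp [h]]
  refine h _ _ fun tr a n a' n' hQ => ?_
  by_cases h₁ : P a n <;> by_cases h₂ : P' a' n' <;> simp [h₁, h₂]
  exact hfg _ _ _ _ _ ⟨hQ, h₁, h₂⟩

/-- A message to an honest server shows only the server and the kind, so its address is free. The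
blocks read may differ between the runs. -/
theorem Rel.read {t : Fin 3} {a a' : Addr} {Q : Bits w → Memory w → Bits w → Memory w → Prop}
    (ha : t = s → a = a') (h : Q (m.block t a) m (m'.block t a') m') :
    Rel s (Client.read t a) m (Client.read t a') m' Q := by
  intro f g hfg
  have : observe {s} (Message.read t a : Message w) = observe {s} (Message.read t a') := by
    by_cases hts : t = s
    · rw [ha hts]
    · simp [observe, Message.server, hts, Message.isWrite]
  simp only [Client.read, wp, this]
  exact hfg _ _ _ _ _ h

theorem Rel.write {t : Fin 3} {a a' : Addr} {v v' : Bits w}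
    {Q : Unit → Memory w → Unit → Memory w → Prop}
    (ha : t = s → a = a' ∧ v = v') (h : Q () (m.set t a v) () (m'.set t a' v')) :
    Rel s (Client.write t a v) m (Client.write t a' v') m' Q := by
  intro f g hfg
  have : observe {s} (Message.write t a v) = observe {s} (Message.write t a' v') := by
    by_cases hts : t = s
    · rw [(ha hts).1, (ha hts).2]
    · simp [observe, Message.server, hts, Message.isWrite]
  simp only [Client.write, wp, this]
  exact hfg _ _ _ _ _ h

theorem Rel.reserve {n : ℕ} {Q : ℕ → Memory w → ℕ → Memory w → Prop}
    (h : Q m.next { m with next := m.next + n } m'.next { m' with next := m'.next + n }) :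
    Rel s (Client.reserve n) m (Client.reserve n) m' Q :=
  fun _ _ hfg => hfg _ _ _ _ _ h

/-- A uniform permutation stays uniform under a bijection, so the two sums are matched term by term
along `e`. Choosing `e` is how the permutations of the two runs get coupled. -/
theorem Rel.perm {n : ℕ} (e : Equiv.Perm (Fin n) ≃ Equiv.Perm (Fin n))
    {k : Equiv.Perm (Fin n) → Client w α} {k' : Equiv.Perm (Fin n) → Client w β}
    {Q : α → Memory w → β → Memory w → Prop}
    (h : ∀ x, Rel s (k x) m (k' (e x)) m' Q) :
    Rel s (Client.perm n >>= k) m (Client.perm n >>= k') m' Q := by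
  intro f g hfg
  change (permThen n k).wp s m f ≤ (permThen n k').wp s m' g
  rw [wp, wp, ← e.sum_comp fun x => _ * (k' x).wp s m' g]
  exact Finset.sum_le_sum fun x _ => mul_le_mul_right (h x f g hfg) _

theorem forM_cons (i : γ) (l : List γ) (f : γ → Client w Unit) :
    (i :: l).forM f = f i >>= fun _ => l.forM f := rfl

theorem forM_map (h : γ → δ) (l : List γ) (f : δ → Client w Unit) :
    (l.map h).forM f = l.forM fun i => f (h i) := by
  induction l with
  | nil => rfl
  | cons i l ih => rw [List.map_cons, forM_cons, forM_cons, ih]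

theorem wp_sum {ι : Type} [Fintype ι] (s : Fin 3) (c : Client w α) (m : Memory w) (κ : ℝ≥0∞)
    (f : ι → List (Message w ⊕ (Fin 3 × Bool)) → α → Memory w → ℝ≥0∞) :
    c.wp s m (fun tr a n => ∑ i, κ * f i tr a n) = ∑ i, κ * c.wp s m (f i) := by
  induction c generalizing m f with
  | done a => rfl
  | readThen t a k ih => exact ih _ m fun i tr => f i _
  | writeThen t a v k ih => exact ih _ fun i tr => f i _
  | coinsThen k ih =>
    simp only [wp, ih, Finset.mul_sum]
    rw [Finset.sum_comm]
    simp only [mul_left_comm]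
  | permThen n k ih =>
    simp only [wp, ih, Finset.mul_sum]
    rw [Finset.sum_comm]
    simp only [mul_left_comm]
  | reserveThen n k ih => exact ih _ _ f

/-- Drawing two blocks before every round of a loop is the same as drawing them all in advance. -/
theorem wp_coins_family (s : Fin 3) (n : ℕ) (body : ℕ → Bits w → Bits w → Client w Unit)
    (m : Memory w) (f : List (Message w ⊕ (Fin 3 × Bool)) → Unit → Memory w → ℝ≥0∞) :
    ((List.range n).forM fun i => do
        let r ← Client.coins
        let r' ← Client.coins
        body i r r').wp s m f =
      ∑ ρ : Fin n → Bits w × Bits w, ((Fintype.card (Bits w) : ℝ≥0∞)⁻¹ ^ 2) ^ n *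
        ((List.finRange n).forM fun i => body i (ρ i).1 (ρ i).2).wp s m f := by
  induction n generalizing body m f with
  | zero => simp [List.finRange_zero]
  | succ n ih =>
    have hL : ((List.range (n + 1)).forM fun i => do
        let r ← Client.coins
        let r' ← Client.coins
        body i r r').wp s m f = ∑ x : Bits w × Bits w, (Fintype.card (Bits w) : ℝ≥0∞)⁻¹ ^ 2 *
          (body 0 x.1 x.2).wp s m fun tr _ m' => (((List.range n).forM fun i => do
            let r ← Client.coins
            let r' ← Client.coins
            body (i + 1) r r').wp s m' fun tr' => f (tr ++ tr')) := by
      have : ((List.range (n + 1)).forM fun i => (do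
          let r ← Client.coins
          let r' ← Client.coins
          body i r r' : Client w Unit)) = Client.coinsThen fun r => Client.coinsThen fun r' =>
            (body 0 r r').andThen fun _ => ((List.range n).forM fun i => do
              let r ← Client.coins
              let r' ← Client.coins
              body (i + 1) r r') := by
        rw [List.range_succ_eq_map, forM_cons, forM_map]
        rfl
      rw [this, wp]
      simp only [wp, wp_andThen, Fintype.sum_prod_type, Finset.mul_sum, sq, mul_assoc]
    have hR : ∀ (x : Bits w × Bits w) (ρ : Fin n → Bits w × Bits w),
        ((List.finRange (n + 1)).forM fun i => body i
          ((Fin.consEquiv fun _ : Fin (n + 1) => Bits w × Bits w) (x, ρ) i).1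
          ((Fin.consEquiv fun _ : Fin (n + 1) => Bits w × Bits w) (x, ρ) i).2).wp s m f =
        (body 0 x.1 x.2).wp s m fun tr _ m' => (((List.finRange n).forM fun i =>
          body (i + 1) (ρ i).1 (ρ i).2).wp s m' fun tr' => f (tr ++ tr')) := by
      intro x ρ
      rw [List.finRange_succ, forM_cons, forM_map]
      exact wp_andThen _ _ _ _ _
    rw [hL]
    -- A family of `n + 1` coin pairs is its first pair together with a family of `n` pairs.
    refine Eq.trans ?_ ((Fin.consEquiv fun _ : Fin (n + 1) => Bits w × Bits w).sum_comp
      fun ρ : Fin (n + 1) → Bits w × Bits w =>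
        ((Fintype.card (Bits w) : ℝ≥0∞)⁻¹ ^ 2) ^ (n + 1) *
          ((List.finRange (n + 1)).forM fun i => body i (ρ i).1 (ρ i).2).wp s m f)
    conv_rhs => rw [Fintype.sum_prod_type]
    refine Finset.sum_congr rfl fun x _ => ?_
    simp only [hR, ih]
    rw [wp_sum, ← Finset.mul_sum, ← Finset.mul_sum,
      pow_succ' ((Fintype.card (Bits w) : ℝ≥0∞)⁻¹ ^ 2), mul_assoc]

/-- The bijection may mix the coins of different rounds. The masks of a permuted array need this:
the mask of an entry in one run is matched with the mask of another entry in the other run. -/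
theorem Rel.coins_family {n : ℕ} (e : (Fin n → Bits w × Bits w) ≃ (Fin n → Bits w × Bits w))
    {body body' : ℕ → Bits w → Bits w → Client w Unit}
    {Q : Unit → Memory w → Unit → Memory w → Prop}
    (h : ∀ ρ, Rel s ((List.finRange n).forM fun i => body i (ρ i).1 (ρ i).2) m
      ((List.finRange n).forM fun i => body' i (e ρ i).1 (e ρ i).2) m' Q) :
    Rel s
      ((List.range n).forM fun i => do
        let r ← Client.coins
        let r' ← Client.coins
        body i r r') m
      ((List.range n).forM fun i => do
        let r ← Client.coins
        let r' ← Client.coins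
        body' i r r') m' Q := by
  intro f g hfg
  rw [wp_coins_family, wp_coins_family]
  conv_rhs => rw [← e.sum_comp]
  exact Finset.sum_le_sum fun ρ _ => mul_le_mul_right (h ρ f g hfg) _

theorem Rel.coins_pair (e : Bits w × Bits w ≃ Bits w × Bits w)
    {k : Bits w → Bits w → Client w α} {k' : Bits w → Bits w → Client w β}
    {Q : α → Memory w → β → Memory w → Prop}
    (h : ∀ x, Rel s (k x.1 x.2) m (k' (e x).1 (e x).2) m' Q) :
    Rel s (Client.coins >>= fun r => Client.coins >>= fun r' => k r r') m
      (Client.coins >>= fun r => Client.coins >>= fun r' => k' r r') m' Q := by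
  intro f g hfg
  change (coinsThen fun r => coinsThen fun r' => k r r').wp s m f ≤
    (coinsThen fun r => coinsThen fun r' => k' r r').wp s m' g
  simp only [wp, Finset.mul_sum]
  rw [← Fintype.sum_prod_type', ← Fintype.sum_prod_type']
  conv_rhs => rw [← e.sum_comp]
  exact Finset.sum_le_sum fun x _ => mul_le_mul_right (mul_le_mul_right (h x f g hfg) _) _

/-! ### Loops -/

theorem Sure.foldlM {σ : Type} {l : List γ} {f : σ → γ → Client w σ} {a : σ} {m : Memory w}
    (I : ℕ → σ → Memory w → Prop) (h₀ : I 0 a m)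
    (hstep : ∀ k (hk : k < l.length) a m, I k a m → (f a l[k]).Sure m (I (k + 1))) :
    (l.foldlM f a).Sure m (I l.length) := by
  induction l generalizing I a m with
  | nil => exact h₀
  | cons i l ih =>
    rw [List.foldlM_cons]
    refine (hstep 0 (by simp) a m h₀).bind fun a' m' h => ?_
    exact ih (fun k => I (k + 1)) h fun k hk a m h => hstep (k + 1) (by simpa using hk) a m h

theorem Sure.forM {l : List γ} {f : γ → Client w Unit} {m : Memory w}
    (I : ℕ → Memory w → Prop) (h₀ : I 0 m)
    (hstep : ∀ k (hk : k < l.length) m, I k m → (f l[k]).Sure m fun _ => I (k + 1)) :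
    (l.forM f).Sure m fun _ => I l.length := by
  induction l generalizing I m with
  | nil => exact h₀
  | cons i l ih =>
    rw [forM_cons]
    refine (hstep 0 (by simp) m h₀).bind fun a' m' h => ?_
    exact ih (fun k => I (k + 1)) h fun k hk m h => hstep (k + 1) (by simpa using hk) m h

theorem Sure.forM_range {n : ℕ} {f : ℕ → Client w Unit} {m : Memory w}
    (I : ℕ → Memory w → Prop) (h₀ : I 0 m)
    (hstep : ∀ k < n, ∀ m, I k m → (f k).Sure m fun _ => I (k + 1)) :
    ((List.range n).forM f).Sure m fun _ => I n := by
  simpa using Sure.forM (l := List.range n) (f := f) I h₀ fun k hk m h => by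
    simpa using hstep k (by simpa using hk) m h

theorem Sure.foldlM_range {σ : Type} {n : ℕ} {f : σ → ℕ → Client w σ} {a : σ} {m : Memory w}
    (I : ℕ → σ → Memory w → Prop) (h₀ : I 0 a m)
    (hstep : ∀ k < n, ∀ a m, I k a m → (f a k).Sure m (I (k + 1))) :
    ((List.range n).foldlM f a).Sure m (I n) := by
  simpa using Sure.foldlM (l := List.range n) (f := f) I h₀ fun k hk a m h => by
    simpa using hstep k (by simpa using hk) a m h

/-- The invariant counts downwards: `I k` describes the moment when exactly the indices below `k`
are still to be treated. -/
theorem Sure.foldlM_range_reverse {σ : Type} {n : ℕ} {f : σ → ℕ → Client w σ} {a : σ}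
    {m : Memory w} (I : ℕ → σ → Memory w → Prop) (h₀ : I n a m)
    (hstep : ∀ k < n, ∀ a m, I (k + 1) a m → (f a k).Sure m (I k)) :
    ((List.range n).reverse.foldlM f a).Sure m (I 0) := by
  induction n generalizing a m with
  | zero => exact h₀
  | succ n ih =>
    rw [List.range_succ, List.reverse_append, List.reverse_singleton, List.singleton_append,
      List.foldlM_cons]
    exact (hstep n (by omega) a m h₀).bind fun a' m' h =>
      ih h fun k hk a m h => hstep k (by omega) a m h

theorem Rel.foldlM {σ τ : Type} {l : List γ} {f : σ → γ → Client w σ} {g : τ → γ → Client w τ}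
    {a : σ} {b : τ} (I : ℕ → σ → Memory w → τ → Memory w → Prop) (h₀ : I 0 a m b m')
    (hstep : ∀ k (hk : k < l.length) a n b n', I k a n b n' →
      Rel s (f a l[k]) n (g b l[k]) n' (I (k + 1))) :
    Rel s (l.foldlM f a) m (l.foldlM g b) m' (I l.length) := by
  induction l generalizing I a m b m' with
  | nil => exact Rel.pure h₀
  | cons i l ih =>
    rw [List.foldlM_cons, List.foldlM_cons]
    refine (hstep 0 (by simp) a m b m' h₀).bind fun a n b n' h => ?_
    exact ih (fun k => I (k + 1)) h fun k hk a m b m' h =>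
      hstep (k + 1) (by simpa using hk) a m b m' h

theorem Rel.foldlM_range {σ τ : Type} {n : ℕ} {f : σ → ℕ → Client w σ} {g : τ → ℕ → Client w τ}
    {a : σ} {b : τ} (I : ℕ → σ → Memory w → τ → Memory w → Prop) (h₀ : I 0 a m b m')
    (hstep : ∀ k < n, ∀ a n b n', I k a n b n' → Rel s (f a k) n (g b k) n' (I (k + 1))) :
    Rel s ((List.range n).foldlM f a) m ((List.range n).foldlM g b) m' (I n) := by
  simpa using Rel.foldlM (l := List.range n) (f := f) (g := g) I h₀ fun k hk a m b m' h => by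
    simpa using hstep k (by simpa using hk) a m b m' h

theorem Rel.foldlM_range_reverse {σ τ : Type} {n : ℕ} {f : σ → ℕ → Client w σ}
    {g : τ → ℕ → Client w τ} {a : σ} {b : τ} (I : ℕ → σ → Memory w → τ → Memory w → Prop)
    (h₀ : I n a m b m')
    (hstep : ∀ k < n, ∀ a m b m', I (k + 1) a m b m' → Rel s (f a k) m (g b k) m' (I k)) :
    Rel s ((List.range n).reverse.foldlM f a) m ((List.range n).reverse.foldlM g b) m' (I 0) := by
  induction n generalizing a m b m' with
  | zero => exact Rel.pure h₀
  | succ n ih =>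
    rw [List.range_succ, List.reverse_append, List.reverse_singleton, List.singleton_append,
      List.foldlM_cons, List.foldlM_cons]
    exact (hstep n (by omega) a m b m' h₀).bind fun a n b n' h =>
      ih h fun k hk a m b m' h => hstep k (by omega) a m b m' h

theorem Rel.forM {l : List γ} {f g : γ → Client w Unit} (I : ℕ → Memory w → Memory w → Prop)
    (h₀ : I 0 m m')
    (hstep : ∀ k (hk : k < l.length) n n', I k n n' →
      Rel s (f l[k]) n (g l[k]) n' fun _ n _ n' => I (k + 1) n n') :
    Rel s (l.forM f) m (l.forM g) m' fun _ n _ n' => I l.length n n' := by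
  induction l generalizing I m m' with
  | nil => exact Rel.pure h₀
  | cons i l ih =>
    rw [forM_cons, forM_cons]
    refine (hstep 0 (by simp) m m' h₀).bind fun _ n _ n' h => ?_
    exact ih (fun k => I (k + 1)) h fun k hk m m' h =>
      hstep (k + 1) (by simpa using hk) m m' h

end Client

open Client

/-! ## Memories -/

section Memories

variable {w : ℕ}

theorem Memory.set_block (m : Memory w) (t : Fin 3) (a : Addr) (v : Bits w) (t' : Fin 3)
    (a' : Addr) :
    (m.set t a v).block t' a' = if t' = t ∧ a' = a then v else m.block t' a' := by
  simp only [Memory.set, Function.update_apply]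
  split_ifs <;> simp_all

theorem Memory.set_block_cell (m : Memory w) (t : Fin 3) (a : Addr) (v : Bits w) (t' : Fin 3)
    (a' : Addr) (h : a'.cell ≠ a.cell) : (m.set t a v).block t' a' = m.block t' a' := by
  rw [Memory.set_block, if_neg]
  rintro ⟨-, rfl⟩
  exact h rfl

/-- From `m` to `m'`, of the reserved cells only those in `C` may have changed. -/
structure Memory.Ext (C : Set ℕ) (m m' : Memory w) : Prop where
  next : m.next ≤ m'.next
  block : ∀ t a, a.cell < m.next → a.cell ∉ C → m'.block t a = m.block t a

theorem Memory.Ext.refl (C : Set ℕ) (m : Memory w) : m.Ext C m :=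
  ⟨le_rfl, fun _ _ _ _ => rfl⟩

/-- Only cells already reserved in `m` have to be accounted for; later changes to cells reserved in
between are not seen from `m`. -/
theorem Memory.Ext.trans {C C' C'' : Set ℕ} {m m' m'' : Memory w} (h : m.Ext C m')
    (h' : m'.Ext C' m'') (hC : ∀ c ∈ C, c < m.next → c ∈ C'')
    (hC' : ∀ c ∈ C', c < m.next → c ∈ C'') : m.Ext C'' m'' := by
  refine ⟨h.next.trans h'.next, fun t a ha hC₀ => ?_⟩
  rw [h'.block t a (ha.trans_le h.next) fun h => hC₀ (hC' _ h ha),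
    h.block t a ha fun h => hC₀ (hC _ h ha)]

theorem Memory.Ext.mono {C C' : Set ℕ} {m m' : Memory w} (h : m.Ext C m')
    (hC : ∀ c ∈ C, c < m.next → c ∈ C') : m.Ext C' m' :=
  h.trans (.refl ∅ m') hC (by simp)

theorem Memory.Ext.trans_same {C : Set ℕ} {m m' m'' : Memory w} (h : m.Ext C m')
    (h' : m'.Ext C m'') : m.Ext C m'' :=
  h.trans h' (fun _ h _ => h) fun _ h _ => h

/-- The cells of an array. -/
def Arr.cells (T : Arr) : Set ℕ := {c | ∃ i < T.len, T.cell i = c}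

theorem Arr.cell_mem {T : Arr} {i : ℕ} (h : i < T.len) : T.cell i ∈ T.cells := ⟨i, h, rfl⟩

/-- The entries lie in different cells. -/
def Arr.Inj (T : Arr) : Prop := ∀ i < T.len, ∀ j < T.len, T.cell i = T.cell j → i = j

/-- An array that was reserved between the memories `m` and `m'`. -/
structure Arr.Fresh (T : Arr) (m m' : Memory w) : Prop where
  inj : T.Inj
  low : ∀ i < T.len, m.next ≤ T.cell i
  high : ∀ i < T.len, T.cell i < m'.next

theorem Arr.Fresh.mono {T : Arr} {m₀ m m' m'' : Memory w} (h : T.Fresh m m')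
    (h₀ : m₀.next ≤ m.next) (h' : m'.next ≤ m''.next) : T.Fresh m₀ m'' :=
  ⟨h.inj, fun i hi => h₀.trans (h.low i hi), fun i hi => (h.high i hi).trans_le h'⟩

theorem Arr.Fresh.not_mem {T : Arr} {m m' : Memory w} (h : T.Fresh m m') {c : ℕ}
    (hc : c < m.next) : c ∉ T.cells := by
  rintro ⟨i, hi, rfl⟩
  exact absurd (h.low i hi) (by omega)

/-- Filling an array that was reserved after `m₀` is invisible from `m₀`. Most subprotocols
therefore satisfy `Ext ∅`, and everything known about older arrays survives them. -/
theorem Memory.Ext.of_fresh {C : Set ℕ} {T : Arr} {m₀ m m' m'' : Memory w} (hm : m₀.next ≤ m.next)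
    (hT : T.Fresh m m') (e : m₀.Ext C m') (e' : m'.Ext T.cells m'') : m₀.Ext C m'' :=
  e.trans e' (fun _ h _ => h) fun c hc hc' => absurd hc (hT.not_mem (by omega))

theorem Arr.Fresh.take {T : Arr} {m m' : Memory w} (h : T.Fresh m m') (n : ℕ) :
    (T.take n).Fresh m m' := by
  have : (T.take n).len ≤ T.len := min_le_right _ _
  exact ⟨fun i hi j hj => h.inj i (by omega) j (by omega), fun i hi => h.low i (by omega),
    fun i hi => h.high i (by omega)⟩

/-- Server `s` holds the same memory. -/
structure Eqv (s : Fin 3) (m m' : Memory w) : Prop where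
  block : m.block s = m'.block s
  next : m.next = m'.next

theorem Eqv.refl (s : Fin 3) (m : Memory w) : Eqv s m m := ⟨rfl, rfl⟩

theorem Eqv.set {s : Fin 3} {m m' : Memory w} (h : Eqv s m m') {t : Fin 3} {a a' : Addr}
    {v v' : Bits w} (ht : t = s → a = a' ∧ v = v') : Eqv s (m.set t a v) (m'.set t a' v') := by
  refine ⟨funext fun b => ?_, h.next⟩
  rw [Memory.set_block, Memory.set_block, h.block]
  by_cases hts : t = s
  · rw [(ht hts).1, (ht hts).2]
  · simp [Ne.symm hts]

end Memories

/-! ## Programs whose addresses do not depend on the data -/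

section Obl

variable {w : ℕ} {α β γ δ : Type} {s : Fin 3}

/-- The programs look the same to server `s`, whatever the other servers hold. -/
def Obl (s : Fin 3) (c : Client w α) (c' : Client w β) (r : α → β → Prop) : Prop :=
  ∀ m m', Eqv s m m' → Rel s c m c' m' fun a n a' n' => Eqv s n n' ∧ r a a'

theorem Obl.mono {c : Client w α} {c' : Client w β} {r r' : α → β → Prop} (h : Obl s c c' r)
    (hr : ∀ a b, r a b → r' a b) : Obl s c c' r' :=
  fun m m' e => (h m m' e).mono fun _ _ _ _ h => ⟨h.1, hr _ _ h.2⟩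

theorem Obl.pure {a : α} {b : β} {r : α → β → Prop} (h : r a b) :
    Obl s (Pure.pure a : Client w α) (Pure.pure b) r :=
  fun _ _ e => Rel.pure ⟨e, h⟩

theorem Obl.bind {c : Client w α} {c' : Client w β} {k : α → Client w γ} {k' : β → Client w δ}
    {r : α → β → Prop} {r' : γ → δ → Prop} (h : Obl s c c' r)
    (hk : ∀ a b, r a b → Obl s (k a) (k' b) r') : Obl s (c >>= k) (c' >>= k') r' :=
  fun m m' e => (h m m' e).bind fun a n b n' hab => hk a b hab.2 n n' hab.1

/-- The answers are related only for `t = s`, because `Eqv` says nothing about the memory of the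
other servers. -/
theorem Obl.read {t : Fin 3} {a a' : Addr} (ha : t = s → a = a') :
    Obl s (Client.read t a : Client w _) (Client.read t a') fun x y => t = s → x = y :=
  fun m m' e => Rel.read ha ⟨e, fun hts => by subst hts; rw [e.block, ha rfl]⟩

theorem Obl.write {t : Fin 3} {a a' : Addr} {v v' : Bits w} (ha : t = s → a = a' ∧ v = v') :
    Obl s (Client.write t a v) (Client.write t a' v') fun _ _ => True :=
  fun _ _ e => Rel.write ha ⟨e.set ha, trivial⟩

theorem Obl.newArr (n : ℕ) : Obl s (newArr n : Client w Arr) (newArr n) Eq := by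
  refine Obl.bind (r := Eq) (fun m m' e => Rel.reserve ⟨⟨e.block, by simp [e.next]⟩, e.next⟩) ?_
  rintro a _ rfl
  exact Obl.pure rfl

theorem Obl.forM {l : List γ} {f g : γ → Client w Unit}
    (h : ∀ i ∈ l, Obl s (f i) (g i) fun _ _ => True) :
    Obl s (l.forM f) (l.forM g) fun _ _ => True := by
  induction l with
  | nil => exact Obl.pure trivial
  | cons i l ih =>
    exact Obl.bind (h i (by simp)) fun _ _ _ => ih fun j hj => h j (by simp [hj])

theorem Obl.foldlM {σ τ : Type} {l : List γ} {f : σ → γ → Client w σ} {g : τ → γ → Client w τ}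
    {a : σ} {b : τ} (r : σ → τ → Prop) (h₀ : r a b)
    (h : ∀ i ∈ l, ∀ a b, r a b → Obl s (f a i) (g b i) r) :
    Obl s (l.foldlM f a) (l.foldlM g b) r := by
  induction l generalizing a b with
  | nil => exact Obl.pure h₀
  | cons i l ih =>
    rw [List.foldlM_cons, List.foldlM_cons]
    exact Obl.bind (h i (by simp) a b h₀) fun a b hab => ih hab fun j hj => h j (by simp [hj])

theorem Obl.mapM {l : List γ} {f : γ → Client w α} {g : γ → Client w β} {r : α → β → Prop}
    (h : ∀ i ∈ l, Obl s (f i) (g i) r) :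
    Obl s (l.mapM f) (l.mapM g) (List.Forall₂ r) := by
  induction l with
  | nil => exact Obl.pure .nil
  | cons i l ih =>
    rw [List.mapM_cons, List.mapM_cons]
    refine Obl.bind (h i (by simp)) fun a b hab => ?_
    exact Obl.bind (ih fun j hj => h j (by simp [hj])) fun as bs hs => Obl.pure (.cons hab hs)

theorem Obl.collect {f : Fin 3 → Client w α} {g : Fin 3 → Client w β} {r : Fin 3 → α → β → Prop}
    (h : ∀ b, Obl s (f b) (g b) (r b)) :
    Obl s (collect f) (collect g) fun x y => ∀ b, r b (x b) (y b) := by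
  refine Obl.bind (h 0) fun x₀ y₀ h₀ => Obl.bind (h 1) fun x₁ y₁ h₁ =>
    Obl.bind (h 2) fun x₂ y₂ h₂ => Obl.pure fun b => ?_
  fin_cases b
  exacts [h₀, h₁, h₂]

theorem Obl.forServers {f g : Fin 3 → Client w Unit}
    (h : ∀ b, Obl s (f b) (g b) fun _ _ => True) :
    Obl s (forServers f) (forServers g) fun _ _ => True :=
  Obl.bind (h 0) fun _ _ _ => Obl.bind (h 1) fun _ _ _ => h 2

theorem Rel.of_obl {m m' : Memory w} {c : Client w α} {c' : Client w β} {r : α → β → Prop}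
    (h : Obl s c c' r) (e : Eqv s m m') :
    Rel s c m c' m' fun a n a' n' => Eqv s n n' ∧ r a a' := h m m' e

end Obl

/-! ## Shares -/

section Shares

variable {D B : ℕ} (F : BlockFormat D B) {s : Fin 3}

/-- Cell `c` holds XOR-shares of `x`. -/
structure Shared (m : Memory F.width) (c : ℕ) (x : Item D B) : Prop where
  decode : F.decode (m.block 0 ⟨0, c⟩ + m.block 1 ⟨1, c⟩ + m.block 2 ⟨2, c⟩) = x
  copy : ∀ b, m.block (b - 1) ⟨b, c⟩ = m.block b ⟨b, c⟩

/-- The entries of `T` are `X 0, X 1, …`. -/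
def Holds (m : Memory F.width) (T : Arr) (X : ℕ → Item D B) : Prop :=
  ∀ i < T.len, T.cell i < m.next ∧ Shared F m (T.cell i) (X i)

/-- A permutation of `{0, …, n - 1}`. -/
structure IsPerm (n : ℕ) (q : ℕ → ℕ) : Prop where
  lt : ∀ i < n, q i < n
  inj : ∀ i < n, ∀ j < n, q i = q j → i = j

/-- The permutation servers hold the permutations `q 0`, `q 1`, `q 2` in `P`. -/
structure HoldsPerm (m : Memory F.width) (P : Arr) (q : Fin 3 → ℕ → ℕ) : Prop where
  perm : ∀ b, IsPerm P.len (q b)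
  high : ∀ i < P.len, P.cell i < m.next
  block : ∀ i < P.len, ∀ b : Fin 3,
    m.block (b - 1) ⟨b, P.cell i⟩ = F.encode (.index (Fin.ofNat _ (q b i)))

/-- Share `b` of `X i` is entry `q b i` of `T`. -/
structure HoldsPermuted (m : Memory F.width) (T : Arr) (q : Fin 3 → ℕ → ℕ) (X : ℕ → Item D B) :
    Prop where
  high : ∀ i < T.len, T.cell i < m.next
  decode : ∀ i < T.len, F.decode (m.block 0 ⟨0, T.cell (q 0 i)⟩ + m.block 1 ⟨1, T.cell (q 1 i)⟩ +
    m.block 2 ⟨2, T.cell (q 2 i)⟩) = X i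
  copy : ∀ i < T.len, ∀ b : Fin 3, m.block (b - 1) ⟨b, T.cell i⟩ = m.block b ⟨b, T.cell i⟩

variable {F} {m m' : Memory F.width} {C : Set ℕ} {T P : Arr} {X : ℕ → Item D B}
  {q : Fin 3 → ℕ → ℕ}

theorem Shared.ext {c : ℕ} {x : Item D B} (h : Shared F m c x) (e : m.Ext C m')
    (hc : c < m.next) (hC : c ∉ C) : Shared F m' c x := by
  constructor
  · rw [e.block _ _ hc hC, e.block _ _ hc hC, e.block _ _ hc hC, h.decode]
  · intro b
    rw [e.block _ _ hc hC, e.block _ _ hc hC, h.copy]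

theorem Holds.ext (h : Holds F m T X) (e : m.Ext C m') (hC : ∀ i < T.len, T.cell i ∉ C) :
    Holds F m' T X := fun i hi =>
  ⟨(h i hi).1.trans_le e.next, (h i hi).2.ext e (h i hi).1 (hC i hi)⟩

theorem Holds.ext_empty (h : Holds F m T X) (e : m.Ext ∅ m') : Holds F m' T X :=
  h.ext e fun _ _ => id

theorem Holds.congr {Y : ℕ → Item D B} (h : Holds F m T X) (hXY : ∀ i < T.len, X i = Y i) :
    Holds F m T Y := fun i hi => hXY i hi ▸ h i hi

theorem HoldsPerm.ext (h : HoldsPerm F m P q) (e : m.Ext C m') (hC : ∀ i < P.len, P.cell i ∉ C) :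
    HoldsPerm F m' P q :=
  ⟨h.perm, fun i hi => (h.high i hi).trans_le e.next, fun i hi b => by
    rw [e.block _ _ (h.high i hi) (hC i hi), h.block i hi]⟩

theorem HoldsPerm.ext_empty (h : HoldsPerm F m P q) (e : m.Ext ∅ m') : HoldsPerm F m' P q :=
  h.ext e fun _ _ => id

theorem HoldsPermuted.ext (h : HoldsPermuted F m T q X) (hq : ∀ b, IsPerm T.len (q b))
    (e : m.Ext C m') (hC : ∀ i < T.len, T.cell i ∉ C) : HoldsPermuted F m' T q X := by
  refine ⟨fun i hi => (h.high i hi).trans_le e.next, fun i hi => ?_, fun i hi b => ?_⟩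
  · have hb : ∀ b, m'.block b ⟨b, T.cell (q b i)⟩ = m.block b ⟨b, T.cell (q b i)⟩ := fun b =>
      e.block _ _ (h.high _ ((hq b).lt i hi)) (hC _ ((hq b).lt i hi))
    rw [hb, hb, hb, h.decode i hi]
  · rw [e.block _ _ (h.high i hi) (hC i hi), e.block _ _ (h.high i hi) (hC i hi), h.copy i hi]

theorem Holds.take (h : Holds F m T X) (n : ℕ) : Holds F m (T.take n) X := fun i hi =>
  h i (hi.trans_le (min_le_right _ _))

theorem Holds.append {S : Arr} {Y : ℕ → Item D B} (hS : Holds F m S X) (hT : Holds F m T Y) :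
    Holds F m (S.append T) fun i => if i < S.len then X i else Y (i - S.len) := by
  intro i hi
  simp only [Arr.append] at hi ⊢
  split_ifs with h
  · exact hS i h
  · exact hT _ (by omega)

/-! ### Primitive operations -/

variable {α : Type}

theorem sure_newArr {w : ℕ} {m : Memory w} (n : ℕ) : (newArr n).Sure m fun T m' =>
    T.len = n ∧ T.Fresh m m' ∧ m.Ext ∅ m' :=
  ⟨rfl, ⟨fun i _ j _ h => by simpa using h, fun i _ => by simp, fun i hi => by simpa using hi⟩,
    ⟨by simp, fun _ _ _ _ => rfl⟩⟩

/-- Differences for the coins of a secret write that change the shared block by `d` and keep the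
shares `s` and `s + 1`. -/
def shareShift {w : ℕ} (s : Fin 3) (d : Bits w) : Bits w × Bits w :=
  -- Server `s` sees the shares `s` and `s + 1` among `r`, `r'`, `x + r + r'`. For `s = 0` these are
  -- the coins, so nothing moves; for `s = 1` the coin `r` is free and absorbs `d`, for `s = 2` the
  -- coin `r'`.
  if s = 1 then (d, 0) else if s = 2 then (0, d) else 0

theorem bits_add_self {w : ℕ} (x : Bits w) : x + x = 0 := funext fun _ => CharTwo.add_self_eq_zero _

/-- Two of three XOR shares are independent of the secret. The shift by `shareShift` throws the
difference of `x` and `x'` onto the share that server `s` does not hold. -/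
theorem obl_secretWrite (T : Arr) (i : ℕ) (x x' : Item D B) :
    Obl s (secretWrite F T i x) (secretWrite F T i x') fun _ _ => True := by
  intro m m' e
  refine Rel.coins_pair (Equiv.addRight (shareShift s (F.encode x + F.encode x'))) fun ρ => ?_
  refine Obl.forServers (fun b => ?_) m m' e
  have h : ∀ b, b = s ∨ b = s + 1 → (![ρ.1, ρ.2, F.encode x + ρ.1 + ρ.2] : Fin 3 → _) b =
      ![(ρ + shareShift s (F.encode x + F.encode x')).1,
        (ρ + shareShift s (F.encode x + F.encode x')).2,
        F.encode x' + (ρ + shareShift s (F.encode x + F.encode x')).1 +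
        (ρ + shareShift s (F.encode x + F.encode x')).2] b := by
    have h₂ : F.encode x + ρ.1 + ρ.2 =
        F.encode x' + (ρ.1 + (F.encode x + F.encode x')) + ρ.2 := by
      linear_combination -(bits_add_self (F.encode x'))
    have h₃ : F.encode x + ρ.1 + ρ.2 =
        F.encode x' + ρ.1 + (ρ.2 + (F.encode x + F.encode x')) := by
      linear_combination -(bits_add_self (F.encode x'))
    rintro b (rfl | rfl)
    · fin_cases b
      · simp [shareShift]
      · simp [shareShift]
      · simpa [shareShift] using h₃
    · fin_cases s
      · simp [shareShift]
      · simpa [shareShift] using h₂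
      · simp [shareShift]
  -- Share `b` goes to server `b` and to server `b - 1`, which are `s` for `b = s` and for `b = s +
  -- 1` respectively.
  refine Obl.bind (Obl.write fun hb => ⟨rfl, h b (.inl hb)⟩) fun _ _ _ => Obl.write fun hb => ?_
  exact ⟨rfl, h b (.inr (by rw [← hb]; simp))⟩

theorem sure_secretWrite (T : Arr) (i : ℕ) (x : Item D B) :
    (secretWrite F T i x).Sure m fun _ m' => m.Ext {T.cell i} m' ∧ Shared F m' (T.cell i) x := by
  intro r r'
  simp only [forServers, bind, andThen, Client.write, Sure]
  refine ⟨⟨le_rfl, fun t a _ hC => ?_⟩, ?_, ?_⟩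
  · have hC' : a.cell ≠ T.cell i := hC
    repeat rw [Memory.set_block_cell _ _ _ _ _ _ hC']
  · simp only [Memory.set_block]
    simp
    rw [show r + r' + (F.encode x + r + r') = F.encode x by
      linear_combination bits_add_self r + bits_add_self r', F.decode_encode]
  · intro b
    fin_cases b <;> simp [Memory.set_block]

theorem sure_reconstructAt {i : ℕ} (hT : Holds F m T X) (hi : i < T.len) :
    (reconstructAt F T i).Sure m fun x m' => m' = m ∧ x = X i :=
  ⟨rfl, (hT i hi).2.decode⟩

theorem sure_scanAt {i : ℕ} (hT : Holds F m T X) (hi : i < T.len) :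
    (scanAt F T i).Sure m fun x m' => m' = m ∧ x = X i := by
  have := (hT i hi).2.copy
  refine ⟨rfl, ?_⟩
  simp only [Matrix.cons_val]
  rw [this 0, this 1, this 2, (hT i hi).2.decode]

/-- The tuple of the places of entry `i`. -/
def posOf (D : ℕ) (q : Fin 3 → ℕ → ℕ) (i : ℕ) : Pos D := fun b => Fin.ofNat _ (q b i)

/-- Places are stored modulo `2 ^ (D + 1)`; below this bound nothing is lost. The length bounds in
later statements serve this purpose. -/
theorem posOf_val {i : ℕ} {n : ℕ} (hq : ∀ b, IsPerm n (q b)) (hi : i < n)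
    (hn : n ≤ 2 ^ (D + 1)) (b : Fin 3) : (posOf D q i b).val = q b i :=
  Nat.mod_eq_of_lt (((hq b).lt i hi).trans_le hn)

theorem sure_readPos {i : ℕ} (hP : HoldsPerm F m P q) (hi : i < P.len) :
    (readPos F P i).Sure m fun p m' => m' = m ∧ p = posOf D q i := by
  refine ⟨rfl, funext fun b => ?_⟩
  have h : ∀ b : Fin 3, (F.decode (m.block (b - 1) ⟨b, P.cell i⟩)).asIndex = posOf D q i b :=
    fun b => by rw [hP.block i hi, F.decode_encode]; rfl
  fin_cases b
  exacts [h 0, h 1, h 2]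

/-- Server `s` is asked for share `s` only, so of the three places just `p s` is exposed to it. -/
theorem obl_reconstruct {p p' : Fin 3 → ℕ} (h : p s = p' s) :
    Obl s (reconstruct F T p) (reconstruct F T p') fun _ _ => True := by
  refine Obl.bind (Obl.collect fun b => Obl.read ?_) fun _ _ _ => Obl.pure trivial
  rintro rfl
  rw [h]

theorem obl_reconstructAt (T : Arr) (i : ℕ) :
    Obl s (reconstructAt F T i) (reconstructAt F T i) fun _ _ => True := obl_reconstruct rfl

theorem obl_scanAt (T : Arr) (i : ℕ) :
    Obl s (scanAt F T i) (scanAt F T i) fun _ _ => True :=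
  Obl.bind (Obl.collect fun _ => Obl.read fun _ => rfl) fun _ _ _ => Obl.pure trivial

theorem obl_readPos (P : Arr) (i : ℕ) :
    Obl s (readPos F P i) (readPos F P i) fun _ _ => True :=
  (Obl.collect (r := fun _ _ _ => True) fun _ => Obl.bind (Obl.read fun _ => rfl)
    fun _ _ _ => Obl.pure trivial).mono fun _ _ _ => trivial

theorem obl_fetchEntry {T L : Arr} {p p' : Pos D} (h : p s = p' s) :
    Obl s (fetchEntry F T L p) (fetchEntry F T L p') fun _ _ => True :=
  Obl.bind (obl_reconstruct (by rw [h])) fun _ _ _ =>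
    Obl.bind (obl_reconstruct (by rw [h])) fun _ _ _ => Obl.pure trivial

theorem sure_fetchEntry {T L : Arr} {Y : ℕ → Item D B} {i n : ℕ} (hq : ∀ b, IsPerm n (q b))
    (hn : n ≤ 2 ^ (D + 1)) (hT : HoldsPermuted F m T q X) (hL : HoldsPermuted F m L q Y)
    (hTn : T.len = n) (hLn : L.len = n) (hi : i < n) :
    (fetchEntry F T L (posOf D q i)).Sure m fun r m' => m' = m ∧ r = (X i, (Y i).asLink) := by
  refine ⟨rfl, ?_⟩
  simp only [posOf_val hq hi hn, Matrix.cons_val]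
  rw [hT.decode i (by omega), hL.decode i (by omega)]

end Shares

open Client

/-! ## Permutations and masks -/

section Loops

variable {w : ℕ} {γ : Type} {s : Fin 3}

/-- Nothing is reserved from `m` to `m'`, and only cells in `C` may have changed. -/
structure Memory.Off (C : Set ℕ) (m m' : Memory w) : Prop where
  next : m'.next = m.next
  block : ∀ t a, a.cell ∉ C → m'.block t a = m.block t a

theorem Memory.Off.ext {C : Set ℕ} {m m' : Memory w} (h : m.Off C m') : m.Ext C m' :=
  ⟨h.next.ge, fun t a _ hC => h.block t a hC⟩

theorem Memory.Off.refl (C : Set ℕ) (m : Memory w) : m.Off C m := ⟨rfl, fun _ _ _ => rfl⟩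

theorem Memory.Off.trans {C : Set ℕ} {m m' m'' : Memory w} (h : m.Off C m') (h' : m'.Off C m'') :
    m.Off C m'' :=
  ⟨h'.next.trans h.next, fun t a hC => (h'.block t a hC).trans (h.block t a hC)⟩

/-- A loop whose round `i` writes `v i` to address `a i` of server `t`. -/
theorem sure_write_loop {l : List γ} {t : Fin 3} {a : γ → Addr} {v : γ → Bits w}
    {body : γ → Client w Unit} {m : Memory w}
    (inj : ∀ i ∈ l, ∀ j ∈ l, a i = a j → i = j)
    (hbody : ∀ i ∈ l, ∀ m' : Memory w,
      (∀ t' a', (t' = t → ∀ j ∈ l, a' ≠ a j) → m'.block t' a' = m.block t' a') →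
      (body i).Sure m' fun _ m'' => m'' = m'.set t (a i) (v i)) :
    (l.forM body).Sure m fun _ m' => m'.next = m.next ∧ (∀ i ∈ l, m'.block t (a i) = v i) ∧
      ∀ t' a', (t' = t → ∀ j ∈ l, a' ≠ a j) → m'.block t' a' = m.block t' a' := by
  refine (Sure.forM (fun k m' => m'.next = m.next ∧
    (∀ j (_ : j < k) (hj : j < l.length), m'.block t (a l[j]) = v l[j]) ∧
    ∀ t' a', (t' = t → ∀ j ∈ l, a' ≠ a j) → m'.block t' a' = m.block t' a')
    ⟨rfl, by simp, fun _ _ _ => rfl⟩ ?_).mono ?_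
  · rintro k hk m' ⟨h₁, h₂, h₃⟩
    refine (hbody _ (List.getElem_mem hk) m' h₃).mono ?_
    rintro _ _ rfl
    refine ⟨h₁, fun j hj hjl => ?_, fun t' a' h => ?_⟩
    · rw [Memory.set_block]
      split_ifs with h
      · rw [inj _ (List.getElem_mem _) _ (List.getElem_mem _) h.2]
      · refine h₂ j (lt_of_le_of_ne (by omega) ?_) hjl
        rintro rfl
        simp at h
    · rw [Memory.set_block, if_neg, h₃ t' a' h]
      exact fun h' => h h'.1 _ (List.getElem_mem hk) h'.2
  · rintro _ m' ⟨h₁, h₂, h₃⟩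
    refine ⟨h₁, fun i hi => ?_, h₃⟩
    obtain ⟨j, hj, rfl⟩ := List.getElem_of_mem hi
    exact h₂ j hj hj

/-- `J` is an invariant of the whole loop; `C b` is established in round `b` and survives the other
two rounds. -/
theorem sure_forServers {f : Fin 3 → Client w Unit} (J : Memory w → Prop)
    (C : Fin 3 → Memory w → Prop)
    (hstep : ∀ b m, J m → (f b).Sure m fun _ n => J n ∧ C b n ∧ ∀ b' ≠ b, C b' m → C b' n)
    {m : Memory w} (hJ : J m) : (forServers f).Sure m fun _ n => J n ∧ ∀ b, C b n := by
  refine (hstep 0 m hJ).bind fun _ n₀ ⟨j₀, h₀, _⟩ => ?_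
  refine (hstep 1 n₀ j₀).bind fun _ n₁ ⟨j₁, h₁, k₁⟩ => ?_
  refine (hstep 2 n₁ j₁).mono fun _ n₂ ⟨j₂, h₂, k₂⟩ => ⟨j₂, fun b => ?_⟩
  fin_cases b
  · exact k₂ _ (by decide) (k₁ _ (by decide) h₀)
  · exact k₂ _ (by decide) h₁
  · exact h₂

/-- A family of three programs of which the one for server `t` establishes `C`. -/
theorem rel_forServers {f g : Fin 3 → Client w Unit} (t : Fin 3)
    (J C : Memory w → Memory w → Prop)
    (hstep : ∀ b m m', Eqv s m m' → J m m' → Rel s (f b) m (g b) m' fun _ n _ n' =>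
      Eqv s n n' ∧ J n n' ∧ (b = t → C n n') ∧ (b ≠ t → C m m' → C n n'))
    {m m' : Memory w} (e : Eqv s m m') (hJ : J m m') :
    Rel s (forServers f) m (forServers g) m' fun _ n _ n' => Eqv s n n' ∧ J n n' ∧ C n n' := by
  refine (hstep 0 m m' e hJ).bind fun _ n₀ _ n₀' ⟨e₀, j₀, h₀, h₀'⟩ => ?_
  refine (hstep 1 n₀ n₀' e₀ j₀).bind fun _ n₁ _ n₁' ⟨e₁, j₁, h₁, h₁'⟩ => ?_
  refine (hstep 2 n₁ n₁' e₁ j₁).mono fun _ n₂ _ n₂' ⟨e₂, j₂, h₂, h₂'⟩ => ⟨e₂, j₂, ?_⟩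
  fin_cases t
  · exact h₂' (by decide) (h₁' (by decide) (h₀ rfl))
  · exact h₂' (by decide) (h₁ rfl)
  · exact h₂ rfl

end Loops

section Permutations

variable {D B : ℕ} {F : BlockFormat D B} {s : Fin 3} {m m' : Memory F.width}
  {P T S R M : Arr} {X : ℕ → Item D B} {q q' : Fin 3 → ℕ → ℕ} {n : ℕ}

theorem fin3_sub_one_add (b : Fin 3) : b - 1 + 1 = b := sub_add_cancel b 1

theorem fin3_add_one_sub (b : Fin 3) : b + 1 - 1 = b := add_sub_cancel_right b 1

theorem fin3_ne_add_one : ∀ b : Fin 3, b ≠ b + 1 := by decide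

theorem IsPerm.surj {q : ℕ → ℕ} (h : IsPerm n q) {j : ℕ} (hj : j < n) : ∃ i < n, q i = j := by
  have : Function.Surjective fun i : Fin n => (⟨q i, h.lt i i.2⟩ : Fin n) :=
    Finite.surjective_of_injective fun i j hij =>
      Fin.ext (h.inj i i.2 j j.2 (by simpa using hij))
  obtain ⟨i, hi⟩ := this ⟨j, hj⟩
  exact ⟨i, i.2, by simpa using hi⟩

/-! ### Drawing permutations -/

/-- The program that stores the permutation `π` in bank `b + 1` of server `b`. -/
def storePerm (F : BlockFormat D B) (P : Arr) (n : ℕ) (b : Fin 3) (π : Equiv.Perm (Fin n)) :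
    Client F.width Unit :=
  (List.finRange n).forM fun i =>
    Client.write b ⟨b + 1, P.cell i⟩ (F.encode (.index (Fin.ofNat _ (π i).val)))

theorem sure_storePerm (b : Fin 3) (π : Equiv.Perm (Fin n)) (hP : P.Inj) (hn : P.len = n) :
    (storePerm F P n b π).Sure m fun _ m' => m'.next = m.next ∧
      (∀ i : Fin n, m'.block b ⟨b + 1, P.cell i⟩ = F.encode (.index (Fin.ofNat _ (π i).val))) ∧
      ∀ t a, (t = b → a.cell ∉ P.cells) → m'.block t a = m.block t a := by
  refine (sure_write_loop (l := List.finRange n) (m := m) (t := b)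
    (a := fun i : Fin n => ⟨b + 1, P.cell i⟩)
    (v := fun i => F.encode (.index (Fin.ofNat _ (π i).val))) (fun i _ j _ h => ?_)
    fun i _ m' _ => by simp [Client.write, Sure]).mono ?_
  · simp only [Addr.mk.injEq, true_and] at h
    exact Fin.ext (hP _ (hn ▸ i.2) _ (hn ▸ j.2) h)
  · rintro _ m' ⟨h₁, h₂, h₃⟩
    refine ⟨h₁, fun i => h₂ i (List.mem_finRange i), fun t a h => h₃ t a fun htb j _ hj => ?_⟩
    exact h htb (hj ▸ Arr.cell_mem (hn ▸ j.2))

theorem sure_genPerms (n : ℕ) : (genPerms F n).Sure m fun P m' =>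
    P.len = n ∧ P.Fresh m m' ∧ m.Ext ∅ m' ∧ ∃ q, HoldsPerm F m' P q := by
  refine (sure_newArr n).bind fun P m₁ ⟨hn, hf, e⟩ => ?_
  refine Sure.bind (sure_forServers (m := m₁)
    (f := fun b => Client.perm n >>= storePerm F P n b) (fun n' => m₁.Off P.cells n')
    (fun b n' => ∃ π : Equiv.Perm (Fin n), ∀ i : Fin n,
      n'.block b ⟨b + 1, P.cell i⟩ = F.encode (.index (Fin.ofNat _ (π i).val)))
    (fun b m₂ hm₂ π => ?_) (.refl _ _)) ?_
  · refine (sure_storePerm b π hf.inj hn).mono fun _ m₃ ⟨h₁, h₂, h₃⟩ => ⟨?_, ⟨π, h₂⟩, ?_⟩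
    · exact hm₂.trans ⟨h₁, fun t a ha => h₃ t a fun _ => ha⟩
    · rintro b' hb' ⟨π', h⟩
      exact ⟨π', fun i => by rw [h₃ _ _ fun h => absurd h hb', h]⟩
  · rintro _ m₂ ⟨h₁, h₂⟩
    choose π hπ using h₂
    refine Sure.pure ⟨hn, hf.mono le_rfl h₁.next.ge, ?_,
      -- The permutation for share `b` is the one drawn in round `b - 1`. Outside `{0, …, n - 1}`
      -- the value `0` is arbitrary.
      fun b i => if h : i < n then π (b - 1) ⟨i, h⟩ else 0, ?_, ?_, ?_⟩
    · exact e.of_fresh le_rfl hf h₁.ext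
    · intro b
      constructor
      · intro i hi
        rw [hn] at hi ⊢
        simp [hi]
      · intro i hi j hj h
        rw [hn] at hi hj
        simpa [hi, hj, Fin.val_inj] using h
    · intro i hi
      rw [h₁.next]
      exact hf.high i hi
    · intro i hi b
      rw [hn] at hi
      have := hπ (b - 1) ⟨i, hi⟩
      rw [fin3_sub_one_add] at this
      simp [hi, this]

/-- The permutations for share `s` can be coupled by any rearrangement `σ` of the entries. -/
theorem rel_genPerms (n : ℕ) (σ : Equiv.Perm (Fin n)) (e : Eqv s m m') :
    Rel s (genPerms F n) m (genPerms F n) m' fun P m₁ P' m₁' => Eqv s m₁ m₁' ∧ P = P' ∧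
      ∀ i : Fin n, m₁.block (s - 1) ⟨s, P.cell i⟩ = m₁'.block (s - 1) ⟨s, P.cell (σ i)⟩ := by
  refine (((Obl.newArr n) m m' e).and_sure (sure_newArr n) (sure_newArr n)).bind ?_
  rintro P m₁ _ m₁' ⟨⟨e, rfl⟩, ⟨hn, hf, _⟩, -⟩
  refine Rel.bind (rel_forServers (s - 1) (fun _ _ => True)
    (fun m m' => ∀ i : Fin n, m.block (s - 1) ⟨s, P.cell i⟩ = m'.block (s - 1) ⟨s, P.cell (σ i)⟩)
    (fun b m m' e _ => ?_) e trivial) fun _ m₂ _ m₂' h => Rel.pure ⟨h.1, rfl, h.2.2⟩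
  -- In round `s - 1` the draw `π` is matched with `π * σ⁻¹`, which sends `σ i` to `π i`. That
  -- permutation is stored on an honest server; the other two rounds use equal draws.
  refine Rel.perm (if b = s - 1 then Equiv.mulRight σ⁻¹ else Equiv.refl _) fun π => ?_
  have ho : Obl s (storePerm F P n b π) (storePerm F P n b
      ((if b = s - 1 then Equiv.mulRight σ⁻¹ else Equiv.refl _ :
        Equiv.Perm (Fin n) ≃ Equiv.Perm (Fin n)) π)) fun _ _ => True :=
    Obl.forM fun i _ => Obl.write fun hb => ⟨rfl, by
      rw [if_neg (by rw [hb]; fin_cases s <;> decide)]; rfl⟩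
  refine ((ho m m' e).and_sure (sure_storePerm b _ hf.inj hn)
    (sure_storePerm b _ hf.inj hn)).mono ?_
  rintro _ m₂ _ m₂' ⟨⟨e₂, -⟩, ⟨-, h₂, h₃⟩, -, h₂', h₃'⟩
  refine ⟨e₂, trivial, ?_, fun hb h i => ?_⟩
  · rintro rfl i
    rw [fin3_sub_one_add] at h₂ h₂'
    rw [h₂, h₂', if_pos rfl]
    simp
  · rw [h₃ _ _ fun h => absurd h.symm hb, h₃' _ _ fun h => absurd h.symm hb, h]

/-! ### Masks -/

/-- The masks of the three shares that are made of two blocks. -/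
def masks {w : ℕ} (r r' : Bits w) : Fin 3 → Bits w := ![r, r', r + r']

/-- The masks of the shares `s` and `s + 1` determine the coins. -/
def maskCoords {w : ℕ} (s : Fin 3) : Bits w × Bits w ≃ Bits w × Bits w where
  toFun x := (masks x.1 x.2 s, masks x.1 x.2 (s + 1))
  -- Any two of `r`, `r'`, `r + r'` add up to the third, so a missing coin is recovered as a sum.
  invFun y := if s = 0 then y else if s = 1 then (y.1 + y.2, y.1) else (y.2, y.1 + y.2)
  left_inv x := by
    have h₁ : x.2 + (x.1 + x.2) = x.1 := by linear_combination bits_add_self x.2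
    have h₂ : x.1 + x.2 + x.1 = x.2 := by linear_combination bits_add_self x.1
    fin_cases s <;> simp [masks, h₁, h₂]
  right_inv x := by
    have h₁ : x.1 + x.2 + x.1 = x.2 := by linear_combination bits_add_self x.1
    have h₂ : x.2 + (x.1 + x.2) = x.1 := by linear_combination bits_add_self x.2
    fin_cases s <;> simp [masks, h₁, h₂]

/-- Coins for masks that agree with those of `ρ` for share `s + 1`, and for share `s` after the
rearrangement `τ` and the addition of `δ`. -/
def maskShift {w n : ℕ} (s : Fin 3) (τ : Equiv.Perm (Fin n)) (δ : Fin n → Bits w) :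
    (Fin n → Bits w × Bits w) ≃ (Fin n → Bits w × Bits w) where
  toFun ρ i := (maskCoords s).symm
    ((maskCoords s (ρ (τ.symm i))).1 + δ i, (maskCoords s (ρ i)).2)
  invFun ρ i := (maskCoords s).symm
    ((maskCoords s (ρ (τ i))).1 + δ (τ i), (maskCoords s (ρ i)).2)
  left_inv ρ := by
    funext i
    simp [add_assoc, bits_add_self]
  right_inv ρ := by
    funext i
    simp [add_assoc, bits_add_self]

theorem maskShift_left {w n : ℕ} (s : Fin 3) (τ : Equiv.Perm (Fin n)) (δ : Fin n → Bits w)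
    (ρ : Fin n → Bits w × Bits w) (i : Fin n) :
    masks (maskShift s τ δ ρ i).1 (maskShift s τ δ ρ i).2 s =
      masks (ρ (τ.symm i)).1 (ρ (τ.symm i)).2 s + δ i := by
  change (maskCoords s (maskShift s τ δ ρ i)).1 = (maskCoords s (ρ (τ.symm i))).1 + δ i
  simp [maskShift]

theorem maskShift_right {w n : ℕ} (s : Fin 3) (τ : Equiv.Perm (Fin n)) (δ : Fin n → Bits w)
    (ρ : Fin n → Bits w × Bits w) (i : Fin n) :
    masks (maskShift s τ δ ρ i).1 (maskShift s τ δ ρ i).2 (s + 1) =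
      masks (ρ i).1 (ρ i).2 (s + 1) := by
  change (maskCoords s (maskShift s τ δ ρ i)).2 = (maskCoords s (ρ i)).2
  simp [maskShift]

/-- One round of `maskShares`. -/
def maskRound (F : BlockFormat D B) (S T : Arr) (i : ℕ) (r r' : Bits F.width) :
    Client F.width Unit :=
  forServers fun b => do
    let x ← Client.read b ⟨b + 1, S.cell i⟩
    Client.write b ⟨b + 1, T.cell i⟩ (x + masks r r' (b + 1))

theorem sure_maskRound {i : ℕ} (r r' : Bits F.width) (hST : S.cell i ≠ T.cell i) :
    (maskRound F S T i r r').Sure m fun _ m' => m.Off {T.cell i} m' ∧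
      ∀ b, m'.block (b - 1) ⟨b, T.cell i⟩ = m.block (b - 1) ⟨b, S.cell i⟩ + masks r r' b := by
  refine (sure_forServers (m := m)
    (f := fun b => do
      let x ← Client.read b ⟨b + 1, S.cell i⟩
      Client.write b ⟨b + 1, T.cell i⟩ (x + masks r r' (b + 1))) (fun m' => m.Off {T.cell i} m')
    (fun b m' => m'.block b ⟨b + 1, T.cell i⟩ =
      m.block b ⟨b + 1, S.cell i⟩ + masks r r' (b + 1)) (fun b m₁ h => ?_) (.refl _ _)).mono
    fun _ m' h => ⟨h.1, fun b => ?_⟩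
  · refine (?_ : _ ∧ _ ∧ _)
    refine ⟨h.trans ⟨rfl, fun t a ha => Memory.set_block_cell _ _ _ _ _ _ ha⟩, ?_, ?_⟩
    · rw [Memory.set_block, if_pos ⟨rfl, rfl⟩, h.block b ⟨b + 1, S.cell i⟩ hST]
    · intro b' hb' h'
      rw [Memory.set_block, if_neg fun h => hb' h.1, h']
  · have := h.2 (b - 1)
    rwa [fin3_sub_one_add] at this

/-- Server `s` masks share `s + 1` and takes no part in the other two shares, so only that mask
matters to it. -/
theorem obl_maskRound {i : ℕ} {r r' v v' : Bits F.width}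
    (h : masks r r' (s + 1) = masks v v' (s + 1)) :
    Obl s (maskRound F S T i r r') (maskRound F S T i v v') fun _ _ => True := by
  refine Obl.forServers fun b => Obl.bind (Obl.read fun _ => rfl) fun x y hxy => ?_
  refine Obl.write fun hb => ⟨rfl, ?_⟩
  rw [hxy hb, hb, h]

/-- Here the coins are fixed in advance, as `Rel.coins_family` provides them; `sure_maskShares` is
the version with the coins drawn in each round. -/
theorem sure_maskLoop {γ : Type} {l : List γ} {idx : γ → ℕ} (r r' : γ → Bits F.width)
    (hl : l.Nodup) (hidx : ∀ i ∈ l, ∀ j ∈ l, idx i = idx j → i = j)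
    (hlt : ∀ i ∈ l, idx i < T.len) (hT : T.Inj) (hST : ∀ i ∈ l, S.cell (idx i) ∉ T.cells) :
    (l.forM fun i => maskRound F S T (idx i) (r i) (r' i)).Sure m fun _ m' => m.Off T.cells m' ∧
      ∀ i ∈ l, ∀ b, m'.block (b - 1) ⟨b, T.cell (idx i)⟩ =
        m.block (b - 1) ⟨b, S.cell (idx i)⟩ + masks (r i) (r' i) b := by
  refine (Sure.forM (l := l) (fun k m' => m.Off T.cells m' ∧
    ∀ j (_ : j < k) (hj : j < l.length), ∀ b, m'.block (b - 1) ⟨b, T.cell (idx l[j])⟩ =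
        m.block (b - 1) ⟨b, S.cell (idx l[j])⟩ + masks (r l[j]) (r' l[j]) b)
    ⟨.refl _ _, by simp⟩ ?_).mono ?_
  · rintro k hk m₁ ⟨h₁, h₂⟩
    have hm := List.getElem_mem hk
    have hc := Arr.cell_mem (hlt _ hm)
    refine (sure_maskRound _ _ fun h => hST _ hm (by rw [h]; exact hc)).mono ?_
    rintro _ m₂ ⟨h₃, h₄⟩
    refine ⟨h₁.trans ⟨h₃.next, fun t a ha => h₃.block t a fun h => ha ?_⟩, fun j hj hjl b => ?_⟩
    · rw [Set.mem_singleton_iff.mp h]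
      exact hc
    · rcases Nat.lt_succ_iff_lt_or_eq.mp hj with hj | rfl
      · rw [h₃.block _ _ fun h => ?_, h₂ j hj hjl]
        have hm' := List.getElem_mem hjl
        have := hidx _ hm' _ hm (hT _ (hlt _ hm') _ (hlt _ hm) h)
        exact absurd (hl.getElem_inj_iff.mp this) hj.ne
      · rw [h₄, h₁.block _ _ (hST _ hm)]
  · rintro _ m' ⟨h₁, h₂⟩
    refine ⟨h₁, fun i hi => ?_⟩
    obtain ⟨j, hj, rfl⟩ := List.getElem_of_mem hi
    exact h₂ j hj hj

theorem sure_maskShares (hl : S.len = T.len) (hT : T.Inj)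
    (hST : ∀ i < S.len, S.cell i ∉ T.cells) :
    (maskShares F S T).Sure m fun _ m' => m.Off T.cells m' ∧
      ∀ i < S.len, ∃ r r', ∀ b, m'.block (b - 1) ⟨b, T.cell i⟩ =
        m.block (b - 1) ⟨b, S.cell i⟩ + masks r r' b := by
  refine Sure.forM_range (fun k m' => m.Off T.cells m' ∧
    ∀ i < k, ∃ r r', ∀ b, m'.block (b - 1) ⟨b, T.cell i⟩ =
        m.block (b - 1) ⟨b, S.cell i⟩ + masks r r' b) ⟨.refl _ _, by simp⟩ ?_
  rintro k hk m₁ ⟨h₁, h₂⟩ r r'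
  have hc : T.cell k ∈ T.cells := Arr.cell_mem (hl ▸ hk)
  refine (sure_maskRound r r' fun h => hST k hk (by rw [h]; exact hc)).mono ?_
  rintro _ m₂ ⟨h₃, h₄⟩
  refine ⟨h₁.trans ⟨h₃.next, fun t a ha => h₃.block t a fun h => ha ?_⟩, fun i hi => ?_⟩
  · rw [Set.mem_singleton_iff.mp h]
    exact hc
  · rcases Nat.lt_succ_iff_lt_or_eq.mp hi with hi | rfl
    · obtain ⟨r, r', h⟩ := h₂ i hi
      refine ⟨r, r', fun b => ?_⟩
      rw [h₃.block _ _ fun h => ?_, h]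
      exact absurd (hT _ (by omega) _ (by omega) h) hi.ne
    · exact ⟨r, r', fun b => by rw [h₄, h₁.block _ _ (hST _ hk)]⟩

/-- The masked shares `s` can be coupled by any rearrangement `τ` of the entries. -/
theorem rel_maskShares (τ : Equiv.Perm (Fin S.len)) (hl : S.len = T.len) (hT : T.Inj)
    (hST : ∀ i < S.len, S.cell i ∉ T.cells) (e : Eqv s m m') :
    Rel s (maskShares F S T) m (maskShares F S T) m' fun _ m₁ _ m₁' => Eqv s m₁ m₁' ∧
      ∀ i : Fin S.len, m₁.block (s - 1) ⟨s, T.cell i⟩ = m₁'.block (s - 1) ⟨s, T.cell (τ i)⟩ := by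
  -- The summand `δ` is the difference of the unmasked shares at matched entries, entry `τ⁻¹ i` of
  -- the first run against entry `i` of the second. It makes the masked shares equal.
  refine Rel.coins_family (maskShift s τ fun i => m.block (s - 1) ⟨s, S.cell (τ.symm i)⟩ +
    m'.block (s - 1) ⟨s, S.cell i⟩) fun ρ => ?_
  have hsure : ∀ (m : Memory F.width) (ρ : Fin S.len → Bits F.width × Bits F.width), _ :=
    fun m ρ => sure_maskLoop (F := F) (S := S) (T := T) (m := m) (l := List.finRange S.len)
      (idx := Fin.val) (fun i => (ρ i).1) (fun i => (ρ i).2) (List.nodup_finRange _)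
      (fun i _ j _ h => Fin.ext h) (fun i _ => hl ▸ i.2) hT fun i _ => hST i i.2
  refine ((Obl.forM fun i _ => obl_maskRound ?_) m m' e |>.and_sure (hsure m ρ)
    (hsure m' _)).mono ?_
  · exact (maskShift_right _ _ _ _ _).symm
  · rintro _ m₁ _ m₁' ⟨⟨e, -⟩, ⟨-, h₁⟩, -, h₂⟩
    refine ⟨e, fun i => ?_⟩
    rw [h₁ i (List.mem_finRange i), h₂ (τ i) (List.mem_finRange _), maskShift_left,
      Equiv.symm_apply_apply]
    linear_combination -(bits_add_self (m'.block (s - 1) ⟨s, S.cell (τ i)⟩))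

/-- What server `s` receives here is share `s`, coming from server `s - 1`. Equality of these blocks
is thus what has to be arranged beforehand. -/
theorem rel_sendShares (e : Eqv s m m')
    (h : ∀ i < T.len, m.block (s - 1) ⟨s, T.cell i⟩ = m'.block (s - 1) ⟨s, T.cell i⟩) :
    Rel s (sendShares F T) m (sendShares F T) m' fun _ m₁ _ m₁' => Eqv s m₁ m₁' := by
  refine (rel_forServers (f := fun b => (List.range T.len).forM fun i => do
      let x ← Client.read b ⟨b + 1, T.cell i⟩
      Client.write (b + 1) ⟨b + 1, T.cell i⟩ x) (g := fun b => (List.range T.len).forM fun i => do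
      let x ← Client.read b ⟨b + 1, T.cell i⟩
      Client.write (b + 1) ⟨b + 1, T.cell i⟩ x) 0 (fun m m' => ∀ i < T.len,
        m.block (s - 1) ⟨s, T.cell i⟩ = m'.block (s - 1) ⟨s, T.cell i⟩) (fun _ _ => True)
    (fun b m m' e h => ?_) e h).mono fun _ _ _ _ h => h.1
  refine (Rel.forM (l := List.range T.len) (fun _ m m' => Eqv s m m' ∧ ∀ i < T.len,
    m.block (s - 1) ⟨s, T.cell i⟩ = m'.block (s - 1) ⟨s, T.cell i⟩) ⟨e, h⟩ ?_).mono
    fun _ _ _ _ h => ⟨h.1, h.2, fun _ => trivial, fun _ _ => trivial⟩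
  rintro k hk n n' ⟨e, h⟩
  rw [List.length_range] at hk
  rw [List.getElem_range]
  refine Rel.bind (P := fun x m₁ y m₁' => m₁ = n ∧ m₁' = n' ∧ (b + 1 = s → x = y))
    (Rel.read (fun _ => rfl) ⟨rfl, rfl, ?_⟩) ?_
  · rintro rfl
    have := h k hk
    rwa [fin3_add_one_sub] at this
  · rintro x _ y _ ⟨rfl, rfl, hxy⟩
    refine Rel.write (fun hb => ⟨rfl, hxy hb⟩) ⟨e.set fun hb => ⟨rfl, hxy hb⟩, fun i hi => ?_⟩
    -- A copy goes to bank `b + 1` of server `b + 1`; for bank `s` this is server `s`, never server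
    -- `s - 1`.
    have : ∀ v : Memory F.width, ∀ x, (v.set (b + 1) ⟨b + 1, T.cell k⟩ x).block (s - 1)
        ⟨s, T.cell i⟩ = v.block (s - 1) ⟨s, T.cell i⟩ := fun v x => by
      rw [Memory.set_block, if_neg]
      rintro ⟨h₁, h₂⟩
      have := (Addr.mk.inj h₂).1
      rw [← this] at h₁
      revert h₁
      fin_cases s <;> decide
    rw [this, this, h i hi]

theorem sure_sendShares (hT : T.Inj) :
    (sendShares F T).Sure m fun _ m' => m.Off T.cells m' ∧ ∀ i < T.len, ∀ b,
      m'.block b ⟨b, T.cell i⟩ = m.block (b - 1) ⟨b, T.cell i⟩ ∧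
      m'.block (b - 1) ⟨b, T.cell i⟩ = m.block (b - 1) ⟨b, T.cell i⟩ := by
  refine (sure_forServers (m := m) (f := fun b => (List.range T.len).forM fun i => do
      let x ← Client.read b ⟨b + 1, T.cell i⟩
      Client.write (b + 1) ⟨b + 1, T.cell i⟩ x)
    (fun m' => m.Off T.cells m' ∧ ∀ i < T.len, ∀ b,
      m'.block (b - 1) ⟨b, T.cell i⟩ = m.block (b - 1) ⟨b, T.cell i⟩)
    (fun b m' => ∀ i < T.len,
      m'.block (b + 1) ⟨b + 1, T.cell i⟩ = m.block b ⟨b + 1, T.cell i⟩)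
    (fun b m₁ h => ?_) ⟨.refl _ _, fun _ _ _ => rfl⟩).mono
    fun _ m' h => ⟨h.1.1, fun i hi b => ⟨?_, h.1.2 i hi b⟩⟩
  · refine (sure_write_loop (l := List.range T.len) (m := m₁) (t := b + 1)
      (a := fun i => ⟨b + 1, T.cell i⟩) (v := fun i => m₁.block b ⟨b + 1, T.cell i⟩)
      (fun i hi j hj h => ?_) fun i hi m₂ h => ?_).mono ?_
    · exact hT _ (List.mem_range.mp hi) _ (List.mem_range.mp hj) (Addr.mk.inj h).2
    · simp only [bind, andThen, Client.read, Client.write, Sure]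
      rw [h _ _ fun h => absurd h (fin3_ne_add_one b)]
    · rintro _ m₂ ⟨h₁, h₂, h₃⟩
      refine ⟨⟨h.1.trans ⟨h₁, fun t a ha => h₃ t a fun _ j hj h => ha ?_⟩, fun i hi b' => ?_⟩,
        fun i hi => ?_, fun b' hb' h' i hi => ?_⟩
      · rw [h]
        exact Arr.cell_mem (List.mem_range.mp hj)
      · rw [h₃ _ _ fun h j hj h' => ?_, h.2 i hi]
        rw [(Addr.mk.inj h').1] at h
        revert h
        fin_cases b <;> decide
      · rw [h₂ i (List.mem_range.mpr hi)]
        have := h.2 i hi (b + 1)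
        rwa [fin3_add_one_sub] at this
      · rw [h₃ _ _ fun h => absurd (add_right_cancel h) hb', h' i hi]
  · have := h.2 (b - 1) i hi
    rwa [fin3_sub_one_add] at this

/-! ### Permute and unpermute -/

/-- The rearrangement of the shares `b + 1` by server `b`. -/
def scatter (F : BlockFormat D B) (P M R : Arr) (n : ℕ) (b : Fin 3) : Client F.width Unit :=
  (List.range n).forM fun i => do
    let j ← Client.read b ⟨b + 1, P.cell i⟩
    let x ← Client.read b ⟨b + 1, M.cell i⟩
    Client.write b ⟨b + 1, R.cell (F.decode j).asIndex⟩ x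

/-- The inverse rearrangement. -/
def gather (F : BlockFormat D B) (P T M : Arr) (n : ℕ) (b : Fin 3) : Client F.width Unit :=
  (List.range n).forM fun i => do
    let j ← Client.read b ⟨b + 1, P.cell i⟩
    let x ← Client.read b ⟨b + 1, T.cell (F.decode j).asIndex⟩
    Client.write b ⟨b + 1, M.cell i⟩ x

theorem permute_eq (P T : Arr) : permute F P T = (do
    let M ← newArr T.len
    let R ← newArr T.len
    maskShares F T M
    forServers (scatter F P M R T.len)
    sendShares F R
    pure R) := rfl

theorem unpermute_eq (P T : Arr) : unpermute F P T = (do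
    let M ← newArr T.len
    let R ← newArr T.len
    forServers (gather F P T M T.len)
    maskShares F M R
    sendShares F R
    pure R) := rfl

theorem HoldsPerm.index_eq (hP : HoldsPerm F m P q) (hn : P.len ≤ 2 ^ (D + 1)) {i : ℕ}
    (hi : i < P.len) (b : Fin 3) :
    ((F.decode (m.block b ⟨b + 1, P.cell i⟩)).asIndex : ℕ) = q (b + 1) i := by
  have := hP.block i hi (b + 1)
  rw [fin3_add_one_sub] at this
  rw [this, F.decode_encode]
  exact Nat.mod_eq_of_lt (((hP.perm _).lt i hi).trans_le hn)

theorem obl_scatter (b : Fin 3) :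
    Obl s (scatter F P M R n b) (scatter F P M R n b) fun _ _ => True :=
  Obl.forM fun i _ => Obl.bind (Obl.read fun _ => rfl) fun j j' hj =>
    Obl.bind (Obl.read fun _ => rfl) fun x x' hx => Obl.write fun hb => by
      rw [hj hb, hx hb]
      exact ⟨rfl, rfl⟩

theorem obl_gather (b : Fin 3) :
    Obl s (gather F P T M n b) (gather F P T M n b) fun _ _ => True :=
  Obl.forM fun i _ => Obl.bind (Obl.read fun _ => rfl) fun j j' hj =>
    Obl.bind (Obl.read fun hb => by rw [hj hb]) fun x x' hx => Obl.write fun hb => ⟨rfl, hx hb⟩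

theorem sure_scatter (hP : HoldsPerm F m P q) (hn : P.len ≤ 2 ^ (D + 1)) (hPl : P.len = n)
    (hRl : R.len = n) (hR : R.Inj) (hPR : ∀ i < n, P.cell i ∉ R.cells)
    (hMR : ∀ i < n, M.cell i ∉ R.cells) (b : Fin 3) :
    (scatter F P M R n b).Sure m fun _ m' => m.Off R.cells m' ∧
      (∀ i < n, m'.block b ⟨b + 1, R.cell (q (b + 1) i)⟩ = m.block b ⟨b + 1, M.cell i⟩) ∧
      ∀ t a, t ≠ b → m'.block t a = m.block t a := by
  have hq := hP.perm (b + 1)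
  rw [hPl] at hq
  have hmem : ∀ j ∈ List.range n, R.cell (q (b + 1) j) ∈ R.cells := fun j hj =>
    Arr.cell_mem (hRl ▸ hq.lt j (List.mem_range.mp hj))
  refine (sure_write_loop (l := List.range n) (m := m) (t := b)
    (a := fun i => ⟨b + 1, R.cell (q (b + 1) i)⟩) (v := fun i => m.block b ⟨b + 1, M.cell i⟩)
    (fun i hi j hj h => ?_) fun i hi m₂ h => ?_).mono ?_
  · rw [List.mem_range] at hi hj
    exact hq.inj i hi j hj (hR _ (hRl ▸ hq.lt i hi) _ (hRl ▸ hq.lt j hj) (Addr.mk.inj h).2)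
  · have hi' := List.mem_range.mp hi
    simp only [bind, andThen, Client.read, Client.write, Sure]
    rw [h _ _ fun _ j hj h => ?_, h _ _ fun _ j hj h => ?_, hP.index_eq hn (hPl ▸ hi')]
    · exact hMR i hi' ((Addr.mk.inj h).2 ▸ hmem j hj)
    · exact hPR i hi' ((Addr.mk.inj h).2 ▸ hmem j hj)
  · rintro _ m₂ ⟨h₁, h₂, h₃⟩
    refine ⟨⟨h₁, fun t a ha => h₃ t a fun _ j hj h => ha (h ▸ hmem j hj)⟩,
      fun i hi => h₂ i (List.mem_range.mpr hi), fun t a ht => h₃ t a fun h => absurd h ht⟩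

theorem sure_gather (hP : HoldsPerm F m P q) (hn : P.len ≤ 2 ^ (D + 1)) (hPl : P.len = n)
    (hMl : M.len = n) (hM : M.Inj) (hPM : ∀ i < n, P.cell i ∉ M.cells)
    (hTM : ∀ i < n, T.cell i ∉ M.cells) (b : Fin 3) :
    (gather F P T M n b).Sure m fun _ m' => m.Off M.cells m' ∧
      (∀ i < n, m'.block b ⟨b + 1, M.cell i⟩ = m.block b ⟨b + 1, T.cell (q (b + 1) i)⟩) ∧
      ∀ t a, t ≠ b → m'.block t a = m.block t a := by
  have hq := hP.perm (b + 1)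
  rw [hPl] at hq
  have hmem : ∀ j ∈ List.range n, M.cell j ∈ M.cells := fun j hj =>
    Arr.cell_mem (hMl ▸ List.mem_range.mp hj)
  refine (sure_write_loop (l := List.range n) (m := m) (t := b)
    (a := fun i => ⟨b + 1, M.cell i⟩) (v := fun i => m.block b ⟨b + 1, T.cell (q (b + 1) i)⟩)
    (fun i hi j hj h => ?_) fun i hi m₂ h => ?_).mono ?_
  · rw [List.mem_range] at hi hj
    exact hM _ (hMl ▸ hi) _ (hMl ▸ hj) (Addr.mk.inj h).2
  · have hi' := List.mem_range.mp hi
    simp only [bind, andThen, Client.read, Client.write, Sure]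
    have h₁ : m₂.block b ⟨b + 1, P.cell i⟩ = m.block b ⟨b + 1, P.cell i⟩ :=
      h _ _ fun _ j hj h => hPM i hi' ((Addr.mk.inj h).2 ▸ hmem j hj)
    rw [h₁, hP.index_eq hn (hPl ▸ hi'), h _ _ fun _ j hj h => ?_]
    exact hTM _ (hq.lt i hi') ((Addr.mk.inj h).2 ▸ hmem j hj)
  · rintro _ m₂ ⟨h₁, h₂, h₃⟩
    refine ⟨⟨h₁, fun t a ha => h₃ t a fun _ j hj h => ha (h ▸ hmem j hj)⟩,
      fun i hi => h₂ i (List.mem_range.mpr hi), fun t a ht => h₃ t a fun h => absurd h ht⟩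

theorem sum_masks {w : ℕ} (x y z r r' : Bits w) :
    x + masks r r' 0 + (y + masks r r' 1) + (z + masks r r' 2) = x + y + z := by
  simp only [masks, Matrix.cons_val]
  linear_combination bits_add_self r + bits_add_self r'

theorem sure_permute (hn : T.len ≤ 2 ^ (D + 1)) (hPl : P.len = T.len) (hP : HoldsPerm F m P q)
    (hT : Holds F m T X) : (permute F P T).Sure m fun R m' =>
      R.len = T.len ∧ R.Fresh m m' ∧ m.Ext ∅ m' ∧ HoldsPermuted F m' R q X := by
  rw [permute_eq]
  refine (sure_newArr _).bind fun M m₁ ⟨hMl, hMf, e₁⟩ => ?_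
  refine (sure_newArr _).bind fun R m₂ ⟨hRl, hRf, e₂⟩ => ?_
  have hTM : ∀ i < T.len, T.cell i ∉ M.cells := fun i hi => hMf.not_mem (hT i hi).1
  refine (sure_maskShares hMl.symm hMf.inj hTM).bind fun _ m₃ ⟨o₃, h₃⟩ => ?_
  have e₃ : m.Ext ∅ m₃ :=
    (e₁.trans_same e₂).of_fresh le_rfl (hMf.mono le_rfl e₂.next) o₃.ext
  have hPlow : ∀ i < T.len, P.cell i < m₁.next := fun i hi =>
    (hP.high i (hPl ▸ hi)).trans_le e₁.next
  have hP₃ := hP.ext_empty e₃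
  have hPR : ∀ i < T.len, P.cell i ∉ R.cells := fun i hi => hRf.not_mem (hPlow i hi)
  have hMR : ∀ i < T.len, M.cell i ∉ R.cells := fun i hi => hRf.not_mem (hMf.high i (hMl ▸ hi))
  refine (sure_forServers (m := m₃) (f := scatter F P M R T.len) (fun m' => m₃.Off R.cells m')
    (fun b m' => ∀ i < T.len,
      m'.block b ⟨b + 1, R.cell (q (b + 1) i)⟩ = m₃.block b ⟨b + 1, M.cell i⟩)
    (fun b m₄ o₄ => ?_) (.refl _ _)).bind fun _ m₄ ⟨o₄, h₄⟩ => ?_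
  · refine (sure_scatter (hP₃.ext o₄.ext (hPl ▸ hPR)) (hPl ▸ hn) hPl hRl hRf.inj hPR hMR b).mono ?_
    rintro _ m₅ ⟨o₅, h₅, h₅'⟩
    refine ⟨o₄.trans o₅, fun i hi => ?_, fun b' hb' h i hi => ?_⟩
    · rw [h₅ i hi, o₄.block _ _ (hMR i hi)]
    · rw [h₅' _ _ hb', h i hi]
  · refine (sure_sendShares hRf.inj).bind fun _ m₅ ⟨o₅, h₅⟩ => Sure.pure ?_
    have n₅ : m₅.next = m₂.next := by rw [o₅.next, o₄.next, o₃.next]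
    refine ⟨hRl, hRf.mono e₁.next n₅.ge, ?_, fun i hi => n₅ ▸ hRf.high i hi, fun i hi => ?_,
      fun i hi b => ?_⟩
    · exact e₃.of_fresh e₁.next (hRf.mono le_rfl o₃.next.ge) (o₄.trans o₅).ext
    · rw [hRl] at hi
      have hqlt : ∀ b, q b i < R.len := fun b => by
        rw [hRl, ← hPl]
        exact (hP.perm b).lt i (hPl ▸ hi)
      obtain ⟨r, r', hr⟩ := h₃ i hi
      have key : ∀ b, m₅.block b ⟨b, R.cell (q b i)⟩ =
          m.block b ⟨b, T.cell i⟩ + masks r r' b := by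
        intro b
        have := h₄ (b - 1) i hi
        rw [fin3_sub_one_add] at this
        rw [(h₅ _ (hqlt b) b).1, this, hr, (e₁.trans_same e₂).block _ _ (hT i hi).1 id,
          (hT i hi).2.copy]
      rw [key, key, key, sum_masks, (hT i hi).2.decode]
    · rw [(h₅ i hi b).1, (h₅ i hi b).2]

theorem sure_unpermute (hn : T.len ≤ 2 ^ (D + 1)) (hPl : P.len = T.len) (hP : HoldsPerm F m P q)
    (hT : HoldsPermuted F m T q X) : (unpermute F P T).Sure m fun R m' =>
      R.len = T.len ∧ R.Fresh m m' ∧ m.Ext ∅ m' ∧ Holds F m' R X := by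
  rw [unpermute_eq]
  refine (sure_newArr _).bind fun M m₁ ⟨hMl, hMf, e₁⟩ => ?_
  refine (sure_newArr _).bind fun R m₂ ⟨hRl, hRf, e₂⟩ => ?_
  have e₁₂ := e₁.trans_same e₂
  have hTM : ∀ i < T.len, T.cell i ∉ M.cells := fun i hi => hMf.not_mem (hT.high i hi)
  have hPM : ∀ i < T.len, P.cell i ∉ M.cells := fun i hi => hMf.not_mem (hP.high i (hPl ▸ hi))
  have hMR : ∀ i < T.len, M.cell i ∉ R.cells := fun i hi => hRf.not_mem (hMf.high i (hMl ▸ hi))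
  refine (sure_forServers (m := m₂) (f := gather F P T M T.len) (fun m' => m₂.Off M.cells m')
    (fun b m' => ∀ i < T.len,
      m'.block b ⟨b + 1, M.cell i⟩ = m₂.block b ⟨b + 1, T.cell (q (b + 1) i)⟩)
    (fun b m₃ o₃ => ?_) (.refl _ _)).bind fun _ m₃ ⟨o₃, h₃⟩ => ?_
  · refine (sure_gather ((hP.ext_empty e₁₂).ext o₃.ext (hPl ▸ hPM)) (hPl ▸ hn) hPl hMl
      hMf.inj hPM hTM b).mono ?_
    rintro _ m₅ ⟨o₅, h₅, h₅'⟩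
    have hq := hP.perm (b + 1)
    rw [hPl] at hq
    refine ⟨o₃.trans o₅, fun i hi => ?_, fun b' hb' h i hi => ?_⟩
    · rw [h₅ i hi, o₃.block _ _ (hTM _ (hq.lt i hi))]
    · rw [h₅' _ _ hb', h i hi]
  · have e₃ : m.Ext ∅ m₃ := e₁₂.of_fresh le_rfl (hMf.mono le_rfl e₂.next) o₃.ext
    refine (sure_maskShares (hMl.trans hRl.symm) hRf.inj (hMl ▸ hMR)).bind fun _ m₄ ⟨o₄, h₄⟩ => ?_
    refine (sure_sendShares hRf.inj).bind fun _ m₅ ⟨o₅, h₅⟩ => Sure.pure ?_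
    have n₅ : m₅.next = m₂.next := by rw [o₅.next, o₄.next, o₃.next]
    refine ⟨hRl, hRf.mono e₁.next n₅.ge, ?_, fun i hi => ⟨n₅ ▸ hRf.high i hi, ?_, fun b => ?_⟩⟩
    · exact e₃.of_fresh e₁.next (hRf.mono le_rfl o₃.next.ge) (o₄.trans o₅).ext
    · have hi' := hRl ▸ hi
      obtain ⟨r, r', hr⟩ := h₄ i (hMl.symm ▸ hi')
      have hqlt : ∀ b, q b i < T.len := fun b => by
        rw [← hPl]
        exact (hP.perm b).lt i (hPl ▸ hi')
      have key : ∀ b, m₅.block b ⟨b, R.cell i⟩ =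
          m.block b ⟨b, T.cell (q b i)⟩ + masks r r' b := by
        intro b
        have := h₃ (b - 1) i hi'
        rw [fin3_sub_one_add] at this
        rw [(h₅ i hi b).1, hr, this, e₁₂.block _ _ (hT.high _ (hqlt b)) id, hT.copy _ (hqlt b)]
      rw [key, key, key, sum_masks, hT.decode i hi']
    · rw [(h₅ i hi b).1, (h₅ i hi b).2]

/-- Fresh masks make the share sent to server `s` uniform, whatever the entries are. The output is
in the order of entries in both runs, so the masks are matched without rearrangement. -/
theorem obl_unpermute : Obl s (unpermute F P T) (unpermute F P T) Eq := by
  rw [unpermute_eq]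
  intro m m' e
  refine (((Obl.newArr _) m m' e).and_sure (sure_newArr _) (sure_newArr _)).bind ?_
  rintro M m₁ _ m₁' ⟨⟨e, rfl⟩, ⟨hMl, hMf, _⟩, -⟩
  refine (((Obl.newArr _) m₁ m₁' e).and_sure (sure_newArr _) (sure_newArr _)).bind ?_
  rintro R m₂ _ m₂' ⟨⟨e, rfl⟩, ⟨hRl, hRf, _⟩, -⟩
  have hMR : ∀ i < M.len, M.cell i ∉ R.cells := fun i hi => hRf.not_mem (hMf.high i hi)
  refine ((Obl.forServers fun b => obl_gather b) m₂ m₂' e).bind ?_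
  rintro _ m₃ _ m₃' ⟨e, -⟩
  have hl := hMl.trans hRl.symm
  refine (rel_maskShares (Equiv.refl _) hl hRf.inj hMR e).bind ?_
  rintro _ m₄ _ m₄' ⟨e, h⟩
  refine (rel_sendShares e fun i hi => h ⟨i, hl ▸ hi⟩).bind fun _ m₅ _ m₅' e => Rel.pure ⟨e, rfl⟩

/-- The witness is `q'⁻¹ ∘ q`, obtained from the surjectivity of `q'`. -/
theorem exists_perm_comp {q q' : ℕ → ℕ} (hq : IsPerm n q) (hq' : IsPerm n q') :
    ∃ τ : Equiv.Perm (Fin n), ∀ i, q' (τ i) = q i := by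
  have h : ∀ i : Fin n, ∃ j : Fin n, q' j = q i := fun i => by
    obtain ⟨j, hj, h⟩ := hq'.surj (hq.lt i i.2)
    exact ⟨⟨j, hj⟩, h⟩
  choose τ hτ using h
  have : Function.Injective τ := fun i j hij => Fin.ext (hq.inj i i.2 j j.2 (by
    rw [← hτ, ← hτ, hij]))
  exact ⟨Equiv.ofBijective τ (Finite.injective_iff_bijective.mp this), hτ⟩

/-- Server `s` receives share `s` in the order of places. Entry `i` of the first run and entry `τ i`
of the second land at one place because `q' s ∘ τ = q s`, and matching their masks makes the
received blocks equal. The hidden permutations `q s` and `q' s` may be arbitrary, and so may the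
contents of `T`. -/
theorem rel_permute (hn : T.len ≤ 2 ^ (D + 1)) (hPl : P.len = T.len) (hP : HoldsPerm F m P q)
    (hP' : HoldsPerm F m' P q') (hT : ∀ i < T.len, T.cell i < m.next) (e : Eqv s m m') :
    Rel s (permute F P T) m (permute F P T) m' fun R m₁ R' m₁' => Eqv s m₁ m₁' ∧ R = R' := by
  rw [permute_eq]
  refine (((Obl.newArr _) m m' e).and_sure (sure_newArr _) (sure_newArr _)).bind ?_
  rintro M m₁ _ m₁' ⟨⟨e, rfl⟩, ⟨hMl, hMf, e₁⟩, -, -, e₁'⟩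
  refine (((Obl.newArr _) m₁ m₁' e).and_sure (sure_newArr _) (sure_newArr _)).bind ?_
  rintro R m₂ _ m₂' ⟨⟨e, rfl⟩, ⟨hRl, hRf, e₂⟩, -, -, e₂'⟩
  have hTM : ∀ i < T.len, T.cell i ∉ M.cells := fun i hi => hMf.not_mem (hT i hi)
  have hPM : ∀ i < P.len, P.cell i ∉ M.cells := fun i hi => hMf.not_mem (hP.high i hi)
  have hPR : ∀ i < T.len, P.cell i ∉ R.cells := fun i hi =>
    hRf.not_mem ((hP.high i (hPl ▸ hi)).trans_le e₁.next)
  have hMR : ∀ i < T.len, M.cell i ∉ R.cells := fun i hi => hRf.not_mem (hMf.high i (hMl ▸ hi))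
  obtain ⟨τ, hτ⟩ := exists_perm_comp (hPl ▸ hP.perm s) (hPl ▸ hP'.perm s)
  have hsure : ∀ m, (maskShares F T M).Sure m fun _ m' => m.Off M.cells m' ∧ _ :=
    fun m => sure_maskShares hMl.symm hMf.inj hTM
  refine ((rel_maskShares τ hMl.symm hMf.inj hTM e).and_sure (hsure _) (hsure _)).bind ?_
  rintro _ m₃ _ m₃' ⟨⟨e, h₃⟩, ⟨o₃, -⟩, o₃', -⟩
  have hP₃ := ((hP.ext_empty e₁).ext_empty e₂).ext o₃.ext hPM
  have hP₃' := ((hP'.ext_empty e₁').ext_empty e₂').ext o₃'.ext hPM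
  refine (rel_forServers (f := scatter F P M R T.len) (g := scatter F P M R T.len) (s - 1)
    (fun n n' => m₃.Off R.cells n ∧ m₃'.Off R.cells n')
    (fun n n' => ∀ j < T.len, n.block (s - 1) ⟨s, R.cell j⟩ = n'.block (s - 1) ⟨s, R.cell j⟩)
    (fun b m₄ m₄' e ⟨o₄, o₄'⟩ => ?_) e ⟨.refl _ _, .refl _ _⟩).bind ?_
  · refine ((obl_scatter b m₄ m₄' e).and_sure
      (sure_scatter (hP₃.ext o₄.ext (hPl ▸ hPR)) (hPl ▸ hn) hPl hRl hRf.inj hPR hMR b)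
      (sure_scatter (hP₃'.ext o₄'.ext (hPl ▸ hPR)) (hPl ▸ hn) hPl hRl hRf.inj hPR hMR b)).mono ?_
    rintro _ m₅ _ m₅' ⟨⟨e, -⟩, ⟨o₅, h₅, k₅⟩, o₅', h₅', k₅'⟩
    refine ⟨e, ⟨o₄.trans o₅, o₄'.trans o₅'⟩, ?_, fun hb h j hj => ?_⟩
    · rintro rfl j hj
      rw [fin3_sub_one_add] at h₅ h₅'
      -- Every place is `q s i` for some `i`, and in the second run it is filled from entry `τ i`.
      obtain ⟨i, hi, rfl⟩ := (hP.perm s).surj (hPl ▸ hj)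
      rw [hPl] at hi
      have := hτ ⟨i, hi⟩
      rw [h₅ i hi, ← this, h₅' _ (τ ⟨i, hi⟩).2, o₄.block _ _ (hMR _ hi),
        o₄'.block _ _ (hMR _ (τ ⟨i, hi⟩).2), ← h₃ ⟨i, hi⟩]
    · rw [k₅ _ _ hb.symm, k₅' _ _ hb.symm, h j hj]
  · rintro _ m₄ _ m₄' ⟨e, -, h₄⟩
    exact (rel_sendShares e fun i hi => h₄ i (hRl ▸ hi)).bind fun _ m₅ _ m₅' e =>
      Rel.pure ⟨e, rfl⟩

end Permutations

open Client

/-! ## Linked lists -/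

section Lists

variable {D B : ℕ} {F : BlockFormat D B} {s : Fin 3} {m m' : Memory F.width}
  {P T S R L : Arr} {q q' : Fin 3 → ℕ → ℕ} {n n₁ : ℕ} {X : ℕ → Item D B}

/-- `i` belongs to class `(c, r)`: it is `≥ n₁` iff `c`, and its entry is real iff `r`. -/
def inClass (X : ℕ → Item D B) (n₁ : ℕ) (c r : Bool) (i : ℕ) : Bool :=
  decide (n₁ ≤ i) == c && (X i).isReal == r

/-- The indices of class `(c, r)` in `{k, …, n - 1}`, in increasing order. -/
def cls (X : ℕ → Item D B) (n₁ n : ℕ) (c r : Bool) (k : ℕ) : List ℕ :=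
  (List.range' k (n - k)).filter (inClass X n₁ c r)

theorem cls_of_le {c r : Bool} {k : ℕ} (h : n ≤ k) : cls X n₁ n c r k = [] := by
  simp [cls, Nat.sub_eq_zero_of_le h]

theorem cls_of_lt {c r : Bool} {k : ℕ} (h : k < n) : cls X n₁ n c r k =
    if inClass X n₁ c r k then k :: cls X n₁ n c r (k + 1) else cls X n₁ n c r (k + 1) := by
  rw [cls, show n - k = (n - (k + 1)) + 1 by omega, List.range'_succ, List.filter_cons]
  rfl

/-- The tail of a class list is again a class list, starting behind the head. This is why following
the link of an entry leads to the head of the rest. -/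
theorem cls_eq_cons {c r : Bool} {k i : ℕ} {l : List ℕ} (h : cls X n₁ n c r k = i :: l) :
    i < n ∧ inClass X n₁ c r i ∧ l = cls X n₁ n c r (i + 1) := by
  induction hd : n - k generalizing k with
  | zero => rw [cls_of_le (by omega)] at h; cases h
  | succ d ih =>
    rw [cls_of_lt (by omega)] at h
    split_ifs at h with hk
    · obtain ⟨rfl, rfl⟩ := List.cons.inj h
      exact ⟨by omega, hk, rfl⟩
    · exact ih h (by omega)

/-- The position of the first entry of a list of indices. -/
def headPos (D : ℕ) (q : Fin 3 → ℕ → ℕ) (l : List ℕ) : Option (Pos D) :=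
  l.head?.map (posOf D q)

/-- The link from entry `i` to the next one of its class. -/
def nextLink (X : ℕ → Item D B) (n₁ n : ℕ) (q : Fin 3 → ℕ → ℕ) (i : ℕ) : Item D B :=
  .link (headPos D q (cls X n₁ n (decide (n₁ ≤ i)) (X i).isReal (i + 1)))

theorem sure_linkScan (hT : Holds F m T X) (hP : HoldsPerm F m P q) (hPl : P.len = T.len) :
    (linkScan F T P n₁).Sure m fun r m' =>
      r.1 = (fun c r => headPos D q (cls X n₁ T.len c r 0)) ∧ r.2.len = T.len ∧
      r.2.Fresh m m' ∧ m.Ext ∅ m' ∧ Holds F m' r.2 (nextLink X n₁ T.len q) := by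
  refine (sure_newArr _).bind fun L m₁ ⟨hLl, hLf, e₁⟩ => ?_
  refine Sure.bind (Sure.foldlM_range_reverse
    -- Once the indices from `k` on are scanned, the heads are those of the class lists of `{k, …,
    -- T.len - 1}`.
    (fun k (heads : Bool → Bool → Option (Pos D)) m' => m₁.Ext L.cells m' ∧
      heads = (fun c r => headPos D q (cls X n₁ T.len c r k)) ∧
      ∀ i, k ≤ i → i < T.len → Shared F m' (L.cell i) (nextLink X n₁ T.len q i))
    ⟨.refl _ _, by funext c r; rw [cls_of_le le_rfl]; rfl, fun i h h' => by omega⟩ ?_) ?_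
  · rintro k hk heads m₂ ⟨e₂, rfl, h₂⟩
    have e := (e₁.of_fresh le_rfl hLf e₂)
    have hc : L.cell k ∈ L.cells := Arr.cell_mem (hLl ▸ hk)
    refine (sure_scanAt (hT.ext_empty e) hk).bind ?_
    rintro _ _ ⟨rfl, rfl⟩
    refine (sure_readPos (hP.ext_empty e) (hPl ▸ hk)).bind ?_
    rintro _ _ ⟨rfl, rfl⟩
    refine (sure_secretWrite _ _ _).bind fun _ m₃ ⟨e₃, h₃⟩ => Sure.pure ⟨?_, ?_, ?_⟩
    · refine e₂.trans e₃ (fun _ h _ => h) fun c h _ => ?_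
      rw [Set.mem_singleton_iff.mp h]
      exact hc
    · funext c r
      rw [cls_of_lt hk]
      by_cases h₁ : decide (n₁ ≤ k) = c <;> by_cases h₂ : (X k).isReal = r
      · subst h₁ h₂
        simp [inClass, headPos]
      · subst h₁
        simp [inClass, h₂, Function.update_of_ne (Ne.symm h₂)]
      · simp [inClass, h₁, Function.update_of_ne (Ne.symm h₁)]
      · simp [inClass, h₁, Function.update_of_ne (Ne.symm h₁)]
    · intro i hi hi'
      rcases eq_or_lt_of_le hi with rfl | hi
      · exact h₃
      · refine (h₂ i hi hi').ext e₃ ((hLf.high i (by omega)).trans_le e₂.next) fun h => ?_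
        exact absurd (hLf.inj _ (by omega) _ (by omega) h) (by omega)
  · rintro heads m₂ ⟨e₂, h, h'⟩
    refine Sure.pure ⟨h, hLl, hLf.mono le_rfl e₂.next, e₁.of_fresh le_rfl hLf e₂, fun i hi => ?_⟩
    exact ⟨(hLf.high i hi).trans_le e₂.next, h' i (by omega) (hLl ▸ hi)⟩

/-- The positions of the heads stay with the client and may differ between the runs; only the array
of links is a public object. -/
theorem obl_linkScan : Obl s (linkScan F T P n₁) (linkScan F T P n₁) fun x y => x.2 = y.2 := by
  refine Obl.bind (Obl.newArr _) ?_
  rintro L _ rfl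
  refine Obl.bind (Obl.foldlM (fun _ _ => True) trivial fun i _ _ _ _ => ?_)
    fun _ _ _ => Obl.pure rfl
  exact Obl.bind (obl_scanAt _ _) fun _ _ _ => Obl.bind (obl_readPos _ _) fun _ _ _ =>
    Obl.bind (obl_secretWrite _ _ _ _) fun _ _ _ => Obl.pure trivial

/-- The cursor `c` stands at the head of the list `l`, a rest of the list of the reals of class `c`
followed by the dummies. -/
def AtList (X : ℕ → Item D B) (n₁ n : ℕ) (q : Fin 3 → ℕ → ℕ) (c : Bool) (l : List ℕ)
    (cur : Cursor D) : Prop :=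
  ∃ k k', l = cls X n₁ n c true k ++ cls X n₁ n c false k' ∧
    cur = Cursor.goTo (headPos D q (cls X n₁ n c true k)) (headPos D q (cls X n₁ n c false k'))

theorem AtList.nil {c : Bool} {cur : Cursor D} (h : AtList X n₁ n q c [] cur) :
    cur.current = none := by
  obtain ⟨k, k', h, rfl⟩ := h
  obtain ⟨h₁, h₂⟩ := List.append_eq_nil_iff.mp h.symm
  rw [h₁, h₂]
  rfl

theorem AtList.cons {c : Bool} {cur : Cursor D} {i : ℕ} {l : List ℕ}
    (h : AtList X n₁ n q c (i :: l) cur) : i < n ∧ cur.current = some (posOf D q i) ∧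
      AtList X n₁ n q c l (Cursor.goTo (nextLink X n₁ n q i).asLink cur.later) := by
  obtain ⟨k, k', h, rfl⟩ := h
  rcases hr : cls X n₁ n c true k with _ | ⟨j, l'⟩
  · rw [hr, List.nil_append] at h
    obtain ⟨h₁, h₂, h₃⟩ := cls_eq_cons h.symm
    simp only [inClass, Bool.and_eq_true, beq_iff_eq] at h₂
    -- The reals are used up, and `n` as starting index describes their empty rest.
    refine ⟨h₁, by rw [← h]; rfl, n, i + 1, ?_, ?_⟩
    · rw [cls_of_le le_rfl, List.nil_append, h₃]
    · rw [cls_of_le le_rfl, nextLink, h₂.1, h₂.2, ← h₃]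
      simp only [headPos, List.head?_nil, Option.map_none, Item.asLink, Cursor.goTo]
      cases l.head? <;> rfl
  · rw [hr, List.cons_append] at h
    obtain ⟨rfl, rfl⟩ := List.cons.inj h
    obtain ⟨h₁, h₂, rfl⟩ := cls_eq_cons hr
    simp only [inClass, Bool.and_eq_true, beq_iff_eq] at h₂
    refine ⟨h₁, rfl, i + 1, k', rfl, ?_⟩
    rw [nextLink, h₂.1, h₂.2]
    rfl

theorem atList_init (c : Bool) : AtList X n₁ n q c
    (cls X n₁ n c true 0 ++ cls X n₁ n c false 0)
    (Cursor.goTo (headPos D q (cls X n₁ n c true 0)) (headPos D q (cls X n₁ n c false 0))) :=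
  ⟨0, 0, rfl, rfl⟩

/-! ### Arrays that hold lists -/

variable (F) in
/-- The array `T` holds the list `l`. -/
def HoldsList (m : Memory F.width) (T : Arr) (l : List (Item D B)) : Prop :=
  T.len = l.length ∧ Holds F m T fun i => l.getD i .dummy

theorem map_range_getD (l : List (Item D B)) :
    (List.range l.length).map (fun i => l.getD i .dummy) = l := by
  refine List.ext_getElem (by simp) fun i h₁ h₂ => ?_
  simp [h₂]

theorem HoldsList.ext {C : Set ℕ} {l : List (Item D B)} (h : HoldsList F m T l)
    (e : m.Ext C m') (hC : ∀ i < T.len, T.cell i ∉ C) : HoldsList F m' T l :=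
  ⟨h.1, h.2.ext e hC⟩

theorem HoldsList.ext_empty {l : List (Item D B)} (h : HoldsList F m T l)
    (e : m.Ext ∅ m') : HoldsList F m' T l :=
  h.ext e fun _ _ => id

theorem HoldsList.take {l : List (Item D B)} (h : HoldsList F m T l) (n : ℕ) :
    HoldsList F m (T.take n) (l.take n) := by
  refine ⟨by simp [Arr.take, h.1], (h.2.take n).congr fun i hi => ?_⟩
  have : i < n := hi.trans_le (min_le_left _ _)
  simp [List.getD, this]

theorem HoldsList.append {l l' : List (Item D B)} (h : HoldsList F m S l)
    (h' : HoldsList F m T l') : HoldsList F m (S.append T) (l ++ l') := by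
  refine ⟨by simp [Arr.append, h.1, h'.1], (h.2.append h'.2).congr fun i _ => ?_⟩
  rw [h.1]
  split_ifs with hi
  · simp [List.getD, List.getElem?_append_left hi]
  · simp [List.getD, List.getElem?_append_right (not_lt.mp hi)]

theorem Holds.toList {l : List (Item D B)} (hl : T.len = l.length)
    (h : ∀ i (hi : i < l.length), T.cell i < m.next ∧ Shared F m (T.cell i) l[i]) :
    HoldsList F m T l :=
  ⟨hl, fun i hi => by simpa [hl ▸ hi] using h i (hl ▸ hi)⟩

theorem encode_inj {x y : Item D B} (h : F.encode x = F.encode y) : x = y := by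
  rw [← F.decode_encode x, h, F.decode_encode]

/-- A coupling speaks about stored blocks, since the drawn permutations are known only through an
existential statement for each run separately. Injectivity of the encoding turns equal blocks back
into equal places. -/
theorem HoldsPerm.eq_of_block_eq {i j : ℕ} (h : HoldsPerm F m P q) (h' : HoldsPerm F m' P q')
    (hn : P.len ≤ 2 ^ (D + 1)) (hi : i < P.len) (hj : j < P.len)
    (hb : m.block (s - 1) ⟨s, P.cell i⟩ = m'.block (s - 1) ⟨s, P.cell j⟩) : q s i = q' s j := by
  rw [h.block i hi, h'.block j hj] at hb
  have : q s i % 2 ^ (D + 1) = q' s j % 2 ^ (D + 1) :=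
    congrArg Fin.val (Item.index.inj (encode_inj hb))
  rwa [Nat.mod_eq_of_lt (((h.perm s).lt i hi).trans_le hn),
    Nat.mod_eq_of_lt (((h'.perm s).lt j hj).trans_le hn)] at this

/-- Matching the two lists position by position is a partial injection of a finite set, and such a
map extends to a permutation. It supplies the `σ` for `rel_genPerms`. -/
theorem exists_perm_of_nodup {n : ℕ} {l l' : List ℕ} (hl : l.Nodup) (hl' : l'.Nodup)
    (hn : ∀ i ∈ l, i < n) (hn' : ∀ i ∈ l', i < n) (hlen : l.length = l'.length) :
    ∃ σ : Equiv.Perm (Fin n), ∀ k (h : k < l.length) (h' : k < l'.length),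
      (σ ⟨l[k], hn _ (List.getElem_mem h)⟩ : ℕ) = l'[k] := by
  -- Off `l` the value of `f` plays no role, as only its restriction to `t` is extended.
  let f : Fin n → Fin n := fun i =>
    if h : l.idxOf i.val < l'.length then ⟨l'[l.idxOf i.val], hn' _ (List.getElem_mem h)⟩ else i
  let t : Finset (Fin n) := Finset.univ.filter fun i => i.val ∈ l
  have hlt : ∀ i ∈ t, l.idxOf i.val < l'.length := fun i hi => by
    rw [← hlen]
    exact List.idxOf_lt_length_iff.mpr (by simpa [t] using hi)
  obtain ⟨g, hg⟩ := Finset.exists_equiv_extend_of_card_eq (t := (Finset.univ : Finset (Fin n)))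
    (s := t) (f := f) (by simp) (Finset.subset_univ _) (by
      intro i hi j hj hij
      simp only [f, hlt i hi, hlt j hj, dite_true, Fin.mk.injEq] at hij
      have := hl'.getElem_inj_iff.mp hij
      exact Fin.ext ((List.idxOf_inj (by simpa [t] using hi)).mp this))
  refine ⟨g.trans (Equiv.subtypeUnivEquiv fun i => Finset.mem_univ i), fun k h h' => ?_⟩
  have := hg ⟨l[k], hn _ (List.getElem_mem h)⟩ (by simp [t])
  simp [this, f, hl.idxOf_getElem, h']

end Lists

open Client

/-! ## Stable compaction -/

section Compact

variable {D B : ℕ} {F : BlockFormat D B} {s : Fin 3} {m m' : Memory F.width}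
  {P T S R L T' L' : Arr} {q q' : Fin 3 → ℕ → ℕ} {n n₁ : ℕ} {X X' : ℕ → Item D B}

/-- The reals of a list followed by the dummies. -/
def compact (l : List (Item D B)) : List (Item D B) :=
  l.filter (fun x => x.isReal) ++ l.filter (fun x => !x.isReal)

/-- The indices of the reals followed by those of the dummies. -/
def order (X : ℕ → Item D B) (n : ℕ) : List ℕ :=
  cls X n n false true 0 ++ cls X n n false false 0

theorem order_eq (X : ℕ → Item D B) (n : ℕ) : order X n =
    (List.range n).filter (fun i => (X i).isReal) ++
      (List.range n).filter (fun i => !(X i).isReal) := by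
  rw [order, cls, cls, Nat.sub_zero, ← List.range_eq_range']
  congr 1 <;> refine List.filter_congr fun i hi => ?_ <;>
    simp [inClass, List.mem_range.mp hi]

theorem order_perm (X : ℕ → Item D B) (n : ℕ) : (order X n).Perm (List.range n) := by
  rw [order_eq]
  exact List.filter_append_perm _ _

theorem map_order (X : ℕ → Item D B) (n : ℕ) :
    (order X n).map X = compact ((List.range n).map X) := by
  rw [order_eq, List.map_append, compact, List.filter_map, List.filter_map]
  rfl

/-- The traversal of the permuted lists by `stableCompact`. -/
def compactRound (F : BlockFormat D B) (T' L' R : Arr) (c : Cursor D) (k : ℕ) :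
    Client F.width (Cursor D) :=
  match c.current with
  | none => pure c
  | some p => do
      let (x, next) ← fetchEntry F T' L' p
      secretWrite F R k x
      pure (Cursor.goTo next c.later)

theorem stableCompact_eq (T : Arr) : stableCompact F T = (do
    let P ← genPerms F T.len
    let r ← linkScan F T P T.len
    let T' ← permute F P T
    let L' ← permute F P r.2
    let R ← newArr T.len
    let _ ← (List.range T.len).foldlM (compactRound F T' L' R)
      (Cursor.goTo (r.1 false true) (r.1 false false))
    pure R) := rfl

theorem sure_compactRound {c : Cursor D} {k i : ℕ} {l : List ℕ} (hq : ∀ b, IsPerm n (q b))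
    (hn : n ≤ 2 ^ (D + 1)) (hT : HoldsPermuted F m T' q X)
    (hL : HoldsPermuted F m L' q (nextLink X n₁ n q)) (hTn : T'.len = n) (hLn : L'.len = n)
    {b : Bool} (h : AtList X n₁ n q b (i :: l) c) :
    (compactRound F T' L' R c k).Sure m fun c' m' => AtList X n₁ n q b l c' ∧
      m.Ext {R.cell k} m' ∧ Shared F m' (R.cell k) (X i) := by
  obtain ⟨hi, hc, hl⟩ := h.cons
  rw [compactRound, hc]
  refine (sure_fetchEntry hq hn hT hL hTn hLn hi).bind ?_
  rintro _ _ ⟨rfl, rfl⟩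
  exact (sure_secretWrite _ _ _).bind fun _ m₁ h₁ => Sure.pure ⟨hl, h₁⟩

theorem obl_compactRound {c c' : Cursor D} {k : ℕ} {p p' : Pos D} (hc : c.current = some p)
    (hc' : c'.current = some p') (h : p s = p' s) :
    Obl s (compactRound F T' L' R c k) (compactRound F T' L' R c' k) fun _ _ => True := by
  rw [compactRound, compactRound, hc, hc']
  exact Obl.bind (obl_fetchEntry h) fun _ _ _ => Obl.bind (obl_secretWrite _ _ _ _)
    fun _ _ _ => Obl.pure trivial

/-- The state of the traversal after `k` rounds. -/
structure CompactInv (F : BlockFormat D B) (m₀ : Memory F.width) (R : Arr) (X : ℕ → Item D B)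
    (n : ℕ) (q : Fin 3 → ℕ → ℕ) (k : ℕ) (c : Cursor D) (m : Memory F.width) : Prop where
  ext : m₀.Ext R.cells m
  at_list : AtList X n n q false ((order X n).drop k) c
  done : ∀ j < k, ∀ hj : j < (order X n).length, Shared F m (R.cell j) (X (order X n)[j])

theorem CompactInv.step {m₀ : Memory F.width} {c : Cursor D} {k : ℕ}
    (h : CompactInv F m₀ R X n q k c m) (hq : ∀ b, IsPerm n (q b)) (hn : n ≤ 2 ^ (D + 1))
    (hT : HoldsPermuted F m₀ T' q X) (hL : HoldsPermuted F m₀ L' q (nextLink X n n q))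
    (hTn : T'.len = n) (hLn : L'.len = n) (hRn : R.len = n) (hR : R.Fresh m' m₀)
    (hT' : T'.Fresh m₁ m') (hL' : L'.Fresh m₂ m') (hk : k < n) :
    (compactRound F T' L' R c k).Sure m (CompactInv F m₀ R X n q (k + 1)) := by
  have hl : (order X n).length = n := by simpa using (order_perm X n).length_eq
  have hk' : k < (order X n).length := hl.symm ▸ hk
  have hat := h.at_list
  rw [List.drop_eq_getElem_cons hk'] at hat
  refine (sure_compactRound hq hn (hT.ext (hTn ▸ hq) h.ext fun i hi => hR.not_mem (hT'.high i hi))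
    (hL.ext (hLn ▸ hq) h.ext fun i hi => hR.not_mem (hL'.high i hi)) hTn hLn hat).mono ?_
  rintro c' m₃ ⟨h₁, e, h₂⟩
  have hc : R.cell k ∈ R.cells := Arr.cell_mem (hRn ▸ hk)
  refine ⟨h.ext.trans e (fun _ h _ => h) fun c h _ => ?_, h₁, fun j hj hjl => ?_⟩
  · rw [Set.mem_singleton_iff.mp h]
    exact hc
  · rcases Nat.lt_succ_iff_lt_or_eq.mp hj with hj | rfl
    · refine (h.done j hj hjl).ext e ((hR.high j (by omega)).trans_le h.ext.next) fun h => ?_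
      exact absurd (hR.inj _ (by omega) _ (by omega) h) hj.ne
    · exact h₂

theorem sure_stableCompact {l : List (Item D B)} (hT : HoldsList F m T l)
    (hn : T.len ≤ 2 ^ (D + 1)) : (stableCompact F T).Sure m fun R m' =>
      R.Fresh m m' ∧ m.Ext ∅ m' ∧ HoldsList F m' R (compact l) := by
  rw [stableCompact_eq]
  set X : ℕ → Item D B := fun i => l.getD i .dummy with hX
  refine (sure_genPerms _).bind fun P m₁ ⟨hPl, hPf, e₁, q, hP⟩ => ?_
  have hT₁ := hT.2.ext_empty e₁
  refine (sure_linkScan hT₁ hP hPl).bind fun r m₂ ⟨hr, hLl, hLf, e₂, hL⟩ => ?_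
  have hP₂ := hP.ext_empty e₂
  refine (sure_permute hn hPl hP₂ (hT₁.ext_empty e₂)).bind fun T' m₃ ⟨hTl', hTf', e₃, hT'⟩ => ?_
  refine (sure_permute (hLl ▸ hn) (hPl.trans hLl.symm) (hP₂.ext_empty e₃)
    (hL.ext_empty e₃)).bind fun L' m₄ ⟨hLl', hLf', e₄, hL'⟩ => ?_
  have hq : ∀ b, IsPerm T.len (q b) := hPl ▸ hP.perm
  refine (sure_newArr _).bind fun R m₅ ⟨hRl, hRf, e₅⟩ => ?_
  have hT₅ := (hT'.ext (hTl' ▸ hq) e₄ fun _ _ => id).ext (hTl' ▸ hq) e₅ fun _ _ => id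
  have hL₅ := hL'.ext (by rw [hLl', hLl]; exact hq) e₅ fun _ _ => id
  refine Sure.bind (Sure.foldlM_range (CompactInv F m₅ R X T.len q) ⟨.refl _ _, ?_, by simp⟩
    fun k hk c m h => h.step hq hn hT₅ hL₅ hTl' (hLl'.trans hLl) hRl hRf
      (hTf'.mono le_rfl e₄.next) hLf' hk) fun c m₆ h => Sure.pure ⟨?_, ?_, ?_⟩
  · rw [hr]
    exact atList_init false
  · have e := ((e₁.trans_same e₂).trans_same e₃).trans_same e₄
    exact hRf.mono e.next h.ext.next
  · have e := ((e₁.trans_same e₂).trans_same e₃).trans_same e₄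
    exact (e.trans_same e₅).of_fresh e.next hRf h.ext
  · have hl : (order X T.len).length = T.len := by simpa using (order_perm X T.len).length_eq
    have : compact l = (order X T.len).map X := by
      rw [map_order, hT.1, map_range_getD]
    rw [this]
    refine Holds.toList (by simp [hl, hRl]) fun i hi => ?_
    rw [List.length_map] at hi
    refine ⟨(hRf.high i (by omega)).trans_le h.ext.next, ?_⟩
    rw [List.getElem_map]
    exact h.done i (by omega) hi

/-- The permutations of both runs can be coupled so that the same places are visited. -/
theorem rel_genPerms_of_order {l l' : List ℕ} (hl : l.Nodup) (hl' : l'.Nodup)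
    (hln : ∀ i ∈ l, i < n) (hln' : ∀ i ∈ l', i < n) (hlen : l.length = l'.length)
    (hn : n ≤ 2 ^ (D + 1)) (e : Eqv s m m') :
    Rel s (genPerms F n) m (genPerms F n) m' fun P m₁ P' m₁' => Eqv s m₁ m₁' ∧ P = P' ∧
      P.len = n ∧ (P.Fresh m m₁ ∧ m.Ext ∅ m₁) ∧ (P.Fresh m' m₁' ∧ m'.Ext ∅ m₁') ∧
      ∃ q q', HoldsPerm F m₁ P q ∧ HoldsPerm F m₁' P q' ∧
        ∀ k (h : k < l.length) (h' : k < l'.length), q s l[k] = q' s l'[k] := by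
  obtain ⟨σ, hσ⟩ := exists_perm_of_nodup hl hl' hln hln' hlen
  refine ((rel_genPerms n σ e).and_sure (sure_genPerms n) (sure_genPerms n)).mono ?_
  rintro P m₁ _ m₁' ⟨⟨e, rfl, hb⟩, ⟨hPl, hPf, e₁, q, hP⟩, -, hPf', e₁', q', hP'⟩
  refine ⟨e, rfl, hPl, ⟨hPf, e₁⟩, ⟨hPf', e₁'⟩, q, q', hP, hP', fun k h h' => ?_⟩
  have hb' := hb ⟨l[k], hln _ (List.getElem_mem h)⟩
  rw [hσ k h h'] at hb'
  refine hP.eq_of_block_eq hP' (hPl.trans_le hn) ?_ ?_ hb'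
  · exact (hln _ (List.getElem_mem h)).trans_eq hPl.symm
  · exact (hln' _ (List.getElem_mem h')).trans_eq hPl.symm

/-- The order of visits is a function of the stored list, so it is known before the permutations are
drawn. Once these are coupled along the two orders, round `k` asks server `s` for the same place in
both runs, although the entries differ. -/
theorem rel_stableCompact {l l' : List (Item D B)} (hT : HoldsList F m T l)
    (hT' : HoldsList F m' T l') (hn : T.len ≤ 2 ^ (D + 1)) (e : Eqv s m m') :
    Rel s (stableCompact F T) m (stableCompact F T) m' fun R m₁ R' m₁' =>
      Eqv s m₁ m₁' ∧ R = R' := by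
  rw [stableCompact_eq]
  set X : ℕ → Item D B := fun i => l.getD i .dummy with hX
  set X' : ℕ → Item D B := fun i => l'.getD i .dummy with hX'
  have hord := order_perm X T.len
  have hord' := order_perm X' T.len
  have hl : (order X T.len).length = T.len := by simpa using hord.length_eq
  have hl' : (order X' T.len).length = T.len := by simpa using hord'.length_eq
  refine (rel_genPerms_of_order (hord.nodup_iff.mpr List.nodup_range)
    (hord'.nodup_iff.mpr List.nodup_range) (fun i hi => List.mem_range.mp (hord.mem_iff.mp hi))
    (fun i hi => List.mem_range.mp (hord'.mem_iff.mp hi)) (hl.trans hl'.symm) hn e).bind ?_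
  rintro P m₁ _ m₁' ⟨e, rfl, hPl, ⟨-, e₁⟩, ⟨-, e₁'⟩, q, q', hP, hP', hqq⟩
  have hT₁ := hT.2.ext_empty e₁
  have hT₁' := hT'.2.ext_empty e₁'
  refine ((obl_linkScan m₁ m₁' e).and_sure (sure_linkScan hT₁ hP hPl)
    (sure_linkScan hT₁' hP' hPl)).bind ?_
  rintro ⟨r, L⟩ m₂ ⟨r', _⟩ m₂' ⟨⟨e, rfl⟩, ⟨hr, hLl, hLf, e₂, hL⟩, hr', -, hLf', e₂', hL'⟩
  dsimp only at hr hr' hLl hLf hLf' hL hL' ⊢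
  have hT₂ := hT₁.ext_empty e₂
  have hT₂' := hT₁'.ext_empty e₂'
  have hP₂ := hP.ext_empty e₂
  have hP₂' := hP'.ext_empty e₂'
  refine ((rel_permute hn hPl hP₂ hP₂' (fun i hi => (hT₂ i hi).1) e).and_sure
    (sure_permute hn hPl hP₂ hT₂) (sure_permute hn hPl hP₂' hT₂')).bind ?_
  rintro T' m₃ _ m₃' ⟨⟨e, rfl⟩, ⟨hTl, hTf, e₃, hTp⟩, -, hTf', e₃', hTp'⟩
  have hP₃ := hP₂.ext_empty e₃
  have hP₃' := hP₂'.ext_empty e₃'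
  have hL₃ := hL.ext_empty e₃
  have hL₃' := hL'.ext_empty e₃'
  refine ((rel_permute (hLl ▸ hn) (hPl.trans hLl.symm) hP₃ hP₃' (fun i hi => (hL₃ i hi).1)
    e).and_sure (sure_permute (hLl ▸ hn) (hPl.trans hLl.symm) hP₃ hL₃)
    (sure_permute (hLl ▸ hn) (hPl.trans hLl.symm) hP₃' hL₃')).bind ?_
  rintro L' m₄ _ m₄' ⟨⟨e, rfl⟩, ⟨hLl', hLf₄, e₄, hLp⟩, -, hLf₄', e₄', hLp'⟩
  refine (((Obl.newArr _) m₄ m₄' e).and_sure (sure_newArr _) (sure_newArr _)).bind ?_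
  rintro R m₅ _ m₅' ⟨⟨e, rfl⟩, ⟨hRl, hRf, e₅⟩, -, hRf', e₅'⟩
  have hq : ∀ b, IsPerm T.len (q b) := hPl ▸ hP.perm
  have hq' : ∀ b, IsPerm T.len (q' b) := hPl ▸ hP'.perm
  have hTp₅ := (hTp.ext (hTl ▸ hq) e₄ fun _ _ => id).ext (hTl ▸ hq) e₅ fun _ _ => id
  have hTp₅' := (hTp'.ext (hTl ▸ hq') e₄' fun _ _ => id).ext (hTl ▸ hq') e₅' fun _ _ => id
  have hLp₅ := hLp.ext (by rw [hLl', hLl]; exact hq) e₅ fun _ _ => id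
  have hLp₅' := hLp'.ext (by rw [hLl', hLl]; exact hq') e₅' fun _ _ => id
  refine Rel.bind (Rel.foldlM_range (fun k c m c' m' => Eqv s m m' ∧
    CompactInv F m₅ R X T.len q k c m ∧ CompactInv F m₅' R X' T.len q' k c' m')
    ⟨e, ⟨.refl _ _, ?_, by simp⟩, ⟨.refl _ _, ?_, by simp⟩⟩ ?_)
    fun _ m₆ _ m₆' h => Rel.pure ⟨h.1, rfl⟩
  · rw [hr]
    exact atList_init false
  · rw [hr']
    exact atList_init false
  · rintro k hk c n c' n' ⟨e, h, h'⟩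
    have hat := h.at_list
    have hat' := h'.at_list
    rw [List.drop_eq_getElem_cons (hl.symm ▸ hk)] at hat
    rw [List.drop_eq_getElem_cons (hl'.symm ▸ hk)] at hat'
    refine ((obl_compactRound hat.cons.2.1 hat'.cons.2.1 ?_ n n' e).and_sure
      (h.step hq hn hTp₅ hLp₅ hTl (hLl'.trans hLl) hRl hRf (hTf.mono le_rfl e₄.next) hLf₄ hk)
      (h'.step hq' hn hTp₅' hLp₅' hTl (hLl'.trans hLl) hRl hRf' (hTf'.mono le_rfl e₄'.next)
        hLf₄' hk)).mono fun _ _ _ _ h => ⟨h.1.1, h.2⟩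
    simp only [posOf, hqq k (hl.symm ▸ hk) (hl'.symm ▸ hk)]

end Compact

open Client

/-! ## Merging -/

section Merge

variable {D B : ℕ} {F : BlockFormat D B} {s : Fin 3} {m m' m₀ m₁ m₂ : Memory F.width}
  {P T S R L T' L' : Arr} {q q' : Fin 3 → ℕ → ℕ} {n n₁ : ℕ} {X X' : ℕ → Item D B}

/-- The state of a merge in terms of indices: the entries still to be fetched, the entries fetched
and not yet output, and the entries fetched so far. -/
structure IndexMerge : Type where
  rem : Bool → List ℕ
  held : Bool → List ℕ
  vis : List ℕ

namespace IndexMerge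

/-- The list from which an entry is fetched when list `s` is preferred. -/
def src (A : IndexMerge) (s : Bool) : Bool := if (A.rem s).isEmpty then !s else s

def fetch (A : IndexMerge) (s : Bool) : IndexMerge :=
  match A.rem (A.src s) with
  | [] => A
  | i :: l => ⟨Function.update A.rem (A.src s) l,
      Function.update A.held (A.src s) (A.held (A.src s) ++ [i]), A.vis ++ [i]⟩

def choose (X : ℕ → Item D B) (A : IndexMerge) : Bool :=
  match A.held false, A.held true with
  | i :: _, j :: _ => !((X i).before (X j))
  | _ :: _, [] => false
  | [], _ => true

def step (X : ℕ → Item D B) (A : IndexMerge) : IndexMerge :=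
  match A.held (A.choose X) with
  | [] => A
  | _ :: l => fetch { A with held := Function.update A.held (A.choose X) l } (A.choose X)

/-- The entries still to be output. -/
def merged (X : ℕ → Item D B) (A : IndexMerge) : List ℕ :=
  List.merge (A.held false ++ A.rem false) (A.held true ++ A.rem true)
    fun i j => (X i).before (X j)

/-- In a good state an empty buffer means an exhausted list, so comparing the buffered heads is as
good as comparing the heads of the full lists. -/
def Good (A : IndexMerge) (s : Bool) : Prop := A.held s = [] → A.rem s = []

theorem fetch_nil {A : IndexMerge} {s : Bool} (h : A.rem (A.src s) = []) : A.fetch s = A := by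
  rw [fetch, h]

theorem fetch_cons {A : IndexMerge} {s : Bool} {i : ℕ} {l : List ℕ}
    (h : A.rem (A.src s) = i :: l) : A.fetch s =
      ⟨Function.update A.rem (A.src s) l,
      Function.update A.held (A.src s) (A.held (A.src s) ++ [i]), A.vis ++ [i]⟩ := by
  rw [fetch, h]

theorem rem_nil_of_src {A : IndexMerge} {s : Bool} (h : A.rem (A.src s) = []) (c : Bool) :
    A.rem c = [] := by
  simp only [src] at h
  cases s <;> cases c <;> split_ifs at h <;> simp_all

/-- A fetch moves the head of the unfetched part to the end of the buffer, so their concatenation,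
and with it the list to be output, does not change. -/
theorem fetch_all (A : IndexMerge) (s c : Bool) :
    (A.fetch s).held c ++ (A.fetch s).rem c = A.held c ++ A.rem c := by
  rcases h : A.rem (A.src s) with _ | ⟨i, l⟩
  · rw [fetch_nil h]
  · rw [fetch_cons h]
    by_cases hc : c = A.src s
    · subst hc
      simp [h]
    · simp [Function.update_of_ne hc]

/-- A fetch meant for `s` fails to refill its buffer only if list `s` has nothing left. Hence the
fetch after each output restores what popping the buffer may have destroyed. -/
theorem good_fetch_self (A : IndexMerge) (s : Bool) : (A.fetch s).Good s := by
  rcases h : A.rem (A.src s) with _ | ⟨i, l⟩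
  · exact fun _ => by rw [fetch_nil h, rem_nil_of_src h]
  · rw [fetch_cons h]
    intro hs
    by_cases hc : s = A.src s
    · rw [← hc] at hs
      simp at hs
    · have : A.rem s = [] := by
        by_contra h'
        exact hc (by simp [src, h'])
      simpa [Function.update_of_ne hc] using this

theorem Good.fetch {A : IndexMerge} {c : Bool} (h : A.Good c) (s : Bool) :
    (A.fetch s).Good c := by
  intro hc
  have := A.fetch_all s c
  rw [hc, List.nil_append] at this
  rcases hs : A.rem (A.src s) with _ | ⟨i, l⟩
  · rw [fetch_nil hs, rem_nil_of_src hs]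
  · rw [fetch_cons hs] at hc ⊢
    by_cases hc' : c = A.src s
    · subst hc'
      simp at hc
    · simp only [Function.update_of_ne hc'] at hc ⊢
      exact h hc

theorem merged_fetch (A : IndexMerge) (s : Bool) : (A.fetch s).merged X = A.merged X := by
  rw [merged, fetch_all, fetch_all, merged]

theorem good_fetch_fetch (A : IndexMerge) (c : Bool) : ((A.fetch false).fetch true).Good c := by
  cases c
  · exact (good_fetch_self _ _).fetch _
  · exact good_fetch_self _ _

/-- The four cases compare the buffered heads as `List.merge` does; goodness excludes that an empty
buffer hides unfetched entries. -/
theorem step_cons {A : IndexMerge} (hA : ∀ c, A.Good c) {i : ℕ} {l : List ℕ}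
    (h : A.merged X = i :: l) : (∃ l', A.held (A.choose X) = i :: l' ∧ A.step X =
      fetch { A with held := Function.update A.held (A.choose X) l' } (A.choose X)) ∧
      (A.step X).merged X = l ∧ ∀ c, (A.step X).Good c := by
  suffices h : ∃ l', A.held (A.choose X) = i :: l' ∧
      merged X { A with held := Function.update A.held (A.choose X) l' } = l by
    obtain ⟨l', h₁, h₂⟩ := h
    have hs : A.step X =
        fetch { A with held := Function.update A.held (A.choose X) l' } (A.choose X) := by
      rw [step, h₁]
    refine ⟨⟨l', h₁, hs⟩, by rw [hs, merged_fetch, h₂], fun c => ?_⟩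
    rw [hs]
    by_cases hc : c = A.choose X
    · subst hc
      exact good_fetch_self _ _
    · refine Good.fetch (fun h => ?_) _
      simp only [Function.update_of_ne hc] at h
      exact hA c h
  have h₀ := hA false
  have h₁ := hA true
  simp only [Good] at h₀ h₁
  rw [merged] at h
  rcases hf : A.held false with _ | ⟨a, la⟩ <;> rcases ht : A.held true with _ | ⟨b, lb⟩
  · rw [hf, ht, h₀ hf, h₁ ht] at h
    simp at h
  · have hch : A.choose X = true := by simp [choose, hf]
    rw [hf, ht, h₀ hf] at h
    simp only [List.append_nil, List.nil_merge, List.cons_append, List.cons.injEq] at h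
    refine ⟨lb, by rw [hch, ht, h.1], ?_⟩
    simp [merged, hch, hf, h₀ hf, h.2]
  · have hch : A.choose X = false := by simp [choose, hf, ht]
    rw [hf, ht, h₁ ht] at h
    simp only [List.append_nil, List.merge_right, List.cons_append, List.cons.injEq] at h
    refine ⟨la, by rw [hch, hf, h.1], ?_⟩
    simp [merged, hch, ht, h₁ ht, h.2]
  · rw [hf, ht, List.cons_append, List.cons_append, List.cons_merge_cons] at h
    by_cases hb : (X a).before (X b)
    · have hch : A.choose X = false := by simp [choose, hf, ht, hb]
      rw [if_pos hb, List.cons.injEq] at h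
      refine ⟨la, by rw [hch, hf, h.1], ?_⟩
      simp [merged, hch, ht, h.2]
    · have hch : A.choose X = true := by simp [choose, hf, ht, hb]
      rw [if_neg hb, List.cons.injEq] at h
      refine ⟨lb, by rw [hch, ht, h.1], ?_⟩
      simp [merged, hch, hf, h.2]

theorem iterate_step {A : IndexMerge} (hA : ∀ c, A.Good c) {k : ℕ}
    (hk : k ≤ (A.merged X).length) : ((step X)^[k] A).merged X = (A.merged X).drop k ∧
      ∀ c, ((step X)^[k] A).Good c := by
  induction k with
  | zero => exact ⟨rfl, hA⟩
  | succ k ih =>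
    obtain ⟨h₁, h₂⟩ := ih (by omega)
    rw [List.drop_eq_getElem_cons (by omega)] at h₁
    rw [Function.iterate_succ_apply']
    exact (step_cons h₂ h₁).2

/-- The entries fetched and to be fetched are those with index `< n`. -/
def Complete (n : ℕ) (A : IndexMerge) : Prop :=
  (A.vis ++ (A.rem false ++ A.rem true)).Perm (List.range n)

theorem Complete.fetch {A : IndexMerge} (h : A.Complete n) (s : Bool) :
    (A.fetch s).Complete n := by
  rcases hs : A.rem (A.src s) with _ | ⟨i, l⟩
  · rwa [fetch_nil hs]
  · rw [fetch_cons hs]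
    refine List.Perm.trans ?_ h
    rw [List.append_assoc]
    refine List.Perm.append_left _ ?_
    cases hc : A.src s <;> rw [hc] at hs
    · simp [hs]
    · simpa [hs] using List.perm_middle.symm

theorem Complete.step {A : IndexMerge} (h : A.Complete n) : (A.step X).Complete n := by
  rw [IndexMerge.step]
  split
  · exact h
  · rename_i l _
    exact Complete.fetch (A := { A with held := Function.update A.held (A.choose X) l }) h _

theorem vis_fetch (A : IndexMerge) (s : Bool) : A.vis <+: (A.fetch s).vis := by
  rcases hs : A.rem (A.src s) with _ | ⟨i, l⟩
  · rw [fetch_nil hs]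
  · rw [fetch_cons hs]
    exact List.prefix_append _ _

theorem vis_step (A : IndexMerge) : A.vis <+: (A.step X).vis := by
  rw [step]
  split
  · exact List.prefix_rfl
  · rename_i l _
    exact vis_fetch { A with held := Function.update A.held (A.choose X) l } _

/-- Visited entries are only appended, so the entry fetched in any round can be read off from the
final list. -/
theorem vis_iterate (A : IndexMerge) {k k' : ℕ} (h : k ≤ k') :
    ((step X)^[k] A).vis <+: ((step X)^[k'] A).vis := by
  induction k', h using Nat.le_induction with
  | base => exact List.prefix_rfl
  | succ k' _ ih =>
    rw [Function.iterate_succ_apply']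
    exact ih.trans (vis_step _)

theorem Complete.iterate {A : IndexMerge} (h : A.Complete n) (k : ℕ) :
    ((IndexMerge.step X)^[k] A).Complete n := by
  induction k with
  | zero => exact h
  | succ k ih =>
    rw [Function.iterate_succ_apply']
    exact ih.step

/-- When nothing is left to output nothing is left to fetch, so every index was fetched exactly
once. -/
theorem Complete.vis_perm {A : IndexMerge} (h : A.Complete n) (hA : A.merged X = []) :
    A.vis.Perm (List.range n) := by
  have hl : (A.merged X).length = 0 := by rw [hA]; rfl
  rw [merged, List.Perm.length_eq (List.merge_perm_append _)] at hl
  simp only [List.length_append] at hl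
  have h₀ : A.rem false = [] := List.eq_nil_of_length_eq_zero (by omega)
  have h₁ : A.rem true = [] := List.eq_nil_of_length_eq_zero (by omega)
  simpa [Complete, h₀, h₁] using h

end IndexMerge

open IndexMerge

/-- The merge state `st` of the client is described by the indices in `A`. -/
structure MatchState (X : ℕ → Item D B) (n₁ n : ℕ) (q : Fin 3 → ℕ → ℕ) (A : IndexMerge)
    (st : MergeState D B) : Prop where
  cursor : ∀ c, AtList X n₁ n q c (A.rem c) (st.cursor c)
  held : ∀ c, st.held c = (A.held c).map X

theorem MatchState.isSome {A : IndexMerge} {st : MergeState D B}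
    (h : MatchState X n₁ n q A st) (c : Bool) :
    (st.cursor c).current.isSome = !(A.rem c).isEmpty := by
  have := h.cursor c
  rcases hr : A.rem c with _ | ⟨i, l⟩ <;> rw [hr] at this
  · simp [this.nil]
  · simp [this.cons.2.1]

theorem MatchState.fetch_nil {A : IndexMerge} {st : MergeState D B} {c : Bool}
    (h : MatchState X n₁ n q A st) (hs : A.rem (A.src c) = []) :
    MergeState.fetch F T' L' c st = pure st := by
  have h₁ := (hs ▸ h.cursor (A.src c)).nil
  have : (if (st.cursor c).current.isSome then c else !c) = A.src c := by
    rw [h.isSome, src]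
    cases (A.rem c).isEmpty <;> rfl
  rw [MergeState.fetch, this, h₁]

theorem MatchState.fetch_cons {A : IndexMerge} {st : MergeState D B} {c : Bool} {i : ℕ}
    {l : List ℕ} (h : MatchState X n₁ n q A st) (hs : A.rem (A.src c) = i :: l) :
    MergeState.fetch F T' L' c st = (do
      let (x, next) ← fetchEntry F T' L' (posOf D q i)
      pure ⟨Function.update st.cursor (A.src c)
          (Cursor.goTo next (st.cursor (A.src c)).later),
        Function.update st.held (A.src c) (st.held (A.src c) ++ [x])⟩) := by
  have h₁ := (hs ▸ h.cursor (A.src c)).cons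
  have : (if (st.cursor c).current.isSome then c else !c) = A.src c := by
    rw [h.isSome, src]
    cases (A.rem c).isEmpty <;> rfl
  rw [MergeState.fetch, this, h₁.2.1]

theorem sure_mergeFetch {A : IndexMerge} {st : MergeState D B} (c : Bool)
    (hq : ∀ b, IsPerm n (q b)) (hn : n ≤ 2 ^ (D + 1)) (hT : HoldsPermuted F m T' q X)
    (hL : HoldsPermuted F m L' q (nextLink X n₁ n q)) (hTn : T'.len = n) (hLn : L'.len = n)
    (h : MatchState X n₁ n q A st) : (MergeState.fetch F T' L' c st).Sure m fun st' m' =>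
      m' = m ∧ MatchState X n₁ n q (A.fetch c) st' := by
  rcases hs : A.rem (A.src c) with _ | ⟨i, l⟩
  · rw [h.fetch_nil hs, IndexMerge.fetch_nil hs]
    exact Sure.pure ⟨rfl, h⟩
  · rw [h.fetch_cons hs, IndexMerge.fetch_cons hs]
    have h₁ := (hs ▸ h.cursor (A.src c)).cons
    refine (sure_fetchEntry hq hn hT hL hTn hLn h₁.1).bind ?_
    rintro _ _ ⟨rfl, rfl⟩
    refine Sure.pure ⟨rfl, fun c' => ?_, fun c' => ?_⟩
    · by_cases hc : c' = A.src c
      · subst hc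
        simpa using h₁.2.2
      · simpa [Function.update_of_ne hc] using h.cursor c'
    · by_cases hc : c' = A.src c
      · subst hc
        simp [h.held]
      · simp [Function.update_of_ne hc, h.held]

/-- From which list an entry is taken depends on the data, but whether one is taken depends only on
the number of entries fetched so far, which is the same in both runs. The new entries stand at the
same index of `v` and `v'`, so their places agree for server `s`. -/
theorem obl_mergeFetch {A A' : IndexMerge} {st st' : MergeState D B} {c c' : Bool} {v v' : List ℕ}
    (h : MatchState X n₁ n q A st) (h' : MatchState X' n₁ n q' A' st') (hA : A.Complete n)
    (hA' : A'.Complete n) (hl : A.vis.length = A'.vis.length) (hv : (A.fetch c).vis <+: v)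
    (hv' : (A'.fetch c').vis <+: v')
    (hqq : ∀ k (h : k < v.length) (h' : k < v'.length), q s v[k] = q' s v'[k]) :
    Obl s (MergeState.fetch F T' L' c st) (MergeState.fetch F T' L' c' st') (fun _ _ => True) ∧
      (A.fetch c).vis.length = (A'.fetch c').vis.length := by
  have hl₁ := hA.length_eq
  have hl₁' := hA'.length_eq
  simp only [List.length_append, List.length_range] at hl₁ hl₁'
  have hsum : ∀ (A : IndexMerge) (c : Bool), A.rem (A.src c) = [] ↔
      (A.rem false).length + (A.rem true).length = 0 := by
    refine fun A c => ⟨fun h => by rw [rem_nil_of_src h, rem_nil_of_src h]; rfl, fun h => ?_⟩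
    cases A.src c <;> exact List.eq_nil_of_length_eq_zero (by omega)
  rcases hs : A.rem (A.src c) with _ | ⟨i, l⟩ <;> rcases hs' : A'.rem (A'.src c') with _ | ⟨i', l'⟩
  · rw [h.fetch_nil hs, h'.fetch_nil hs', IndexMerge.fetch_nil hs, IndexMerge.fetch_nil hs']
    exact ⟨Obl.pure trivial, hl⟩
  · have := (hsum A c).mp hs
    have := mt (hsum A' c').mpr (by simp [hs'])
    omega
  · have := (hsum A' c').mp hs'
    have := mt (hsum A c).mpr (by simp [hs])
    omega
  · rw [IndexMerge.fetch_cons hs] at hv ⊢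
    rw [IndexMerge.fetch_cons hs'] at hv' ⊢
    rw [h.fetch_cons hs, h'.fetch_cons hs']
    refine ⟨Obl.bind (obl_fetchEntry ?_) fun _ _ _ => Obl.pure trivial, by simp [hl]⟩
    obtain ⟨t, rfl⟩ := hv
    obtain ⟨t', rfl⟩ := hv'
    have := hqq A.vis.length (by simp) (by simp [hl])
    simp [hl] at this
    rw [posOf, posOf]
    rw [show q s i = q' s i' by simpa using this]

/-- One round of `merge`. -/
def mergeRound (F : BlockFormat D B) (T' L' R : Arr) (st : MergeState D B) (k : ℕ) :
    Client F.width (MergeState D B) :=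
  match st.held st.choose with
  | [] => pure st
  | x :: xs => do
      secretWrite F R k x
      MergeState.fetch F T' L' st.choose
        { st with held := Function.update st.held st.choose xs }

theorem merge_eq (T₁ T₂ : Arr) : merge F T₁ T₂ = (do
    let P ← genPerms F (T₁.append T₂).len
    let r ← linkScan F (T₁.append T₂) P T₁.len
    let T' ← permute F P (T₁.append T₂)
    let L' ← permute F P r.2
    let R ← newArr (T₁.append T₂).len
    let st₁ ← MergeState.fetch F T' L' false
      ⟨fun s => Cursor.goTo (r.1 s true) (r.1 s false), fun _ => []⟩
    let st₂ ← MergeState.fetch F T' L' true st₁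
    let _ ← (List.range (T₁.append T₂).len).foldlM (mergeRound F T' L' R) st₂
    pure R) := rfl

theorem MatchState.choose_eq {A : IndexMerge} {st : MergeState D B}
    (h : MatchState X n₁ n q A st) : st.choose = A.choose X := by
  rw [MergeState.choose, IndexMerge.choose, h.held, h.held]
  cases A.held false <;> cases A.held true <;> rfl

theorem MatchState.round_eq {A : IndexMerge} {st : MergeState D B} {i k : ℕ} {l : List ℕ}
    (h : MatchState X n₁ n q A st) (hA : A.held (A.choose X) = i :: l) :
    mergeRound F T' L' R st k = (do
      secretWrite F R k (X i)
      MergeState.fetch F T' L' (A.choose X)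
        { st with held := Function.update st.held (A.choose X) (l.map X) }) ∧
    MatchState X n₁ n q { A with held := Function.update A.held (A.choose X) l }
      { st with held := Function.update st.held (A.choose X) (l.map X) } := by
  refine ⟨by rw [mergeRound, h.choose_eq, h.held, hA]; rfl, h.cursor, fun c => ?_⟩
  by_cases hc : c = A.choose X
  · subst hc
    simp
  · simp [Function.update_of_ne hc, h.held]

/-- The state of the traversal after `k` rounds. -/
structure MergeInv (F : BlockFormat D B) (m₀ : Memory F.width) (R : Arr) (X : ℕ → Item D B)
    (n₁ n : ℕ) (q : Fin 3 → ℕ → ℕ) (A : IndexMerge) (k : ℕ) (st : MergeState D B)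
    (m : Memory F.width) : Prop where
  ext : m₀.Ext R.cells m
  state : MatchState X n₁ n q ((step X)^[k] A) st
  done : ∀ j < k, ∀ hj : j < (A.merged X).length, Shared F m (R.cell j) (X (A.merged X)[j])

theorem MergeInv.step {A : IndexMerge} {st : MergeState D B} {k : ℕ}
    (h : MergeInv F m₀ R X n₁ n q A k st m) (hA : ∀ c, A.Good c) (hl : (A.merged X).length = n)
    (hq : ∀ b, IsPerm n (q b)) (hn : n ≤ 2 ^ (D + 1))
    (hT : HoldsPermuted F m₀ T' q X) (hL : HoldsPermuted F m₀ L' q (nextLink X n₁ n q))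
    (hTn : T'.len = n) (hLn : L'.len = n) (hRn : R.len = n) (hR : R.Fresh m' m₀)
    (hT' : T'.Fresh m₁ m') (hL' : L'.Fresh m₂ m') (hk : k < n) :
    (mergeRound F T' L' R st k).Sure m (MergeInv F m₀ R X n₁ n q A (k + 1)) := by
  obtain ⟨h₁, h₂⟩ := iterate_step (X := X) hA (k := k) (by omega)
  rw [List.drop_eq_getElem_cons (by omega)] at h₁
  obtain ⟨⟨l', hl', hst⟩, -⟩ := step_cons h₂ h₁
  obtain ⟨hr, hm⟩ := h.state.round_eq (F := F) (T' := T') (L' := L') (R := R) (k := k) hl'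
  rw [hr]
  have hc : R.cell k ∈ R.cells := Arr.cell_mem (hRn ▸ hk)
  refine (sure_secretWrite _ _ _).bind fun _ m₃ ⟨e₃, h₃⟩ => ?_
  have e : m₀.Ext R.cells m₃ := h.ext.trans e₃ (fun _ h _ => h) fun c h _ => by
    rw [Set.mem_singleton_iff.mp h]
    exact hc
  refine (sure_mergeFetch _ hq hn
    (hT.ext (hTn ▸ hq) e fun i hi => hR.not_mem (hT'.high i hi))
    (hL.ext (hLn ▸ hq) e fun i hi => hR.not_mem (hL'.high i hi)) hTn hLn hm).mono ?_
  rintro st' _ ⟨rfl, hst'⟩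
  refine ⟨e, ?_, fun j hj hjl => ?_⟩
  · rw [Function.iterate_succ_apply', hst]
    exact hst'
  · rcases Nat.lt_succ_iff_lt_or_eq.mp hj with hj | rfl
    · refine (h.done j hj hjl).ext e₃ ((hR.high j (by omega)).trans_le h.ext.next) fun h => ?_
      exact absurd (hR.inj _ (by omega) _ (by omega) h) hj.ne
    · exact h₃

/-- The state of a merge before the first fetch. -/
def initMerge (X : ℕ → Item D B) (n₁ n : ℕ) : IndexMerge :=
  ⟨fun c => cls X n₁ n c true 0 ++ cls X n₁ n c false 0, fun _ => [], []⟩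

theorem initMerge_complete (X : ℕ → Item D B) (n₁ n : ℕ) : (initMerge X n₁ n).Complete n := by
  rw [Complete, initMerge, List.nil_append]
  have h : ∀ c, (cls X n₁ n c true 0 ++ cls X n₁ n c false 0).Perm
      ((List.range n).filter fun i => decide (n₁ ≤ i) == c) := by
    intro c
    refine (List.Perm.trans ?_ (List.filter_append_perm (fun i => (X i).isReal)
      ((List.range n).filter fun i => decide (n₁ ≤ i) == c)))
    rw [cls, cls, List.filter_filter, List.filter_filter, Nat.sub_zero, ← List.range_eq_range']
    refine List.Perm.of_eq ?_
    congr 1 <;> refine List.filter_congr fun i _ => ?_ <;>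
      simp [inClass, Bool.and_comm]
  refine ((h false).append (h true)).trans ?_
  refine (List.perm_append_comm.trans (List.Perm.trans ?_
    (List.filter_append_perm (fun i => decide (n₁ ≤ i)) (List.range n))))
  refine List.Perm.of_eq ?_
  congr 1 <;> refine List.filter_congr fun i _ => ?_ <;> cases decide (n₁ ≤ i) <;> rfl

/-- Merging commutes with passing from indices to entries, and the class lists of the two halves
become the compacted input lists. -/
theorem initMerge_merged (l₁ l₂ : List (Item D B)) :
    ((initMerge (fun i => (l₁ ++ l₂).getD i .dummy) l₁.length (l₁ ++ l₂).length).merged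
        fun i => (l₁ ++ l₂).getD i .dummy).map (fun i => (l₁ ++ l₂).getD i .dummy) =
      List.merge (compact l₁) (compact l₂) Item.before := by
  set X : ℕ → Item D B := fun i => (l₁ ++ l₂).getD i .dummy with hX
  rw [merged, List.map_merge (s := Item.before) fun _ _ _ _ => rfl]
  have hmap₁ : (List.range l₁.length).map X = l₁ := by
    conv_rhs => rw [← map_range_getD l₁]
    refine List.map_congr_left fun i hi => ?_
    rw [List.mem_range] at hi
    simp [hX, List.getD, List.getElem?_append_left hi]
  have hmap₂ : (List.range l₂.length).map (fun i => X (l₁.length + i)) = l₂ := by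
    conv_rhs => rw [← map_range_getD l₂]
    refine List.map_congr_left fun i _ => ?_
    simp [hX, List.getD, List.getElem?_append_right]
  have hcls : ∀ r, (cls X l₁.length (l₁ ++ l₂).length false r 0).map X =
      l₁.filter (fun x => x.isReal == r) ∧
      (cls X l₁.length (l₁ ++ l₂).length true r 0).map X =
      l₂.filter (fun x => x.isReal == r) := by
    intro r
    rw [cls, cls, Nat.sub_zero, ← List.range_eq_range', List.length_append, List.range_add,
      List.filter_append, List.filter_append, List.filter_map, List.filter_map]
    constructor
    · conv_rhs => rw [← hmap₁, List.filter_map]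
      rw [List.filter_eq_nil_iff (l := List.range l₂.length) |>.mpr, List.map_nil,
        List.append_nil]
      · congr 1
        refine List.filter_congr fun i hi => ?_
        simp [inClass, List.mem_range.mp hi]
      · simp [inClass]
    · conv_rhs => rw [← hmap₂, List.filter_map]
      rw [List.filter_eq_nil_iff (l := List.range l₁.length) |>.mpr, List.nil_append,
        List.map_map]
      · congr 1
        refine List.filter_congr fun i hi => ?_
        simp [inClass]
      · simp +contextual [inClass]
  simp only [initMerge, List.nil_append, List.map_append, hcls, compact]
  simp

theorem initMerge_length (X : ℕ → Item D B) (n₁ n : ℕ) :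
    ((((initMerge X n₁ n).fetch false).fetch true).merged X).length = n := by
  rw [merged, List.Perm.length_eq (List.merge_perm_append _), fetch_all, fetch_all, fetch_all,
    fetch_all]
  simpa [initMerge] using (initMerge_complete X n₁ n).length_eq

theorem sure_merge {T₁ T₂ : Arr} {l₁ l₂ : List (Item D B)} (h₁ : HoldsList F m T₁ l₁)
    (h₂ : HoldsList F m T₂ l₂) (hn : T₁.len + T₂.len ≤ 2 ^ (D + 1)) :
    (merge F T₁ T₂).Sure m fun R m' => R.Fresh m m' ∧ m.Ext ∅ m' ∧
      HoldsList F m' R (List.merge (compact l₁) (compact l₂) Item.before) := by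
  rw [merge_eq]
  have hT := h₁.append h₂
  have hlen : (T₁.append T₂).len = (l₁ ++ l₂).length := hT.1
  change (T₁.append T₂).len ≤ _ at hn
  generalize T₁.append T₂ = T at *
  set X : ℕ → Item D B := fun i => (l₁ ++ l₂).getD i .dummy with hX
  refine (sure_genPerms _).bind fun P m₁ ⟨hPl, hPf, e₁, q, hP⟩ => ?_
  have hT₁ := hT.2.ext_empty e₁
  refine (sure_linkScan hT₁ hP hPl).bind fun r m₂ ⟨hr, hLl, hLf, e₂, hL⟩ => ?_
  have hP₂ := hP.ext_empty e₂
  refine (sure_permute hn hPl hP₂ (hT₁.ext_empty e₂)).bind fun T' m₃ ⟨hTl', hTf', e₃, hT'⟩ => ?_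
  refine (sure_permute (hLl ▸ hn) (hPl.trans hLl.symm) (hP₂.ext_empty e₃)
    (hL.ext_empty e₃)).bind fun L' m₄ ⟨hLl', hLf', e₄, hL'⟩ => ?_
  have hq : ∀ b, IsPerm T.len (q b) := hPl ▸ hP.perm
  refine (sure_newArr _).bind fun R m₅ ⟨hRl, hRf, e₅⟩ => ?_
  have hT₅ := (hT'.ext (hTl' ▸ hq) e₄ fun _ _ => id).ext (hTl' ▸ hq) e₅ fun _ _ => id
  have hL₅ := hL'.ext (by rw [hLl', hLl]; exact hq) e₅ fun _ _ => id
  set A := ((initMerge X T₁.len T.len).fetch false).fetch true with hA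
  have hm₀ : MatchState X T₁.len T.len q (initMerge X T₁.len T.len)
      (⟨fun s => Cursor.goTo (r.1 s true) (r.1 s false), fun _ => []⟩ : MergeState D B) := by
    refine ⟨fun c => ?_, fun _ => rfl⟩
    rw [hr]
    exact atList_init c
  have hmm : A.merged X = (initMerge X T₁.len T.len).merged X := by
    rw [hA, merged_fetch, merged_fetch]
  have hmap : (A.merged X).map X = List.merge (compact l₁) (compact l₂) Item.before := by
    rw [hmm, ← initMerge_merged, hlen, h₁.1]
  have hml : (A.merged X).length = T.len := initMerge_length X T₁.len T.len
  refine (sure_mergeFetch false hq hn hT₅ hL₅ hTl' (hLl'.trans hLl) hm₀).bind ?_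
  rintro st₁ _ ⟨rfl, hm₁⟩
  refine (sure_mergeFetch true hq hn hT₅ hL₅ hTl' (hLl'.trans hLl) hm₁).bind ?_
  rintro st₂ _ ⟨rfl, hm₂⟩
  refine Sure.bind (Sure.foldlM_range (MergeInv F _ R X T₁.len T.len q A) ⟨.refl _ _, hm₂, by simp⟩
    fun k hk c m h => h.step (good_fetch_fetch _) hml hq hn hT₅ hL₅ hTl' (hLl'.trans hLl) hRl hRf
      (hTf'.mono le_rfl e₄.next) hLf' hk) fun c m₆ h => Sure.pure ⟨?_, ?_, ?_⟩
  · have e := ((e₁.trans_same e₂).trans_same e₃).trans_same e₄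
    exact hRf.mono e.next h.ext.next
  · have e := ((e₁.trans_same e₂).trans_same e₃).trans_same e₄
    exact (e.trans_same e₅).of_fresh e.next hRf h.ext
  · rw [← hmap]
    refine Holds.toList (by simp [hml, hRl]) fun i hi => ?_
    rw [List.length_map] at hi
    refine ⟨(hRf.high i (by omega)).trans_le h.ext.next, ?_⟩
    rw [List.getElem_map]
    exact h.done i (by omega) hi

/-- The permutations are coupled along the orders of fetching, not of output, because fetching is
what exposes places. Both orders are permutations of all indices and are determined by the stored
lists before anything is drawn. -/
theorem rel_merge {T₁ T₂ : Arr} {l₁ l₂ l₁' l₂' : List (Item D B)} (h₁ : HoldsList F m T₁ l₁)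
    (h₂ : HoldsList F m T₂ l₂) (h₁' : HoldsList F m' T₁ l₁') (h₂' : HoldsList F m' T₂ l₂')
    (hn : T₁.len + T₂.len ≤ 2 ^ (D + 1)) (e : Eqv s m m') :
    Rel s (merge F T₁ T₂) m (merge F T₁ T₂) m' fun R m₁ R' m₁' => Eqv s m₁ m₁' ∧ R = R' := by
  rw [merge_eq]
  have hT := h₁.append h₂
  have hT' := h₁'.append h₂'
  change (T₁.append T₂).len ≤ _ at hn
  generalize T₁.append T₂ = T at *
  set X : ℕ → Item D B := fun i => (l₁ ++ l₂).getD i .dummy with hX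
  set X' : ℕ → Item D B := fun i => (l₁' ++ l₂').getD i .dummy with hX'
  -- `v` is the complete order of fetching: after one step for each index nothing is left to output.
  have hA : ∀ X : ℕ → Item D B, ∃ A v, A = ((initMerge X T₁.len T.len).fetch false).fetch true ∧
      v = ((step X)^[T.len] A).vis ∧ v.Perm (List.range T.len) ∧ v.length = T.len := by
    intro X
    refine ⟨_, _, rfl, rfl, ?_⟩
    suffices h : _ from ⟨h, by simpa using h.length_eq⟩
    have hl := initMerge_length X T₁.len T.len
    refine (((initMerge_complete X T₁.len T.len).fetch false).fetch true).iterate _ |>.vis_perm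
      (X := X) ?_
    rw [(iterate_step (good_fetch_fetch _) hl.ge).1]
    exact List.drop_eq_nil_of_le hl.le
  obtain ⟨A, v, hA, hv, hvp, hvl⟩ := hA X
  obtain ⟨A', v', hA', hv', hvp', hvl'⟩ := ‹∀ X : ℕ → Item D B, _› X'
  have hml : (A.merged X).length = T.len := hA ▸ initMerge_length X T₁.len T.len
  have hml' : (A'.merged X').length = T.len := hA' ▸ initMerge_length X' T₁.len T.len
  have hg : ∀ c, A.Good c := hA ▸ good_fetch_fetch _
  have hg' : ∀ c, A'.Good c := hA' ▸ good_fetch_fetch _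
  have hc := initMerge_complete X T₁.len T.len
  have hc' := initMerge_complete X' T₁.len T.len
  have hcA : A.Complete T.len := hA ▸ (hc.fetch false).fetch true
  have hcA' : A'.Complete T.len := hA' ▸ (hc'.fetch false).fetch true
  have hpre : ∀ k ≤ T.len, ((step X)^[k] A).vis <+: v := fun k hk => hv ▸ vis_iterate _ hk
  have hpre' : ∀ k ≤ T.len, ((step X')^[k] A').vis <+: v' := fun k hk => hv' ▸ vis_iterate _ hk
  refine (rel_genPerms_of_order (hvp.nodup_iff.mpr List.nodup_range)
    (hvp'.nodup_iff.mpr List.nodup_range) (fun i hi => List.mem_range.mp (hvp.mem_iff.mp hi))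
    (fun i hi => List.mem_range.mp (hvp'.mem_iff.mp hi)) (hvl.trans hvl'.symm) hn e).bind ?_
  rintro P m₁ _ m₁' ⟨e, rfl, hPl, ⟨-, e₁⟩, ⟨-, e₁'⟩, q, q', hP, hP', hqq⟩
  have hT₁ := hT.2.ext_empty e₁
  have hT₁' := hT'.2.ext_empty e₁'
  refine ((obl_linkScan m₁ m₁' e).and_sure (sure_linkScan hT₁ hP hPl)
    (sure_linkScan hT₁' hP' hPl)).bind ?_
  rintro ⟨r, L⟩ m₂ ⟨r', _⟩ m₂' ⟨⟨e, rfl⟩, ⟨hr, hLl, hLf, e₂, hL⟩, hr', -, hLf', e₂', hL'⟩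
  dsimp only at hr hr' hLl hLf hLf' hL hL' ⊢
  have hT₂ := hT₁.ext_empty e₂
  have hT₂' := hT₁'.ext_empty e₂'
  have hP₂ := hP.ext_empty e₂
  have hP₂' := hP'.ext_empty e₂'
  refine ((rel_permute hn hPl hP₂ hP₂' (fun i hi => (hT₂ i hi).1) e).and_sure
    (sure_permute hn hPl hP₂ hT₂) (sure_permute hn hPl hP₂' hT₂')).bind ?_
  rintro T' m₃ _ m₃' ⟨⟨e, rfl⟩, ⟨hTl, hTf, e₃, hTp⟩, -, hTf', e₃', hTp'⟩
  have hP₃ := hP₂.ext_empty e₃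
  have hP₃' := hP₂'.ext_empty e₃'
  have hL₃ := hL.ext_empty e₃
  have hL₃' := hL'.ext_empty e₃'
  refine ((rel_permute (hLl ▸ hn) (hPl.trans hLl.symm) hP₃ hP₃' (fun i hi => (hL₃ i hi).1)
    e).and_sure (sure_permute (hLl ▸ hn) (hPl.trans hLl.symm) hP₃ hL₃)
    (sure_permute (hLl ▸ hn) (hPl.trans hLl.symm) hP₃' hL₃')).bind ?_
  rintro L' m₄ _ m₄' ⟨⟨e, rfl⟩, ⟨hLl', hLf₄, e₄, hLp⟩, -, hLf₄', e₄', hLp'⟩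
  refine (((Obl.newArr _) m₄ m₄' e).and_sure (sure_newArr _) (sure_newArr _)).bind ?_
  rintro R m₅ _ m₅' ⟨⟨e, rfl⟩, ⟨hRl, hRf, e₅⟩, -, hRf', e₅'⟩
  have hq : ∀ b, IsPerm T.len (q b) := hPl ▸ hP.perm
  have hq' : ∀ b, IsPerm T.len (q' b) := hPl ▸ hP'.perm
  have hTp₅ := (hTp.ext (hTl ▸ hq) e₄ fun _ _ => id).ext (hTl ▸ hq) e₅ fun _ _ => id
  have hTp₅' := (hTp'.ext (hTl ▸ hq') e₄' fun _ _ => id).ext (hTl ▸ hq') e₅' fun _ _ => id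
  have hLp₅ := hLp.ext (by rw [hLl', hLl]; exact hq) e₅ fun _ _ => id
  have hLp₅' := hLp'.ext (by rw [hLl', hLl]; exact hq') e₅' fun _ _ => id
  have hLl₅ := hLl'.trans hLl
  have hm₀ : MatchState X T₁.len T.len q (initMerge X T₁.len T.len)
      (⟨fun s => Cursor.goTo (r s true) (r s false), fun _ => []⟩ : MergeState D B) := by
    refine ⟨fun c => ?_, fun _ => rfl⟩
    rw [hr]
    exact atList_init c
  have hm₀' : MatchState X' T₁.len T.len q' (initMerge X' T₁.len T.len)
      (⟨fun s => Cursor.goTo (r' s true) (r' s false), fun _ => []⟩ : MergeState D B) := by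
    refine ⟨fun c => ?_, fun _ => rfl⟩
    rw [hr']
    exact atList_init c
  have hpA : A.vis <+: v := hpre 0 (Nat.zero_le _)
  have hpA' : A'.vis <+: v' := hpre' 0 (Nat.zero_le _)
  obtain ⟨ho₁, hl₁⟩ := obl_mergeFetch (F := F) (T' := T') (L' := L') (c := false) (c' := false)
    hm₀ hm₀' hc hc' rfl
    (((vis_fetch _ true).trans (hA ▸ List.prefix_rfl)).trans hpA)
    (((vis_fetch _ true).trans (hA' ▸ List.prefix_rfl)).trans hpA') hqq
  refine ((ho₁ m₅ m₅' e).and_sure (sure_mergeFetch false hq hn hTp₅ hLp₅ hTl hLl₅ hm₀)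
    (sure_mergeFetch false hq' hn hTp₅' hLp₅' hTl hLl₅ hm₀')).bind ?_
  rintro st₁ _ st₁' _ ⟨⟨e, -⟩, ⟨rfl, hm₁⟩, rfl, hm₁'⟩
  obtain ⟨ho₂, hl₂⟩ := obl_mergeFetch (F := F) (T' := T') (L' := L') (c := true) (c' := true)
    hm₁ hm₁' (hc.fetch _) (hc'.fetch _) hl₁ (hA ▸ hpA) (hA' ▸ hpA') hqq
  refine ((ho₂ _ _ e).and_sure (sure_mergeFetch true hq hn hTp₅ hLp₅ hTl hLl₅ hm₁)
    (sure_mergeFetch true hq' hn hTp₅' hLp₅' hTl hLl₅ hm₁')).bind ?_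
  rintro st₂ m₅ st₂' m₅' ⟨⟨e, -⟩, ⟨rfl, hm₂⟩, rfl, hm₂'⟩
  rw [← hA] at hm₂ hl₂
  rw [← hA'] at hm₂' hl₂
  refine Rel.bind (Rel.foldlM_range (fun k c m c' m' => Eqv s m m' ∧
    ((step X)^[k] A).vis.length = ((step X')^[k] A').vis.length ∧
    MergeInv F m₅ R X T₁.len T.len q A k c m ∧ MergeInv F m₅' R X' T₁.len T.len q' A' k c' m')
    ⟨e, hl₂, ⟨.refl _ _, hm₂, by simp⟩, ⟨.refl _ _, hm₂', by simp⟩⟩ ?_)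
    fun _ m₆ _ m₆' h => Rel.pure ⟨h.1, rfl⟩
  rintro k hk c n c' n' ⟨e, hvk, h, h'⟩
  obtain ⟨a₁, a₂⟩ := iterate_step (X := X) hg (k := k) (by omega)
  rw [List.drop_eq_getElem_cons (by omega)] at a₁
  obtain ⟨⟨l, hl, hst⟩, -⟩ := step_cons a₂ a₁
  obtain ⟨b₁, b₂⟩ := iterate_step (X := X') hg' (k := k) (by omega)
  rw [List.drop_eq_getElem_cons (by omega)] at b₁
  obtain ⟨⟨l', hl', hst'⟩, -⟩ := step_cons b₂ b₁
  obtain ⟨hr, hm⟩ := h.state.round_eq (F := F) (T' := T') (L' := L') (R := R) (k := k) hl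
  obtain ⟨hr', hm'⟩ := h'.state.round_eq (F := F) (T' := T') (L' := L') (R := R) (k := k) hl'
  have hpk := hpre (k + 1) hk
  have hpk' := hpre' (k + 1) hk
  rw [Function.iterate_succ_apply', hst] at hpk
  rw [Function.iterate_succ_apply', hst'] at hpk'
  obtain ⟨ho, hlk⟩ := obl_mergeFetch (F := F) (T' := T') (L' := L') hm hm'
    (hcA.iterate (X := X) k) (hcA'.iterate (X := X') k) hvk hpk hpk' hqq
  have hob : Obl s (mergeRound F T' L' R c k) (mergeRound F T' L' R c' k) fun _ _ => True := by
    rw [hr, hr']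
    exact Obl.bind (obl_secretWrite _ _ _ _) fun _ _ _ => ho
  refine ((hob n n' e).and_sure
    (h.step hg hml hq hn hTp₅ hLp₅ hTl hLl₅ hRl hRf (hTf.mono le_rfl e₄.next) hLf₄ hk)
    (h'.step hg' hml' hq' hn hTp₅' hLp₅' hTl hLl₅ hRl hRf' (hTf'.mono le_rfl e₄'.next) hLf₄' hk)
    ).mono fun _ _ _ _ h => ⟨h.1.1, ?_, h.2⟩
  rw [Function.iterate_succ_apply', Function.iterate_succ_apply', hst, hst', hlk]

end Merge

open Client

/-! ## One-time memories -/

section OneTime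

variable {D B : ℕ} {F : BlockFormat D B} {s : Fin 3} {m m' m₀ m₁ m₂ : Memory F.width}
  {P T S R L T' L' A U : Arr} {q q' : Fin 3 → ℕ → ℕ} {n : ℕ} {X X' Y : ℕ → Item D B}
  {l l' : List (Item D B)} {o : OTM} {c c' : ℕ}

/-- A loop whose round `i` secretly writes `Y i` to entry `f i` of `A`. -/
theorem sure_fill {is : List ℕ} {f : ℕ → ℕ} {body : ℕ → Client F.width Unit} (hA : A.Inj)
    (hlow : ∀ i < A.len, A.cell i < m.next) (hf : ∀ i ∈ is, f i < A.len)
    (hinj : ∀ i ∈ is, ∀ j ∈ is, f i = f j → i = j)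
    (hbody : ∀ i ∈ is, ∀ m', m.Ext {c | ∃ i ∈ is, A.cell (f i) = c} m' →
      (body i).Sure m' fun _ m'' => m'.Ext {A.cell (f i)} m'' ∧
        Shared F m'' (A.cell (f i)) (Y i)) :
    (is.forM body).Sure m fun _ m' => m.Ext {c | ∃ i ∈ is, A.cell (f i) = c} m' ∧
      ∀ i ∈ is, Shared F m' (A.cell (f i)) (Y i) := by
  refine (Sure.forM (l := is) (fun k m' => m.Ext {c | ∃ i ∈ is, A.cell (f i) = c} m' ∧
    ∀ j (_ : j < k) (hj : j < is.length), Shared F m' (A.cell (f is[j])) (Y is[j]))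
    ⟨.refl _ _, by simp⟩ ?_).mono ?_
  · rintro k hk m₁ ⟨e, h⟩
    have hm := List.getElem_mem hk
    refine (hbody _ hm m₁ e).mono ?_
    rintro _ m₂ ⟨e₂, h₂⟩
    refine ⟨e.trans e₂ (fun _ h _ => h) fun c h _ => ⟨_, hm, (Set.mem_singleton_iff.mp h).symm⟩,
      fun j hj hjl => ?_⟩
    have hmj := List.getElem_mem hjl
    by_cases hjk : f is[j] = f is[k]
    · rw [hinj _ hmj _ hm hjk]
      exact h₂
    · have hjk' : j < k := by
        rcases Nat.lt_succ_iff_lt_or_eq.mp hj with h | rfl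
        · exact h
        · exact absurd rfl hjk
      refine (h j hjk' hjl).ext e₂ ((hlow _ (hf _ hmj)).trans_le e.next) fun h => ?_
      exact hjk (hA _ (hf _ hmj) _ (hf _ hm) h)
  · rintro _ m' ⟨e, h⟩
    refine ⟨e, fun i hi => ?_⟩
    obtain ⟨j, hj, rfl⟩ := List.getElem_of_mem hi
    exact h j hj hj

/-- The entries of a one-time memory for the list `l`. -/
def otmEntry (l : List (Item D B)) (i : ℕ) : Item D B :=
  if i < l.length then l.getD i .dummy else .special (Fin.ofNat _ (i - l.length))

/-- The links of a one-time memory of size `n`. -/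
def otmLink (D B : ℕ) (q : Fin 3 → ℕ → ℕ) (n i : ℕ) : Item D B :=
  if n ≤ i ∧ i + 1 < 2 * n then .link (some (posOf D q (i + 1))) else .link none

/-- The head of the list of the special dummies when `c` of them are used up. -/
def otmHead (D B : ℕ) (q : Fin 3 → ℕ → ℕ) (n c : ℕ) : Item D B :=
  if c < n then .link (some (posOf D q (n + c))) else .link none

variable (F) in
/-- The one-time memory `o` was built from `l` with the permutations `q`, and `c` special dummies
are used up. -/
structure OTMHolds (m : Memory F.width) (o : OTM) (l : List (Item D B)) (q : Fin 3 → ℕ → ℕ)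
    (c : ℕ) : Prop where
  lenP : o.P.len = 2 * l.length
  lenT : o.T.len = 2 * l.length
  lenL : o.L.len = 2 * l.length
  bound : 2 * l.length ≤ 2 ^ (D + 1)
  perm : HoldsPerm F m o.P q
  entries : HoldsPermuted F m o.T q (otmEntry l)
  links : HoldsPermuted F m o.L q (otmLink D B q l.length)
  high : o.dpos.cell 0 < m.next
  head : Shared F m (o.dpos.cell 0) (otmHead D B q l.length c)
  sepP : o.dpos.cell 0 ∉ o.P.cells
  sepT : o.dpos.cell 0 ∉ o.T.cells
  sepL : o.dpos.cell 0 ∉ o.L.cells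

/-- The cells of a one-time memory. -/
def OTM.cells (o : OTM) : Set ℕ := o.P.cells ∪ o.T.cells ∪ o.L.cells ∪ {o.dpos.cell 0}

theorem OTMHolds.isPerm (h : OTMHolds F m o l q c) (b : Fin 3) : IsPerm (2 * l.length) (q b) :=
  h.lenP ▸ h.perm.perm b

theorem OTMHolds.ext {C : Set ℕ} (h : OTMHolds F m o l q c) (e : m.Ext C m')
    (hC : ∀ x ∈ o.cells, x ∉ C) : OTMHolds F m' o l q c where
  lenP := h.lenP
  lenT := h.lenT
  lenL := h.lenL
  bound := h.bound
  perm := h.perm.ext e fun i hi => hC _ (by simp [OTM.cells, Arr.cell_mem hi])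
  entries := h.entries.ext (h.lenT ▸ h.isPerm) e fun i hi =>
    hC _ (by simp [OTM.cells, Arr.cell_mem hi])
  links := h.links.ext (h.lenL ▸ h.isPerm) e fun i hi =>
    hC _ (by simp [OTM.cells, Arr.cell_mem hi])
  high := h.high.trans_le e.next
  head := h.head.ext e h.high (hC _ (by simp [OTM.cells]))
  sepP := h.sepP
  sepT := h.sepT
  sepL := h.sepL

theorem OTMHolds.ext_empty (h : OTMHolds F m o l q c) (e : m.Ext ∅ m') : OTMHolds F m' o l q c :=
  h.ext e fun _ _ => id

theorem OTMHolds.cells_lt (h : OTMHolds F m o l q c) : ∀ x ∈ o.cells, x < m.next := by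
  rintro x (((⟨i, hi, rfl⟩ | ⟨i, hi, rfl⟩) | ⟨i, hi, rfl⟩) | rfl)
  exacts [h.perm.high i hi, h.entries.high i hi, h.links.high i hi, h.high]

/-! ### Lookup -/

/-- The request `r` visits entry `v`: a real request an entry of the list, a dummy request the
next special dummy. -/
def Visits (D : ℕ) (q : Fin 3 → ℕ → ℕ) (n c : ℕ) (r : Option (Pos D)) (v : ℕ) : Prop :=
  (r = some (posOf D q v) ∧ v < n) ∨ (r = none ∧ v = n + c ∧ c < n)

/-- The number of special dummies used up after a request. -/
def usedAfter (c : ℕ) (r : Option (Pos D)) : ℕ := if r.isSome then c else c + 1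

theorem Visits.lt {r : Option (Pos D)} {v : ℕ} (h : Visits D q n c r v) : v < 2 * n := by
  rcases h with ⟨-, h⟩ | ⟨-, h, h'⟩ <;> omega

theorem Visits.pos_eq {r : Option (Pos D)} {v : ℕ} (h : Visits D q n c r v) :
    r.getD (((otmHead D B q n c).asLink).getD 0) = posOf D q v := by
  rcases h with ⟨rfl, h⟩ | ⟨rfl, rfl, h'⟩
  · rfl
  · simp [otmHead, h', Item.asLink]

theorem lookup_eq (o : OTM) (r : Option (Pos D)) : o.lookup F r = (do
    let h ← reconstructAt F o.dpos 0
    let x ← fetchEntry F o.T o.L (r.getD (h.asLink.getD 0))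
    secretWrite F o.dpos 0 (.link (if r.isSome then h.asLink else x.2))
    pure x.1) := by
  cases r <;> rfl

/-- A real request leaves the head as it is; a dummy request reads the special dummy with number `c`
and stores its link, which is the head for `c + 1`. -/
theorem sure_lookup {r : Option (Pos D)} {v : ℕ} (h : OTMHolds F m o l q c)
    (hv : Visits D q l.length c r v) : (o.lookup F r).Sure m fun x m' =>
      m.Ext {o.dpos.cell 0} m' ∧ OTMHolds F m' o l q (usedAfter c r) ∧
        (r.isSome → x = l.getD v .dummy) := by
  rw [lookup_eq]
  refine Sure.bind (Q := fun x m' => m' = m ∧ x = otmHead D B q l.length c)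
    ⟨rfl, h.head.decode⟩ ?_
  rintro _ _ ⟨rfl, rfl⟩
  rw [hv.pos_eq]
  refine (sure_fetchEntry h.isPerm h.bound h.entries h.links h.lenT h.lenL hv.lt).bind ?_
  rintro _ _ ⟨rfl, rfl⟩
  refine (sure_secretWrite _ _ _).bind fun _ m₁ ⟨e, h₁⟩ => Sure.pure ⟨e, ?_, ?_⟩
  · have hP : ∀ i < o.P.len, o.P.cell i ∉ ({o.dpos.cell 0} : Set ℕ) := fun i hi h' =>
      h.sepP (h' ▸ Arr.cell_mem hi)
    have hT : ∀ i < o.T.len, o.T.cell i ∉ ({o.dpos.cell 0} : Set ℕ) := fun i hi h' =>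
      h.sepT (h' ▸ Arr.cell_mem hi)
    have hL : ∀ i < o.L.len, o.L.cell i ∉ ({o.dpos.cell 0} : Set ℕ) := fun i hi h' =>
      h.sepL (h' ▸ Arr.cell_mem hi)
    refine ⟨h.lenP, h.lenT, h.lenL, h.bound, h.perm.ext e hP,
      h.entries.ext (h.lenT ▸ h.isPerm) e hT, h.links.ext (h.lenL ▸ h.isPerm) e hL,
      h.high.trans_le e.next, ?_, h.sepP, h.sepT, h.sepL⟩
    convert h₁ using 1
    rcases hv with ⟨rfl, hv⟩ | ⟨rfl, rfl, hc⟩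
    · simp only [usedAfter, Option.isSome_some, if_true, otmHead]
      split_ifs <;> rfl
    · simp only [usedAfter, Option.isSome_none, otmHead, otmLink]
      by_cases h' : c + 1 < l.length
      · simp [h', Item.asLink, show l.length + (c + 1) < 2 * l.length by omega, add_assoc]
      -- The last special dummy carries the link `none`, which is the head of the exhausted list.
      · simp [h', Item.asLink, show ¬ l.length + c + 1 < 2 * l.length by omega]
  · rcases hv with ⟨rfl, hv⟩ | ⟨rfl, -⟩
    · simp [otmEntry, hv]
    · simp

/-- Real and dummy requests perform the same accesses, and server `s` learns only the place of share
`s`. So the kinds of the two requests and the entries `v`, `v'` may differ as long as these places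
coincide. -/
theorem rel_lookup {r r' : Option (Pos D)} {v v' : ℕ} (h : OTMHolds F m o l q c)
    (h' : OTMHolds F m' o l' q' c') (hv : Visits D q l.length c r v)
    (hv' : Visits D q' l'.length c' r' v') (hqq : q s v = q' s v') (e : Eqv s m m') :
    Rel s (o.lookup F r) m (o.lookup F r') m' fun _ m₁ _ m₁' => Eqv s m₁ m₁' := by
  rw [lookup_eq, lookup_eq]
  have h₁ : (reconstructAt F o.dpos 0).Sure m fun x m' => m' = m ∧ x = otmHead D B q l.length c :=
    ⟨rfl, h.head.decode⟩
  have h₁' : (reconstructAt F o.dpos 0).Sure m' fun x m₁ => m₁ = m' ∧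
    x = otmHead D B q' l'.length c' := ⟨rfl, h'.head.decode⟩
  refine ((obl_reconstructAt _ _ m m' e).and_sure h₁ h₁').bind ?_
  rintro _ _ _ _ ⟨⟨e, -⟩, ⟨rfl, rfl⟩, rfl, rfl⟩
  rw [hv.pos_eq, hv'.pos_eq]
  refine (obl_fetchEntry (by simp only [posOf, hqq]) _ _ e).bind ?_
  rintro _ _ _ _ ⟨e, -⟩
  refine (obl_secretWrite _ _ _ _ _ _ e).bind ?_
  rintro _ _ _ _ ⟨e, -⟩
  exact Rel.pure e

/-! ### Getall -/

theorem sure_getall (h : OTMHolds F m o l q c) : (o.getall F).Sure m fun R m' =>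
    R.Fresh m m' ∧ m.Ext ∅ m' ∧ HoldsList F m' R l := by
  refine (sure_unpermute (h.lenT ▸ h.bound) (h.lenP.trans h.lenT.symm) h.perm h.entries).bind ?_
  rintro R m₁ ⟨hl, hf, e₁, hR⟩
  have h₁ := h.ext_empty e₁
  refine (sure_unpermute (h.lenL ▸ h.bound) (h.lenP.trans h.lenL.symm) h₁.perm h₁.links).bind ?_
  rintro R' m₂ ⟨-, -, e₂, -⟩
  have hl' : R.len / 2 = l.length := by rw [hl, h.lenT]; omega
  refine Sure.pure ⟨(hf.mono le_rfl e₂.next).take _, e₁.trans_same e₂, ?_,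
    ((hR.ext_empty e₂).take _).congr fun i hi => ?_⟩
  · simp only [Arr.take]
    omega
  · have : i < l.length := hl' ▸ hi.trans_le (min_le_left _ _)
    simp [otmEntry, this]

theorem obl_getall (o : OTM) : Obl s (o.getall F) (o.getall F) Eq := by
  refine Obl.bind obl_unpermute ?_
  rintro R _ rfl
  exact Obl.bind obl_unpermute fun _ _ _ => Obl.pure rfl

/-! ### Build -/

/-- The key-position map. -/
def placeEntry (q : Fin 3 → ℕ → ℕ) (i : ℕ) (x : Item D B) : Item D B :=
  match x.key? with
  | some k => .place k (posOf D q i)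
  | none => .dummy

/-- The key-position map of a one-time memory for `l`. -/
def placeList (q : Fin 3 → ℕ → ℕ) (l : List (Item D B)) : List (Item D B) :=
  l.mapIdx (placeEntry q)

/-- `Build` up to the drawing of the permutations. -/
def buildEntries (F : BlockFormat D B) (T : Arr) : Client F.width Arr := do
  let T' ← newArr (2 * T.len)
  (List.range T.len).forM fun i => do
    let x ← reconstructAt F T i
    secretWrite F T' i x
  (List.range T.len).forM fun i => secretWrite F T' (T.len + i) (.special (Fin.ofNat _ i))
  pure T'

/-- The list of the special dummies. -/
def buildLinks (F : BlockFormat D B) (P : Arr) (n : ℕ) : Client F.width Arr := do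
  let L ← newArr (2 * n)
  secretWrite F L (2 * n - 1) (.link none)
  (List.range (n - 1)).reverse.forM fun i => do
    let p ← readPos F P (n + i + 1)
    secretWrite F L (n + i) (.link (some p))
  (List.range n).forM fun i => secretWrite F L i (.link none)
  pure L

def buildHead (F : BlockFormat D B) (P : Arr) (n : ℕ) : Client F.width Arr := do
  let dpos ← newArr 1
  let p ← readPos F P n
  secretWrite F dpos 0 (.link (some p))
  pure dpos

def buildPlaces (F : BlockFormat D B) (T' P : Arr) (n : ℕ) : Client F.width Arr := do
  let U ← newArr n
  (List.range n).forM fun i => do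
    let x ← reconstructAt F T' i
    let p ← readPos F P i
    secretWrite F U i (match x.key? with
      | some k => .place k p
      | none => .dummy)
  pure U

theorem build_eq (T : Arr) : build F T = (do
    let T' ← buildEntries F T
    let P ← genPerms F (2 * T.len)
    let L ← buildLinks F P T.len
    let dpos ← buildHead F P T.len
    let U ← buildPlaces F T' P T.len
    let T'' ← permute F P T'
    let L'' ← permute F P L
    pure (⟨P, T'', L'', dpos⟩, U)) := by
  simp only [build, buildEntries, buildLinks, buildHead, buildPlaces, bind_assoc, pure_bind]

theorem sure_buildEntries (hT : HoldsList F m T l) : (buildEntries F T).Sure m fun T' m' =>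
    T'.len = 2 * T.len ∧ T'.Fresh m m' ∧ m.Ext ∅ m' ∧ Holds F m' T' (otmEntry l) := by
  refine (sure_newArr _).bind fun T' m₁ ⟨hl, hf, e₁⟩ => ?_
  refine (sure_fill (A := T') (f := id) (Y := fun i => l.getD i .dummy) hf.inj hf.high
    (by simp [hl]; omega) (by simp) fun i hi m₂ e => ?_).bind fun _ m₂ ⟨e₂, h₂⟩ => ?_
  · have := List.mem_range.mp hi
    refine (sure_reconstructAt (hT.2.ext_empty (e₁.trans e (by simp) ?_)) this).bind ?_
    · rintro c ⟨j, hj, rfl⟩ h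
      have := hf.low j (by rw [hl]; have := List.mem_range.mp hj; omega)
      simp at h
      omega
    · rintro _ _ ⟨rfl, rfl⟩
      exact sure_secretWrite _ _ _
  · refine (sure_fill (A := T') (f := fun i => T.len + i) (Y := fun i => .special (Fin.ofNat _ i))
      hf.inj (fun i hi => (hf.high i hi).trans_le e₂.next) (by simp [hl]; omega) (by simp)
      fun i hi m₃ e => sure_secretWrite _ _ _).bind fun _ m₃ ⟨e₃, h₃⟩ => Sure.pure ?_
    have e : ∀ m n : Memory F.width, ∀ f : ℕ → ℕ, (∀ i < T.len, f i < 2 * T.len) →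
        m.Ext {c | ∃ i ∈ List.range T.len, T'.cell (f i) = c} n → m.Ext T'.cells n := by
      intro m n f hf e
      refine e.mono ?_
      rintro c ⟨i, hi, rfl⟩ -
      exact Arr.cell_mem (hl ▸ hf i (List.mem_range.mp hi))
    have e₂' := e _ _ id (by simp; omega) e₂
    have e₃' := e _ _ _ (by omega) e₃
    refine ⟨hl, hf.mono le_rfl (e₂.next.trans e₃.next),
      e₁.of_fresh le_rfl hf (e₂'.trans_same e₃'), fun i hi => ?_⟩
    refine ⟨(hf.high i hi).trans_le (e₂.next.trans e₃.next), ?_⟩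
    rw [otmEntry, ← hT.1]
    split_ifs with h
    · refine (h₂ i (List.mem_range.mpr h)).ext e₃ ((hf.high i hi).trans_le e₂.next) ?_
      rintro ⟨j, hj, h'⟩
      have := hf.inj _ (by have := List.mem_range.mp hj; omega) _ hi h'
      omega
    · have := h₃ (i - T.len) (List.mem_range.mpr (by omega))
      rwa [Nat.add_sub_cancel' (not_lt.mp h)] at this

theorem sure_buildLinks (hP : HoldsPerm F m P q) (hPl : P.len = 2 * n) (hn : 1 ≤ n) :
    (buildLinks F P n).Sure m fun L m' =>
      L.len = 2 * n ∧ L.Fresh m m' ∧ m.Ext ∅ m' ∧ Holds F m' L (otmLink D B q n) := by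
  refine (sure_newArr _).bind fun L m₁ ⟨hl, hf, e₁⟩ => ?_
  refine (sure_secretWrite _ _ _).bind fun _ m₂ ⟨e₂, h₂⟩ => ?_
  have e₂' : m₁.Ext L.cells m₂ := e₂.mono fun c hc _ => by
    rw [Set.mem_singleton_iff.mp hc]
    exact Arr.cell_mem (by omega)
  refine (sure_fill (A := L) (f := fun i => n + i)
    (Y := fun i => .link (some (posOf D q (n + i + 1)))) hf.inj
    (fun i hi => (hf.high i hi).trans_le e₂.next) (by simp [hl]; omega) (by simp)
    fun i hi m₃ e => ?_).bind fun _ m₃ ⟨e₃, h₃⟩ => ?_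
  · have hi' : i < n - 1 := by simpa using hi
    refine (sure_readPos (hP.ext_empty ((e₁.of_fresh le_rfl hf e₂').trans e (by simp) ?_))
      (by omega)).bind ?_
    · rintro c ⟨j, hj, rfl⟩ h
      have := hf.low (n + j) (by rw [hl]; simp at hj; omega)
      omega
    · rintro _ _ ⟨rfl, rfl⟩
      exact sure_secretWrite _ _ _
  · have e₃' : m₂.Ext L.cells m₃ := e₃.mono fun c hc _ => by
      obtain ⟨j, hj, rfl⟩ := hc
      exact Arr.cell_mem (by rw [hl]; simp at hj; omega)
    refine (sure_fill (A := L) (f := id) (Y := fun i => .link none) hf.inj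
      (fun i hi => (hf.high i hi).trans_le (e₂.next.trans e₃.next)) (by simp [hl]; omega)
      (by simp) fun i hi m₄ e => sure_secretWrite _ _ _).bind fun _ m₄ ⟨e₄, h₄⟩ => Sure.pure ?_
    have e₄' : m₃.Ext L.cells m₄ := e₄.mono fun c hc _ => by
      obtain ⟨j, hj, rfl⟩ := hc
      exact Arr.cell_mem (by rw [hl]; simp at hj; simp; omega)
    have hnext := (e₂.next.trans e₃.next).trans e₄.next
    refine ⟨hl, hf.mono le_rfl hnext,
      e₁.of_fresh le_rfl hf ((e₂'.trans_same e₃').trans_same e₄'),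
      fun i hi => ⟨(hf.high i hi).trans_le hnext, ?_⟩⟩
    rw [otmLink]
    by_cases h : i < n
    · rw [if_neg (by omega)]
      exact h₄ i (List.mem_range.mpr h)
    · have h4 : L.cell i ∉ {c | ∃ i ∈ List.range n, L.cell (id i) = c} := by
        rintro ⟨j, hj, h'⟩
        have hj' := List.mem_range.mp hj
        have := hf.inj j (by omega) _ hi h'
        omega
      by_cases h' : i + 1 < 2 * n
      · rw [if_pos (by omega)]
        have := h₃ (i - n) (by simp; omega)
        rw [show n + (i - n) = i by omega] at this
        exact this.ext e₄ ((hf.high i hi).trans_le (e₂.next.trans e₃.next)) h4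
      · rw [if_neg (by omega)]
        have : i = 2 * n - 1 := by omega
        subst this
        refine (h₂.ext e₃ ((hf.high _ hi).trans_le e₂.next) ?_).ext e₄
          ((hf.high _ hi).trans_le (e₂.next.trans e₃.next)) h4
        rintro ⟨j, hj, h'⟩
        simp at hj
        have := hf.inj _ (by omega) _ hi h'
        omega

theorem sure_buildHead (hP : HoldsPerm F m P q) (hn : n < P.len) (hn' : 1 ≤ n) :
    (buildHead F P n).Sure m fun A m' => A.len = 1 ∧ A.Fresh m m' ∧ m.Ext ∅ m' ∧
      Shared F m' (A.cell 0) (otmHead D B q n 0) := by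
  refine (sure_newArr _).bind fun A m₁ ⟨hl, hf, e₁⟩ => ?_
  refine (sure_readPos (hP.ext_empty e₁) hn).bind ?_
  rintro _ _ ⟨rfl, rfl⟩
  refine (sure_secretWrite _ _ _).bind fun _ m₂ ⟨e₂, h₂⟩ => Sure.pure ?_
  refine ⟨hl, hf.mono le_rfl e₂.next, e₁.of_fresh le_rfl hf (e₂.mono fun c hc _ => ?_), ?_⟩
  · rw [Set.mem_singleton_iff.mp hc]
    exact Arr.cell_mem (by omega)
  · rwa [otmHead, if_pos (by omega)]

theorem sure_buildPlaces (hT : Holds F m T' (otmEntry l)) (hP : HoldsPerm F m P q)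
    (hTl : T'.len = 2 * l.length) (hPl : P.len = 2 * l.length) :
    (buildPlaces F T' P l.length).Sure m fun U m' => U.Fresh m m' ∧ m.Ext ∅ m' ∧
      HoldsList F m' U (placeList q l) := by
  refine (sure_newArr _).bind fun U m₁ ⟨hl, hf, e₁⟩ => ?_
  refine (sure_fill (A := U) (f := id) (Y := fun i => placeEntry q i (l.getD i .dummy)) hf.inj
    hf.high (by simp [hl]) (by simp) fun i hi m₂ e => ?_).bind fun _ m₂ ⟨e₂, h₂⟩ => Sure.pure ?_
  · have hi' := List.mem_range.mp hi
    have e' : m.Ext ∅ m₂ := by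
      refine e₁.trans e (by simp) ?_
      rintro c ⟨j, hj, rfl⟩ h
      have := hf.low j (by rw [hl]; exact List.mem_range.mp hj)
      simp at h
      omega
    refine (sure_reconstructAt (hT.ext_empty e') (by omega)).bind ?_
    rintro _ _ ⟨rfl, rfl⟩
    refine (sure_readPos (hP.ext_empty e') (by omega)).bind ?_
    rintro _ _ ⟨rfl, rfl⟩
    rw [otmEntry, if_pos hi']
    exact sure_secretWrite _ _ _
  · have e₂' : m₁.Ext U.cells m₂ := e₂.mono fun c hc _ => by
      obtain ⟨j, hj, rfl⟩ := hc
      exact Arr.cell_mem (by rw [hl]; exact List.mem_range.mp hj)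
    refine ⟨hf.mono le_rfl e₂.next, e₁.of_fresh le_rfl hf e₂', ?_⟩
    refine Holds.toList (by simp [placeList, hl]) fun i hi => ?_
    have hi' : i < l.length := by simpa [placeList] using hi
    refine ⟨(hf.high i (by omega)).trans_le e₂.next, ?_⟩
    have := h₂ i (List.mem_range.mpr hi')
    simpa [placeList, List.getElem?_eq_getElem hi'] using this

theorem obl_buildEntries : Obl s (buildEntries F T) (buildEntries F T) Eq := by
  refine Obl.bind (Obl.newArr _) ?_
  rintro T' _ rfl
  refine Obl.bind (Obl.forM fun i _ => Obl.bind (obl_reconstructAt _ _) fun _ _ _ =>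
    obl_secretWrite _ _ _ _) fun _ _ _ => ?_
  exact Obl.bind (Obl.forM fun i _ => obl_secretWrite _ _ _ _) fun _ _ _ => Obl.pure rfl

theorem obl_buildLinks : Obl s (buildLinks F P n) (buildLinks F P n) Eq := by
  refine Obl.bind (Obl.newArr _) ?_
  rintro L _ rfl
  refine Obl.bind (obl_secretWrite _ _ _ _) fun _ _ _ => ?_
  refine Obl.bind (Obl.forM fun i _ => Obl.bind (obl_readPos _ _) fun _ _ _ =>
    obl_secretWrite _ _ _ _) fun _ _ _ => ?_
  exact Obl.bind (Obl.forM fun i _ => obl_secretWrite _ _ _ _) fun _ _ _ => Obl.pure rfl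

theorem obl_buildHead : Obl s (buildHead F P n) (buildHead F P n) Eq := by
  refine Obl.bind (Obl.newArr _) ?_
  rintro A _ rfl
  exact Obl.bind (obl_readPos _ _) fun _ _ _ => Obl.bind (obl_secretWrite _ _ _ _)
    fun _ _ _ => Obl.pure rfl

theorem obl_buildPlaces : Obl s (buildPlaces F T P n) (buildPlaces F T P n) Eq := by
  refine Obl.bind (Obl.newArr _) ?_
  rintro A _ rfl
  exact Obl.bind (Obl.forM fun i _ => Obl.bind (obl_reconstructAt _ _) fun _ _ _ =>
    Obl.bind (obl_readPos _ _) fun _ _ _ => obl_secretWrite _ _ _ _) fun _ _ _ => Obl.pure rfl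

/-- The permutations are random, so they appear existentially. The bound from below says that all
cells are new, which later separates the memory from the older ones. -/
theorem sure_build (hT : HoldsList F m T l) (hl : 1 ≤ l.length)
    (hn : 2 * l.length ≤ 2 ^ (D + 1)) : (build F T).Sure m fun r m' =>
      m.Ext ∅ m' ∧ (∀ x ∈ r.1.cells, m.next ≤ x) ∧
      ∃ q, OTMHolds F m' r.1 l q 0 ∧ HoldsList F m' r.2 (placeList q l) := by
  rw [build_eq]
  refine (sure_buildEntries hT).bind fun T' m₁ ⟨hTl, hTf, e₁, hT'⟩ => ?_
  refine (sure_genPerms _).bind fun P m₂ ⟨hPl, hPf, e₂, q, hP⟩ => ?_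
  rw [hT.1] at hTl hPl ⊢
  have hPn : P.len ≤ 2 ^ (D + 1) := hPl ▸ hn
  refine (sure_buildLinks hP hPl hl).bind fun L m₃ ⟨hLl, hLf, e₃, hL⟩ => ?_
  have hP₃ := hP.ext_empty e₃
  refine (sure_buildHead hP₃ (by omega) hl).bind fun A m₄ ⟨hAl, hAf, e₄, hA⟩ => ?_
  have hP₄ := hP₃.ext_empty e₄
  have hT₄ := ((hT'.ext_empty e₂).ext_empty e₃).ext_empty e₄
  refine (sure_buildPlaces hT₄ hP₄ hTl hPl).bind fun U m₅ ⟨hUf, e₅, hU⟩ => ?_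
  have hP₅ := hP₄.ext_empty e₅
  have hT₅ := hT₄.ext_empty e₅
  refine (sure_permute (hTl ▸ hn) (hPl.trans hTl.symm) hP₅ hT₅).bind ?_
  rintro T'' m₆ ⟨hTl'', hTf'', e₆, hT''⟩
  have hP₆ := hP₅.ext_empty e₆
  have hL₆ := ((hL.ext_empty e₄).ext_empty e₅).ext_empty e₆
  refine (sure_permute (hLl ▸ hn) (hPl.trans hLl.symm) hP₆ hL₆).bind ?_
  rintro L'' m₇ ⟨hLl'', hLf'', e₇, hL''⟩
  have e₂₄ := (e₂.trans_same e₃).trans_same e₄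
  have e₅₇ := (e₅.trans_same e₆).trans_same e₇
  have hAlow := hAf.low 0 (by omega)
  have hAhigh := hAf.high 0 (by omega)
  have hq : ∀ b, IsPerm (2 * l.length) (q b) := hPl ▸ hP.perm
  refine Sure.pure ⟨(e₁.trans_same e₂₄).trans_same e₅₇, ?_, q, ⟨hPl, hTl''.trans hTl,
    hLl''.trans hLl, hn, hP₆.ext_empty e₇, hT''.ext ?_ e₇ fun _ _ => id, hL'',
    hAhigh.trans_le e₅₇.next, hA.ext e₅₇ hAhigh id, ?_, ?_, ?_⟩,
    (hU.ext_empty e₆).ext_empty e₇⟩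
  · have h₁ := e₁.next
    have h₂ := e₂.next
    have h₃ := e₃.next
    have h₄ := e₄.next
    have h₅ := e₅.next
    have h₆ := e₆.next
    rintro x (((⟨i, hi, rfl⟩ | ⟨i, hi, rfl⟩) | ⟨i, hi, rfl⟩) | rfl)
    · have := hPf.low i hi
      change m.next ≤ P.cell i
      omega
    · have := hTf''.low i hi
      change m.next ≤ T''.cell i
      omega
    · have := hLf''.low i hi
      change m.next ≤ L''.cell i
      omega
    · change m.next ≤ A.cell 0
      omega
  · rw [hTl'', hTl]
    exact hq
  · rintro ⟨i, hi, h⟩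
    have h₁ := hPf.high i hi
    have h₂ := e₃.next
    change P.cell i = A.cell 0 at h
    omega
  · exact hTf''.not_mem (hAhigh.trans_le e₅.next)
  · exact hLf''.not_mem (hAhigh.trans_le (e₅.trans_same e₆).next)

/-- The permutations of both runs can be coupled so that the entries `v` of the one and the
entries `v'` of the other have the same places. -/
theorem rel_build {v v' : List ℕ} (hT : HoldsList F m T l) (hT' : HoldsList F m' T l')
    (hl : 1 ≤ l.length) (hn : 2 * l.length ≤ 2 ^ (D + 1)) (hv : v.Nodup) (hv' : v'.Nodup)
    (hvn : ∀ i ∈ v, i < 2 * l.length) (hvn' : ∀ i ∈ v', i < 2 * l.length)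
    (hlen : v.length = v'.length) (e : Eqv s m m') :
    Rel s (build F T) m (build F T) m' fun r m₁ r' m₁' => Eqv s m₁ m₁' ∧ r = r' ∧
      ∀ k (h : k < v.length) (h' : k < v'.length),
        m₁.block (s - 1) ⟨s, r.1.P.cell v[k]⟩ = m₁'.block (s - 1) ⟨s, r.1.P.cell v'[k]⟩ := by
  rw [build_eq]
  refine ((obl_buildEntries m m' e).and_sure (sure_buildEntries hT) (sure_buildEntries hT')).bind
    ?_
  rintro T' m₁ _ m₁' ⟨⟨e, rfl⟩, ⟨hTl, hTf, e₁, hT₁⟩, -, hTf', e₁', hT₁'⟩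
  rw [hT.1] at hTl ⊢
  -- What follows this draw works for arbitrary permutations and never overwrites `P`, so the
  -- pairing of `v` with `v'` lasts to the end.
  refine (rel_genPerms_of_order hv hv' hvn hvn' hlen hn e).bind ?_
  rintro P m₂ _ m₂' ⟨e, rfl, hPl, ⟨hPf, e₂⟩, ⟨hPf', e₂'⟩, q, q', hP, hP', hqq⟩
  have hPn : P.len ≤ 2 ^ (D + 1) := hPl ▸ hn
  refine ((obl_buildLinks m₂ m₂' e).and_sure (sure_buildLinks hP hPl hl)
    (sure_buildLinks hP' hPl hl)).bind ?_
  rintro L m₃ _ m₃' ⟨⟨e, rfl⟩, ⟨hLl, hLf, e₃, hL⟩, -, hLf', e₃', hL'⟩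
  have hP₃ := hP.ext_empty e₃
  have hP₃' := hP'.ext_empty e₃'
  refine ((obl_buildHead m₃ m₃' e).and_sure (sure_buildHead hP₃ (by omega) hl)
    (sure_buildHead hP₃' (by omega) hl)).bind ?_
  rintro A m₄ _ m₄' ⟨⟨e, rfl⟩, ⟨-, -, e₄, -⟩, -, -, e₄', -⟩
  have hP₄ := hP₃.ext_empty e₄
  have hP₄' := hP₃'.ext_empty e₄'
  have hT₄ := ((hT₁.ext_empty e₂).ext_empty e₃).ext_empty e₄
  have hT₄' := ((hT₁'.ext_empty e₂').ext_empty e₃').ext_empty e₄'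
  have hll : l.length = l'.length := hT.1.symm.trans hT'.1
  refine ((obl_buildPlaces m₄ m₄' e).and_sure (sure_buildPlaces hT₄ hP₄ hTl hPl)
    (hll ▸ sure_buildPlaces hT₄' hP₄' (hll ▸ hTl) (hll ▸ hPl))).bind ?_
  rintro U m₅ _ m₅' ⟨⟨e, rfl⟩, ⟨-, e₅, -⟩, -, e₅', -⟩
  have hP₅ := hP₄.ext_empty e₅
  have hP₅' := hP₄'.ext_empty e₅'
  have hT₅ := hT₄.ext_empty e₅
  have hT₅' := hT₄'.ext_empty e₅'
  refine ((rel_permute (hTl ▸ hn) (hPl.trans hTl.symm) hP₅ hP₅' (fun i hi => (hT₅ i hi).1)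
    e).and_sure (sure_permute (hTl ▸ hn) (hPl.trans hTl.symm) hP₅ hT₅)
    (sure_permute (hTl ▸ hn) (hPl.trans hTl.symm) hP₅' hT₅')).bind ?_
  rintro T'' m₆ _ m₆' ⟨⟨e, rfl⟩, ⟨-, -, e₆, -⟩, -, -, e₆', -⟩
  have hP₆ := hP₅.ext_empty e₆
  have hP₆' := hP₅'.ext_empty e₆'
  have hL₆ := ((hL.ext_empty e₄).ext_empty e₅).ext_empty e₆
  have hL₆' := ((hL'.ext_empty e₄').ext_empty e₅').ext_empty e₆'
  refine ((rel_permute (hLl ▸ hn) (hPl.trans hLl.symm) hP₆ hP₆' (fun i hi => (hL₆ i hi).1)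
    e).and_sure (sure_permute (hLl ▸ hn) (hPl.trans hLl.symm) hP₆ hL₆)
    (sure_permute (hLl ▸ hn) (hPl.trans hLl.symm) hP₆' hL₆')).bind ?_
  rintro L'' m₇ _ m₇' ⟨⟨e, rfl⟩, ⟨-, -, e₇, -⟩, -, -, e₇', -⟩
  refine Rel.pure ⟨e, rfl, fun k h h' => ?_⟩
  have hP₇ := hP₆.ext_empty e₇
  have hP₇' := hP₆'.ext_empty e₇'
  rw [hP₇.block _ (hPl ▸ hvn _ (List.getElem_mem h)), hqq k h h',
    hP₇'.block _ (hPl ▸ hvn' _ (List.getElem_mem h'))]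

end OneTime

open Client

/-! ## Scans and shuffles -/

section Scans

variable {D B : ℕ} {F : BlockFormat D B} {s : Fin 3} {m m' : Memory F.width}
  {T A U : Arr} {l l' : List (Item D B)}

theorem HoldsList.set {i : ℕ} {x : Item D B} (h : HoldsList F m T l) (hT : T.Inj) (hi : i < T.len)
    (e : m.Ext {T.cell i} m') (hx : Shared F m' (T.cell i) x) : HoldsList F m' T (l.set i x) := by
  refine ⟨by simpa using h.1, fun j hj => ⟨(h.2 j hj).1.trans_le e.next, ?_⟩⟩
  have hj' : j < l.length := h.1 ▸ hj
  by_cases hij : i = j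
  · subst hij
    simpa [List.getD, hj'] using hx
  · have := (h.2 j hj).2.ext e (h.2 j hj).1 fun h' => hij (hT _ hj _ hi h').symm
    simpa [List.getD, List.getElem?_set, hij] using this

/-- In a sorted list turn all but the first entry of each address into dummies. -/
def markDup : Option (Fin (2 ^ D)) → List (Item D B) → List (Item D B)
  | _, [] => []
  | last, x :: l => (if x.isReal && x.key? == last then .dummy else x) :: markDup x.key? l

theorem length_markDup (last : Option (Fin (2 ^ D))) (l : List (Item D B)) :
    (markDup last l).length = l.length := by
  induction l generalizing last with
  | nil => rfl
  | cons x l ih => simp [markDup, ih]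

theorem sure_markDuplicates (hT : HoldsList F m T l) (hi : T.Inj) :
    (markDuplicates F T).Sure m fun _ m' => m.Ext T.cells m' ∧
      HoldsList F m' T (markDup none l) := by
  -- Invariant: a finished prefix and an untouched rest, on which the list recursion is still to be
  -- run.
  refine Sure.bind (Sure.foldlM_range (fun k last m' => m.Ext T.cells m' ∧ ∃ pre rest,
    pre.length = k ∧ pre ++ markDup last rest = markDup none l ∧ HoldsList F m' T (pre ++ rest))
    ⟨.refl _ _, [], l, rfl, rfl, hT⟩ ?_) ?_
  · rintro k hk last m₁ ⟨e, pre, rest, rfl, hp, h⟩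
    have hr : pre.length < (pre ++ rest).length := h.1 ▸ hk
    rcases rest with _ | ⟨x, rest⟩
    · simp at hr
    refine (sure_reconstructAt h.2 hk).bind ?_
    rintro _ _ ⟨rfl, rfl⟩
    have hx : (pre ++ x :: rest).getD pre.length .dummy = x := by simp
    rw [hx]
    refine (sure_secretWrite _ _ _).bind fun _ m₂ ⟨e₂, h₂⟩ => Sure.pure ⟨?_, ?_⟩
    · exact e.trans_same (e₂.mono fun c hc _ => by
        rw [Set.mem_singleton_iff.mp hc]
        exact Arr.cell_mem hk)
    · refine ⟨pre ++ [if x.isReal && x.key? == last then .dummy else x], rest, by simp, ?_, ?_⟩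
      rotate_left
      · have := h.set hi hk e₂ h₂
        rw [List.set_append_right _ _ le_rfl, Nat.sub_self] at this
        rw [List.append_assoc]
        exact this
      · rw [← hp, List.append_assoc]
        rfl
  · rintro last m' ⟨e, pre, rest, hk, hp, h⟩
    have := h.1
    rw [List.length_append, hk] at this
    obtain rfl : rest = [] := List.length_eq_zero_iff.mp (by omega)
    refine Sure.pure ⟨e, ?_⟩
    rw [← hp]
    exact h

theorem obl_markDuplicates : Obl s (markDuplicates F T) (markDuplicates F T) fun _ _ => True := by
  refine Obl.bind (Obl.foldlM (fun _ _ => True) trivial fun i _ _ _ _ => ?_)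
    fun _ _ _ => Obl.pure trivial
  exact Obl.bind (obl_reconstructAt _ _) fun _ _ _ => Obl.bind (obl_secretWrite _ _ _ _)
    fun _ _ _ => Obl.pure trivial

/-- Combine adjacent entries of the same address. -/
def scanUpd : List (Item D B) → List (Item D B)
  | x :: y :: l =>
    (if x.isReal && x.key? == y.key? then x.update y else x) ::
      scanUpd ((if x.isReal && x.key? == y.key? then .dummy else y) :: l)
  | l => l
termination_by l => l.length

theorem scanUpd_of_length_le (h : l.length ≤ 1) : scanUpd l = l := by
  match l, h with
  | [], _ => rw [scanUpd]; simp
  | [x], _ => rw [scanUpd]; simp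

theorem length_scanUpd (l : List (Item D B)) : (scanUpd l).length = l.length := by
  induction hn : l.length generalizing l with
  | zero => rw [scanUpd_of_length_le (by omega), hn]
  | succ n ih =>
    match l, hn with
    | [x], hn => rw [scanUpd_of_length_le (by simp), hn]
    | x :: y :: l, hn =>
      rw [scanUpd, List.length_cons, ih _ (by simpa using hn)]

theorem sure_scanUpdate (hA : HoldsList F m A l) (hi : A.Inj) :
    (scanUpdate F A).Sure m fun _ m' => m.Ext A.cells m' ∧ HoldsList F m' A (scanUpd l) := by
  refine (Sure.forM_range (fun k m' => m.Ext A.cells m' ∧ ∃ pre rest,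
    pre.length = k ∧ pre ++ scanUpd rest = scanUpd l ∧ HoldsList F m' A (pre ++ rest))
    ⟨.refl _ _, [], l, rfl, rfl, hA⟩ ?_).mono ?_
  · rintro k hk m₁ ⟨e, pre, rest, rfl, hp, h⟩
    have hr : pre.length + 1 < (pre ++ rest).length := by
      rw [← h.1]
      omega
    obtain ⟨x, y, rest, rfl⟩ : ∃ x y r, rest = x :: y :: r := by
      match rest, hr with
      | [], hr => simp at hr
      | [x], hr => simp at hr
      | x :: y :: r, _ => exact ⟨x, y, r, rfl⟩
    refine (sure_reconstructAt h.2 (by omega)).bind ?_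
    rintro _ _ ⟨rfl, rfl⟩
    refine (sure_reconstructAt h.2 (by omega)).bind ?_
    rintro _ _ ⟨rfl, rfl⟩
    have hx : (pre ++ x :: y :: rest).getD pre.length .dummy = x := by simp
    have hy : (pre ++ x :: y :: rest).getD (pre.length + 1) .dummy = y := by
      simp [List.getD]
    rw [hx, hy]
    refine (sure_secretWrite _ _ _).bind fun _ m₂ ⟨e₂, h₂⟩ => ?_
    refine (sure_secretWrite _ _ _).mono fun _ m₃ ⟨e₃, h₃⟩ => ⟨?_, ?_⟩
    · refine (e.trans_same (e₂.mono fun c hc _ => ?_)).trans_same (e₃.mono fun c hc _ => ?_) <;>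
      · rw [Set.mem_singleton_iff.mp hc]
        exact Arr.cell_mem (by omega)
    · refine ⟨pre ++ [if x.isReal && x.key? == y.key? then x.update y else x],
        (if x.isReal && x.key? == y.key? then .dummy else y) :: rest, by simp, ?_, ?_⟩
      · rw [← hp, List.append_assoc, scanUpd.eq_1]
        rfl
      · have := (h.set hi (by omega) e₂ h₂).set hi (by omega) e₃ h₃
        rw [List.set_append_right _ _ le_rfl, Nat.sub_self, List.set_append_right _ _ (by omega),
          Nat.add_sub_cancel_left] at this
        rw [List.append_assoc]
        exact this
  · rintro _ m' ⟨e, pre, rest, hk, hp, h⟩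
    have := h.1
    rw [List.length_append, hk] at this
    rw [scanUpd_of_length_le (by omega)] at hp
    exact ⟨e, hp ▸ h⟩

theorem obl_scanUpdate : Obl s (scanUpdate F A) (scanUpdate F A) fun _ _ => True :=
  Obl.forM fun _ _ => Obl.bind (obl_reconstructAt _ _) fun _ _ _ =>
    Obl.bind (obl_reconstructAt _ _) fun _ _ _ => Obl.bind (obl_secretWrite _ _ _ _)
      fun _ _ _ => obl_secretWrite _ _ _ _

/-- The entries of the update array made from the key-position map `u` of level `lv`. -/
def convertList (lv : ℕ) (u : List (Item D B)) : List (Item D B) :=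
  (List.range u.length).map fun i => convertEntry lv (if i = 0 then .dummy else
    u.getD (i - 1) .dummy) (u.getD i .dummy) (u.getD (i + 1) .dummy)

/-- The entry of `U` to the left of entry `i`. -/
def leftOf (F : BlockFormat D B) (U : Arr) (i : ℕ) : Client F.width (Item D B) :=
  if i = 0 then pure .dummy else reconstructAt F U (i - 1)

/-- The entry of `U` to the right of entry `i`. -/
def rightOf (F : BlockFormat D B) (U : Arr) (i : ℕ) : Client F.width (Item D B) :=
  if i + 1 < U.len then reconstructAt F U (i + 1) else pure .dummy

theorem convert_eq (U : Arr) (lv : ℕ) : convert F U lv = (do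
    let V ← newArr U.len
    (List.range U.len).forM fun i => do
      let left ← leftOf F U i
      let x ← reconstructAt F U i
      let right ← rightOf F U i
      secretWrite F V i (convertEntry lv left x right)
    pure V) := by
  unfold convert
  congr 1
  funext V
  congr 2
  funext i
  rcases em (i = 0) with h | h <;> rcases em (i + 1 < U.len) with h' | h'
  · simp only [leftOf, rightOf, if_pos h, if_pos h']
  · simp only [leftOf, rightOf, if_pos h, if_neg h']
  · simp only [leftOf, rightOf, if_neg h, if_pos h']
  · simp only [leftOf, rightOf, if_neg h, if_neg h']

theorem sure_convert (hU : HoldsList F m U l) (lv : ℕ) : (convert F U lv).Sure m fun V m' =>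
    V.Fresh m m' ∧ m.Ext ∅ m' ∧ HoldsList F m' V (convertList lv l) := by
  rw [convert_eq]
  refine (sure_newArr _).bind fun V m₁ ⟨hl, hf, e₁⟩ => ?_
  refine (sure_fill (A := V) (f := id) (Y := fun i => convertEntry lv (if i = 0 then .dummy else
    l.getD (i - 1) .dummy) (l.getD i .dummy) (l.getD (i + 1) .dummy)) hf.inj hf.high
    (by simp [hl]) (by simp) fun i hi m₃ e => ?_).bind fun _ m₂ ⟨e₂, h₂⟩ => Sure.pure ?_
  · have hi' := List.mem_range.mp hi
    have hU₂ : HoldsList F m₃ U l := hU.ext_empty (e₁.trans e (by simp) (by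
      rintro c ⟨j, hj, rfl⟩ h
      have := hf.low j (by rw [hl]; exact List.mem_range.mp hj)
      simp at h
      omega))
    refine Sure.bind (Q := fun x m' => m' = m₃ ∧ x = if i = 0 then .dummy else
      l.getD (i - 1) .dummy) ?_ ?_
    · unfold leftOf
      split_ifs
      · exact Sure.pure ⟨rfl, rfl⟩
      · exact sure_reconstructAt hU₂.2 (by omega)
    rintro _ m₃ ⟨rfl, rfl⟩
    refine (sure_reconstructAt hU₂.2 hi').bind ?_
    rintro _ m₃ ⟨rfl, rfl⟩
    refine Sure.bind (Q := fun x m' => m' = m₃ ∧ x = l.getD (i + 1) .dummy) ?_ ?_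
    · unfold rightOf
      split_ifs with h
      · exact sure_reconstructAt hU₂.2 h
      · rw [hU.1, not_lt] at h
        exact Sure.pure ⟨rfl, by simp [List.getD, h]⟩
    rintro _ m₃ ⟨rfl, rfl⟩
    exact sure_secretWrite _ _ _
  · have e₂' : m₁.Ext V.cells m₂ := e₂.mono fun c hc _ => by
      obtain ⟨j, hj, rfl⟩ := hc
      exact Arr.cell_mem (by rw [hl]; exact List.mem_range.mp hj)
    refine ⟨hf.mono le_rfl e₂.next, e₁.of_fresh le_rfl hf e₂', ?_⟩
    have hlen : (convertList lv l).length = l.length := by simp [convertList]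
    refine Holds.toList (by rw [hl, hU.1, hlen]) fun i hi => ?_
    have hi' : i < V.len := by rw [hl, hU.1]; omega
    refine ⟨(hf.high i hi').trans_le e₂.next, ?_⟩
    have := h₂ i (List.mem_range.mpr (hl ▸ hi'))
    simpa [convertList] using this

theorem obl_convert (lv : ℕ) : Obl s (convert F U lv) (convert F U lv) Eq := by
  rw [convert_eq]
  refine Obl.bind (Obl.newArr _) ?_
  rintro V _ rfl
  refine Obl.bind (Obl.forM fun i _ => ?_) fun _ _ _ => Obl.pure rfl
  refine Obl.bind (r := fun _ _ => True) ?_ fun _ _ _ => Obl.bind (obl_reconstructAt _ _)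
    fun _ _ _ => Obl.bind (r := fun _ _ => True) ?_ fun _ _ _ => obl_secretWrite _ _ _ _
  · unfold leftOf
    split_ifs
    · exact Obl.pure trivial
    · exact obl_reconstructAt _ _
  · unfold rightOf
    split_ifs
    · exact obl_reconstructAt _ _
    · exact Obl.pure trivial

/-! ### Shuffle -/

/-- Merge the lists `ls` successively into `f`. -/
def mergeAll (f : List (Item D B)) (ls : List (List (Item D B))) : List (Item D B) :=
  ls.foldl (fun t l => List.merge (compact t) (compact l) Item.before) f

theorem length_compact (l : List (Item D B)) : (compact l).length = l.length := by
  have := (List.filter_append_perm (fun x : Item D B => x.isReal) l).length_eq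
  exact this

theorem length_mergeAll (f : List (Item D B)) (ls : List (List (Item D B))) :
    (mergeAll f ls).length = f.length + (ls.map List.length).sum := by
  induction ls generalizing f with
  | nil => simp [mergeAll]
  | cons l ls ih =>
    have := ih (List.merge (compact f) (compact l) Item.before)
    rw [mergeAll] at this ⊢
    rw [List.foldl_cons, this]
    simp [List.length_merge, length_compact]
    omega

/-- The list of the freshest entries among `f` and `ls`, in the order of addresses. -/
def freshList (lv : ℕ) (f : List (Item D B)) (ls : List (List (Item D B))) : List (Item D B) :=
  (compact (markDup none (mergeAll f ls))).take (2 ^ lv)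

/-- The list `t` with the updates `v`. -/
def updateList (lv : ℕ) (t v : List (Item D B)) : List (Item D B) :=
  (compact (scanUpd (List.merge (compact t) (compact v) Item.before))).take (2 ^ lv)

/-- The part of `shuffle` that does not involve the update array. -/
def freshArr (F : BlockFormat D B) (levels : Levels) (fetched : OTM) (lv : ℕ) :
    Client F.width Arr := do
  let lists ← ((List.range (lv + 1)).filterMap levels).mapM fun o => o.getall F
  let T₀ ← fetched.getall F
  let T ← lists.foldlM (fun T S => merge F T S) T₀
  markDuplicates F T
  let T' ← stableCompact F T
  pure (T'.take (2 ^ lv))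

def updateArr (F : BlockFormat D B) (T U : Arr) (lv : ℕ) : Client F.width Arr := do
  let A ← merge F T U
  scanUpdate F A
  let A' ← stableCompact F A
  pure (A'.take (2 ^ lv))

theorem sure_mapM_getall {os : List OTM} {ls : List (List (Item D B))}
    (h : List.Forall₂ (fun o l => ∃ q c, OTMHolds F m o l q c) os ls) :
    (os.mapM fun o : OTM => o.getall F).Sure m fun Ts m' => m.Ext ∅ m' ∧
      List.Forall₂ (HoldsList F m') Ts ls := by
  induction os generalizing m ls with
  | nil =>
    cases h
    exact Sure.pure ⟨.refl _ _, .nil⟩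
  | cons o os ih =>
    obtain ⟨l, ls, ⟨q, c, h'⟩, hs, rfl⟩ := List.forall₂_cons_left_iff.mp h
    rw [List.mapM_cons]
    refine (sure_getall h').bind fun R m₁ ⟨hf, e₁, hR⟩ => ?_
    refine (ih (hs.imp fun o l ⟨q, c, h⟩ => ⟨q, c, h.ext_empty e₁⟩)).bind
      fun Rs m₂ ⟨e₂, hRs⟩ => Sure.pure ⟨e₁.trans_same e₂, .cons (hR.ext_empty e₂) hRs⟩

theorem obl_mapM_getall (os : List OTM) :
    Obl s (os.mapM fun o : OTM => o.getall F) (os.mapM fun o : OTM => o.getall F) Eq :=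
  (Obl.mapM (r := Eq) fun o _ => obl_getall o).mono fun _ _ h => List.forall₂_eq_eq_eq ▸ h

/-- Freshness is kept relative to the earlier `m₀`, so that `markDuplicates`, which works in place,
may overwrite the result even when there was nothing to merge. -/
theorem sure_mergeAll {Ts : List Arr} {ls : List (List (Item D B))} {m₀ : Memory F.width}
    (hTs : List.Forall₂ (HoldsList F m) Ts ls) (hT : HoldsList F m T l) (hf : T.Fresh m₀ m)
    (h₀ : m₀.next ≤ m.next) (hn : l.length + (ls.map List.length).sum ≤ 2 ^ (D + 1)) :
    (Ts.foldlM (fun T S => merge F T S) T).Sure m fun R m' =>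
      R.Fresh m₀ m' ∧ m.Ext ∅ m' ∧ HoldsList F m' R (mergeAll l ls) := by
  induction Ts generalizing m T l ls with
  | nil =>
    cases hTs
    exact Sure.pure ⟨hf, .refl _ _, hT⟩
  | cons S Ts ih =>
    obtain ⟨l', ls, h, hs, rfl⟩ := List.forall₂_cons_left_iff.mp hTs
    rw [List.map_cons, List.sum_cons] at hn
    rw [List.foldlM_cons]
    refine (sure_merge hT h (by rw [hT.1, h.1]; omega)).bind fun R m₁ ⟨hRf, e₁, hR⟩ => ?_
    refine (ih (hs.imp fun _ _ h => h.ext_empty e₁) hR (hRf.mono h₀ le_rfl)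
      (h₀.trans e₁.next) ?_).mono fun R' m₂ ⟨hf', e₂, h'⟩ => ⟨hf', e₁.trans_same e₂, h'⟩
    simp only [List.length_merge, length_compact]
    omega

theorem rel_mergeAll {Ts : List Arr} {ls ls' : List (List (Item D B))}
    (hTs : List.Forall₂ (HoldsList F m) Ts ls) (hTs' : List.Forall₂ (HoldsList F m') Ts ls')
    (hT : HoldsList F m T l) (hT' : HoldsList F m' T l')
    (hn : l.length + (ls.map List.length).sum ≤ 2 ^ (D + 1)) (e : Eqv s m m') :
    Rel s (Ts.foldlM (fun T S => merge F T S) T) m (Ts.foldlM (fun T S => merge F T S) T) m'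
      fun R n R' n' => Eqv s n n' ∧ R = R' := by
  induction Ts generalizing m m' T l l' ls ls' with
  | nil => exact Rel.pure ⟨e, rfl⟩
  | cons S Ts ih =>
    obtain ⟨k, ls, h, hs, rfl⟩ := List.forall₂_cons_left_iff.mp hTs
    obtain ⟨k', ls', h', hs', rfl⟩ := List.forall₂_cons_left_iff.mp hTs'
    rw [List.map_cons, List.sum_cons] at hn
    rw [List.foldlM_cons]
    have hb : T.len + S.len ≤ 2 ^ (D + 1) := by rw [hT.1, h.1]; omega
    refine ((rel_merge hT h hT' h' hb e).and_sure (sure_merge hT h hb)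
      (sure_merge hT' h' hb)).bind ?_
    rintro R m₁ _ m₁' ⟨⟨e, rfl⟩, ⟨-, e₁, hR⟩, -, e₁', hR'⟩
    refine ih (hs.imp fun _ _ h => h.ext_empty e₁) (hs'.imp fun _ _ h => h.ext_empty e₁') hR hR'
      ?_ e
    simp only [List.length_merge, length_compact]
    omega

variable {levels : Levels} {o : OTM} {f f' : List (Item D B)} {ls ls' : List (List (Item D B))}
  {lv : ℕ}

theorem sure_freshArr
    (hls : List.Forall₂ (fun o l => ∃ q c, OTMHolds F m o l q c)
      ((List.range (lv + 1)).filterMap levels) ls)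
    (hf : ∃ q c, OTMHolds F m o f q c)
    (hn : f.length + (ls.map List.length).sum ≤ 2 ^ (D + 1)) :
    (freshArr F levels o lv).Sure m fun T m' => m.Ext ∅ m' ∧
      HoldsList F m' T (freshList lv f ls) := by
  obtain ⟨q, c, hf⟩ := hf
  refine (sure_mapM_getall hls).bind fun Ts m₁ ⟨e₁, hTs⟩ => ?_
  refine (sure_getall (hf.ext_empty e₁)).bind fun T₀ m₂ ⟨hf₀, e₂, hT₀⟩ => ?_
  refine (sure_mergeAll (hTs.imp fun _ _ h => h.ext_empty e₂) hT₀ hf₀ e₂.next hn).bind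
    fun T m₃ ⟨hfT, e₃, hT⟩ => ?_
  refine (sure_markDuplicates hT hfT.inj).bind fun _ m₄ ⟨e₄, hT₄⟩ => ?_
  have e := (e₂.trans_same e₃).of_fresh le_rfl hfT e₄
  refine (sure_stableCompact hT₄ (by rw [hT₄.1, length_markDup, length_mergeAll]; exact hn)).bind
    fun R m₅ ⟨_, e₅, hR⟩ => Sure.pure ⟨(e₁.trans_same e).trans_same e₅, hR.take _⟩

theorem rel_freshArr {o : OTM}
    (hls : List.Forall₂ (fun o l => ∃ q c, OTMHolds F m o l q c)
      ((List.range (lv + 1)).filterMap levels) ls)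
    (hls' : List.Forall₂ (fun o l => ∃ q c, OTMHolds F m' o l q c)
      ((List.range (lv + 1)).filterMap levels) ls')
    (hf : ∃ q c, OTMHolds F m o f q c) (hf' : ∃ q c, OTMHolds F m' o f' q c)
    (hn : f.length + (ls.map List.length).sum ≤ 2 ^ (D + 1))
    (hn' : f'.length + (ls'.map List.length).sum ≤ 2 ^ (D + 1)) (e : Eqv s m m') :
    Rel s (freshArr F levels o lv) m (freshArr F levels o lv) m'
      fun R n R' n' => Eqv s n n' ∧ R = R' := by
  obtain ⟨q, c, hf⟩ := hf
  obtain ⟨q', c', hf'⟩ := hf'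
  refine ((Rel.of_obl (obl_mapM_getall _) e).and_sure (sure_mapM_getall hls)
    (sure_mapM_getall hls')).bind ?_
  rintro Ts m₁ _ m₁' ⟨⟨e, rfl⟩, ⟨e₁, hTs⟩, e₁', hTs'⟩
  have hf := hf.ext_empty e₁
  have hf' := hf'.ext_empty e₁'
  refine ((Rel.of_obl (obl_getall _) e).and_sure (sure_getall hf) (sure_getall hf')).bind ?_
  rintro T₀ m₂ _ m₂' ⟨⟨e, rfl⟩, ⟨hf₀, e₂, hT₀⟩, hf₀', e₂', hT₀'⟩
  have hTs := hTs.imp fun _ _ h => h.ext_empty e₂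
  have hTs' := hTs'.imp fun _ _ h => h.ext_empty e₂'
  refine ((rel_mergeAll hTs hTs' hT₀ hT₀' hn e).and_sure
    (sure_mergeAll hTs hT₀ hf₀ e₂.next hn) (sure_mergeAll hTs' hT₀' hf₀' e₂'.next hn')).bind ?_
  rintro T m₃ _ m₃' ⟨⟨e, rfl⟩, ⟨hfT, e₃, hT⟩, hfT', e₃', hT'⟩
  refine ((Rel.of_obl obl_markDuplicates e).and_sure (sure_markDuplicates hT hfT.inj)
    (sure_markDuplicates hT' hfT'.inj)).bind ?_
  rintro _ m₄ _ m₄' ⟨⟨e, -⟩, ⟨e₄, hT₄⟩, e₄', hT₄'⟩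
  refine (rel_stableCompact hT₄ hT₄' (by rw [hT₄.1, length_markDup, length_mergeAll]; exact hn)
    e).bind ?_
  rintro R m₅ _ m₅' ⟨e, rfl⟩
  exact Rel.pure ⟨e, rfl⟩

theorem sure_updateArr {v : List (Item D B)} (hT : HoldsList F m T l) (hU : HoldsList F m U v)
    (hn : l.length + v.length ≤ 2 ^ (D + 1)) : (updateArr F T U lv).Sure m fun R m' =>
      m.Ext ∅ m' ∧ HoldsList F m' R (updateList lv l v) := by
  refine (sure_merge hT hU (by rwa [hT.1, hU.1])).bind fun A m₁ ⟨hf, e₁, hA⟩ => ?_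
  refine (sure_scanUpdate hA hf.inj).bind fun _ m₂ ⟨e₂, hA₂⟩ => ?_
  refine (sure_stableCompact hA₂ ?_).bind fun R m₃ ⟨_, e₃, hR⟩ =>
    Sure.pure ⟨(e₁.of_fresh le_rfl hf e₂).trans_same e₃, hR.take _⟩
  rwa [hA₂.1, length_scanUpd, List.length_merge, length_compact, length_compact]

theorem rel_updateArr {v v' : List (Item D B)} (hT : HoldsList F m T l) (hU : HoldsList F m U v)
    (hT' : HoldsList F m' T l') (hU' : HoldsList F m' U v')
    (hn : l.length + v.length ≤ 2 ^ (D + 1)) (e : Eqv s m m') :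
    Rel s (updateArr F T U lv) m (updateArr F T U lv) m' fun R n R' n' => Eqv s n n' ∧ R = R' := by
  have hn₁ : T.len + U.len ≤ 2 ^ (D + 1) := by rwa [hT.1, hU.1]
  refine ((rel_merge hT hU hT' hU' hn₁ e).and_sure (sure_merge hT hU hn₁)
    (sure_merge hT' hU' hn₁)).bind ?_
  rintro A m₁ _ m₁' ⟨⟨e, rfl⟩, ⟨hf, e₁, hA⟩, hf', e₁', hA'⟩
  refine ((Rel.of_obl obl_scanUpdate e).and_sure (sure_scanUpdate hA hf.inj)
    (sure_scanUpdate hA' hf'.inj)).bind ?_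
  rintro _ m₂ _ m₂' ⟨⟨e, -⟩, ⟨e₂, hA₂⟩, e₂', hA₂'⟩
  refine (rel_stableCompact hA₂ hA₂' ?_ e).bind ?_
  · rwa [hA₂.1, length_scanUpd, List.length_merge, length_compact, length_compact]
  · rintro R m₃ _ m₃' ⟨e, rfl⟩
    exact Rel.pure ⟨e, rfl⟩

/-- The list of the level that is built by a shuffle. -/
def shuffleList (lv : ℕ) (f : List (Item D B)) (ls : List (List (Item D B)))
    (v : Option (List (Item D B))) : List (Item D B) :=
  match v with
  | none => freshList lv f ls
  | some v => updateList lv (freshList lv f ls) v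

theorem length_freshList (h : 2 ^ lv ≤ f.length + (ls.map List.length).sum) :
    (freshList lv f ls).length = 2 ^ lv := by
  rw [freshList, List.length_take, length_compact, length_markDup, length_mergeAll, min_eq_left h]

theorem length_updateList {t v : List (Item D B)} (h : t.length = 2 ^ lv) :
    (updateList lv t v).length = 2 ^ lv := by
  rw [updateList, List.length_take, length_compact, length_scanUpd, List.length_merge,
    length_compact, length_compact, min_eq_left (by omega)]

theorem length_shuffleList {v : Option (List (Item D B))}
    (h : 2 ^ lv ≤ f.length + (ls.map List.length).sum) :
    (shuffleList lv f ls v).length = 2 ^ lv := by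
  cases v with
  | none => exact length_freshList h
  | some v => exact length_updateList (length_freshList h)

variable (F) in
/-- The inputs of a shuffle. -/
structure ShuffleInput (m : Memory F.width) (levels : Levels) (o : OTM) (upd : Option Arr)
    (lv : ℕ) (f : List (Item D B)) (ls : List (List (Item D B)))
    (v : Option (List (Item D B))) : Prop where
  levels : List.Forall₂ (fun o l => ∃ q c, OTMHolds F m o l q c)
    ((List.range (lv + 1)).filterMap levels) ls
  fetched : ∃ q c, OTMHolds F m o f q c
  updates : Option.Rel (HoldsList F m) upd v
  upper : f.length + (ls.map List.length).sum ≤ 2 ^ (D + 1)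
  lower : 2 ^ lv ≤ f.length + (ls.map List.length).sum
  level_le : lv ≤ D
  update_le : ∀ v' ∈ v, 2 ^ lv + v'.length ≤ 2 ^ (D + 1)

/-- The list that is built by a shuffle, without the building. -/
def shuffleArr (F : BlockFormat D B) (levels : Levels) (fetched : OTM) (upd : Option Arr)
    (lv : ℕ) : Client F.width Arr := do
  let T ← freshArr F levels fetched lv
  match upd with
    | none => pure T
    | some U => updateArr F T U lv

theorem shuffle_eq_build (levels : Levels) (fetched : OTM) (upd : Option Arr) (lv : ℕ) :
    shuffle F levels fetched upd lv = shuffleArr F levels fetched upd lv >>= build F := by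
  cases upd <;> simp only [shuffle, shuffleArr, freshArr, updateArr, bind_assoc, pure_bind]

variable {upd : Option Arr} {v v' : Option (List (Item D B))}

theorem ShuffleInput.sure (h : ShuffleInput F m levels o upd lv f ls v) :
    (shuffleArr F levels o upd lv).Sure m fun T m' => m.Ext ∅ m' ∧
      HoldsList F m' T (shuffleList lv f ls v) := by
  refine (sure_freshArr h.levels h.fetched h.upper).bind fun T m₁ ⟨e₁, hT⟩ => ?_
  have hu := h.updates
  have hl := h.update_le
  cases hu with
  | none => exact Sure.pure ⟨e₁, hT⟩
  | some hU =>
    refine (sure_updateArr hT (hU.ext_empty e₁) ?_).mono fun R m₂ ⟨e₂, hR⟩ =>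
      ⟨e₁.trans_same e₂, hR⟩
    rw [length_freshList h.lower]
    exact hl _ rfl

theorem ShuffleInput.rel (h : ShuffleInput F m levels o upd lv f ls v)
    (h' : ShuffleInput F m' levels o upd lv f' ls' v') (e : Eqv s m m') :
    Rel s (shuffleArr F levels o upd lv) m (shuffleArr F levels o upd lv) m'
      fun R n R' n' => Eqv s n n' ∧ R = R' := by
  refine ((rel_freshArr h.levels h'.levels h.fetched h'.fetched h.upper h'.upper e).and_sure
    (sure_freshArr h.levels h.fetched h.upper)
    (sure_freshArr h'.levels h'.fetched h'.upper)).bind ?_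
  rintro T m₁ _ m₁' ⟨⟨e, rfl⟩, ⟨e₁, hT⟩, e₁', hT'⟩
  have hu := h.updates
  have hu' := h'.updates
  have hl := h.update_le
  cases hu with
  | none => exact Rel.pure ⟨e, rfl⟩
  | some hU =>
    cases hu' with
    | some hU' =>
      refine rel_updateArr hT (hU.ext_empty e₁) hT' (hU'.ext_empty e₁') ?_ e
      rw [length_freshList h.lower]
      exact hl _ rfl

theorem ShuffleInput.sure_shuffle (h : ShuffleInput F m levels o upd lv f ls v) :
    (shuffle F levels o upd lv).Sure m fun r m' => m.Ext ∅ m' ∧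
      (∀ x ∈ r.1.cells, m.next ≤ x) ∧ ∃ q, OTMHolds F m' r.1 (shuffleList lv f ls v) q 0 ∧
        HoldsList F m' r.2 (placeList q (shuffleList lv f ls v)) := by
  rw [shuffle_eq_build]
  refine h.sure.bind fun T m₁ ⟨e₁, hT⟩ => ?_
  have hp := Nat.pow_le_pow_right (n := 2) (by norm_num) h.level_le
  refine (sure_build hT ?_ ?_).mono fun r m₂ ⟨e₂, hc, h⟩ =>
    ⟨e₁.trans_same e₂, fun x hx => e₁.next.trans (hc x hx), h⟩ <;>
    rw [length_shuffleList h.lower]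
  · exact Nat.one_le_two_pow
  · rw [pow_succ]
    omega

/-- All temporary permutations are drawn and used up inside the shuffle. Only those of the final
`build` live on, so `w` and `w'` can be the entries that later requests will visit. -/
theorem ShuffleInput.rel_shuffle (h : ShuffleInput F m levels o upd lv f ls v)
    (h' : ShuffleInput F m' levels o upd lv f' ls' v') {w w' : List ℕ} (hw : w.Nodup)
    (hw' : w'.Nodup) (hwn : ∀ i ∈ w, i < 2 * 2 ^ lv) (hwn' : ∀ i ∈ w', i < 2 * 2 ^ lv)
    (hlen : w.length = w'.length) (e : Eqv s m m') :
    Rel s (shuffle F levels o upd lv) m (shuffle F levels o upd lv) m'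
      fun r n r' n' => Eqv s n n' ∧ r = r' ∧
        ∀ k (h : k < w.length) (h' : k < w'.length),
          n.block (s - 1) ⟨s, r.1.P.cell w[k]⟩ = n'.block (s - 1) ⟨s, r.1.P.cell w'[k]⟩ := by
  rw [shuffle_eq_build]
  refine ((h.rel h' e).and_sure h.sure h'.sure).bind ?_
  rintro T m₁ _ m₁' ⟨⟨e, rfl⟩, ⟨e₁, hT⟩, e₁', hT'⟩
  have hp := Nat.pow_le_pow_right (n := 2) (by norm_num) h.level_le
  have hl := length_shuffleList (v := v) h.lower
  refine rel_build hT hT' ?_ ?_ hw hw' (by rwa [hl]) (by rwa [hl]) hlen e <;> rw [hl]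
  · exact Nat.one_le_two_pow
  · rw [pow_succ]
    omega

end Scans

/-! ## The lists of keys -/

section Keys

variable {D B : ℕ} {l l' l₁ l₂ : List (Item D B)} {x y : Item D B} {k n lv : ℕ} {S : Finset ℕ}

/-- The key of a real entry, and `2 ^ D` for the other ones. -/
def Item.rank (x : Item D B) : ℕ :=
  match x.key? with
  | some k => k.val
  | none => 2 ^ D

/-- Giving non-real entries the rank `2 ^ D`, above all keys, turns the order on entries into the
order on numbers. -/
theorem before_iff : x.before y = true ↔ x.rank ≤ y.rank := by
  unfold Item.before Item.rank
  rcases x.key? with _ | a <;> rcases y.key? with _ | b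
  · simp
  · simp
  · simp [a.2.le]
  · simp

theorem isReal_iff : x.isReal = true ↔ x.rank < 2 ^ D := by
  unfold Item.isReal Item.rank
  rcases x.key? with _ | a <;> simp

theorem rank_le (x : Item D B) : x.rank ≤ 2 ^ D := by
  unfold Item.rank
  rcases x.key? with _ | a
  · rfl
  · exact a.2.le

theorem isReal_eq (x : Item D B) : x.isReal = decide (x.rank < 2 ^ D) := by
  rw [Bool.eq_iff_iff, isReal_iff, decide_eq_true_iff]

theorem key?_eq_iff : x.key? = y.key? ↔ x.rank = y.rank := by
  unfold Item.rank
  rcases x.key? with _ | a <;> rcases y.key? with _ | b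
  · simp
  · simp [b.2.ne']
  · simp [a.2.ne]
  · simp [Fin.ext_iff]

theorem rank_update (x y : Item D B) : (x.update y).rank = x.rank := by
  cases x <;> cases y <;> rfl

theorem rank_dummy : (Item.dummy : Item D B).rank = 2 ^ D := rfl

/-- The entries with key `k`. -/
def withKey (k : ℕ) (l : List (Item D B)) : List (Item D B) := l.filter fun x => x.rank = k

theorem withKey_nil : withKey k ([] : List (Item D B)) = [] := rfl

theorem withKey_cons : withKey k (x :: l) =
    if x.rank = k then x :: withKey k l else withKey k l := by
  simp [withKey, List.filter_cons]

theorem withKey_append : withKey k (l ++ l') = withKey k l ++ withKey k l' :=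
  List.filter_append _ _

theorem withKey_eq_nil (h : ∀ x ∈ l, x.rank ≠ k) : withKey k l = [] := by
  simpa [withKey] using h

/-- Sorted by key, dummies last. -/
def KeySorted (l : List (Item D B)) : Prop := l.Pairwise fun x y => x.rank ≤ y.rank

/-- The keys of the real entries. -/
def realKeys (l : List (Item D B)) : List ℕ := (l.map Item.rank).filter fun k => k < 2 ^ D

/-- The real entries are sorted by key. -/
def SemiSorted (l : List (Item D B)) : Prop := (realKeys l).Pairwise (· ≤ ·)

theorem realKeys_cons : realKeys (x :: l) =
    if x.rank < 2 ^ D then x.rank :: realKeys l else realKeys l := by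
  simp [realKeys, List.filter_cons]

theorem realKeys_eq (l : List (Item D B)) :
    realKeys l = (l.filter fun x => x.isReal).map Item.rank := by
  rw [realKeys, List.filter_map]
  congr 1
  exact List.filter_congr fun x _ => (isReal_eq x).symm

theorem KeySorted.semiSorted (h : KeySorted l) : SemiSorted l :=
  (List.pairwise_map.mpr h).filter _

theorem SemiSorted.keySorted_compact (h : SemiSorted l) : KeySorted (compact l) := by
  rw [SemiSorted, realKeys_eq, List.pairwise_map] at h
  refine List.pairwise_append.mpr ⟨h, ?_, ?_⟩
  · refine List.pairwise_of_forall_mem_list fun x hx y hy => ?_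
    have hx := (List.mem_filter.mp hx).2
    have hy := (List.mem_filter.mp hy).2
    simp only [isReal_eq, Bool.not_eq_true', decide_eq_false_iff_not, not_lt] at hx hy
    exact (rank_le x).trans hy
  · intro x hx y hy
    have hy := (List.mem_filter.mp hy).2
    simp only [isReal_eq, Bool.not_eq_true', decide_eq_false_iff_not, not_lt] at hy
    exact (rank_le x).trans hy

theorem withKey_compact (hk : k < 2 ^ D) : withKey k (compact l) = withKey k l := by
  rw [compact, withKey_append]
  have : withKey k (l.filter fun x => !x.isReal) = [] := by
    refine withKey_eq_nil fun x hx h => ?_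
    have hx := (List.mem_filter.mp hx).2
    simp only [isReal_eq, Bool.not_eq_true', decide_eq_false_iff_not, not_lt] at hx
    omega
  rw [this, List.append_nil, withKey, withKey, List.filter_filter]
  refine List.filter_congr fun x _ => ?_
  rw [isReal_eq, ← Bool.decide_and]
  exact decide_eq_decide.mpr ⟨fun h => h.1, fun h => ⟨h, h ▸ hk⟩⟩

theorem keySorted_merge (h₁ : KeySorted l₁) (h₂ : KeySorted l₂) :
    KeySorted (List.merge l₁ l₂ Item.before) := by
  have := List.pairwise_merge (le := Item.before (D := D) (B := B))
    (fun a b c h h' => before_iff.mpr ((before_iff.mp h).trans (before_iff.mp h')))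
    (fun a b => by
      rw [Bool.or_eq_true, before_iff, before_iff]
      exact le_total _ _) l₁ l₂ (h₁.imp before_iff.mpr) (h₂.imp before_iff.mpr)
  exact this.imp before_iff.mp

/-- Ties favour the first list, so its copies of a key precede those of the second. The effect of
the protocols on lists is followed key by key with statements of this shape. -/
theorem withKey_merge (h₁ : KeySorted l₁) :
    withKey k (List.merge l₁ l₂ Item.before) = withKey k l₁ ++ withKey k l₂ := by
  induction l₁ generalizing l₂ with
  | nil => simp [withKey_nil]
  | cons x l₁ ih₁ =>
    induction l₂ with
    | nil => simp [withKey_nil]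
    | cons y l₂ ih₂ =>
      rw [List.cons_merge_cons]
      have h₁' := List.pairwise_cons.mp h₁
      split_ifs with h
      · rw [withKey_cons, ih₁ h₁'.2, withKey_cons (x := x)]
        split_ifs <;> simp
      · rw [before_iff, not_le] at h
        rw [withKey_cons, ih₂, withKey_cons (x := y)]
        split_ifs with hy
        -- `y` is strictly smaller than `x`, hence than all of the sorted first list, which thus has
        -- no copy of this key.
        · rw [withKey_eq_nil (l := x :: l₁)]
          · rfl
          · intro z hz
            rcases List.mem_cons.mp hz with rfl | hz
            · omega
            · have := h₁'.1 z hz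
              omega
        · rfl

/-! ### Scans -/

/-- The scan only turns entries into dummies, so keys disappear but none is moved; the real entries
stay sorted. -/
theorem realKeys_markDup (last : Option (Fin (2 ^ D))) (l : List (Item D B)) :
    (realKeys (markDup last l)).Sublist (realKeys l) := by
  induction l generalizing last with
  | nil => exact .refl _
  | cons x l ih =>
    rw [markDup, realKeys_cons, realKeys_cons (x := x)]
    split_ifs with h₁ h₂ h₃ h₄ h₅
    all_goals first
      | exact ih _
      | exact (ih _).cons _
      | exact (ih _).cons_cons _
      | simp [rank_dummy] at *

/-- In a sorted list the copies of a key are adjacent, so the comparison with the preceding key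
finds all of them but the first. The assumption on `last` ensures that once the scan has passed `k`
no copy of it follows. -/
theorem withKey_markDup {last : Option (Fin (2 ^ D))} (h : KeySorted l) (hk : k < 2 ^ D)
    (hl : ∀ y ∈ l, ∀ j ∈ last, j.val ≤ y.rank) : withKey k (markDup last l) =
      if last = some ⟨k, hk⟩ then [] else (withKey k l).take 1 := by
  induction l generalizing last with
  | nil => simp [markDup, withKey_nil]
  | cons x l ih =>
    have h' := List.pairwise_cons.mp h
    have ih := ih (last := x.key?) h'.2 fun y hy j hj => by
      have : x.rank = j.val := by rw [Item.rank, hj]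
      exact this ▸ h'.1 y hy
    rw [markDup, withKey_cons, withKey_cons, ih]
    rcases hx : x.key? with _ | j
    · have hr : x.rank = 2 ^ D := by rw [Item.rank, hx]
      have hnil : withKey k l = [] := withKey_eq_nil fun y hy => by
        have := h'.1 y hy
        omega
      have : x.isReal = false := by rw [isReal_eq]; simp [hr]
      simp [this, hr, hnil, hk.ne']
    · have hr : x.rank = j.val := by rw [Item.rank, hx]
      have hreal : x.isReal = true := isReal_iff.mpr (hr ▸ j.2)
      by_cases hj : last = some j
      · subst hj
        by_cases hjk : j.val = k
        · subst hjk
          simp [hreal, rank_dummy, hk.ne']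
        · have : (j : Fin (2 ^ D)) ≠ ⟨k, hk⟩ := fun h => hjk (congrArg Fin.val h)
          simp [hreal, rank_dummy, hk.ne', this, hr, hjk]
      · have hj' : (some j == last) = false := by simpa using Ne.symm hj
        by_cases hjk : j.val = k
        · subst hjk
          simp [hreal, hj', hr, hj]
        · have : (j : Fin (2 ^ D)) ≠ ⟨k, hk⟩ := fun h => hjk (congrArg Fin.val h)
          simp only [hreal, hj', hr, hjk, Bool.and_false, Bool.false_eq_true, if_false,
            Option.some.injEq, this]
          split_ifs with hlast
          · have hnil : withKey k l = [] := withKey_eq_nil fun y hy => by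
              have h₁ := h'.1 y hy
              have h₂ : k ≤ x.rank := hl x (by simp) ⟨k, hk⟩ hlast
              omega
            simp [hnil]
          · rfl

/-- A dummy is never combined with its successor. Hence after two entries are combined, the scan
goes on behind them as if it started afresh. -/
theorem scanUpd_dummy_cons (l : List (Item D B)) :
    scanUpd (.dummy :: l) = .dummy :: scanUpd l := by
  rcases l with _ | ⟨y, l⟩
  · rw [scanUpd_of_length_le (by simp), scanUpd_of_length_le (by simp)]
  · rw [scanUpd]
    have : (Item.dummy : Item D B).isReal = false := rfl
    simp [this]

theorem scanUpd_cons_of_same (h : x.rank = y.rank) (hx : x.rank < 2 ^ D) :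
    scanUpd (x :: y :: l) = x.update y :: .dummy :: scanUpd l := by
  have : (x.isReal && x.key? == y.key?) = true := by
    simp [isReal_iff.mpr hx, key?_eq_iff.mpr h]
  rw [scanUpd, this, ← scanUpd_dummy_cons]
  rfl

theorem scanUpd_cons_of_not (h : ¬ (x.rank = y.rank ∧ x.rank < 2 ^ D)) :
    scanUpd (x :: y :: l) = x :: scanUpd (y :: l) := by
  have : (x.isReal && x.key? == y.key?) = false := by
    rw [← isReal_iff, ← key?_eq_iff, and_comm] at h
    rw [Bool.eq_false_iff]
    simpa using h
  rw [scanUpd, this]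
  rfl

theorem realKeys_scanUpd (l : List (Item D B)) :
    (realKeys (scanUpd l)).Sublist (realKeys l) := by
  induction hn : l.length using Nat.strong_induction_on generalizing l with
  | _ n ih =>
    match l, hn with
    | [], _ => rw [scanUpd_of_length_le (by simp)]
    | [x], _ => rw [scanUpd_of_length_le (by simp)]
    | x :: y :: l, hn =>
      by_cases h : x.rank = y.rank ∧ x.rank < 2 ^ D
      · rw [scanUpd_cons_of_same h.1 h.2, realKeys_cons, realKeys_cons (x := .dummy),
          realKeys_cons (x := x), realKeys_cons (x := y), rank_update, rank_dummy,
          ← h.1]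
        simp only [if_pos h.2, lt_irrefl, if_false]
        exact ((ih _ (by simp at hn; omega) l rfl).cons _).cons_cons _
      · rw [scanUpd_cons_of_not h, realKeys_cons, realKeys_cons (x := x)]
        have := ih _ (by simp at hn ⊢; omega) (y :: l) rfl
        split_ifs
        · exact this.cons_cons _
        · exact this

/-- An entry and its update. -/
def applyUpd : List (Item D B) → List (Item D B)
  | [x, y] => [x.update y]
  | l => l

/-- In the intended use the two copies are an entry of the level and its update. A third copy would
survive the scan, since the second has become a dummy by the time it is reached. -/
theorem withKey_scanUpd (h : KeySorted l) (hk : k < 2 ^ D) (hl : (withKey k l).length ≤ 2) :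
    withKey k (scanUpd l) = applyUpd (withKey k l) := by
  induction hn : l.length using Nat.strong_induction_on generalizing l with
  | _ n ih =>
    match l, hn with
    | [], _ => rw [scanUpd_of_length_le (by simp)]; rfl
    | [x], _ =>
      rw [scanUpd_of_length_le (by simp), withKey_cons]
      split_ifs <;> rfl
    | x :: y :: l, hn =>
      have h' := List.pairwise_cons.mp h
      have h'' := List.pairwise_cons.mp h'.2
      rw [withKey_cons, withKey_cons] at hl ⊢
      by_cases hxy : x.rank = y.rank ∧ x.rank < 2 ^ D
      · rw [scanUpd_cons_of_same hxy.1 hxy.2, withKey_cons, withKey_cons, rank_update, rank_dummy,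
          ← hxy.1, if_neg hk.ne']
        rw [← hxy.1] at hl
        split_ifs at hl ⊢ with hx
        · have hnil : withKey k l = [] := by simpa using hl
          rw [ih _ (by simp at hn; omega) h''.2 (by simp [hnil]) rfl, hnil]
          rfl
        · exact ih _ (by simp at hn; omega) h''.2 hl rfl
      · rw [scanUpd_cons_of_not hxy, withKey_cons,
          ih _ (by simp at hn ⊢; omega) h'.2 (l := y :: l) _ rfl]
        · rw [withKey_cons]
          by_cases hx : x.rank = k
          · have hy : k < y.rank := by
              have := h'.1 y (by simp)
              omega
            have hnil : withKey k l = [] := withKey_eq_nil fun z hz => by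
              have := h''.1 z hz
              omega
            simp [hx, hnil, hy.ne', applyUpd]
          · simp [hx]
        · rw [withKey_cons]
          refine le_trans ?_ hl
          split_ifs <;> simp

theorem sorted_mergeAll {f : List (Item D B)} {ls : List (List (Item D B))} (hf : KeySorted f)
    (hls : ∀ l ∈ ls, SemiSorted l) : KeySorted (mergeAll f ls) := by
  induction ls generalizing f with
  | nil => exact hf
  | cons l ls ih =>
    exact ih (keySorted_merge hf.semiSorted.keySorted_compact
      (hls l (by simp)).keySorted_compact) fun l hl => hls l (by simp [hl])

theorem withKey_mergeAll {f : List (Item D B)} {ls : List (List (Item D B))} (hf : KeySorted f)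
    (hls : ∀ l ∈ ls, SemiSorted l) (hk : k < 2 ^ D) :
    withKey k (mergeAll f ls) = withKey k (f ++ ls.flatten) := by
  induction ls generalizing f with
  | nil => simp [mergeAll]
  | cons l ls ih =>
    have := ih (keySorted_merge hf.semiSorted.keySorted_compact
      (hls l (by simp)).keySorted_compact) fun l hl => hls l (by simp [hl])
    rw [mergeAll] at this ⊢
    rw [List.foldl_cons, this, withKey_append, withKey_merge hf.semiSorted.keySorted_compact,
      withKey_compact hk, withKey_compact hk, List.flatten_cons, withKey_append, withKey_append,
      List.append_assoc]

/-! ### Lists with a given set of keys -/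

/-- The list of the keys in `S`. -/
def sortKeys (S : Finset ℕ) : List ℕ := S.sort (· ≤ ·)

theorem mem_sortKeys : k ∈ sortKeys S ↔ k ∈ S := Finset.mem_sort _

theorem nodup_sortKeys (S : Finset ℕ) : (sortKeys S).Nodup := Finset.sort_nodup _ _

theorem length_sortKeys (S : Finset ℕ) : (sortKeys S).length = S.card := Finset.length_sort _

theorem pairwise_sortKeys (S : Finset ℕ) : (sortKeys S).Pairwise (· < ·) :=
  List.sortedLT_iff_pairwise.mp (Finset.sortedLT_sort S)

/-- The place of a key in a list with the keys `S`. -/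
def keyIdx (S : Finset ℕ) (k : ℕ) : ℕ := (sortKeys S).idxOf k

theorem keyIdx_lt (h : k ∈ S) : keyIdx S k < S.card := by
  rw [← length_sortKeys]
  exact List.idxOf_lt_length_iff.mpr (mem_sortKeys.mpr h)

theorem keyIdx_inj {k' : ℕ} (h : k ∈ S) (he : keyIdx S k = keyIdx S k') : k = k' :=
  (List.idxOf_inj (mem_sortKeys.mpr h)).mp he

/-- The list consists of entries with the keys `S`, in the order of keys, followed by dummies;
it has length `n`. -/
structure KeyList (S : Finset ℕ) (n : ℕ) (l : List (Item D B)) : Prop where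
  ranks : l.map Item.rank = sortKeys S ++ List.replicate (n - S.card) (2 ^ D)
  card_le : S.card ≤ n
  lt : ∀ k ∈ S, k < 2 ^ D

theorem KeyList.length_eq (h : KeyList S n l) : l.length = n := by
  have h₁ := congrArg List.length h.ranks
  have := h.card_le
  simp only [List.length_map, List.length_append, length_sortKeys, List.length_replicate] at h₁
  omega

theorem KeyList.keySorted (h : KeyList S n l) : KeySorted l := by
  have : (l.map Item.rank).Pairwise (· ≤ ·) := by
    rw [h.ranks]
    refine List.pairwise_append.mpr ⟨(pairwise_sortKeys S).imp fun h => h.le, ?_, ?_⟩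
    · exact List.pairwise_replicate.mpr (.inr le_rfl)
    · intro a ha b hb
      rw [(List.mem_replicate.mp hb).2]
      exact (h.lt a (mem_sortKeys.mp ha)).le
  exact List.pairwise_map.mp this

/-- Where a key stands depends only on the set of keys, not on the contents or on any coin. This is
what lets the model name the visited entries. -/
theorem KeyList.rank_getElem_iff (h : KeyList S n l) {i : ℕ} (hi : i < l.length) (hk : k < 2 ^ D) :
    l[i].rank = k ↔ k ∈ S ∧ i = keyIdx S k := by
  have hl := h.length_eq
  have hr : l[i].rank = (l.map Item.rank)[i]'(by simpa using hi) := by simp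
  simp only [hr, h.ranks]
  rw [List.getElem_append]
  split_ifs with hs
  · constructor
    · rintro rfl
      exact ⟨mem_sortKeys.mp (List.getElem_mem hs), ((nodup_sortKeys S).idxOf_getElem i hs).symm⟩
    · rintro ⟨hk, rfl⟩
      exact List.getElem_idxOf hs
  · rw [List.getElem_replicate]
    constructor
    · intro h
      omega
    · rintro ⟨hk, rfl⟩
      rw [length_sortKeys] at hs
      exact absurd (keyIdx_lt hk) hs

theorem filter_eq_singleton {α : Type} {l : List α} {p : α → Bool} {i : ℕ} (hi : i < l.length)
    (h : ∀ j (hj : j < l.length), p l[j] = true ↔ j = i) : l.filter p = [l[i]] := by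
  induction l generalizing i with
  | nil => simp at hi
  | cons a l ih =>
    rw [List.filter_cons]
    rcases i with _ | i
    · have h0 : p a = true := (h 0 (by simp)).mpr rfl
      rw [if_pos h0]
      congr 1
      refine List.filter_eq_nil_iff.mpr fun b hb => ?_
      obtain ⟨j, hj, rfl⟩ := List.getElem_of_mem hb
      have := h (j + 1) (by simpa using hj)
      simpa using this
    · have h0 : ¬ p a = true := fun h' => by simpa using (h 0 (by simp)).mp h'
      rw [if_neg h0]
      refine ih (by simpa using hi) fun j hj => ?_
      have := h (j + 1) (by simpa using hj)
      simpa using this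

theorem KeyList.withKey_of_mem (h : KeyList S n l) (hk : k ∈ S) :
    withKey k l = [l.getD (keyIdx S k) .dummy] := by
  have hi : keyIdx S k < l.length := h.length_eq ▸ (keyIdx_lt hk).trans_le h.card_le
  rw [withKey, filter_eq_singleton hi, List.getD_eq_getElem _ _ hi]
  intro j hj
  rw [decide_eq_true_iff, h.rank_getElem_iff hj (h.lt k hk)]
  exact ⟨fun h => h.2, fun h => ⟨hk, h⟩⟩

theorem KeyList.withKey_of_not_mem (h : KeyList S n l) (hk : k ∉ S) (hk' : k < 2 ^ D) :
    withKey k l = [] := by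
  refine withKey_eq_nil fun x hx hr => ?_
  obtain ⟨i, hi, rfl⟩ := List.getElem_of_mem hx
  exact hk ((h.rank_getElem_iff hi hk').mp hr).1

theorem mem_realKeys : k ∈ realKeys l ↔ k < 2 ^ D ∧ withKey k l ≠ [] := by
  simp [realKeys, withKey]
  exact and_comm

theorem count_realKeys (hk : k < 2 ^ D) : (realKeys l).count k = (withKey k l).length := by
  induction l with
  | nil => rfl
  | cons x l ih =>
    rw [realKeys_cons, withKey_cons]
    split_ifs with h₁ h₂ h₂
    · subst h₂
      simp [ih]
    · simp [ih, h₂]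
    · omega
    · exact ih

/-- Compaction makes a list with given keys out of a list of sorted real entries. -/
theorem keyList_take_compact (hl : SemiSorted l) (hk : ∀ k < 2 ^ D, (withKey k l).length ≤ 1)
    (hS : ∀ k, k ∈ S ↔ k < 2 ^ D ∧ withKey k l ≠ []) (hn : S.card ≤ n) (hn' : n ≤ l.length) :
    KeyList S n ((compact l).take n) ∧
      ∀ k < 2 ^ D, withKey k ((compact l).take n) = withKey k l := by
  have hnd : (realKeys l).Nodup := List.nodup_iff_count_le_one.mpr fun k => by
    by_cases h : k < 2 ^ D
    · rw [count_realKeys h]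
      exact hk k h
    · rw [List.count_eq_zero_of_not_mem]
      · simp
      · exact fun h' => h (mem_realKeys.mp h').1
  -- Both sides are sorted and without repetition, and have the same elements.
  have hr : realKeys l = sortKeys S := by
    refine List.Perm.eq_of_pairwise (fun a b _ _ => le_antisymm) hl
      ((pairwise_sortKeys S).imp fun h => h.le) ?_
    rw [List.perm_ext_iff_of_nodup hnd (nodup_sortKeys S)]
    intro k
    rw [mem_realKeys, mem_sortKeys, hS]
  rw [realKeys_eq] at hr
  set R := l.filter fun x => x.isReal
  set N := l.filter fun x => !x.isReal with hN
  have hR : R.length = S.card := by rw [← length_sortKeys, ← hr, List.length_map]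
  have hNl : R.length + N.length = l.length := by
    rw [← List.length_append]
    exact length_compact l
  have ht : (compact l).take n = R ++ N.take (n - S.card) := by
    change (R ++ N).take n = _
    rw [List.take_append, List.take_of_length_le (by omega), hR]
  have hNr : ∀ x ∈ N, x.rank = 2 ^ D := fun x hx => by
    have hx := (List.mem_filter.mp hx).2
    simp only [isReal_eq, Bool.not_eq_true', decide_eq_false_iff_not, not_lt] at hx
    exact (rank_le x).antisymm hx
  rw [ht]
  refine ⟨⟨?_, hn, fun k hk => ((hS k).mp hk).1⟩, fun k hk => ?_⟩
  · rw [List.map_append, hr]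
    congr 1
    refine List.eq_replicate_iff.mpr ⟨by simp; omega, fun k hk => ?_⟩
    obtain ⟨x, hx, rfl⟩ := List.mem_map.mp hk
    exact hNr x (List.mem_of_mem_take hx)
  · rw [← withKey_compact hk (l := l), compact, withKey_append, withKey_append,
      withKey_eq_nil (l := N), withKey_eq_nil (l := N.take _)]
    · intro x hx
      rw [hNr x (List.mem_of_mem_take hx)]
      exact hk.ne'
    · intro x hx
      rw [hNr x hx]
      exact hk.ne'

/-- When `f` is the fetched block and `ls` are the levels from the lowest on, newer copies come
first, and keeping the first copy of a key keeps the freshest. -/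
theorem keyList_freshList {f : List (Item D B)} {ls : List (List (Item D B))} (hf : KeySorted f)
    (hls : ∀ l ∈ ls, SemiSorted l)
    (hS : ∀ k, k ∈ S ↔ k < 2 ^ D ∧ withKey k (f ++ ls.flatten) ≠ []) (hn : S.card ≤ 2 ^ lv)
    (hn' : 2 ^ lv ≤ f.length + (ls.map List.length).sum) :
    KeyList S (2 ^ lv) (freshList lv f ls) ∧ ∀ k < 2 ^ D,
      withKey k (freshList lv f ls) = (withKey k (f ++ ls.flatten)).take 1 := by
  have hs := sorted_mergeAll hf hls
  have hw : ∀ k < 2 ^ D, withKey k (markDup none (mergeAll f ls)) =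
      (withKey k (f ++ ls.flatten)).take 1 := fun k hk => by
    rw [withKey_markDup hs hk (by simp), if_neg (by simp), withKey_mergeAll hf hls hk]
  have := keyList_take_compact (l := markDup none (mergeAll f ls)) (S := S)
    (hs.semiSorted.sublist (realKeys_markDup _ _)) (fun k hk => by rw [hw k hk]; simp)
    (fun k => by
      rw [hS]
      refine and_congr_right fun hk => ?_
      rw [hw k hk]
      simp) hn (by rwa [length_markDup, length_mergeAll])
  exact ⟨this.1, fun k hk => (this.2 k hk).trans (hw k hk)⟩

/-- The update array mentions keys of `S` only, each at most once. So it changes labels but not the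
set of keys, and each key meets at most one update. -/
theorem keyList_updateList {t v : List (Item D B)} (ht : KeyList S (2 ^ lv) t) (hv : SemiSorted v)
    (hvS : ∀ k < 2 ^ D, (withKey k v).length ≤ 1 ∧ (k ∉ S → withKey k v = [])) :
    KeyList S (2 ^ lv) (updateList lv t v) ∧ ∀ k ∈ S,
      withKey k (updateList lv t v) = applyUpd (withKey k t ++ withKey k v) := by
  have hts := ht.keySorted.semiSorted.keySorted_compact
  have hs := keySorted_merge hts hv.keySorted_compact
  have hm : ∀ k < 2 ^ D, withKey k (List.merge (compact t) (compact v) Item.before) =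
      withKey k t ++ withKey k v := fun k hk => by
    rw [withKey_merge hts, withKey_compact hk, withKey_compact hk]
  have ht1 : ∀ k ∈ S, ∃ x, withKey k t = [x] := fun k hk => ⟨_, ht.withKey_of_mem hk⟩
  have hw : ∀ k < 2 ^ D, withKey k (scanUpd (List.merge (compact t) (compact v) Item.before)) =
      applyUpd (withKey k t ++ withKey k v) := fun k hk => by
    rw [withKey_scanUpd hs hk, hm k hk]
    rw [hm k hk, List.length_append]
    have h₁ := (hvS k hk).1
    by_cases h : k ∈ S
    · obtain ⟨x, hx⟩ := ht1 k h
      rw [hx]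
      simp
      omega
    · rw [ht.withKey_of_not_mem h hk]
      simp
      omega
  have happ : ∀ k < 2 ^ D, (k ∉ S → applyUpd (withKey k t ++ withKey k v) = []) ∧
      (k ∈ S → ∃ x, applyUpd (withKey k t ++ withKey k v) = [x]) := fun k hk => by
    refine ⟨fun h => ?_, fun h => ?_⟩
    · rw [ht.withKey_of_not_mem h hk, (hvS k hk).2 h]
      rfl
    · obtain ⟨x, hx⟩ := ht1 k h
      have h₁ := (hvS k hk).1
      rw [hx]
      rcases hv' : withKey k v with _ | ⟨y, _ | ⟨z, r⟩⟩
      · exact ⟨x, rfl⟩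
      · exact ⟨x.update y, rfl⟩
      · rw [hv'] at h₁
        simp at h₁
  have := keyList_take_compact (l := scanUpd (List.merge (compact t) (compact v) Item.before))
    (S := S) (n := 2 ^ lv) (hs.semiSorted.sublist (realKeys_scanUpd _)) (fun k hk => ?_)
    (fun k => ?_) ht.card_le ?_
  · exact ⟨this.1, fun k hk => (this.2 k (ht.lt k hk)).trans (hw k (ht.lt k hk))⟩
  · rw [hw k hk]
    by_cases h : k ∈ S
    · obtain ⟨x, hx⟩ := (happ k hk).2 h
      simp [hx]
    · simp [(happ k hk).1 h]
  · constructor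
    · intro h
      have hk := ht.lt k h
      obtain ⟨x, hx⟩ := (happ k hk).2 h
      exact ⟨hk, by simp [hw k hk, hx]⟩
    · rintro ⟨hk, h⟩
      by_contra h'
      exact h (by rw [hw k hk, (happ k hk).1 h'])
  · rw [length_scanUpd, List.length_merge, length_compact, length_compact, ht.length_eq]
    omega

/-! ### Update arrays -/

variable {q : Fin 3 → ℕ → ℕ}

/-- The label of the entry with key `c` in a one-time memory of level `lv` with the keys `S`. -/
def labelIn (D : ℕ) (S : Finset ℕ) (q : Fin 3 → ℕ → ℕ) (lv c : ℕ) : Option (Label D) :=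
  if c ∈ S then some ⟨Fin.ofNat _ lv, posOf D q (keyIdx S c)⟩ else none

/-- The entry of the update array made from the entry with key `c`. -/
def updateEntry (D B : ℕ) (S : Finset ℕ) (q : Fin 3 → ℕ → ℕ) (lv c : ℕ) : Item D B :=
  if c % 2 = 1 ∧ c - 1 ∈ S then .dummy
  else .labels (Fin.ofNat _ (c / 2)) (labelIn D S q lv (2 * (c / 2)))
    (labelIn D S q lv (2 * (c / 2) + 1))

theorem key?_eq_some (h : x.rank = k) (hk : k < 2 ^ D) : x.key? = some (Fin.ofNat _ k) := by
  unfold Item.rank at h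
  rcases hx : x.key? with _ | j
  · rw [hx] at h
    exact absurd h hk.ne'
  · rw [hx] at h
    subst h
    simp

theorem key?_eq_none (h : x.rank = 2 ^ D) : x.key? = none := by
  unfold Item.rank at h
  rcases hx : x.key? with _ | j
  · rfl
  · rw [hx] at h
    exact absurd h j.2.ne

theorem KeyList.rank_getD (h : KeyList S n l) (i : ℕ) : (l.getD i .dummy).rank =
    if hi : i < (sortKeys S).length then (sortKeys S)[i] else 2 ^ D := by
  by_cases hl : i < l.length
  · have hr : (l.getD i .dummy).rank = (l.map Item.rank)[i]'(by simpa using hl) := by simp [hl]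
    simp only [hr, h.ranks, List.getElem_append, List.getElem_replicate]
  · have := h.card_le
    rw [dif_neg (by rw [length_sortKeys]; have := h.length_eq; omega),
      List.getD_eq_default _ _ (not_lt.mp hl), rank_dummy]

theorem KeyList.getD_placeList (h : KeyList S n l) (i : ℕ) :
    (placeList q l).getD i .dummy = if hi : i < (sortKeys S).length then
      .place (Fin.ofNat _ ((sortKeys S)[i])) (posOf D q i) else .dummy := by
  have hr := h.rank_getD i
  by_cases hl : i < l.length
  · have hp : (placeList q l).getD i .dummy = placeEntry q i (l.getD i .dummy) := by
      simp [placeList, hl]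
    rw [hp, placeEntry]
    split_ifs at hr ⊢ with hi
    · rw [key?_eq_some hr (h.lt _ (mem_sortKeys.mp (List.getElem_mem hi)))]
    · rw [key?_eq_none hr]
  · have := h.card_le
    rw [dif_neg (by rw [length_sortKeys]; have := h.length_eq; omega),
      List.getD_eq_default _ _ (by simpa [placeList] using hl)]

theorem sortKeys_lt {i j : ℕ} (hij : i < j) (hj : j < (sortKeys S).length) :
    (sortKeys S)[i] < (sortKeys S)[j] :=
  List.pairwise_iff_getElem.mp (pairwise_sortKeys S) i j _ hj hij

/-- Consecutive numbers are neighbours in a sorted list. So `convert` finds the sibling of an entry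
by looking one entry to the side. -/
theorem succ_mem_iff {i : ℕ} (hi : i < (sortKeys S).length) : (sortKeys S)[i] + 1 ∈ S ↔
    ∃ h : i + 1 < (sortKeys S).length, (sortKeys S)[i + 1] = (sortKeys S)[i] + 1 := by
  constructor
  · intro h
    obtain ⟨j, hj, he⟩ := List.getElem_of_mem (mem_sortKeys.mpr h)
    have hij : i < j := by
      by_contra hij
      rcases (not_lt.mp hij).lt_or_eq with h' | rfl
      · have := sortKeys_lt h' hi
        omega
      · omega
    refine ⟨by omega, ?_⟩
    rcases (Nat.succ_le_of_lt hij).lt_or_eq with h' | rfl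
    · have h₁ := sortKeys_lt h' hj
      have h₂ := sortKeys_lt (Nat.lt_succ_self i) (h'.trans hj)
      simp only [Nat.succ_eq_add_one] at h₁ h₂
      omega
    · exact he
  · rintro ⟨h, he⟩
    rw [← he]
    exact mem_sortKeys.mp (List.getElem_mem h)

theorem pred_mem_iff {i : ℕ} (hi : i < (sortKeys S).length) (h0 : (sortKeys S)[i] ≠ 0) :
    (sortKeys S)[i] - 1 ∈ S ↔
      ∃ _ : i ≠ 0, (sortKeys S)[i - 1] + 1 = (sortKeys S)[i] := by
  constructor
  · intro h
    obtain ⟨j, hj, he⟩ := List.getElem_of_mem (mem_sortKeys.mpr h)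
    have hj' : (sortKeys S)[j] + 1 ∈ S := by
      rw [he, Nat.sub_add_cancel (by omega)]
      exact mem_sortKeys.mp (List.getElem_mem hi)
    obtain ⟨hj'', he'⟩ := (succ_mem_iff hj).mp hj'
    have : j + 1 = i := by
      refine ((nodup_sortKeys S).getElem_inj_iff (hi := hj'') (hj := hi)).mp ?_
      omega
    subst this
    exact ⟨by omega, he'.symm⟩
  · rintro ⟨h, he⟩
    rw [← he, Nat.add_sub_cancel]
    exact mem_sortKeys.mp (List.getElem_mem _)

theorem labelIn_getElem {i : ℕ} (hi : i < (sortKeys S).length) :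
    labelIn D S q lv (sortKeys S)[i] = some ⟨Fin.ofNat _ lv, posOf D q i⟩ := by
  rw [labelIn, if_pos (mem_sortKeys.mp (List.getElem_mem hi)), keyIdx,
    (nodup_sortKeys S).idxOf_getElem i hi]

theorem KeyList.convertList_eq (h : KeyList S n l) : convertList lv (placeList q l) =
    (sortKeys S).map (updateEntry D B S q lv) ++ List.replicate (n - S.card) .dummy := by
  have hln := h.length_eq
  have hcard := h.card_le
  have hlen := length_sortKeys S
  have hp : (placeList q l).length = n := by simp [placeList, hln]
  refine List.ext_getElem (by simp [convertList, hp, length_sortKeys]; omega) fun i hi hi' => ?_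
  have hval : ∀ j (hj : j < (sortKeys S).length),
      (Fin.ofNat (2 ^ D) (sortKeys S)[j]).val = (sortKeys S)[j] := fun j hj =>
    Nat.mod_eq_of_lt (h.lt _ (mem_sortKeys.mp (List.getElem_mem hj)))
  rw [List.getElem_append]
  simp only [convertList, List.getElem_map, List.getElem_range, h.getD_placeList,
    List.getElem_replicate, List.length_map]
  by_cases hs : i < (sortKeys S).length
  · rw [dif_pos hs, dif_pos hs]
    have hpar : parent (Fin.ofNat (2 ^ D) (sortKeys S)[i]) =
        Fin.ofNat _ ((sortKeys S)[i] / 2) := by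
      ext
      have := hval i hs
      rw [parent]
      simp only [this]
      refine (Nat.mod_eq_of_lt ((Nat.div_le_self _ _).trans_lt ?_)).symm
      exact h.lt _ (mem_sortKeys.mp (List.getElem_mem hs))
    have hlab := labelIn_getElem (D := D) (lv := lv) (q := q) hs
    simp only [convertEntry, hval i hs, hpar, updateEntry]
    rcases Nat.mod_two_eq_zero_or_one (sortKeys S)[i] with h2 | h2
    · rw [if_pos h2, if_neg (by omega)]
      have he : 2 * ((sortKeys S)[i] / 2) = (sortKeys S)[i] := by omega
      rw [he, hlab]
      by_cases hsucc : (sortKeys S)[i] + 1 ∈ S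
      · obtain ⟨h₁, h₂⟩ := (succ_mem_iff hs).mp hsucc
        have hlab' := labelIn_getElem (D := D) (lv := lv) (q := q) h₁
        rw [h₂] at hlab'
        rw [dif_pos h₁, hlab']
        simp only [hval _ h₁]
        rw [if_pos h₂]
      · have hn : labelIn D S q lv ((sortKeys S)[i] + 1) = none := if_neg hsucc
        rw [hn]
        split_ifs with h₁
        · simp only [hval _ h₁]
          rw [if_neg fun h₂ => hsucc ((succ_mem_iff hs).mpr ⟨h₁, h₂⟩)]
        · rfl
    · rw [if_neg (by omega)]
      have he : 2 * ((sortKeys S)[i] / 2) + 1 = (sortKeys S)[i] := by omega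
      have he' : 2 * ((sortKeys S)[i] / 2) = (sortKeys S)[i] - 1 := by omega
      rw [he, hlab, he']
      by_cases hpred : (sortKeys S)[i] - 1 ∈ S
      · obtain ⟨h₁, h₂⟩ := (pred_mem_iff hs (by omega)).mp hpred
        rw [if_neg h₁, dif_pos (by omega)]
        simp only [hval _ (show i - 1 < (sortKeys S).length by omega)]
        rw [if_pos h₂, if_pos ⟨h2, hpred⟩]
      · have hn : labelIn D S q lv ((sortKeys S)[i] - 1) = none := if_neg hpred
        rw [hn, if_neg (show ¬((sortKeys S)[i] % 2 = 1 ∧ (sortKeys S)[i] - 1 ∈ S) from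
          fun h => hpred h.2)]
        by_cases h₁ : i = 0
        · rw [if_pos h₁]
        · rw [if_neg h₁, dif_pos (by omega)]
          simp only [hval _ (show i - 1 < (sortKeys S).length by omega)]
          rw [if_neg fun h₂ => hpred ((pred_mem_iff hs (by omega)).mpr ⟨h₁, h₂⟩)]
  · rw [dif_neg hs, dif_neg hs]
    rfl

theorem rank_labels (hk : k < 2 ^ D) (a b : Option (Label D)) :
    (Item.labels (Fin.ofNat _ k) a b : Item D B).rank = k := Nat.mod_eq_of_lt hk

theorem rank_updateEntry {c : ℕ} (hc : c < 2 ^ D) : (updateEntry D B S q lv c).rank =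
    if c % 2 = 1 ∧ c - 1 ∈ S then 2 ^ D else c / 2 := by
  unfold updateEntry
  split_ifs
  · rfl
  · exact rank_labels (by omega) _ _

/-- Halving keys is monotone, so the parents come in order; the dummies do not count. -/
theorem KeyList.semiSorted_convertList (h : KeyList S n l) :
    SemiSorted (convertList lv (placeList q l)) := by
  rw [h.convertList_eq, SemiSorted, realKeys, List.map_append, List.filter_append]
  have : ((List.replicate (n - S.card) (Item.dummy : Item D B)).map Item.rank).filter
      (fun k => k < 2 ^ D) = [] := by
    simp [rank_dummy]
  rw [this, List.append_nil, List.map_map, List.pairwise_filter, List.pairwise_map]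
  refine List.Pairwise.imp_of_mem (fun {a b} ha hb hab h₁ h₂ => ?_) (pairwise_sortKeys S)
  have ha := h.lt a (mem_sortKeys.mp ha)
  have hb := h.lt b (mem_sortKeys.mp hb)
  simp only [Function.comp_apply, rank_updateEntry ha, rank_updateEntry hb,
    decide_eq_true_iff] at h₁ h₂ ⊢
  split_ifs at h₁ h₂ ⊢ <;> omega

/-- Of two siblings in `S` the left one produces the entry of the parent and the right one a dummy;
a child without sibling produces the entry itself. So no parent occurs twice. -/
theorem KeyList.withKey_convertList (h : KeyList S n l) (hk : k < 2 ^ D) :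
    withKey k (convertList lv (placeList q l)) =
      if 2 * k ∈ S ∨ 2 * k + 1 ∈ S then
        [.labels (Fin.ofNat _ k) (labelIn D S q lv (2 * k)) (labelIn D S q lv (2 * k + 1))]
      else [] := by
  rw [h.convertList_eq, withKey_append, withKey_eq_nil (l := List.replicate _ _) (fun x hx => by
    rw [(List.mem_replicate.mp hx).2, rank_dummy]; exact hk.ne'), List.append_nil]
  rw [withKey, List.filter_map]
  have hr : ∀ c ∈ sortKeys S, (updateEntry D B S q lv c).rank =
      if c % 2 = 1 ∧ c - 1 ∈ S then 2 ^ D else c / 2 := fun c hc =>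
    rank_updateEntry (h.lt c (mem_sortKeys.mp hc))
  split_ifs with hc
  · obtain ⟨c, hcS, hc'⟩ : ∃ c ∈ S, ∀ c' ∈ S, (updateEntry D B S q lv c').rank = k ↔ c' = c := by
      by_cases h₀ : 2 * k ∈ S
      · refine ⟨2 * k, h₀, fun c' hc' => ?_⟩
        rw [hr c' (mem_sortKeys.mpr hc')]
        constructor
        · intro h'
          split_ifs at h' with h₁
          · omega
          · by_contra hne
            have : c' - 1 = 2 * k := by omega
            exact h₁ ⟨by omega, this ▸ h₀⟩
        · rintro rfl
          rw [if_neg (by omega)]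
          omega
      · have h₁ := hc.resolve_left h₀
        refine ⟨2 * k + 1, h₁, fun c' hc' => ?_⟩
        rw [hr c' (mem_sortKeys.mpr hc')]
        constructor
        · intro h'
          split_ifs at h' with h₂
          · omega
          · by_contra hne
            have : c' = 2 * k := by omega
            exact h₀ (this ▸ hc')
        · rintro rfl
          rw [if_neg (by simp [h₀])]
          omega
    have hi := List.idxOf_lt_length_iff.mpr (mem_sortKeys.mpr hcS)
    rw [filter_eq_singleton hi, List.getElem_idxOf hi, List.map_singleton]
    · have hrc := (hc' c hcS).mpr rfl
      rw [hr c (mem_sortKeys.mpr hcS)] at hrc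
      rw [updateEntry]
      split_ifs at hrc ⊢
      · omega
      · rw [hrc]
    · intro j hj
      have hjS := mem_sortKeys.mp (List.getElem_mem hj)
      simp only [Function.comp_apply, decide_eq_true_iff, hc' _ hjS]
      constructor
      · intro he
        rw [← he, (nodup_sortKeys S).idxOf_getElem j hj]
      · rintro rfl
        exact List.getElem_idxOf hj
  · rw [List.map_eq_nil_iff, List.filter_eq_nil_iff]
    intro c hcS
    simp only [Function.comp_apply, decide_eq_true_iff, hr c hcS]
    intro h'
    have hcS := mem_sortKeys.mp hcS
    split_ifs at h' with h₁
    · omega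
    · refine hc ?_
      rcases Nat.mod_two_eq_zero_or_one c with h2 | h2
      · exact .inl (by rwa [show 2 * k = c by omega])
      · exact .inr (by rwa [show 2 * k + 1 = c by omega])

end Keys

/-! ## The keys in the levels and the visited places -/

section Model

/-- The keys in all levels of all depths, and the numbers of special dummies that are used up. -/
structure Model : Type where
  full : ℕ → ℕ → Bool
  keys : ℕ → ℕ → Finset ℕ
  used : ℕ → ℕ → ℕ

variable {D : ℕ} {M M' : Model} {a d j k : ℕ}

/-- The number formed by the `d` leading bits of `a`. -/
def prefixOf (D a d : ℕ) : ℕ := a / 2 ^ (D - d)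

theorem prefixOf_lt (h : a < 2 ^ D) (hd : d ≤ D) : prefixOf D a d < 2 ^ d := by
  refine Nat.div_lt_of_lt_mul ?_
  rwa [← pow_add, Nat.sub_add_cancel hd]

theorem prefixOf_succ_div (hd : d + 1 ≤ D) : prefixOf D a (d + 1) / 2 = prefixOf D a d := by
  rw [prefixOf, prefixOf, Nat.div_div_eq_div_mul, ← pow_succ, show D - (d + 1) + 1 = D - d by omega]

/-- The smallest empty level of depth `D`, or `D`. -/
def freeLevel (D : ℕ) (full : ℕ → ℕ → Bool) : ℕ :=
  ((List.range (D + 1)).find? fun j => !full D j).getD D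

/-- The level that is built next. -/
def buildLevel (D : ℕ) (full : ℕ → ℕ → Bool) (d : ℕ) : ℕ := min d (freeLevel D full)

theorem freeLevel_spec (D : ℕ) (full : ℕ → ℕ → Bool) : freeLevel D full ≤ D ∧
    (∀ j < freeLevel D full, full D j = true) ∧
    (freeLevel D full < D → full D (freeLevel D full) = false) := by
  rw [freeLevel]
  rcases h : (List.range (D + 1)).find? fun j => !full D j with _ | i
  · simp only [List.find?_eq_none, List.mem_range, Bool.not_eq_true',
      Bool.not_eq_false] at h
    exact ⟨le_rfl, fun j hj => by simpa using h j (by simp at hj; omega), by simp⟩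
  · rw [List.find?_range_eq_some] at h
    obtain ⟨h₁, h₂, h₃⟩ := h
    simp only [List.mem_range] at h₂
    exact ⟨by simp; omega, fun j hj => by simpa using h₃ j hj, fun _ => by simpa using h₁⟩

/-- The smallest level with key `k`. -/
def Model.loc (M : Model) (d k : ℕ) : Option ℕ :=
  (List.range (d + 1)).find? fun j => k ∈ M.keys d j

theorem Model.loc_eq_some : M.loc d k = some j ↔
    k ∈ M.keys d j ∧ j ≤ d ∧ ∀ i < j, k ∉ M.keys d i := by
  rw [Model.loc, List.find?_range_eq_some]
  simp

theorem Model.loc_eq_none : M.loc d k = none ↔ ∀ j ≤ d, k ∉ M.keys d j := by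
  rw [Model.loc, List.find?_eq_none]
  simp

/-- The keys of a level that is built after a request for `k`. -/
def Model.newKeys (M : Model) (d l k : ℕ) : Finset ℕ :=
  insert k ((Finset.range (l + 1)).biUnion (M.keys d))

theorem Model.mem_newKeys {l c : ℕ} : c ∈ M.newKeys d l k ↔ c = k ∨ ∃ i ≤ l, c ∈ M.keys d i := by
  simp [Model.newKeys]

/-- The special dummies used up after a request. -/
def Model.usedAfter (D : ℕ) (M : Model) (a d j : ℕ) : ℕ :=
  if M.loc d (prefixOf D a d) = some j then M.used d j else M.used d j + 1

/-- The levels after a request. -/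
def Model.step (D : ℕ) (M : Model) (a : ℕ) : Model where
  full d j := if j < buildLevel D M.full d then false else
    if j = buildLevel D M.full d then true else M.full d j
  keys d j := if j < buildLevel D M.full d then ∅ else
    if j = buildLevel D M.full d then M.newKeys d j (prefixOf D a d) else M.keys d j
  used d j := if j = buildLevel D M.full d then 0 else M.usedAfter D a d j

/-- The entry of the one-time memory in level `j` of depth `d` that is visited by a request. -/
def Model.visit (D : ℕ) (M : Model) (a d j : ℕ) : ℕ :=
  if M.loc d (prefixOf D a d) = some j then keyIdx (M.keys d j) (prefixOf D a d)
  else 2 ^ j + M.used d j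

/-- The entries that are visited until the memory is destroyed. -/
def Model.future (D : ℕ) : Model → List ℕ → ℕ → ℕ → List ℕ
  | _, [], _, _ => []
  | M, a :: as, d, j => M.visit D a d j ::
      if j ≤ buildLevel D M.full d then [] else Model.future D (M.step D a) as d j

/-- The properties of the levels that are kept by requests. -/
structure Model.Inv (D : ℕ) (M : Model) : Prop where
  full_le : ∀ d j, M.full d j = true → j ≤ d
  full_of_mem : ∀ d j, ∀ k ∈ M.keys d j, M.full d j = true
  card_le : ∀ d ≤ D, ∀ j, (M.keys d j).card ≤ 2 ^ j
  lt : ∀ d ≤ D, ∀ j, ∀ k ∈ M.keys d j, k < 2 ^ d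
  shape : ∀ d ≤ D, ∀ j < d, M.full d j = M.full D j
  -- The full levels below `j` form a binary counter of the requests since level `j` was built.
  used_le : ∀ d ≤ D, ∀ j, M.full d j = true →
    M.used d j ≤ ∑ i ∈ Finset.range j, if M.full d i then 2 ^ i else 0
  -- Some copy of the parent lies no higher than the child, so a rebuild that moves a child moves
  -- the parent as well.
  parent : ∀ d, d + 1 ≤ D → ∀ j, ∀ k ∈ M.keys (d + 1) j, ∃ i ≤ j, k / 2 ∈ M.keys d i
  root : M.full 0 0 = true → 0 ∈ M.keys 0 0

/-- No keys at all. -/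
def Model.empty : Model := ⟨fun _ _ => false, fun _ _ => ∅, fun _ _ => 0⟩

theorem Model.inv_empty : Model.empty.Inv D := by
  constructor <;> simp [Model.empty]

theorem sum_two_pow_lt (j : ℕ) (p : ℕ → Bool) :
    ∑ i ∈ Finset.range j, (if p i then 2 ^ i else 0) + 1 ≤ 2 ^ j := by
  induction j with
  | zero => simp
  | succ j ih =>
    rw [Finset.sum_range_succ, pow_succ]
    split_ifs <;> omega

theorem Model.Inv.used_lt (h : M.Inv D) (hd : d ≤ D) (hf : M.full d j = true) :
    M.used d j < 2 ^ j :=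
  Nat.lt_of_succ_le ((Nat.succ_le_succ (h.used_le d hd j hf)).trans (sum_two_pow_lt j _))

theorem buildLevel_le (D : ℕ) (full : ℕ → ℕ → Bool) (d : ℕ) : buildLevel D full d ≤ d :=
  min_le_left _ _

theorem Model.Inv.full_of_lt (h : M.Inv D) (hd : d ≤ D) (hj : j < buildLevel D M.full d) :
    M.full d j = true := by
  rw [h.shape d hd j (hj.trans_le (buildLevel_le _ _ _))]
  exact (freeLevel_spec D M.full).2.1 j (hj.trans_le (min_le_right _ _))

theorem Model.Inv.buildLevel_spec (h : M.Inv D) (hd : d ≤ D) :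
    M.full d (buildLevel D M.full d) = false ∨ buildLevel D M.full d = d := by
  rcases lt_or_ge (freeLevel D M.full) d with h' | h'
  · left
    have hl : buildLevel D M.full d = freeLevel D M.full := min_eq_right h'.le
    rw [hl, h.shape d hd _ h']
    exact (freeLevel_spec D M.full).2.2 (h'.trans_le hd)
  · exact .inr (min_eq_left h')

theorem Model.Inv.newKeys_lt (h : M.Inv D) (hd : d ≤ D) (ha : a < 2 ^ D) {l c : ℕ}
    (hc : c ∈ M.newKeys d l (prefixOf D a d)) : c < 2 ^ d := by
  rcases Model.mem_newKeys.mp hc with rfl | ⟨i, -, hi⟩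
  · exact prefixOf_lt ha hd
  · exact h.lt d hd i c hi

/-- If the level was empty, the levels below it hold at most `2 ^ l - 1` keys and the requested one
is added. Otherwise it is the last level of its depth, where only `2 ^ d` addresses exist. -/
theorem Model.Inv.card_newKeys_le (h : M.Inv D) (hd : d ≤ D) (ha : a < 2 ^ D) :
    (M.newKeys d (buildLevel D M.full d) (prefixOf D a d)).card ≤
      2 ^ buildLevel D M.full d := by
  rcases h.buildLevel_spec hd with hl | hl
  · set l := buildLevel D M.full d
    have hl0 : M.keys d l = ∅ := by
      refine Finset.eq_empty_of_forall_notMem fun k hk => ?_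
      rw [h.full_of_mem d l k hk] at hl
      cases hl
    refine (Finset.card_insert_le _ _).trans ?_
    refine (Nat.succ_le_succ Finset.card_biUnion_le).trans ?_
    rw [Finset.sum_range_succ, hl0, Finset.card_empty, add_zero]
    have := sum_two_pow_lt l fun _ => true
    simp only [if_true] at this
    exact (Nat.succ_le_succ (Finset.sum_le_sum fun i _ => h.card_le d hd i)).trans this
  · rw [hl]
    refine (Finset.card_le_card (t := Finset.range (2 ^ d)) fun c hc => ?_).trans (by simp)
    exact Finset.mem_range.mpr (h.newKeys_lt hd ha hc)

/-- A child in the merged levels has its parent in a level that is no higher and is at most `d`;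
hence it is at most the minimum of `d` and the free level and belongs to the merged levels of depth
`d`. -/
theorem Model.Inv.parent_newKeys (h : M.Inv D) (hd : d + 1 ≤ D) {c : ℕ}
    (hc : c ∈ M.newKeys (d + 1) (buildLevel D M.full (d + 1)) (prefixOf D a (d + 1))) :
    c / 2 ∈ M.newKeys d (buildLevel D M.full d) (prefixOf D a d) := by
  rw [Model.mem_newKeys] at hc ⊢
  rcases hc with rfl | ⟨i, hi, hc⟩
  · exact .inl (prefixOf_succ_div hd)
  · obtain ⟨i', hi', hc'⟩ := h.parent d hd i c hc
    have := h.full_le d i' (h.full_of_mem d i' _ hc')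
    simp only [buildLevel] at hi ⊢
    exact .inr ⟨i', by omega, hc'⟩

theorem Model.Inv.step (h : M.Inv D) (ha : a < 2 ^ D) : (M.step D a).Inv D := by
  have hbl := buildLevel_le D M.full
  constructor
  · intro d j hf
    simp only [Model.step] at hf
    split_ifs at hf with h₁ h₂
    · exact h₂ ▸ hbl d
    · exact h.full_le d j hf
  · intro d j k hk
    simp only [Model.step] at hk ⊢
    split_ifs at hk ⊢ with h₁ h₂
    · simp at hk
    · rfl
    · exact h.full_of_mem d j k hk
  · intro d hd j
    simp only [Model.step]
    split_ifs with h₁ h₂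
    · simp
    · subst h₂
      exact h.card_newKeys_le hd ha
    · exact h.card_le d hd j
  · intro d hd j k hk
    simp only [Model.step] at hk
    split_ifs at hk with h₁ h₂
    · simp at hk
    · exact h.newKeys_lt hd ha hk
    · exact h.lt d hd j k hk
  · intro d hd j hj
    have hs := h.shape d hd j hj
    have h₁ : j < buildLevel D M.full d ↔ j < buildLevel D M.full D := by
      simp only [buildLevel]
      omega
    have h₂ : j = buildLevel D M.full d ↔ j = buildLevel D M.full D := by
      simp only [buildLevel]
      omega
    simp only [Model.step, hs, h₁, h₂]
  · intro d hd j hf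
    have hl := h.buildLevel_spec hd
    have hfl := fun i (hi : i < buildLevel D M.full d) => h.full_of_lt hd hi
    obtain ⟨l, hle⟩ : ∃ l, buildLevel D M.full d = l := ⟨_, rfl⟩
    simp only [Model.step, hle] at hf hl hfl ⊢
    split_ifs at hf ⊢ with h₁ h₂
    · simp
    · have hjd := h.full_le d j hf
      have hlj : l < j := by omega
      have hl' : M.full d l = false := by
        rcases hl with hl | hl
        · exact hl
        · omega
      have hu : M.usedAfter D a d j ≤ M.used d j + 1 := by
        unfold Model.usedAfter
        split_ifs <;> omega
      refine hu.trans ((Nat.succ_le_succ (h.used_le d hd j hf)).trans ?_)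
      rw [← Finset.sum_range_add_sum_Ico _ (show l + 1 ≤ j by omega),
        ← Finset.sum_range_add_sum_Ico _ (show l + 1 ≤ j by omega), Finset.sum_range_succ,
        Finset.sum_range_succ, hl']
      have e₁ : ∑ i ∈ Finset.Ico (l + 1) j, (if (if i < l then false else if i = l then true else
          M.full d i) = true then 2 ^ i else 0) =
          ∑ i ∈ Finset.Ico (l + 1) j, if M.full d i = true then 2 ^ i else 0 := by
        refine Finset.sum_congr rfl fun i hi => ?_
        have := (Finset.mem_Ico.mp hi).1
        rw [if_neg (show ¬ i < l by omega), if_neg (show ¬ i = l by omega)]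
      rw [e₁]
      -- One tick of the counter: the levels below `l`, worth at most `2 ^ l - 1`, are emptied and
      -- the empty level `l` becomes full. This makes up for one more special dummy.
      have e₂ := sum_two_pow_lt l fun i => M.full d i
      simp only [lt_irrefl, if_false, if_true, Bool.false_eq_true]
      omega
  · intro d hd j k hk
    have hll : buildLevel D M.full d ≤ buildLevel D M.full (d + 1) := by
      simp only [buildLevel]
      omega
    simp only [Model.step] at hk
    split_ifs at hk with h₁ h₂
    · simp at hk
    · subst h₂
      refine ⟨_, hll, ?_⟩
      simp only [Model.step, lt_irrefl, if_false, if_true]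
      exact h.parent_newKeys hd hk
    · obtain ⟨i, hi, hk'⟩ := h.parent d hd j k hk
      rcases le_or_gt i (buildLevel D M.full d) with hi' | hi'
      · refine ⟨buildLevel D M.full d, by omega, ?_⟩
        simp only [Model.step, lt_irrefl, if_false, if_true]
        exact Model.mem_newKeys.mpr (.inr ⟨i, hi', hk'⟩)
      · refine ⟨i, hi, ?_⟩
        simp only [Model.step]
        rwa [if_neg (by omega), if_neg (by omega)]
  · intro _
    have h0 : buildLevel D M.full 0 = 0 := Nat.le_zero.mp (hbl 0)
    simp only [Model.step, h0, lt_irrefl, if_false, if_true]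
    refine Model.mem_newKeys.mpr (.inl ?_)
    have := prefixOf_lt ha (Nat.zero_le D)
    simp at this
    exact this.symm

theorem Model.Inv.visit_lt (h : M.Inv D) (hd : d ≤ D) (hf : M.full d j = true) :
    M.visit D a d j < 2 * 2 ^ j := by
  rw [Model.visit]
  split_ifs with hl
  · have := keyIdx_lt (Model.loc_eq_some.mp hl).1
    have := h.card_le d hd j
    omega
  · have := h.used_lt hd hf
    omega

/-- No entry is visited twice. -/
theorem Model.Inv.future_spec (h : M.Inv D) {as : List ℕ} (has : ∀ a ∈ as, a < 2 ^ D)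
    (hd : d ≤ D) (hf : M.full d j = true) : (M.future D as d j).Nodup ∧
      ∀ v ∈ M.future D as d j, v < 2 * 2 ^ j ∧
        ((∃ k ∈ M.keys d j, (∀ i < j, k ∉ M.keys d i) ∧ v = keyIdx (M.keys d j) k) ∨
          2 ^ j + M.used d j ≤ v) := by
  induction as generalizing M with
  | nil => simp [Model.future]
  | cons a as ih =>
    have hv : M.visit D a d j < 2 * 2 ^ j ∧ ((∃ k ∈ M.keys d j, (∀ i < j, k ∉ M.keys d i) ∧
        M.visit D a d j = keyIdx (M.keys d j) k) ∨ 2 ^ j + M.used d j ≤ M.visit D a d j) := by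
      refine ⟨h.visit_lt hd hf, ?_⟩
      rw [Model.visit]
      split_ifs with hl
      · obtain ⟨h₁, -, h₂⟩ := Model.loc_eq_some.mp hl
        exact .inl ⟨_, h₁, h₂, rfl⟩
      · exact .inr le_rfl
    rw [Model.future]
    split_ifs with hj
    · simpa using hv
    · rw [not_le] at hj
      have ha := has a (by simp)
      have hf' : (M.step D a).full d j = true := by
        simp only [Model.step]
        rwa [if_neg (by omega), if_neg (by omega)]
      have hk' : (M.step D a).keys d j = M.keys d j := by
        simp only [Model.step]
        rw [if_neg (by omega), if_neg (by omega)]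
      have hu' : (M.step D a).used d j = M.usedAfter D a d j := by
        simp only [Model.step]
        rw [if_neg (by omega)]
      obtain ⟨hnd, hall⟩ := ih (h.step ha) (fun b hb => has b (by simp [hb])) hf'
      rw [hk', hu'] at hall
      -- The request puts its key into the level `buildLevel`, below `j`. A key that is absent below
      -- `j` afterwards is therefore not the requested one, and it was absent below `j` before.
      have hmono : ∀ k, (∀ i < j, k ∉ (M.step D a).keys d i) →
          k ≠ prefixOf D a d ∧ ∀ i < j, k ∉ M.keys d i := by
        intro k hk
        have hkl := hk _ hj
        simp only [Model.step, lt_irrefl, if_false, if_true, Model.mem_newKeys, not_or,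
          not_exists, not_and] at hkl
        refine ⟨hkl.1, fun i hi hki => ?_⟩
        rcases le_or_gt i (buildLevel D M.full d) with hil | hil
        · exact hkl.2 i hil hki
        · refine hk i hi ?_
          simp only [Model.step]
          rwa [if_neg (by omega), if_neg (by omega)]
      refine ⟨List.nodup_cons.mpr ⟨fun hmem => ?_, hnd⟩, fun v hv' => ?_⟩
      -- Real entries lie below `2 ^ j` and special dummies from there on, so a repetition would be
      -- within one kind. Two real visits belong to different keys by `hmono`, and after a dummy
      -- visit the counter has gone up.
      · obtain ⟨-, ⟨k, hk, hk₂, hv'⟩ | hv'⟩ := hall _ hmem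
        · have hk₃ := hmono k hk₂
          rw [Model.visit] at hv'
          split_ifs at hv' with hl
          · exact hk₃.1 (keyIdx_inj hk hv'.symm)
          · have := keyIdx_lt hk
            have := h.card_le d hd j
            omega
        · rw [Model.visit, Model.usedAfter] at hv'
          split_ifs at hv' with hl
          · have := keyIdx_lt (Model.loc_eq_some.mp hl).1
            have := h.card_le d hd j
            omega
          · omega
      · rcases List.mem_cons.mp hv' with rfl | hv'
        · exact hv
        · obtain ⟨h₁, ⟨k, hk, hk₂, hv'⟩ | hv'⟩ := hall _ hv'
          · exact ⟨h₁, .inl ⟨k, hk, (hmono k hk₂).2, hv'⟩⟩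
          · refine ⟨h₁, .inr (le_trans ?_ hv')⟩
            unfold Model.usedAfter
            split_ifs <;> omega

theorem Model.full_step (h : M.full = M'.full) (a a' : ℕ) :
    (M.step D a).full = (M'.step D a').full := by
  simp only [Model.step, h]

/-- Which levels are full depends on the number of requests only, never on their addresses. So
corresponding levels have equally many visits before they are destroyed, and these can be paired. -/
theorem Model.length_future {as as' : List ℕ} (h : M.full = M'.full)
    (hl : as.length = as'.length) (d j : ℕ) :
    (M.future D as d j).length = (M'.future D as' d j).length := by
  induction as generalizing M M' as' with
  | nil =>
    obtain rfl : as' = [] := List.length_eq_zero_iff.mp hl.symm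
    rfl
  | cons a as ih =>
    rcases as' with _ | ⟨a', as'⟩
    · simp at hl
    · rw [Model.future, Model.future, h]
      split_ifs
      · rfl
      · simp only [List.length_cons]
        rw [ih (Model.full_step h a a') (by simpa using hl)]

end Model

open Client

/-! ## Lookups -/

section Lookups

variable {D B : ℕ} {F : BlockFormat D B} {s : Fin 3} {m m' m₀ m₀' : Memory F.width}
  {st : ℕ → Levels} {M M' : Model} {lst lst' : ℕ → ℕ → List (Item D B)}
  {q q' : ℕ → ℕ → Fin 3 → ℕ → ℕ} {a a' d j k : ℕ}

/-- The position label of the block with key `k` of depth `d`. -/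
def Model.label (M : Model) (D : ℕ) (q : ℕ → ℕ → Fin 3 → ℕ → ℕ) (d k : ℕ) : Option (Label D) :=
  (M.loc d k).map fun j => ⟨Fin.ofNat _ j, posOf D (q d j) (keyIdx (M.keys d j) k)⟩

variable (F) in
/-- The one-time memories `st` hold the lists `lst`, permuted by `q`, with the keys of `M`. -/
structure Consistent (m : Memory F.width) (st : ℕ → Levels) (M : Model)
    (lst : ℕ → ℕ → List (Item D B)) (q : ℕ → ℕ → Fin 3 → ℕ → ℕ) : Prop where
  shape : ∀ d ≤ D, ∀ j, (st d j).isSome = M.full d j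
  holds : ∀ d ≤ D, ∀ j, ∀ o ∈ st d j, OTMHolds F m o (lst d j) (q d j) (M.used d j)
  sep : ∀ d ≤ D, ∀ j, ∀ o ∈ st d j, ∀ d' ≤ D, ∀ j', ∀ o' ∈ st d' j', (d, j) ≠ (d', j') →
    o.dpos.cell 0 ∉ o'.cells
  list : ∀ d ≤ D, ∀ j, M.full d j = true → KeyList (M.keys d j) (2 ^ j) (lst d j)

/-- The same levels with other numbers of used special dummies. -/
def Model.withUsed (M : Model) (u : ℕ → ℕ → ℕ) : Model := { M with used := u }

theorem Consistent.congr_used {u : ℕ → ℕ → ℕ} (h : Consistent F m st M lst q)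
    (hu : ∀ d ≤ D, ∀ j, M.full d j = true → M.used d j = u d j) :
    Consistent F m st (M.withUsed u) lst q where
  shape := h.shape
  holds d hd j o ho := by
    have := h.holds d hd j o ho
    rwa [hu d hd j (by rw [← h.shape d hd j, Option.mem_def.mp ho]; rfl)] at this
  sep := h.sep
  list := h.list

theorem Consistent.ext {C : Set ℕ} (h : Consistent F m st M lst q) (e : m.Ext C m')
    (hC : ∀ d ≤ D, ∀ j, ∀ o ∈ st d j, ∀ x ∈ o.cells, x ∉ C) : Consistent F m' st M lst q :=
  ⟨h.shape, fun d hd j o ho => (h.holds d hd j o ho).ext e (hC d hd j o ho), h.sep, h.list⟩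

theorem Consistent.ext_empty (h : Consistent F m st M lst q) (e : m.Ext ∅ m') :
    Consistent F m' st M lst q := h.ext e fun _ _ _ _ _ _ _ => id

/-- The cells of the heads of the lists of special dummies. -/
def headCells (D : ℕ) (st : ℕ → Levels) : Set ℕ :=
  {c | ∃ d ≤ D, ∃ j, ∃ o ∈ st d j, o.dpos.cell 0 = c}

/-- The request to level `j`. -/
def Model.request (M : Model) (D : ℕ) (q : ℕ → ℕ → Fin 3 → ℕ → ℕ) (d k j : ℕ) :
    Option (Pos D) :=
  if M.loc d k = some j then some (posOf D (q d j) (keyIdx (M.keys d j) k)) else none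

/-- One round of `posLookup`. -/
def lookupRound (F : BlockFormat D B) (levels : Levels) (lab : Option (Label D))
    (v : Item D B) (j : ℕ) : Client F.width (Item D B) :=
  match levels j with
  | none => pure v
  | some o =>
      match lab.filter fun lb => lb.level.val == j with
      | some lb => o.lookup F (some lb.pos)
      | none => do
          let _ ← o.lookup F none
          pure v

/-- In terms of `request` a round is one lookup in either case; only the use of its result depends
on the kind of request. -/
theorem lookupRound_some {levels : Levels} {o : OTM} (ho : levels j = some o) (hd : d ≤ D)
    (v : Item D B) : lookupRound F levels (M.label D q d k) v j = (do
      let x ← o.lookup F (M.request D q d k j)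
      pure (if (M.request D q d k j).isSome then x else v)) := by
  rw [lookupRound, ho]
  have hf : ((M.label D q d k).filter fun lb => lb.level.val == j).map Label.pos =
      M.request D q d k j := by
    rw [Model.label, Model.request]
    rcases hl : M.loc d k with _ | i
    · simp
    · have hi := (Model.loc_eq_some.mp hl).2.1
      have hv : (Fin.ofNat (D + 1) i).val = i := Nat.mod_eq_of_lt (by omega)
      by_cases hij : i = j
      · subst hij
        rw [Option.map_some, Option.filter_some, if_pos (by simpa using hv), if_pos rfl]
        rfl
      · rw [Option.map_some, Option.filter_some, if_neg (by rw [hv]; simpa using hij),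
          if_neg (by simpa using hij)]
        rfl
  rw [← hf]
  dsimp only
  generalize (M.label D q d k).filter (fun lb => lb.level.val == j) = r
  rcases r with _ | lb
  · rfl
  · simp

/-- The found item. -/
def Model.item (M : Model) (lst : ℕ → ℕ → List (Item D B)) (d k : ℕ) : Item D B :=
  match M.loc d k with
  | some i => (lst d i).getD (keyIdx (M.keys d i) k) .dummy
  | none => .dummy

/-- The numbers of used special dummies after the first `n` lookups at depth `d`, and those at
smaller depths. -/
def Model.usedBefore (M : Model) (D a d n d' j : ℕ) : ℕ :=
  if d' < d ∨ d' = d ∧ j < n then M.usedAfter D a d' j else M.used d' j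

variable (F) in
/-- The state after `n` rounds of `posLookup`. -/
structure LookupInv (m₀ : Memory F.width) (st : ℕ → Levels) (M : Model)
    (lst : ℕ → ℕ → List (Item D B)) (q : ℕ → ℕ → Fin 3 → ℕ → ℕ) (a d n : ℕ) (v : Item D B)
    (m : Memory F.width) : Prop where
  ext : m₀.Ext (headCells D st) m
  consistent : Consistent F m st (M.withUsed (M.usedBefore D a d n)) lst q
  item : v = if ∃ i < n, M.loc d (prefixOf D a d) = some i then M.item lst d (prefixOf D a d)
    else .dummy

theorem LookupInv.full {v : Item D B} (h : LookupInv F m₀ st M lst q a d j v m) (hd : d ≤ D)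
    (j' : ℕ) : (st d j').isSome = M.full d j' := h.consistent.shape d hd j'

theorem LookupInv.visits {v : Item D B} {o : OTM} (h : LookupInv F m₀ st M lst q a d j v m)
    (hM : M.Inv D) (hd : d ≤ D) (ho : st d j = some o) :
    M.full d j = true ∧ OTMHolds F m o (lst d j) (q d j) (M.used d j) ∧
      Visits D (q d j) (lst d j).length (M.used d j)
        (M.request D q d (prefixOf D a d) j) (M.visit D a d j) := by
  have hf : M.full d j = true := by
    rw [← h.full hd j, ho]
    rfl
  have hu : M.usedBefore D a d j d j = M.used d j := if_neg (by omega)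
  have hO := h.consistent.holds d hd j o ho
  change OTMHolds F m o (lst d j) (q d j) (M.usedBefore D a d j d j) at hO
  rw [hu] at hO
  refine ⟨hf, hO, ?_⟩
  have hl := h.consistent.list d hd j hf
  rw [hl.length_eq, Model.request, Model.visit]
  split_ifs with h'
  · exact .inl ⟨rfl, (keyIdx_lt (Model.loc_eq_some.mp h').1).trans_le hl.card_le⟩
  · exact .inr ⟨rfl, rfl, hM.used_lt hd hf⟩

theorem LookupInv.sure {v : Item D B} (h : LookupInv F m₀ st M lst q a d j v m) (hM : M.Inv D)
    (hd : d ≤ D) :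
    (lookupRound F (st d) (M.label D q d (prefixOf D a d)) v j).Sure m
      (LookupInv F m₀ st M lst q a d (j + 1)) := by
  have hloc : (∃ i < j + 1, M.loc d (prefixOf D a d) = some i) ↔
      (∃ i < j, M.loc d (prefixOf D a d) = some i) ∨ M.loc d (prefixOf D a d) = some j := by
    constructor
    · rintro ⟨i, hi, hl⟩
      rcases Nat.lt_succ_iff_lt_or_eq.mp hi with hi | rfl
      · exact .inl ⟨i, hi, hl⟩
      · exact .inr hl
    · rintro (⟨i, hi, hl⟩ | hl)
      · exact ⟨i, by omega, hl⟩
      · exact ⟨j, by omega, hl⟩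
  rcases ho : st d j with _ | o
  · rw [lookupRound, ho]
    have hf : M.full d j = false := by
      have := h.consistent.shape d hd j
      rw [ho] at this
      exact this.symm
    have hl : M.loc d (prefixOf D a d) ≠ some j := fun hl => by
      rw [hM.full_of_mem d j _ (Model.loc_eq_some.mp hl).1] at hf
      cases hf
    refine Sure.pure ⟨h.ext, ?_, ?_⟩
    · refine h.consistent.congr_used fun d' hd' j' hf' => ?_
      have hf' : M.full d' j' = true := hf'
      simp only [Model.withUsed, Model.usedBefore]
      have : ¬ (d' = d ∧ j' = j) := by
        rintro ⟨rfl, rfl⟩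
        exact Bool.false_ne_true (hf.symm.trans hf')
      split_ifs <;> first | rfl | omega
    · have := h.item
      simp only [hloc, hl, or_false]
      exact this
  · rw [lookupRound_some ho hd]
    obtain ⟨hf, hO, hv⟩ := h.visits hM hd ho
    refine (sure_lookup hO hv).bind fun x m₁ ⟨e₁, hO₁, hx⟩ => Sure.pure ⟨?_, ⟨?_, ?_, ?_, ?_⟩, ?_⟩
    · exact h.ext.trans_same (e₁.mono fun c hc _ => ⟨d, hd, j, o, ho, hc.symm⟩)
    · exact h.consistent.shape
    · intro d' hd' j' o' ho'
      by_cases hdj : (d, j) = (d', j')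
      · obtain ⟨rfl, rfl⟩ := Prod.mk.inj hdj
        obtain rfl : o = o' := Option.some.inj (ho.symm.trans ho')
        have hu' : RecORAM.usedAfter (M.used d j) (M.request D q d (prefixOf D a d) j) =
            M.usedBefore D a d (j + 1) d j := by
          have hb : M.usedBefore D a d (j + 1) d j = M.usedAfter D a d j :=
            if_pos (.inr ⟨rfl, Nat.lt_succ_self j⟩)
          rw [hb, Model.usedAfter]
          by_cases hl : M.loc d (prefixOf D a d) = some j
          · have hr : M.request D q d (prefixOf D a d) j = some _ := if_pos hl
            rw [hr, if_pos hl]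
            rfl
          · have hr : M.request D q d (prefixOf D a d) j = none := if_neg hl
            rw [hr, if_neg hl]
            rfl
        rw [hu'] at hO₁
        exact hO₁
      -- The lookup rewrites only the head cell of `o`, which by `sep` belongs to no other one-time
      -- memory.
      · have := (h.consistent.holds d' hd' j' o' ho').ext e₁ fun x hx hx' => by
          rw [Set.mem_singleton_iff.mp hx'] at hx
          exact h.consistent.sep d hd j o ho d' hd' j' o' ho' hdj hx
        convert this using 1
        simp only [Model.withUsed, Model.usedBefore]
        have : ¬ (d' = d ∧ j' = j) := by
          rintro ⟨rfl, rfl⟩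
          exact hdj rfl
        split_ifs <;> first | rfl | omega
    · exact h.consistent.sep
    · exact h.consistent.list
    · simp only [hloc]
      by_cases hl : M.loc d (prefixOf D a d) = some j
      · have hr : M.request D q d (prefixOf D a d) j =
            some (posOf D (q d j) (keyIdx (M.keys d j) (prefixOf D a d))) := if_pos hl
        have hx := hx (by rw [hr]; rfl)
        rw [Model.visit, if_pos hl] at hx
        rw [hr, if_pos (by rfl), if_pos (.inr hl), hx, Model.item, hl]
      · have hr : M.request D q d (prefixOf D a d) j = none := if_neg hl
        have := h.item
        simp only [hr, hl, or_false]
        exact this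

theorem LookupInv.rel {v v' : Item D B} (h : LookupInv F m₀ st M lst q a d j v m)
    (h' : LookupInv F m₀' st M' lst' q' a' d j v' m') (hM : M.Inv D) (hM' : M'.Inv D)
    (hd : d ≤ D)
    (hq : M.full d j = true → q d j s (M.visit D a d j) = q' d j s (M'.visit D a' d j))
    (e : Eqv s m m') :
    Rel s (lookupRound F (st d) (M.label D q d (prefixOf D a d)) v j) m
      (lookupRound F (st d) (M'.label D q' d (prefixOf D a' d)) v' j) m'
      fun _ n _ n' => Eqv s n n' := by
  rcases ho : st d j with _ | o
  · rw [lookupRound, lookupRound, ho]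
    exact Rel.pure e
  · rw [lookupRound_some ho hd, lookupRound_some ho hd]
    obtain ⟨hf, hO, hv⟩ := h.visits hM hd ho
    obtain ⟨-, hO', hv'⟩ := h'.visits hM' hd ho
    refine (rel_lookup hO hO' hv hv' (hq hf) e).bind ?_
    rintro _ _ _ _ e
    exact Rel.pure e

theorem LookupInv.zero (h : Consistent F m st (M.withUsed (M.usedBefore D a d 0)) lst q) :
    LookupInv F m st M lst q a d 0 .dummy m :=
  ⟨.refl _ _, h, (if_neg (by simp)).symm⟩

theorem sure_posLookup (h : Consistent F m st (M.withUsed (M.usedBefore D a d 0)) lst q)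
    (hM : M.Inv D) (hd : d ≤ D) :
    (posLookup F d (st d) (M.label D q d (prefixOf D a d))).Sure m
      (LookupInv F m st M lst q a d (d + 1)) :=
  Sure.foldlM_range (LookupInv F m st M lst q a d) (.zero h)
    fun _ _ _ _ h => h.sure hM hd

theorem rel_posLookup (h : Consistent F m st (M.withUsed (M.usedBefore D a d 0)) lst q)
    (h' : Consistent F m' st (M'.withUsed (M'.usedBefore D a' d 0)) lst' q')
    (hM : M.Inv D) (hM' : M'.Inv D) (hd : d ≤ D) (hq : ∀ j, M.full d j = true →
      q d j s (M.visit D a d j) = q' d j s (M'.visit D a' d j)) (e : Eqv s m m') :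
    Rel s (posLookup F d (st d) (M.label D q d (prefixOf D a d))) m
      (posLookup F d (st d) (M'.label D q' d (prefixOf D a' d))) m'
      fun _ n _ n' => Eqv s n n' := by
  refine (Rel.foldlM_range (fun j v n v' n' => Eqv s n n' ∧ LookupInv F m st M lst q a d j v n ∧
    LookupInv F m' st M' lst' q' a' d j v' n') ⟨e, .zero h, .zero h'⟩ ?_).mono
    fun _ _ _ _ h => h.1
  rintro j - v n v' n' ⟨e, h, h'⟩
  exact (h.rel h' hM hM' hd (hq j) e).and_sure (h.sure hM hd) (h'.sure hM' hd)

theorem LookupInv.item_eq {v : Item D B} (h : LookupInv F m₀ st M lst q a d (d + 1) v m) :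
    v = M.item lst d (prefixOf D a d) := by
  rw [h.item]
  split_ifs with hl
  · rfl
  · rw [Model.item]
    rcases hl' : M.loc d (prefixOf D a d) with _ | i
    · rfl
    · exact absurd ⟨i, Nat.lt_succ_of_le (Model.loc_eq_some.mp hl').2.1, hl'⟩ hl

/-! ### The fetch phase -/

/-- The labels of the children in the entries of depth `d`. -/
def LabelsAt (D B : ℕ) (M : Model) (lst : ℕ → ℕ → List (Item D B))
    (q : ℕ → ℕ → Fin 3 → ℕ → ℕ) (d : ℕ) : Prop :=
  ∀ k, (M.loc d k).isSome → M.item lst d k =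
    .labels (Fin.ofNat _ k) (M.label D q (d + 1) (2 * k)) (M.label D q (d + 1) (2 * k + 1))

theorem Consistent.rank_item (h : Consistent F m st M lst q) (hM : M.Inv D) (hd : d ≤ D) :
    (M.item lst d k).rank = if (M.loc d k).isSome then k else 2 ^ D := by
  rw [Model.item]
  rcases hl : M.loc d k with _ | j
  · rfl
  · have hk := (Model.loc_eq_some.mp hl).1
    have hL := h.list d hd j (hM.full_of_mem d j k hk)
    have hi : keyIdx (M.keys d j) k < (lst d j).length :=
      hL.length_eq ▸ (keyIdx_lt hk).trans_le hL.card_le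
    dsimp only
    rw [List.getD_eq_getElem _ _ hi, if_pos (by rfl)]
    exact (hL.rank_getElem_iff hi (hL.lt k hk)).mpr ⟨hk, rfl⟩

/-- Every key has its parent at the preceding depth, so a block that was never accessed has no
accessed child. This makes the empty labels of a new block correct. -/
theorem Model.Inv.label_child_eq_none (hM : M.Inv D) (hd : d + 1 ≤ D) {c : ℕ} (hc : c / 2 = k)
    (hk : M.loc d k = none) : M.label D q (d + 1) c = none := by
  rw [Model.label, Option.map_eq_none_iff, Model.loc_eq_none]
  intro j _ hj
  obtain ⟨i, -, hi⟩ := hM.parent d hd j c hj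
  rw [hc] at hi
  exact Model.loc_eq_none.mp hk i (hM.full_le d i (hM.full_of_mem d i k hi)) hi

/-- The block that is found, or a new one. -/
def foundItem (D : ℕ) (x : Item D B) (key : Fin (2 ^ D)) (d : ℕ) : Item D B :=
  if x.isReal then x else if d < D then .labels key none none else .data key 0

/-- The block that is put back. -/
def storedItem (D : ℕ) (found : Item D B) (r : Request D B) (d : ℕ) : Item D B :=
  if d < D then found else .data (truncate r.addr d) (r.newValue found.value)

/-- The label of the requested block of depth `d`. -/
def nextLabel (F : BlockFormat D B) (st : ℕ → Levels) (x : Item D B) (r : Request D B) (d : ℕ) :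
    Client F.width (Option (Label D)) :=
  if d = 0 then rootLabel F (st 0) else pure (x.childLabel ((truncate r.addr d).val % 2))

/-- The one-time memory of size one for a block. -/
@[irreducible] def buildSingle (F : BlockFormat D B) (x : Item D B) : Client F.width OTM := do
  let T ← newArr 1
  secretWrite F T 0 x
  let r ← build F T
  pure r.1

/-- One round of the fetch phase. -/
def fetchRound (F : BlockFormat D B) (st : ℕ → Levels) (r : Request D B)
    (s : Item D B × Levels) (d : ℕ) : Client F.width (Item D B × Levels) := do
  let lab ← nextLabel F st s.1 r d
  let x ← posLookup F d (st d) lab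
  let o ← buildSingle F (storedItem D (foundItem D x (truncate r.addr d) d) r d)
  pure (foundItem D x (truncate r.addr d) d, Function.update s.2 d (some o))

theorem fetchPhase_eq (st : ℕ → Levels) (r : Request D B) : fetchPhase F st r = (do
    let x ← (List.range (D + 1)).foldlM (fetchRound F st r) (.dummy, fun _ => none)
    pure (x.1.value, x.2)) := by
  unfold fetchPhase
  congr 1
  congr 1
  funext s d
  simp only [fetchRound, buildSingle, bind_assoc, pure_bind]
  rcases em (d = 0) with h | h
  · simp only [nextLabel, if_pos h]
    rfl
  · simp only [nextLabel, if_neg h]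
    rfl

end Lookups

open Client

section Fetch

variable {D B : ℕ} {F : BlockFormat D B} {s : Fin 3} {m m' m₀ m₀' : Memory F.width}
  {st : ℕ → Levels} {M M' : Model} {lst lst' : ℕ → ℕ → List (Item D B)}
  {q q' : ℕ → ℕ → Fin 3 → ℕ → ℕ} {a a' d j k n : ℕ} {r r' : Request D B} {x y : Item D B}

theorem sure_newSingle (x : Item D B) : (newArr 1 >>= fun T => secretWrite F T 0 x >>= fun _ =>
    (pure T : Client F.width Arr)).Sure m fun T m' => m.Ext ∅ m' ∧ HoldsList F m' T [x] := by
  refine (sure_newArr _).bind fun T m₁ ⟨hl, hf, e₁⟩ => ?_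
  refine (sure_secretWrite _ _ _).bind fun _ m₂ ⟨e₂, h₂⟩ => Sure.pure ⟨?_, ?_⟩
  · refine e₁.of_fresh le_rfl hf (e₂.mono fun c hc _ => ?_)
    rw [Set.mem_singleton_iff.mp hc]
    exact Arr.cell_mem (by omega)
  · refine Holds.toList (by simpa using hl) fun i hi => ?_
    obtain rfl : i = 0 := by simpa using hi
    exact ⟨(hf.high 0 (by omega)).trans_le e₂.next, h₂⟩

theorem buildSingle_eq (x : Item D B) : buildSingle F x =
    (newArr 1 >>= fun T => secretWrite F T 0 x >>= fun _ => (pure T : Client F.width Arr)) >>=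
      fun T => build F T >>= fun r => pure r.1 := by
  simp only [buildSingle, bind_assoc, pure_bind]

theorem sure_buildSingle (x : Item D B) : (buildSingle F x).Sure m fun o m' => m.Ext ∅ m' ∧
    (∀ c ∈ o.cells, m.next ≤ c) ∧ ∃ q c, OTMHolds F m' o [x] q c := by
  rw [buildSingle_eq]
  refine (sure_newSingle x).bind fun T m₁ ⟨e₁, hT⟩ => ?_
  refine (sure_build hT le_rfl ?_).bind fun r m₂ ⟨e₂, hc, q, h, _⟩ =>
    Sure.pure ⟨e₁.trans_same e₂, fun c h => e₁.next.trans (hc c h), q, 0, h⟩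
  rw [pow_succ]
  have := Nat.one_le_two_pow (n := D)
  simp
  omega

/-- No entries are paired, because this memory is never looked up: the shuffle only unpermutes it.
-/
theorem rel_buildSingle (x y : Item D B) (e : Eqv s m m') :
    Rel s (buildSingle F x) m (buildSingle F y) m' fun o n o' n' => Eqv s n n' ∧ o = o' := by
  rw [buildSingle_eq, buildSingle_eq]
  have hO : Obl s (newArr 1 >>= fun T => secretWrite F T 0 x >>= fun _ =>
      (pure T : Client F.width Arr)) (newArr 1 >>= fun T => secretWrite F T 0 y >>= fun _ =>
      (pure T : Client F.width Arr)) Eq := by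
    refine Obl.bind (Obl.newArr 1) ?_
    rintro T _ rfl
    exact Obl.bind (obl_secretWrite _ _ _ _) fun _ _ _ => Obl.pure rfl
  refine ((Rel.of_obl hO e).and_sure (sure_newSingle x) (sure_newSingle y)).bind ?_
  rintro T m₁ _ m₁' ⟨⟨e, rfl⟩, ⟨-, hT⟩, -, hT'⟩
  refine (rel_build (v := []) (v' := []) hT hT' le_rfl ?_ .nil .nil (by simp) (by simp) rfl
    e).bind ?_
  · rw [pow_succ]
    have := Nat.one_le_two_pow (n := D)
    simp
    omega
  · rintro r m₂ _ m₂' ⟨e, rfl, -⟩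
    exact Rel.pure ⟨e, rfl⟩

/-- The fetched block of depth `d`. -/
structure IsFetched (D B : ℕ) (M : Model) (q : ℕ → ℕ → Fin 3 → ℕ → ℕ) (k d : ℕ) (x : Item D B) :
    Prop where
  rank : x.rank = k
  labels : d < D → x =
    .labels (Fin.ofNat _ k) (M.label D q (d + 1) (2 * k)) (M.label D q (d + 1) (2 * k + 1))

variable (F) in
/-- The state of the fetch phase after `n` rounds. -/
structure FetchInv (m₀ : Memory F.width) (st : ℕ → Levels) (M : Model)
    (lst : ℕ → ℕ → List (Item D B)) (q : ℕ → ℕ → Fin 3 → ℕ → ℕ) (a n : ℕ) (s : Item D B × Levels)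
    (m : Memory F.width) : Prop where
  ext : m₀.Ext (headCells D st) m
  consistent : Consistent F m st (M.withUsed (M.usedBefore D a n 0)) lst q
  label : n ≠ 0 → n ≤ D →
    s.1.childLabel (prefixOf D a n % 2) = M.label D q n (prefixOf D a n)
  fetched : ∀ d < n, ∃ o x q' c, s.2 d = some o ∧ OTMHolds F m o [x] q' c ∧
    IsFetched D B M q (prefixOf D a d) d x
  low : ∀ d < n, ∀ o ∈ s.2 d, ∀ c ∈ o.cells, m₀.next ≤ c

theorem Consistent.headCells_lt (h : Consistent F m st M lst q) :
    ∀ c ∈ headCells D st, c < m.next := by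
  rintro c ⟨d, hd, j, o, ho, rfl⟩
  exact (h.holds d hd j o ho).high

theorem loc_zero (hM : M.Inv D) (h : M.full 0 0 = true) : M.loc 0 0 = some 0 :=
  Model.loc_eq_some.mpr ⟨hM.root h, le_rfl, by simp⟩

theorem prefixOf_zero (ha : a < 2 ^ D) : prefixOf D a 0 = 0 := by
  simpa using prefixOf_lt ha (Nat.zero_le D)

theorem sure_nextLabel {u : ℕ → ℕ → ℕ} (h : Consistent F m st (M.withUsed u) lst q) (hM : M.Inv D)
    (hl : d ≠ 0 → x.childLabel (prefixOf D r.addr.val d % 2) =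
      M.label D q d (prefixOf D r.addr.val d)) :
    (nextLabel F st x r d).Sure m fun lab m' => m' = m ∧
      lab = M.label D q d (prefixOf D r.addr.val d) := by
  rw [nextLabel]
  split_ifs with hd
  · subst hd
    rw [prefixOf_zero r.addr.isLt]
    rcases ho : st 0 0 with _ | o
    · rw [rootLabel, ho]
      have hf := h.shape 0 (Nat.zero_le D) 0
      rw [ho] at hf
      have : M.loc 0 0 = none := Model.loc_eq_none.mpr fun j _ hk => by
        have hfj := hM.full_of_mem 0 j 0 hk
        obtain rfl := Nat.le_zero.mp (hM.full_le 0 j hfj)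
        exact Bool.false_ne_true (hf.trans hfj)
      refine Sure.pure ⟨rfl, ?_⟩
      rw [Model.label, this]
      rfl
    · rw [rootLabel, ho]
      have hf := h.shape 0 (Nat.zero_le D) 0
      rw [ho] at hf
      have hO := h.holds 0 (Nat.zero_le D) 0 o ho
      have hL := h.list 0 (Nat.zero_le D) 0 hf.symm
      have hc := hM.card_le 0 (Nat.zero_le D) 0
      refine (sure_readPos hO.perm (i := 0) ?_).bind ?_
      · rw [hO.lenP, hL.length_eq]
        simp
      · rintro p _ ⟨rfl, rfl⟩
        refine Sure.pure ⟨rfl, ?_⟩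
        have hi := keyIdx_lt (hM.root hf.symm)
        -- The only level of depth `0` has at most one key, so its index is `0`, the entry that
        -- `rootLabel` reads.
        rw [Model.label, loc_zero hM hf.symm, Option.map_some, show keyIdx (M.keys 0 0) 0 = 0 by
          simp at hc; omega]
        rfl
  · exact Sure.pure ⟨rfl, hl hd⟩

theorem obl_nextLabel (st : ℕ → Levels) (x y : Item D B) (r r' : Request D B) (d : ℕ) :
    Obl s (nextLabel F st x r d) (nextLabel F st y r' d) fun _ _ => True := by
  rw [nextLabel, nextLabel]
  split_ifs
  · rw [rootLabel]
    split
    · exact Obl.pure trivial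
    · exact Obl.bind (obl_readPos _ _) fun _ _ _ => Obl.pure trivial
  · exact Obl.pure trivial

theorem Consistent.isFetched_foundItem (h : Consistent F m st M lst q) (hM : M.Inv D) (hd : d ≤ D)
    (hlab : ∀ d < D, LabelsAt D B M lst q d) (r : Request D B) :
    IsFetched D B M q (prefixOf D r.addr.val d) d
      (foundItem D (M.item lst d (prefixOf D r.addr.val d)) (truncate r.addr d) d) := by
  have hr := h.rank_item hM hd (k := prefixOf D r.addr.val d)
  have hlt : prefixOf D r.addr.val d < 2 ^ D :=
    (prefixOf_lt r.addr.isLt hd).trans_le (Nat.pow_le_pow_right (by norm_num) hd)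
  have ht : truncate r.addr d = Fin.ofNat (2 ^ D) (prefixOf D r.addr.val d) :=
    Fin.ext (Nat.mod_eq_of_lt hlt).symm
  rw [foundItem]
  rcases hl : M.loc d (prefixOf D r.addr.val d) with _ | i
  · rw [hl] at hr
    have hnr : (M.item lst d (prefixOf D r.addr.val d)).isReal = false := by
      rw [isReal_eq, hr]
      simp
    rw [hnr, if_neg (by simp)]
    refine ⟨?_, fun hdD => ?_⟩
    · split_ifs <;> rfl
    · rw [if_pos hdD, ht, hM.label_child_eq_none hdD (by omega) hl,
        hM.label_child_eq_none hdD (by omega) hl]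
  · rw [hl] at hr
    have hr : (M.item lst d (prefixOf D r.addr.val d)).rank = prefixOf D r.addr.val d := hr
    rw [if_pos (isReal_iff.mpr (by rw [hr]; exact hlt))]
    exact ⟨hr, fun hdD => hlab d hdD _ (by rw [hl]; rfl)⟩

theorem IsFetched.storedItem (h : IsFetched D B M q (prefixOf D r.addr.val d) d x) :
    IsFetched D B M q (prefixOf D r.addr.val d) d (storedItem D x r d) := by
  rw [RecORAM.storedItem]
  split_ifs with hdD
  · exact h
  · exact ⟨rfl, fun h => absurd h hdD⟩

theorem IsFetched.childLabel (h : IsFetched D B M q (prefixOf D a d) d x) (hd : d + 1 ≤ D) :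
    x.childLabel (prefixOf D a (d + 1) % 2) = M.label D q (d + 1) (prefixOf D a (d + 1)) := by
  have hp := prefixOf_succ_div (a := a) hd
  rw [h.labels hd, Item.childLabel]
  split_ifs with h2
  · rw [show 2 * prefixOf D a d = prefixOf D a (d + 1) by omega]
  · rw [show 2 * prefixOf D a d + 1 = prefixOf D a (d + 1) by omega]

theorem FetchInv.sure {x : Item D B × Levels} (h : FetchInv F m₀ st M lst q r.addr.val d x m)
    (h₀ : Consistent F m₀ st M lst q)
    (hM : M.Inv D) (hd : d ≤ D) (hlab : ∀ d < D, LabelsAt D B M lst q d) :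
    (fetchRound F st r x d).Sure m (FetchInv F m₀ st M lst q r.addr.val (d + 1)) := by
  have hc : ∀ c ∈ headCells D st, c < m₀.next := h₀.headCells_lt
  have hf := h₀.isFetched_foundItem hM hd hlab r
  rw [fetchRound]
  refine (sure_nextLabel h.consistent hM fun h' => h.label h' hd).bind fun lab m₁' h₁' => ?_
  obtain ⟨rfl, rfl⟩ := h₁'
  refine (sure_posLookup h.consistent hM hd).bind fun y m₁ h₁ => ?_
  obtain rfl := h₁.item_eq
  refine (sure_buildSingle _).bind fun o m₂ h₂ => Sure.pure ?_
  obtain ⟨e₂, ho, q', c, hO⟩ := h₂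
  refine ⟨?_, ?_, ?_, ?_, ?_⟩
  · exact (h.ext.trans_same h₁.ext).trans_same (e₂.mono (by simp))
  · refine (h₁.consistent.ext_empty e₂).congr_used fun d' hd' j hf => ?_
    have hj := hM.full_le d' j hf
    simp only [Model.withUsed, Model.usedBefore]
    split_ifs <;> first | rfl | omega
  · exact fun _ hdD => hf.childLabel hdD
  · intro d' hd'
    by_cases hdd : d' = d
    · subst hdd
      exact ⟨o, _, q', c, by simp, hO, hf.storedItem⟩
    · obtain ⟨o', x', q'', c', ho', hO', hf'⟩ := h.fetched d' (by omega)
      refine ⟨o', x', q'', c', by simpa [hdd] using ho',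
        (hO'.ext h₁.ext fun z hz hz' => ?_).ext_empty
        e₂, hf'⟩
      -- Lookups change old head cells only, while the cells of fetched memories were reserved after
      -- `m₀`.
      have := h.low d' (by omega) o' ho' z hz
      have := hc z hz'
      omega
  · intro d' hd' o' ho' z hz
    by_cases hdd : d' = d
    · subst hdd
      obtain rfl : o = o' := by simpa using ho'
      exact (h.ext.next.trans h₁.ext.next).trans (ho z hz)
    · exact h.low d' (by omega) o' (by simpa [hdd] using ho') z hz

theorem FetchInv.rel {x x' : Item D B × Levels}
    (h : FetchInv F m₀ st M lst q r.addr.val d x m)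
    (h' : FetchInv F m₀' st M' lst' q' r'.addr.val d x' m') (hM : M.Inv D) (hM' : M'.Inv D)
    (hd : d ≤ D) (hq : ∀ j, M.full d j = true →
      q d j s (M.visit D r.addr d j) = q' d j s (M'.visit D r'.addr d j))
    (hx : x.2 = x'.2) (e : Eqv s m m') :
    Rel s (fetchRound F st r x d) m (fetchRound F st r' x' d) m'
      fun y n y' n' => Eqv s n n' ∧ y.2 = y'.2 := by
  rw [fetchRound, fetchRound]
  refine ((Rel.of_obl (obl_nextLabel st x.1 x'.1 r r' d) e).and_sure
    (sure_nextLabel h.consistent hM fun hd' => h.label hd' hd)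
    (sure_nextLabel h'.consistent hM' fun hd' => h'.label hd' hd)).bind ?_
  rintro _ _ _ _ ⟨⟨e, -⟩, ⟨rfl, rfl⟩, rfl, rfl⟩
  refine (rel_posLookup h.consistent h'.consistent hM hM' hd hq e).bind fun y n y' n' e => ?_
  refine (rel_buildSingle _ _ e).bind fun o n o' n' h => ?_
  obtain ⟨e, rfl⟩ := h
  exact Rel.pure ⟨e, by rw [hx]⟩

theorem FetchInv.zero (h : Consistent F m st M lst q) :
    FetchInv F m st M lst q a 0 (.dummy, fun _ => none) m where
  ext := .refl _ _
  consistent := h.congr_used fun d _ j _ => (if_neg (by omega)).symm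
  label h := absurd rfl h
  fetched _ h := absurd h (Nat.not_lt_zero _)
  low _ h := absurd h (Nat.not_lt_zero _)

theorem FetchInv.consistent_usedAfter {x : Item D B × Levels}
    (h : FetchInv F m₀ st M lst q a (D + 1) x m) :
    Consistent F m st (M.withUsed (M.usedAfter D a)) lst q :=
  h.consistent.congr_used fun _ hd _ _ => if_pos (.inl (Nat.lt_succ_of_le hd))

theorem sure_fetchPhase (h : Consistent F m st M lst q) (hM : M.Inv D)
    (hlab : ∀ d < D, LabelsAt D B M lst q d) (r : Request D B) :
    (fetchPhase F st r).Sure m fun y m' =>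
      ∃ x, FetchInv F m st M lst q r.addr.val (D + 1) (x, y.2) m' := by
  rw [fetchPhase_eq]
  refine (Sure.foldlM_range (FetchInv F m st M lst q r.addr.val) (.zero h)
    fun d hd x n hx => hx.sure h hM (Nat.le_of_lt_succ hd) hlab).bind fun x n hx => ?_
  exact Sure.pure ⟨x.1, hx⟩

theorem rel_fetchPhase (h : Consistent F m st M lst q) (h' : Consistent F m' st M' lst' q')
    (hM : M.Inv D) (hM' : M'.Inv D) (hlab : ∀ d < D, LabelsAt D B M lst q d)
    (hlab' : ∀ d < D, LabelsAt D B M' lst' q' d) (hq : ∀ d ≤ D, ∀ j, M.full d j = true →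
      q d j s (M.visit D r.addr d j) = q' d j s (M'.visit D r'.addr d j)) (e : Eqv s m m') :
    Rel s (fetchPhase F st r) m (fetchPhase F st r') m'
      fun y n y' n' => Eqv s n n' ∧ y.2 = y'.2 := by
  rw [fetchPhase_eq, fetchPhase_eq]
  refine (Rel.foldlM_range (fun d x n x' n' => (Eqv s n n' ∧ x.2 = x'.2) ∧
    FetchInv F m st M lst q r.addr.val d x n ∧ FetchInv F m' st M' lst' q' r'.addr.val d x' n')
    ⟨⟨e, rfl⟩, .zero h, .zero h'⟩ ?_).bind ?_
  · rintro d hd x n x' n' ⟨⟨e, hx⟩, hI, hI'⟩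
    have hd := Nat.le_of_lt_succ hd
    exact (hI.rel hI' hM hM' hd (hq d hd) hx e).and_sure (hI.sure h hM hd hlab)
      (hI'.sure h' hM' hd hlab')
  · rintro x n x' n' ⟨h, -⟩
    exact Rel.pure h

end Fetch

/-! ### The lists of the rebuilt levels and their position labels. -/

section Rebuild

variable {D B : ℕ} {M : Model} {lst lst' : ℕ → ℕ → List (Item D B)}
  {q q' : ℕ → ℕ → Fin 3 → ℕ → ℕ} {a d j k l : ℕ} {x : Item D B}

/-- The lists of the nonempty levels up to `l`. -/
def Model.lists (M : Model) (lst : ℕ → ℕ → List (Item D B)) (d l : ℕ) : List (List (Item D B)) :=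
  (List.range (l + 1)).filterMap fun j => if M.full d j = true then some (lst d j) else none

theorem Model.sum_lists (hl : ∀ j, M.full d j = true → (lst d j).length = 2 ^ j) (l : ℕ) :
    ((M.lists lst d l).map List.length).sum =
      ∑ j ∈ Finset.range (l + 1), if M.full d j = true then 2 ^ j else 0 := by
  rw [Model.lists]
  induction l + 1 with
  | zero => rfl
  | succ n ih =>
    rw [List.range_succ, List.filterMap_append, List.map_append, List.sum_append, ih,
      Finset.sum_range_succ]
    by_cases h : M.full d n = true
    · simp [h, hl n h]
    · simp [h]

theorem Model.Inv.lists_upper (hl : ∀ j, M.full d j = true → (lst d j).length = 2 ^ j) (h : l ≤ D) :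
    1 + ((M.lists lst d l).map List.length).sum ≤ 2 ^ (D + 1) := by
  rw [Model.sum_lists hl, add_comm]
  exact (sum_two_pow_lt _ _).trans (Nat.pow_le_pow_right (by norm_num) (by omega))

/-- The full levels below `l` and the fetched block already supply `2 ^ l` entries, so cutting the
compacted list to `2 ^ l` really gives this length. -/
theorem Model.Inv.lists_lower (hl : ∀ j, M.full d j = true → (lst d j).length = 2 ^ j)
    (h : ∀ j < l, M.full d j = true) : 2 ^ l ≤ 1 + ((M.lists lst d l).map List.length).sum := by
  have hs : ∀ n ≤ l,
      ∑ j ∈ Finset.range n, (if M.full d j = true then 2 ^ j else 0) + 1 = 2 ^ n := by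
    intro n hn
    induction n with
    | zero => rfl
    | succ n ih =>
      rw [Finset.sum_range_succ, if_pos (h n (by omega)), pow_succ]
      have := ih (by omega)
      omega
  rw [Model.sum_lists hl, Finset.sum_range_succ]
  have := hs l le_rfl
  omega

/-- Each level holds at most one copy of a key, and the copies come in the order of levels. The
first one, if any, is that at `loc`. -/
theorem Model.Inv.withKey_lists (hM : M.Inv D)
    (hL : ∀ j, M.full d j = true → KeyList (M.keys d j) (2 ^ j) (lst d j)) (hk : k < 2 ^ D)
    (l : ℕ) :
    withKey k (M.lists lst d l).flatten = ((List.range (l + 1)).filter fun j => k ∈ M.keys d j).map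
      fun j => (lst d j).getD (keyIdx (M.keys d j) k) .dummy := by
  rw [Model.lists]
  induction l + 1 with
  | zero => rfl
  | succ n ih =>
    rw [List.range_succ, List.filterMap_append, List.flatten_append, withKey_append, ih,
      List.filter_append, List.map_append]
    congr 1
    by_cases h : M.full d n = true
    · by_cases hkn : k ∈ M.keys d n
      · simp [h, hkn, (hL n h).withKey_of_mem hkn]
      · simp [h, hkn, (hL n h).withKey_of_not_mem hkn hk]
    · have hkn : k ∉ M.keys d n := fun hkn => h (hM.full_of_mem d n k hkn)
      simp [h, hkn, withKey_nil]

/-- The fetched block precedes all levels and hides older copies of its key; for another key the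
copy in the lowest level wins, which is the one that a lookup finds. -/
theorem Model.Inv.withKey_cons_lists (hM : M.Inv D)
    (hL : ∀ j, M.full d j = true → KeyList (M.keys d j) (2 ^ j) (lst d j)) (hk : k < 2 ^ D)
    (hl : l ≤ d) (hkS : k ∈ M.newKeys d l x.rank) :
    (withKey k ([x] ++ (M.lists lst d l).flatten)).take 1 =
      [if k = x.rank then x else M.item lst d k] := by
  rw [List.singleton_append, withKey_cons, hM.withKey_lists hL hk]
  split_ifs with h₁ h₂ h₂
  · simp
  · exact absurd h₁.symm h₂
  · exact absurd h₂.symm h₁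
  · obtain ⟨i, hi, hki⟩ := (Model.mem_newKeys.mp hkS).resolve_left h₂
    rcases hloc : M.loc d k with _ | j
    · exact absurd hki (Model.loc_eq_none.mp hloc i (by omega))
    · obtain ⟨hj, hjd, hmin⟩ := Model.loc_eq_some.mp hloc
      have hji : j ≤ i := not_lt.mp fun h => hmin i h hki
      have hf : ((List.range (l + 1)).filter fun j => k ∈ M.keys d j).head? = some j := by
        rw [List.head?_filter, List.find?_range_eq_some]
        simp
        exact ⟨hj, by omega, hmin⟩
      rw [Model.item, hloc]
      generalize (List.range (l + 1)).filter (fun j => k ∈ M.keys d j) = L at hf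
      rcases L with _ | ⟨i', L⟩
      · cases hf
      · obtain rfl : i' = j := Option.some.inj hf
        simp

/-- The rebuilt level without updates. -/
theorem Model.Inv.keyList_fresh (hM : M.Inv D) (hd : d ≤ D) (ha : a < 2 ^ D)
    (hL : ∀ j, M.full d j = true → KeyList (M.keys d j) (2 ^ j) (lst d j))
    (hx : x.rank = prefixOf D a d) (hl : l = buildLevel D M.full d) :
    KeyList (M.newKeys d l (prefixOf D a d)) (2 ^ l) (freshList l [x] (M.lists lst d l)) ∧
      ∀ k ∈ M.newKeys d l (prefixOf D a d), withKey k (freshList l [x] (M.lists lst d l)) =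
        [if k = x.rank then x else M.item lst d k] := by
  have hlt : ∀ k ∈ M.newKeys d l (prefixOf D a d), k < 2 ^ D := fun k hk =>
    (hM.newKeys_lt hd ha hk).trans_le (Nat.pow_le_pow_right (by norm_num) hd)
  have hls : ∀ t ∈ M.lists lst d l, SemiSorted t := by
    intro t ht
    obtain ⟨j, -, hj⟩ := List.mem_filterMap.mp ht
    split_ifs at hj with hf
    obtain rfl := Option.some.inj hj
    exact (hL j hf).keySorted.semiSorted
  have hS : ∀ k, k ∈ M.newKeys d l (prefixOf D a d) ↔
      k < 2 ^ D ∧ withKey k ([x] ++ (M.lists lst d l).flatten) ≠ [] := by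
    intro k
    constructor
    · intro hk
      refine ⟨hlt k hk, fun h => ?_⟩
      have := hM.withKey_cons_lists hL (hlt k hk) (hl ▸ buildLevel_le _ _ _ : l ≤ d)
        (by rwa [hx] : k ∈ M.newKeys d l x.rank)
      rw [h] at this
      simp at this
    · rintro ⟨hk, h⟩
      rw [Model.mem_newKeys]
      by_contra hc
      rw [not_or] at hc
      refine h ?_
      rw [List.singleton_append, withKey_cons, if_neg fun h => hc.1 (by rw [← h, hx]),
        hM.withKey_lists hL hk, List.map_eq_nil_iff, List.filter_eq_nil_iff]
      intro i hi
      simp only [List.mem_range] at hi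
      simpa using fun h => hc.2 ⟨i, by omega, h⟩
  have hlower : 2 ^ l ≤ [x].length + ((M.lists lst d l).map List.length).sum := by
    refine Model.Inv.lists_lower (fun j hj => (hL j hj).length_eq) fun j hj => ?_
    subst hl
    exact hM.full_of_lt hd hj
  have hcard : (M.newKeys d l (prefixOf D a d)).card ≤ 2 ^ l := by
    subst hl
    exact hM.card_newKeys_le hd ha
  obtain ⟨h₁, h₂⟩ := keyList_freshList (List.pairwise_singleton _ _) hls hS hcard hlower
  refine ⟨h₁, fun k hk => ?_⟩
  rw [h₂ k (hlt k hk)]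
  exact hM.withKey_cons_lists hL (hlt k hk) (hl ▸ buildLevel_le _ _ _) (by rwa [hx])

theorem Model.loc_step_of_mem
    (hk : k ∈ M.newKeys d (buildLevel D M.full d) (prefixOf D a d)) :
    (M.step D a).loc d k = some (buildLevel D M.full d) := by
  refine Model.loc_eq_some.mpr ⟨?_, buildLevel_le _ _ _, fun i hi => ?_⟩
  · simpa [Model.step] using hk
  · simp [Model.step, hi]

theorem Model.loc_step_of_not_mem
    (hk : k ∉ M.newKeys d (buildLevel D M.full d) (prefixOf D a d)) :
    (M.step D a).loc d k = M.loc d k := by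
  rw [Model.loc, Model.loc]
  congr 1
  funext j
  congr 1
  rw [eq_iff_iff]
  have hk' := fun i (hi : i ≤ buildLevel D M.full d) h =>
    hk (Model.mem_newKeys.mpr (.inr ⟨i, hi, h⟩))
  simp only [Model.step]
  split_ifs with h₁ h₂
  · exact ⟨fun h => absurd h (Finset.notMem_empty _), fun h => absurd h (hk' j h₁.le)⟩
  · subst h₂
    exact ⟨fun h => absurd h hk, fun h => absurd h (hk' _ le_rfl)⟩
  · rfl

theorem Model.lt_of_loc_eq_some
    (hk : k ∉ M.newKeys d (buildLevel D M.full d) (prefixOf D a d)) (h : M.loc d k = some j) :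
    buildLevel D M.full d < j := by
  by_contra hj
  exact hk (Model.mem_newKeys.mpr (.inr ⟨j, not_lt.mp hj, (Model.loc_eq_some.mp h).1⟩))

/-- A key that is not in the rebuilt level can be found only above it, where neither permutations
nor sets of keys change, so its old label stays valid. -/
theorem Model.label_step (hq : ∀ j ≠ buildLevel D M.full d, q' d j = q d j) (c : ℕ) :
    (M.step D a).label D q' d c = (labelIn D (M.newKeys d (buildLevel D M.full d) (prefixOf D a d))
      (q' d (buildLevel D M.full d)) (buildLevel D M.full d) c).or (M.label D q d c) := by
  rw [labelIn]
  split_ifs with hc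
  · rw [Model.label, Model.loc_step_of_mem hc]
    simp [Model.step]
  · rw [Option.none_or, Model.label, Model.label, Model.loc_step_of_not_mem hc]
    rcases hl : M.loc d c with _ | j
    · rfl
    · have := Model.lt_of_loc_eq_some hc hl
      rw [Option.map_some, Option.map_some, hq j (by omega)]
      simp only [Model.step]
      rw [if_neg (by omega), if_neg (by omega)]

theorem Model.Inv.updates_spec (hM : M.Inv D) (hd : d + 1 ≤ D) {S : Finset ℕ}
    {u : List (Item D B)} {p : Fin 3 → ℕ → ℕ} {n : ℕ}
    (hS : S = M.newKeys (d + 1) (buildLevel D M.full (d + 1)) (prefixOf D a (d + 1)))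
    (hu : KeyList S n u) (l : ℕ) (hk : k < 2 ^ D) :
    (withKey k (convertList l (placeList p u))).length ≤ 1 ∧
      (k ∉ M.newKeys d (buildLevel D M.full d) (prefixOf D a d) →
        withKey k (convertList l (placeList p u)) = []) := by
  rw [hu.withKey_convertList hk]
  refine ⟨by split_ifs <;> simp, fun hkS => if_neg ?_⟩
  subst hS
  rintro (h | h)
  · have := hM.parent_newKeys hd h
    rw [show 2 * k / 2 = k by omega] at this
    exact hkS this
  · have := hM.parent_newKeys hd h
    rw [show (2 * k + 1) / 2 = k by omega] at this
    exact hkS this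

/-- The entries of the rebuilt level with updates. -/
theorem Model.Inv.keyList_updated (hM : M.Inv D) (hd : d + 1 ≤ D) (ha : a < 2 ^ D)
    (hL : ∀ j, M.full d j = true → KeyList (M.keys d j) (2 ^ j) (lst d j))
    (hx : IsFetched D B M q (prefixOf D a d) d x) (hl : l = buildLevel D M.full d)
    (hlab : LabelsAt D B M lst q d) {S : Finset ℕ} {u : List (Item D B)} {n l' : ℕ}
    (hS : S = M.newKeys (d + 1) (buildLevel D M.full (d + 1)) (prefixOf D a (d + 1)))
    (hu : KeyList S n u) (hl' : l' = buildLevel D M.full (d + 1))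
    (hq : ∀ j ≠ l', q' (d + 1) j = q (d + 1) j) {t : List (Item D B)}
    (ht : t = updateList l (freshList l [x] (M.lists lst d l))
      (convertList l' (placeList (q' (d + 1) l') u))) :
    KeyList (M.newKeys d l (prefixOf D a d)) (2 ^ l) t ∧
      ∀ k ∈ M.newKeys d l (prefixOf D a d), t.getD (keyIdx (M.newKeys d l (prefixOf D a d)) k)
        .dummy = .labels (Fin.ofNat _ k) ((M.step D a).label D q' (d + 1) (2 * k))
          ((M.step D a).label D q' (d + 1) (2 * k + 1)) := by
  obtain ⟨h₁, h₂⟩ := hM.keyList_fresh (by omega) ha hL hx.rank hl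
  obtain ⟨h₃, h₄⟩ := keyList_updateList h₁
    (hu.semiSorted_convertList (q := q' (d + 1) l') (lv := l'))
    fun k hk => by
      rw [hl]
      exact hM.updates_spec hd hS hu l' hk
  rw [← ht] at h₃ h₄
  refine ⟨h₃, fun k hk => ?_⟩
  have hk' := h₃.lt k hk
  have h := h₄ k hk
  -- Fetched or taken from a level, the entry carries the old labels of its children, to which the
  -- updates are then applied.
  have hitem : (if k = x.rank then x else M.item lst d k) = .labels (Fin.ofNat _ k)
      (M.label D q (d + 1) (2 * k)) (M.label D q (d + 1) (2 * k + 1)) := by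
    split_ifs with hkx
    · rw [hx.labels (by omega), ← hx.rank, hkx]
    · refine hlab k ?_
      obtain ⟨i, hi, hki⟩ := (Model.mem_newKeys.mp hk).resolve_left fun h =>
        hkx (h.trans hx.rank.symm)
      rw [Option.isSome_iff_ne_none]
      intro hn
      exact Model.loc_eq_none.mp hn i (hi.trans (hl ▸ buildLevel_le _ _ _)) hki
  rw [h₃.withKey_of_mem hk, h₂ k hk, hu.withKey_convertList hk', hitem] at h
  subst hl'
  rw [Model.label_step hq, Model.label_step hq, ← hS]
  split_ifs at h with hc
  · refine (List.singleton_inj.mp h).trans ?_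
    simp [Item.update]
  · rw [not_or] at hc
    refine (List.singleton_inj.mp h).trans ?_
    rw [labelIn, labelIn, if_neg hc.1, if_neg hc.2, Option.none_or, Option.none_or]

/-- The entries of the rebuilt depth have the new labels of the children. -/
theorem Model.Inv.labelsAt_step (hM : M.Inv D) (hd : d + 1 ≤ D) (hl : l = buildLevel D M.full d)
    (hlab : LabelsAt D B M lst q d) (hlst : ∀ j ≠ l, lst' d j = lst d j)
    (hq : ∀ j ≠ buildLevel D M.full (d + 1), q' (d + 1) j = q (d + 1) j)
    (ht : ∀ k ∈ M.newKeys d l (prefixOf D a d),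
      (lst' d l).getD (keyIdx (M.newKeys d l (prefixOf D a d)) k) .dummy =
        .labels (Fin.ofNat _ k) ((M.step D a).label D q' (d + 1) (2 * k))
          ((M.step D a).label D q' (d + 1) (2 * k + 1))) :
    LabelsAt D B (M.step D a) lst' q' d := by
  intro k hk
  subst hl
  by_cases hkS : k ∈ M.newKeys d (buildLevel D M.full d) (prefixOf D a d)
  · rw [Model.item, Model.loc_step_of_mem hkS, ← ht k hkS]
    simp [Model.step]
  · rw [Model.loc_step_of_not_mem hkS] at hk
    -- An entry that stays put has children that stay put, by `parent_newKeys`; their labels are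
    -- unchanged.
    have hc : ∀ c, c / 2 = k → (M.step D a).label D q' (d + 1) c = M.label D q (d + 1) c := by
      rintro c rfl
      rw [Model.label_step hq, labelIn, if_neg fun h => hkS (hM.parent_newKeys hd h),
        Option.none_or]
    rw [hc _ (by omega), hc _ (by omega), ← hlab k hk, Model.item, Model.item,
      Model.loc_step_of_not_mem hkS]
    rcases hl : M.loc d k with _ | j
    · rfl
    · have := Model.lt_of_loc_eq_some hkS hl
      dsimp only
      rw [hlst j (by omega)]
      simp only [Model.step]
      rw [if_neg (by omega), if_neg (by omega)]

end Rebuild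

open Client

/-! ### The maintain phase: correctness and coupling. -/

section Maintain

variable {D B : ℕ} {F : BlockFormat D B} {s : Fin 3} {m m' m₀ m₀' : Memory F.width}
  {st st' : ℕ → Levels} {M M' : Model} {lst lst' lst₁ lst₁' : ℕ → ℕ → List (Item D B)}
  {q q' q₁ q₁' : ℕ → ℕ → Fin 3 → ℕ → ℕ} {a a' d j k l n : ℕ} {o : OTM} {fetched : Levels}
  {y y' : (ℕ → Levels) × Option Arr}

theorem forall₂_filterMap {α β γ : Type} {R : β → γ → Prop} {f : α → Option β} {g : α → Option γ}
    {L : List α} (h : ∀ a ∈ L, Option.Rel R (f a) (g a)) :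
    List.Forall₂ R (L.filterMap f) (L.filterMap g) := by
  induction L with
  | nil => exact .nil
  | cons a L ih =>
    have ih := ih fun b hb => h b (by simp [hb])
    have ha := h a (by simp)
    generalize hf : f a = u at ha
    generalize hg : g a = v at ha
    rw [List.filterMap_cons, List.filterMap_cons, hf, hg]
    cases ha with
    | none => exact ih
    | some hr => exact .cons hr ih

/-- The levels after level `l` is rebuilt. -/
def rebuiltLevels (levels : Levels) (o : OTM) (l : ℕ) : Levels := fun j =>
  if j < l then none else if j = l then some o else levels j

/-- The new memory lies in cells reserved after `m` and all older ones below `m.next`, so neither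
can contain a head cell of the other. -/
theorem Consistent.rebuild {st' : ℕ → Levels} {S : Finset ℕ} {t : List (Item D B)}
    {p : Fin 3 → ℕ → ℕ} (h : Consistent F m st M lst q) (e : m.Ext ∅ m')
    (hlow : ∀ c ∈ o.cells, m.next ≤ c) (ho : OTMHolds F m' o t p 0) (ht : KeyList S (2 ^ l) t)
    (hst : st' = Function.update st d (rebuiltLevels (st d) o l))
    (hlst : ∀ d' j, lst' d' j = if d' = d ∧ j = l then t else lst d' j)
    (hq : ∀ d' j, q' d' j = if d' = d ∧ j = l then p else q d' j)
    (hf : ∀ d' ≤ D, ∀ j, M'.full d' j =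
      if d' = d ∧ j < l then false else if d' = d ∧ j = l then true else M.full d' j)
    (hS : M'.keys d l = S) (hu : M'.used d l = 0)
    (hM : ∀ d' ≤ D, ∀ j, ¬ (d' = d ∧ j ≤ l) →
      M'.keys d' j = M.keys d' j ∧ M'.used d' j = M.used d' j) :
    Consistent F m' st' M' lst' q' := by
  have hs : ∀ d' j o', o' ∈ st' d' j →
      (d' = d ∧ j = l ∧ o' = o) ∨ (¬ (d' = d ∧ j ≤ l) ∧ o' ∈ st d' j) := by
    intro d' j o' ho'
    rw [hst] at ho'
    by_cases hd : d' = d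
    · subst hd
      rw [Function.update_self, rebuiltLevels] at ho'
      split_ifs at ho' with h₁ h₂
      · cases ho'
      · exact .inl ⟨rfl, h₂, (Option.some.inj ho').symm⟩
      · exact .inr ⟨by omega, ho'⟩
    · rw [Function.update_of_ne hd] at ho'
      exact .inr ⟨fun h => hd h.1, ho'⟩
  have hhead : ∀ o : OTM, o.dpos.cell 0 ∈ o.cells := fun o => by simp [OTM.cells]
  refine ⟨fun d' hd' j => ?_, fun d' hd' j o' ho' => ?_, ?_, fun d' hd' j hf' => ?_⟩
  · rw [hf d' hd', hst]
    by_cases hd : d' = d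
    · subst hd
      rw [Function.update_self, rebuiltLevels]
      simp only [true_and]
      split_ifs
      · rfl
      · rfl
      · exact h.shape d' hd' j
    · rw [Function.update_of_ne hd, if_neg fun h => hd h.1, if_neg fun h => hd h.1]
      exact h.shape d' hd' j
  · rw [hlst, hq]
    rcases hs d' j o' ho' with ⟨rfl, rfl, rfl⟩ | ⟨hn, ho'⟩
    · rwa [if_pos ⟨rfl, rfl⟩, if_pos ⟨rfl, rfl⟩, hu]
    · rw [if_neg (by omega), if_neg (by omega), (hM d' hd' j hn).2]
      exact (h.holds d' hd' j o' ho').ext_empty e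
  · intro d₁ hd₁ j₁ o₁ ho₁ d₂ hd₂ j₂ o₂ ho₂ hne hmem
    rcases hs d₁ j₁ o₁ ho₁ with ⟨rfl, rfl, rfl⟩ | ⟨hn, ho₁⟩ <;>
      rcases hs d₂ j₂ o₂ ho₂ with ⟨rfl, rfl, rfl⟩ | ⟨hn', ho₂⟩
    · exact hne rfl
    · exact absurd ((h.holds d₂ hd₂ j₂ o₂ ho₂).cells_lt _ hmem) (not_lt.mpr (hlow _ (hhead _)))
    · exact absurd ((h.holds d₁ hd₁ j₁ o₁ ho₁).cells_lt _ (hhead _)) (not_lt.mpr (hlow _ hmem))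
    · exact h.sep d₁ hd₁ j₁ o₁ ho₁ d₂ hd₂ j₂ o₂ ho₂ hne hmem
  · rw [hf d' hd'] at hf'
    rw [hlst]
    split_ifs at hf' with h₁ h₂
    · obtain ⟨rfl, rfl⟩ := h₂
      rw [if_pos ⟨rfl, rfl⟩, hS]
      exact ht
    · rw [if_neg h₂, (hM d' hd' j (by omega)).1]
      exact h.list d' hd' j hf'

/-- The model after the rebuilding of the depths from `n` on. -/
def Model.mix (D : ℕ) (M : Model) (a n : ℕ) : Model where
  full d j := if n ≤ d then (M.step D a).full d j else M.full d j
  keys d j := if n ≤ d then (M.step D a).keys d j else M.keys d j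
  used d j := if n ≤ d then (M.step D a).used d j else M.usedAfter D a d j

theorem Model.mix_zero (M : Model) (a : ℕ) : M.mix D a 0 = M.step D a := by
  simp [Model.mix]

variable (F) in
/-- The situation after the fetch phase. -/
structure MaintainInput (m₀ : Memory F.width) (st : ℕ → Levels) (M : Model)
    (lst : ℕ → ℕ → List (Item D B)) (q : ℕ → ℕ → Fin 3 → ℕ → ℕ) (a : ℕ) (fetched : Levels) :
    Prop where
  consistent : Consistent F m₀ st (M.withUsed (M.usedAfter D a)) lst q
  inv : M.Inv D
  addr : a < 2 ^ D
  labels : ∀ d < D, LabelsAt D B M lst q d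
  fetched : ∀ d ≤ D, ∃ f x p c, fetched d = some f ∧ OTMHolds F m₀ f [x] p c ∧
    IsFetched D B M q (prefixOf D a d) d x

variable (F) in
/-- The situation after the rebuilding of the depths from `n` on. -/
structure MaintainInv (m₀ : Memory F.width) (st : ℕ → Levels) (M : Model)
    (lst : ℕ → ℕ → List (Item D B)) (q : ℕ → ℕ → Fin 3 → ℕ → ℕ) (a n : ℕ)
    (y : (ℕ → Levels) × Option Arr) (lst' : ℕ → ℕ → List (Item D B))
    (q' : ℕ → ℕ → Fin 3 → ℕ → ℕ) (m : Memory F.width) : Prop where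
  ext : m₀.Ext ∅ m
  consistent : Consistent F m y.1 (M.mix D a n) lst' q'
  lst_eq : ∀ d j, d < n ∨ j ≠ buildLevel D M.full d → lst' d j = lst d j
  q_eq : ∀ d j, d < n ∨ j ≠ buildLevel D M.full d → q' d j = q d j
  levels_eq : ∀ d < n, y.1 d = st d
  labels : ∀ d, n ≤ d → d < D → LabelsAt D B (M.step D a) lst' q' d
  no_updates : n = D + 1 → y.2 = none
  updates : n ≠ 0 → n ≤ D → ∃ U, y.2 = some U ∧ HoldsList F m U (convertList
    (buildLevel D M.full n) (placeList (q' n (buildLevel D M.full n))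
      (lst' n (buildLevel D M.full n))))

theorem MaintainInput.lists (h : MaintainInput F m₀ st M lst q a fetched) (hd : d ≤ D) :
    List.Forall₂ (fun o l => ∃ q c, OTMHolds F m₀ o l q c)
      ((List.range (l + 1)).filterMap (st d)) (M.lists lst d l) := by
  refine forall₂_filterMap fun j _ => ?_
  have hs := h.consistent.shape d hd j
  change _ = M.full d j at hs
  rcases ho : st d j with _ | o
  · rw [ho] at hs
    rw [← hs]
    exact .none
  · rw [ho] at hs
    rw [← hs]
    exact .some ⟨_, _, h.consistent.holds d hd j o ho⟩

/-- Depth `D` has no update array; at any other depth the updates are those converted from the level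
just rebuilt at depth `d + 1`. The labels can already be stated for the new model, since depth `d +
1` is not touched any more. -/
theorem MaintainInput.shuffle (h : MaintainInput F m₀ st M lst q a fetched)
    (hI : MaintainInv F m₀ st M lst q a (d + 1) y lst' q' m) (hd : d ≤ D)
    (hl : l = buildLevel D M.full d) : ∃ f x v, fetched d = some f ∧
      ShuffleInput F m (y.1 d) f y.2 l [x] (M.lists lst d l) v ∧
      KeyList (M.newKeys d l (prefixOf D a d)) (2 ^ l) (shuffleList l [x] (M.lists lst d l) v) ∧
      (d < D → ∀ k ∈ M.newKeys d l (prefixOf D a d), (shuffleList l [x] (M.lists lst d l) v).getD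
        (keyIdx (M.newKeys d l (prefixOf D a d)) k) .dummy =
          .labels (Fin.ofNat _ k) ((M.step D a).label D q' (d + 1) (2 * k))
            ((M.step D a).label D q' (d + 1) (2 * k + 1))) := by
  obtain ⟨f, x, p, c, hf, hO, hx⟩ := h.fetched d hd
  have hL : ∀ j, M.full d j = true → KeyList (M.keys d j) (2 ^ j) (lst d j) :=
    h.consistent.list d hd
  have hle : l ≤ d := hl ▸ buildLevel_le _ _ _
  have hlevels : List.Forall₂ (fun o l => ∃ q c, OTMHolds F m o l q c)
      ((List.range (l + 1)).filterMap (y.1 d)) (M.lists lst d l) := by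
    rw [hI.levels_eq d (Nat.lt_succ_self d)]
    exact (h.lists hd).imp fun _ _ ⟨q, c, h⟩ => ⟨q, c, h.ext_empty hI.ext⟩
  have hupper : [x].length + ((M.lists lst d l).map List.length).sum ≤ 2 ^ (D + 1) :=
    Model.Inv.lists_upper (fun j hj => (hL j hj).length_eq) (by omega)
  have hlower : 2 ^ l ≤ [x].length + ((M.lists lst d l).map List.length).sum := by
    refine Model.Inv.lists_lower (fun j hj => (hL j hj).length_eq) fun j hj => ?_
    subst hl
    exact h.inv.full_of_lt hd hj
  rcases hd.lt_or_eq with hdD | rfl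
  · obtain ⟨U, hU, hUl⟩ := hI.updates (by omega) hdD
    have hu := hI.consistent.list (d + 1) hdD (buildLevel D M.full (d + 1)) (by
      simp [Model.mix, Model.step])
    have hk : (M.mix D a (d + 1)).keys (d + 1) (buildLevel D M.full (d + 1)) =
        M.newKeys (d + 1) (buildLevel D M.full (d + 1)) (prefixOf D a (d + 1)) := by
      simp [Model.mix, Model.step]
    have ht := h.inv.keyList_updated hdD h.addr hL hx hl (h.labels d hdD) hk hu rfl
      (fun j hj => hI.q_eq _ _ (.inr hj)) rfl
    refine ⟨f, x, some (convertList (buildLevel D M.full (d + 1)) (placeList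
      (q' (d + 1) (buildLevel D M.full (d + 1))) (lst' (d + 1) (buildLevel D M.full (d + 1))))), hf,
      ⟨hlevels, ⟨p, c, hO.ext_empty hI.ext⟩, ?_, hupper, hlower, by omega, ?_⟩, ht.1, fun _ => ht.2⟩
    · rw [hU]
      exact .some hUl
    · rintro v' hv'
      obtain rfl := Option.some.inj hv'
      have hln : (convertList (buildLevel D M.full (d + 1)) (placeList
          (q' (d + 1) (buildLevel D M.full (d + 1)))
          (lst' (d + 1) (buildLevel D M.full (d + 1))))).length
          = 2 ^ buildLevel D M.full (d + 1) := by
        simpa [convertList, placeList] using hu.length_eq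
      rw [hln, pow_succ, mul_two]
      have := buildLevel_le D M.full (d + 1)
      exact Nat.add_le_add (Nat.pow_le_pow_right (by norm_num) (by omega))
        (Nat.pow_le_pow_right (by norm_num) (by omega))
  · refine ⟨f, x, none, hf, ⟨hlevels, ⟨p, c, hO.ext_empty hI.ext⟩, ?_, hupper, hlower, by omega,
      by simp⟩, (h.inv.keyList_fresh hd h.addr hL hx.rank hl).1, fun h => absurd h (lt_irrefl _)⟩
    rw [hI.no_updates rfl]
    exact .none

/-- The update array for the preceding depth. -/
def nextUpdates (F : BlockFormat D B) (U : Arr) (l d : ℕ) : Client F.width (Option Arr) :=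
  if 1 ≤ d then some <$> convert F U l else pure none

/-- The rebuilding of level `l` of depth `d`. -/
@[irreducible] def rebuildRound (F : BlockFormat D B) (f : OTM) (l : ℕ)
    (y : (ℕ → Levels) × Option Arr) (d : ℕ) : Client F.width ((ℕ → Levels) × Option Arr) := do
  let r ← shuffle F (y.1 d) f y.2 l
  let u ← nextUpdates F r.2 l d
  pure (Function.update y.1 d (rebuiltLevels (y.1 d) r.1 l), u)

/-- One round of the maintain phase. -/
def maintainRound (F : BlockFormat D B) (n : ℕ) (fetched : Levels)
    (y : (ℕ → Levels) × Option Arr) (d : ℕ) : Client F.width ((ℕ → Levels) × Option Arr) :=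
  match fetched d with
  | none => pure y
  | some f => rebuildRound F f (if d < n then d else n) y d

theorem maintainPhase_eq (st : ℕ → Levels) (fetched : Levels) : maintainPhase F st fetched = (do
    let x ← (List.range (D + 1)).reverse.foldlM (maintainRound F (emptyLevel D st) fetched)
      (st, none)
    pure x.1) := by
  unfold maintainPhase
  dsimp only
  congr 2
  funext y d
  rw [maintainRound]
  rcases fetched d with _ | f
  · rfl
  · dsimp only
    rw [rebuildRound]
    congr 1
    funext r
    rcases em (1 ≤ d) with h | h
    · simp only [nextUpdates, if_pos h]
      rfl
    · simp only [nextUpdates, if_neg h]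
      rfl

theorem sure_nextUpdates {U : Arr} {t : List (Item D B)} (hU : HoldsList F m U t) (l d : ℕ) :
    (nextUpdates F U l d).Sure m fun u m' => m.Ext ∅ m' ∧
      (d ≠ 0 → ∃ V, u = some V ∧ HoldsList F m' V (convertList l t)) := by
  rw [nextUpdates]
  split_ifs with hd
  · rw [map_eq_pure_bind]
    exact (sure_convert hU l).bind fun V m' h => Sure.pure ⟨h.2.1, fun _ => ⟨V, rfl, h.2.2⟩⟩
  · exact Sure.pure ⟨.refl _ _, fun h => absurd (Nat.pos_of_ne_zero h) hd⟩

theorem obl_nextUpdates (U : Arr) (l d : ℕ) :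
    Obl s (nextUpdates F U l d) (nextUpdates F U l d) Eq := by
  rw [nextUpdates]
  split_ifs with hd
  · rw [map_eq_pure_bind]
    refine Obl.bind (obl_convert l) ?_
    rintro V _ rfl
    exact Obl.pure rfl
  · exact Obl.pure rfl

theorem emptyLevel_eq (h : ∀ j, (st D j).isSome = M.full D j) :
    emptyLevel D st = freeLevel D M.full := by
  rw [emptyLevel, freeLevel]
  congr 2
  funext j
  rw [← h j]
  cases st D j <;> rfl

theorem level_eq (d : ℕ) (full : ℕ → ℕ → Bool) :
    (if d < freeLevel D full then d else freeLevel D full) = buildLevel D full d := by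
  rw [buildLevel]
  split_ifs <;> omega

theorem MaintainInput.sure_rebuild (h : MaintainInput F m₀ st M lst q a fetched)
    (hI : MaintainInv F m₀ st M lst q a (d + 1) y lst' q' m) (hd : d ≤ D)
    (hl : l = buildLevel D M.full d) {f : OTM} {v : Option (List (Item D B))} {x : Item D B}
    (hS : ShuffleInput F m (y.1 d) f y.2 l [x] (M.lists lst d l) v)
    (hK : KeyList (M.newKeys d l (prefixOf D a d)) (2 ^ l) (shuffleList l [x] (M.lists lst d l) v))
    (hlab : d < D → ∀ k ∈ M.newKeys d l (prefixOf D a d),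
      (shuffleList l [x] (M.lists lst d l) v).getD
        (keyIdx (M.newKeys d l (prefixOf D a d)) k) .dummy =
          .labels (Fin.ofNat _ k) ((M.step D a).label D q' (d + 1) (2 * k))
            ((M.step D a).label D q' (d + 1) (2 * k + 1))) :
    (rebuildRound F f l y d).Sure m fun y' m' => m.Ext ∅ m' ∧
      ∃ lst'' q'', MaintainInv F m₀ st M lst q a d y' lst'' q'' m' := by
  generalize ht : shuffleList l [x] (M.lists lst d l) v = t at hK hlab
  rw [rebuildRound]
  refine hS.sure_shuffle.bind fun r m₁ h₁ => ?_
  obtain ⟨e₁, hlow, p, hO, hU⟩ := h₁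
  rw [ht] at hO hU
  refine (sure_nextUpdates hU l d).bind fun u m₂ h₂ => Sure.pure ?_
  obtain ⟨e₂, hu⟩ := h₂
  refine ⟨e₁.trans_same e₂, fun d' j => if d' = d ∧ j = l then t else lst' d' j,
    fun d' j => if d' = d ∧ j = l then p else q' d' j, ?_⟩
  have hne : ∀ d' j, d' < d ∨ j ≠ buildLevel D M.full d' → ¬ (d' = d ∧ j = l) := by
    rintro d' j hj ⟨rfl, rfl⟩
    omega
  have hold : ∀ d' j, d' < d ∨ j ≠ buildLevel D M.full d' →
      d' < d + 1 ∨ j ≠ buildLevel D M.full d' := fun d' j hj => by omega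
  refine ⟨(hI.ext.trans_same e₁).trans_same e₂, ?_, ?_, ?_, ?_, ?_, fun h => by omega, ?_⟩
  · refine hI.consistent.rebuild (e₁.trans_same e₂) hlow (hO.ext_empty e₂) hK rfl (fun _ _ => rfl)
      (fun _ _ => rfl) ?_ ?_ ?_ ?_
    · intro d' hd' j
      subst hl
      by_cases hdd : d' = d
      · subst hdd
        simp [Model.mix, Model.step]
      · have : d ≤ d' ↔ d + 1 ≤ d' := by omega
        simp [Model.mix, this, hdd]
    · subst hl
      simp [Model.mix, Model.step]
    · subst hl
      simp [Model.mix, Model.step]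
    · intro d' hd' j hj
      by_cases hdd : d' = d
      · subst hdd
        have hj' : l < j := by omega
        simp only [Model.mix, Model.step]
        rw [if_pos le_rfl, if_pos le_rfl, if_neg (by omega), if_neg (by omega), if_neg (by omega),
          if_neg (by omega), if_neg (by omega)]
        exact ⟨rfl, rfl⟩
      · have : d ≤ d' ↔ d + 1 ≤ d' := by omega
        simp [Model.mix, this]
  · intro d' j hj
    rw [if_neg (hne d' j hj)]
    exact hI.lst_eq d' j (hold d' j hj)
  · intro d' j hj
    rw [if_neg (hne d' j hj)]
    exact hI.q_eq d' j (hold d' j hj)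
  · intro d' hd'
    dsimp only
    rw [Function.update_of_ne (by omega)]
    exact hI.levels_eq d' (by omega)
  · intro d' hdd hd'
    rcases hdd.lt_or_eq with hdd | rfl
    · intro k hk
      have := hI.labels d' hdd hd' k hk
      simp only [Model.label, Model.item, show d' ≠ d by omega, show d' + 1 ≠ d by omega, false_and,
        if_false] at this ⊢
      exact this
    -- At depth `d` itself the new labels meet the memories of depth `d + 1`, which were rebuilt in
    -- the preceding round.
    · refine h.inv.labelsAt_step hd' hl (h.labels d hd') (fun j hj => ?_) (fun j hj => ?_) ?_
      · rw [if_neg fun h => hj h.2]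
        exact hI.lst_eq d j (by omega)
      · rw [if_neg fun h => by omega]
        exact hI.q_eq _ _ (.inr hj)
      · intro k hk
        rw [if_pos ⟨rfl, rfl⟩, hlab hd' k hk]
        simp only [Model.label, show d + 1 ≠ d by omega, false_and, if_false]
  · intro h0 _
    obtain ⟨V, hV, hV'⟩ := hu h0
    refine ⟨V, hV, ?_⟩
    rw [← hl, if_pos ⟨rfl, rfl⟩, if_pos ⟨rfl, rfl⟩]
    exact hV'

theorem MaintainInput.sure_maintainRound (h : MaintainInput F m₀ st M lst q a fetched)
    (hI : ∃ lst' q', MaintainInv F m₀ st M lst q a (d + 1) y lst' q' m) (hd : d ≤ D) :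
    (maintainRound F (freeLevel D M.full) fetched y d).Sure m fun y' m' => m.Ext ∅ m' ∧
      ∃ lst' q', MaintainInv F m₀ st M lst q a d y' lst' q' m' := by
  obtain ⟨lst', q', hI⟩ := hI
  obtain ⟨f, x, v, hf, hS, hK, hlab⟩ := h.shuffle hI hd rfl
  rw [maintainRound, hf]
  dsimp only
  rw [level_eq]
  exact h.sure_rebuild hI hd rfl hS hK hlab

/-- The places of the entries that will be visited agree for server `s`. -/
def Coupled (s : Fin 3) (D n : ℕ) (full : ℕ → ℕ → Bool) (w w' : ℕ → List ℕ) (st : ℕ → Levels)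
    {b : ℕ} (m m' : Memory b) : Prop :=
  ∀ d, n ≤ d → d ≤ D → ∀ o ∈ st d (buildLevel D full d), ∀ k (h : k < (w d).length)
    (h' : k < (w' d).length), o.P.cell (w d)[k] < m.next ∧ o.P.cell (w' d)[k] < m'.next ∧
      m.block (s - 1) ⟨s, o.P.cell (w d)[k]⟩ = m'.block (s - 1) ⟨s, o.P.cell (w' d)[k]⟩

/-- The draw for the rebuilt level is coupled along `w d` and `w' d`. The levels rebuilt before keep
their coupling, because this round writes to new cells only. -/
theorem MaintainInput.rel_rebuild {w w' : ℕ → List ℕ}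
    (h : MaintainInput F m₀ st M lst q a fetched)
    (h' : MaintainInput F m₀' st M' lst₁ q₁ a' fetched) (hfull : M.full = M'.full)
    (hI : ∃ lst' q', MaintainInv F m₀ st M lst q a (d + 1) y lst' q' m)
    (hI' : ∃ lst' q', MaintainInv F m₀' st M' lst₁ q₁ a' (d + 1) y lst' q' m') (hd : d ≤ D)
    (hw : (w d).Nodup) (hw' : (w' d).Nodup) (hwl : (w d).length = (w' d).length)
    (hwn : ∀ i ∈ w d, i < 2 * 2 ^ buildLevel D M.full d)
    (hwn' : ∀ i ∈ w' d, i < 2 * 2 ^ buildLevel D M.full d) (e : Eqv s m m')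
    (hc : Coupled s D (d + 1) M.full w w' y.1 m m') :
    Rel s (maintainRound F (freeLevel D M.full) fetched y d) m
      (maintainRound F (freeLevel D M.full) fetched y d) m' fun z n z' n' =>
        Eqv s n n' ∧ z = z' ∧ Coupled s D d M.full w w' z.1 n n' := by
  obtain ⟨lst', q', hI⟩ := hI
  obtain ⟨lst₁', q₁', hI'⟩ := hI'
  obtain ⟨f, x, v, hf, hS, -, -⟩ := h.shuffle hI hd rfl
  obtain ⟨f', x', v', hf', hS', -, -⟩ := h'.shuffle hI' hd rfl
  obtain rfl : f = f' := Option.some.inj (hf.symm.trans hf')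
  rw [maintainRound, hf]
  dsimp only
  rw [level_eq, rebuildRound]
  rw [← hfull] at hS'
  refine ((hS.rel_shuffle hS' hw hw' hwn hwn' hwl e).and_sure hS.sure_shuffle
    hS'.sure_shuffle).bind ?_
  rintro r m₁ _ m₁' ⟨⟨e, rfl, hb⟩, ⟨e₁, -, p, hO, hU⟩, e₁', -, p', hO', hU'⟩
  refine ((Rel.of_obl (obl_nextUpdates _ _ _) e).and_sure (sure_nextUpdates hU _ _)
    (sure_nextUpdates hU' _ _)).bind ?_
  rintro u m₂ _ m₂' ⟨⟨e, rfl⟩, ⟨e₂, -⟩, e₂', -⟩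
  refine Rel.pure ⟨e, rfl, ?_⟩
  have hcell : ∀ {mm : Memory F.width} {t p i}, OTMHolds F mm r.1 t p 0 → i < 2 * t.length →
      r.1.P.cell i < mm.next := fun {mm t p i} hO hi =>
    hO.cells_lt _ (by simp [OTM.cells, Arr.cell_mem (show i < r.1.P.len by rw [hO.lenP]; exact hi)])
  intro d' hdd hd' o ho k hk hk'
  rcases hdd.lt_or_eq with hdd | rfl
  · dsimp only at ho
    rw [Function.update_of_ne (by omega)] at ho
    obtain ⟨hn, hn', hb⟩ := hc d' hdd hd' o ho k hk hk'
    have e₃ := e₁.trans_same e₂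
    have e₃' := e₁'.trans_same e₂'
    refine ⟨hn.trans_le e₃.next, hn'.trans_le e₃'.next, ?_⟩
    rw [e₃.block _ _ hn (Set.notMem_empty _), e₃'.block _ _ hn' (Set.notMem_empty _), hb]
  · have ho : r.1 = o := by
      simpa [rebuiltLevels] using ho
    subst ho
    have hn := hcell hO (i := (w d)[k]) (by
      rw [length_shuffleList hS.lower]
      exact hwn _ (List.getElem_mem hk))
    have hn' := hcell hO' (i := (w' d)[k]) (by
      rw [length_shuffleList hS'.lower]
      exact hwn' _ (List.getElem_mem hk'))
    refine ⟨hn.trans_le e₂.next, hn'.trans_le e₂'.next, ?_⟩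
    rw [e₂.block _ _ hn (Set.notMem_empty _), e₂'.block _ _ hn' (Set.notMem_empty _), hb k hk hk']

theorem MaintainInput.inv_start (h : MaintainInput F m₀ st M lst q a fetched) :
    MaintainInv F m₀ st M lst q a (D + 1) (st, none) lst q m₀ := by
  refine ⟨.refl _ _, ⟨fun d hd j => ?_, fun d hd j o ho => ?_, h.consistent.sep,
    fun d hd j hf => ?_⟩,
    fun _ _ _ => rfl, fun _ _ _ => rfl, fun _ _ => rfl, fun _ _ _ => by omega, fun _ => rfl,
    fun _ _ => by omega⟩
  · simp only [Model.mix, if_neg (show ¬ D + 1 ≤ d by omega)]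
    exact h.consistent.shape d hd j
  · simp only [Model.mix, if_neg (show ¬ D + 1 ≤ d by omega)]
    exact h.consistent.holds d hd j o ho
  · simp only [Model.mix, if_neg (show ¬ D + 1 ≤ d by omega)] at hf ⊢
    exact h.consistent.list d hd j hf

theorem MaintainInput.emptyLevel_eq (h : MaintainInput F m₀ st M lst q a fetched) :
    emptyLevel D st = freeLevel D M.full :=
  RecORAM.emptyLevel_eq (h.consistent.shape D le_rfl)

theorem MaintainInput.sure_maintainPhase (h : MaintainInput F m₀ st M lst q a fetched) :
    (maintainPhase F st fetched).Sure m₀ fun st' m' =>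
      ∃ u lst' q', MaintainInv F m₀ st M lst q a 0 (st', u) lst' q' m' := by
  rw [maintainPhase_eq, h.emptyLevel_eq]
  refine (Sure.foldlM_range_reverse
    (fun n y m => ∃ lst' q', MaintainInv F m₀ st M lst q a n y lst' q' m)
    ⟨_, _, h.inv_start⟩ fun d hd y m hI => ?_).bind fun y m hI => Sure.pure ?_
  · exact (h.sure_maintainRound hI (Nat.le_of_lt_succ hd)).mono fun _ _ h => h.2
  · obtain ⟨lst', q', hI⟩ := hI
    exact ⟨y.2, lst', q', hI⟩

theorem MaintainInput.rel_maintainPhase {w w' : ℕ → List ℕ}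
    (h : MaintainInput F m₀ st M lst q a fetched)
    (h' : MaintainInput F m₀' st M' lst₁ q₁ a' fetched) (hfull : M.full = M'.full)
    (hw : ∀ d ≤ D, (w d).Nodup ∧ (w' d).Nodup ∧ (w d).length = (w' d).length ∧
      (∀ i ∈ w d, i < 2 * 2 ^ buildLevel D M.full d) ∧
      ∀ i ∈ w' d, i < 2 * 2 ^ buildLevel D M.full d) (e : Eqv s m₀ m₀') :
    Rel s (maintainPhase F st fetched) m₀ (maintainPhase F st fetched) m₀' fun z n z' n' =>
      Eqv s n n' ∧ z = z' ∧ Coupled s D 0 M.full w w' z n n' := by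
  rw [maintainPhase_eq, h.emptyLevel_eq]
  refine (Rel.foldlM_range_reverse (fun k y n y' n' => (Eqv s n n' ∧ y = y' ∧
      Coupled s D k M.full w w' y.1 n n') ∧
    (∃ lst' q', MaintainInv F m₀ st M lst q a k y lst' q' n) ∧
    ∃ lst' q', MaintainInv F m₀' st M' lst₁ q₁ a' k y' lst' q' n')
    ⟨⟨e, rfl, fun d hd hd' => by omega⟩, ⟨_, _, h.inv_start⟩, _, _, h'.inv_start⟩ ?_).bind ?_
  · rintro d hd y n _ n' ⟨⟨e, rfl, hc⟩, hI, hI'⟩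
    have hd := Nat.le_of_lt_succ hd
    obtain ⟨h₁, h₂, h₃, h₄, h₅⟩ := hw d hd
    have hs' := h'.sure_maintainRound hI' hd
    rw [← hfull] at hs'
    exact ((h.rel_rebuild h' hfull hI hI' hd h₁ h₂ h₃ h₄ h₅ e hc).and_sure
      (h.sure_maintainRound hI hd) hs').mono fun _ _ _ _ h => ⟨h.1, h.2.1.2, h.2.2.2⟩
  · rintro y n _ n' ⟨⟨e, rfl, hc⟩, -⟩
    exact Rel.pure ⟨e, rfl, hc⟩

end Maintain

open Client
open scoped ENNReal

/-! ### Sequences of requests and the view of the adversary. -/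

section Serve

variable {D B : ℕ} {F : BlockFormat D B} {s : Fin 3} {m m' : Memory F.width}
  {st : ℕ → Levels} {M M' : Model} {lst lst' : ℕ → ℕ → List (Item D B)}
  {q q' : ℕ → ℕ → Fin 3 → ℕ → ℕ} {a a' : ℕ} {as as' : List ℕ} {r r' : Request D B}

variable (F) in
/-- The situation between two requests. -/
structure ServeInv (m : Memory F.width) (st : ℕ → Levels) (M : Model)
    (lst : ℕ → ℕ → List (Item D B)) (q : ℕ → ℕ → Fin 3 → ℕ → ℕ) : Prop where
  consistent : Consistent F m st M lst q
  inv : M.Inv D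
  labels : ∀ d < D, LabelsAt D B M lst q d

/-- The permutations of server `s` agree on the entries that will be visited. -/
def Matched (s : Fin 3) (D : ℕ) (M M' : Model) (as as' : List ℕ)
    (q q' : ℕ → ℕ → Fin 3 → ℕ → ℕ) : Prop :=
  ∀ d ≤ D, ∀ j, M.full d j = true → ∀ k (h : k < (M.future D as d j).length)
    (h' : k < (M'.future D as' d j).length),
    q d j s (M.future D as d j)[k] = q' d j s (M'.future D as' d j)[k]

theorem Matched.visit (h : Matched s D M M' (a :: as) (a' :: as') q q') {d j : ℕ} (hd : d ≤ D)
    (hf : M.full d j = true) : q d j s (M.visit D a d j) = q' d j s (M'.visit D a' d j) := by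
  simpa only [Model.future, List.getElem_cons_zero] using
    h d hd j hf 0 (by simp [Model.future]) (by simp [Model.future])

theorem FetchInv.maintainInput {m₀ : Memory F.width} {x : Item D B × Levels}
    (h : FetchInv F m₀ st M lst q a (D + 1) x m) (hM : M.Inv D) (ha : a < 2 ^ D)
    (hlab : ∀ d < D, LabelsAt D B M lst q d) : MaintainInput F m st M lst q a x.2 where
  consistent := h.consistent_usedAfter
  inv := hM
  addr := ha
  labels := hlab
  fetched d hd := by
    obtain ⟨o, y, p, c, ho, hO, hy⟩ := h.fetched d (Nat.lt_succ_of_le hd)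
    exact ⟨o, y, p, c, ho, hO, hy⟩

theorem MaintainInv.serveInv {m₀ : Memory F.width} {y : (ℕ → Levels) × Option Arr}
    (h : MaintainInv F m₀ st M lst q a 0 y lst' q' m) (hM : M.Inv D) (ha : a < 2 ^ D) :
    ServeInv F m y.1 (M.step D a) lst' q' :=
  ⟨Model.mix_zero (D := D) M a ▸ h.consistent, hM.step ha,
    fun d hd => h.labels d (Nat.zero_le d) hd⟩

/-- The visited places of the rebuilt levels. -/
def Model.nextFuture (D : ℕ) (M : Model) (a : ℕ) (as : List ℕ) (d : ℕ) : List ℕ :=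
  (M.step D a).future D as d (buildLevel D M.full d)

theorem Model.Inv.nextFuture_spec (hM : M.Inv D) (ha : a < 2 ^ D) (has : ∀ b ∈ as, b < 2 ^ D)
    {d : ℕ} (hd : d ≤ D) : (M.nextFuture D a as d).Nodup ∧
      ∀ i ∈ M.nextFuture D a as d, i < 2 * 2 ^ buildLevel D M.full d := by
  have h := (hM.step ha).future_spec has hd (j := buildLevel D M.full d) (by simp [Model.step])
  exact ⟨h.1, fun i hi => (h.2 i hi).1⟩

/-- An emptied level imposes no condition. For the rebuilt level the coupling just made says that
the stored places agree. An untouched level keeps its permutations, and its list of visits loses the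
first entry. -/
theorem Matched.step {m₀ m₀' : Memory F.width} {y : (ℕ → Levels) × Option Arr}
    {u : Option Arr} {lst₁ lst₁' : ℕ → ℕ → List (Item D B)} {q₁ q₁' : ℕ → ℕ → Fin 3 → ℕ → ℕ}
    (h : Matched s D M M' (a :: as) (a' :: as') q q') (hfull : M.full = M'.full)
    (hM : M.Inv D) (hM' : M'.Inv D) (ha : a < 2 ^ D) (ha' : a' < 2 ^ D)
    (has : ∀ b ∈ as, b < 2 ^ D) (has' : ∀ b ∈ as', b < 2 ^ D)
    (hI : MaintainInv F m₀ st M lst q a 0 y lst₁ q₁ m)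
    (hI' : MaintainInv F m₀' st M' lst' q' a' 0 (y.1, u) lst₁' q₁' m')
    (hc : Coupled s D 0 M.full (M.nextFuture D a as) (M'.nextFuture D a' as') y.1 m m') :
    Matched s D (M.step D a) (M'.step D a') as as' q₁ q₁' := by
  intro d hd j hf k hk hk'
  rcases lt_trichotomy j (buildLevel D M.full d) with hj | rfl | hj
  · simp [Model.step, hj] at hf
  · have hC := (hI.serveInv hM ha).consistent
    have hC' := (hI'.serveInv hM' ha').consistent
    have hs := hC.shape d hd (buildLevel D M.full d)
    rw [hf, Option.isSome_iff_exists] at hs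
    obtain ⟨o, ho⟩ := hs
    have hO := hC.holds d hd _ o ho
    have hO' := hC'.holds d hd _ o ho
    have hl := (hC.list d hd _ hf).length_eq
    have hw' : M'.nextFuture D a' as' d =
        (M'.step D a').future D as' d (buildLevel D M.full d) := by
      rw [Model.nextFuture, hfull]
    obtain ⟨-, -, hb⟩ := hc d (Nat.zero_le d) hd o ho k hk (by rwa [hw'])
    simp only [hw'] at hb
    have hlt' := (hM'.nextFuture_spec ha' has' hd).2
    rw [hw', ← hfull] at hlt'
    refine hO.perm.eq_of_block_eq hO'.perm (hO.lenP.trans_le hO.bound) ?_ ?_ hb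
    · rw [hO.lenP, hl]
      exact (hM.nextFuture_spec ha has hd).2 _ (List.getElem_mem hk)
    · rw [hO.lenP, hl]
      exact hlt' _ (List.getElem_mem hk')
  · have hfut : M.future D (a :: as) d j =
        M.visit D a d j :: (M.step D a).future D as d j := by
      rw [Model.future, if_neg (by omega)]
    have hfut' : M'.future D (a' :: as') d j =
        M'.visit D a' d j :: (M'.step D a').future D as' d j := by
      rw [Model.future, ← hfull, if_neg (by omega)]
    have hf' : M.full d j = true := by
      simp only [Model.step] at hf
      rwa [if_neg (by omega), if_neg (by omega)] at hf
    have := h d hd j hf' (k + 1) (by rw [hfut]; simpa using hk) (by rw [hfut']; simpa using hk')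
    rw [hI.q_eq d j (.inr hj.ne'), hI'.q_eq d j (.inr (hfull ▸ hj.ne'))]
    simpa only [hfut, hfut', List.getElem_cons_succ] using this

theorem access_eq (st : ℕ → Levels) (r : Request D B) :
    (recursiveORAM F).access st r = (do
      let x ← fetchPhase F st r
      let st' ← maintainPhase F st x.2
      pure (x.1, st')) := rfl

/-- The visits of the current request are the first entries of the matched lists, which couples the
fetch phase. The rebuilt levels are coupled along `nextFuture`, the visits made by the remaining
requests. -/
theorem rel_access (h : ServeInv F m st M lst q) (h' : ServeInv F m' st M' lst' q')
    (hfull : M.full = M'.full) (hlen : as.length = as'.length) (has : ∀ b ∈ as, b < 2 ^ D)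
    (has' : ∀ b ∈ as', b < 2 ^ D)
    (hq : Matched s D M M' (r.addr.val :: as) (r'.addr.val :: as') q q') (e : Eqv s m m') :
    Rel s ((recursiveORAM F).access st r) m ((recursiveORAM F).access st r') m' fun y n y' n' =>
      Eqv s n n' ∧ y.2 = y'.2 ∧ ∃ lst₁ lst₁' q₁ q₁',
        ServeInv F n y.2 (M.step D r.addr) lst₁ q₁ ∧
        ServeInv F n' y.2 (M'.step D r'.addr) lst₁' q₁' ∧
        Matched s D (M.step D r.addr) (M'.step D r'.addr) as as' q₁ q₁' := by
  rw [access_eq, access_eq]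
  refine ((rel_fetchPhase h.consistent h'.consistent h.inv h'.inv h.labels h'.labels
    (fun d hd j hf => hq.visit hd hf) e).and_sure (sure_fetchPhase h.consistent h.inv h.labels r)
    (sure_fetchPhase h'.consistent h'.inv h'.labels r')).bind ?_
  rintro ⟨v, x⟩ m₁ ⟨v', x'⟩ m₁' ⟨⟨e, hx⟩, ⟨z, hz⟩, z', hz'⟩
  obtain rfl : x = x' := hx
  have hI := hz.maintainInput h.inv r.addr.isLt h.labels
  have hI' := hz'.maintainInput h'.inv r'.addr.isLt h'.labels
  dsimp only at hI hI' ⊢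
  refine ((hI.rel_maintainPhase hI' hfull (w := M.nextFuture D r.addr as)
    (w' := M'.nextFuture D r'.addr as') (fun d hd => ?_) e).and_sure hI.sure_maintainPhase
    hI'.sure_maintainPhase).bind ?_
  · have hs := h.inv.nextFuture_spec r.addr.isLt has hd
    have hs' := h'.inv.nextFuture_spec r'.addr.isLt has' hd
    refine ⟨hs.1, hs'.1, ?_, hs.2, hfull ▸ hs'.2⟩
    rw [Model.nextFuture, Model.nextFuture, ← hfull]
    exact Model.length_future (Model.full_step hfull _ _) hlen _ _
  · rintro st' m₂ _ m₂' ⟨⟨e, rfl, hc⟩, ⟨u, lst₁, q₁, hJ⟩, u', lst₁', q₁', hJ'⟩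
    exact Rel.pure ⟨e, rfl, lst₁, lst₁', q₁, q₁', hJ.serveInv h.inv r.addr.isLt,
      hJ'.serveInv h'.inv r'.addr.isLt, hq.step hfull h.inv h'.inv r.addr.isLt r'.addr.isLt has has'
        hJ hJ' hc⟩

/-- The trivial relation suffices for the outcomes, since `Rel` itself compares the transcripts. -/
theorem rel_serve {rs rs' : List (Request D B)} (hlen : rs.length = rs'.length)
    (h : ServeInv F m st M lst q) (h' : ServeInv F m' st M' lst' q') (hfull : M.full = M'.full)
    (hq : Matched s D M M' (rs.map fun r => r.addr.val) (rs'.map fun r => r.addr.val) q q')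
    (e : Eqv s m m') :
    Rel s ((recursiveORAM F).serve st rs) m ((recursiveORAM F).serve st rs') m'
      fun _ _ _ _ => True := by
  have hlt : ∀ rs : List (Request D B), ∀ b ∈ rs.map fun r => r.addr.val, b < 2 ^ D := by
    intro rs b hb
    obtain ⟨r, -, rfl⟩ := List.mem_map.mp hb
    exact r.addr.isLt
  induction rs generalizing rs' m m' st M M' lst lst' q q' with
  | nil =>
    obtain rfl : rs' = [] := List.length_eq_zero_iff.mp hlen.symm
    exact Rel.pure trivial
  | cons r rs ih =>
    rcases rs' with _ | ⟨r', rs'⟩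
    · simp at hlen
    · have hlen : rs.length = rs'.length := by simpa using hlen
      refine (rel_access h h' hfull (by simpa using hlen) (hlt rs) (hlt rs') hq e).bind ?_
      rintro ⟨v, st₁⟩ m₁ ⟨v', st₁'⟩ m₁' ⟨e, hst, lst₁, lst₁', q₁, q₁', h₁, h₁', hq₁⟩
      obtain rfl : st₁ = st₁' := hst
      refine (ih hlen h₁ h₁' (Model.full_step hfull _ _) hq₁ e).bind ?_
      rintro vs m₂ vs' m₂' -
      exact Rel.pure trivial

theorem serveInv_start : ServeInv F (Memory.blank F.width) (fun _ _ => none) Model.empty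
    (fun _ _ => []) (fun _ _ _ _ => 0) where
  consistent := by
    constructor <;> simp [Model.empty]
  inv := Model.inv_empty
  labels d _ k hk := by
    rw [Model.loc_eq_none.mpr fun j _ => by simp [Model.empty]] at hk
    cases hk

theorem map_apply_eq_tsum {X Y : Type} (p : PMF X) (h : X → Y) (y : Y) [DecidableEq Y] :
    p.map h y = ∑' x, p x * if h x = y then 1 else 0 := by
  rw [← tsum_map_mul p h fun z => if z = y then 1 else 0, tsum_eq_single y]
  · simp
  · intro z hz
    simp [hz]

/-- With the indicator of one transcript for both functions, the coupling gives an inequality of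
probabilities; exchanging the two sequences gives the other one. At the start all levels are empty,
so `Matched` holds vacuously. -/
theorem view_singleton (s : Fin 3) {R₀ R₁ : List (Request D B)} (h : R₀.length = R₁.length) :
    (recursiveORAM F).view {s} R₀ = (recursiveORAM F).view {s} R₁ := by
  classical
  have key : ∀ {R₀ R₁ : List (Request D B)}, R₀.length = R₁.length → ∀ t,
      (recursiveORAM F).view {s} R₀ t ≤ (recursiveORAM F).view {s} R₁ t := by
    intro R₀ R₁ h t
    rw [Scheme.view, Scheme.view, map_apply_eq_tsum, map_apply_eq_tsum,
      ← wp_eq_tsum s _ _ fun tr _ _ => if tr = t then 1 else 0,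
      ← wp_eq_tsum s _ _ fun tr _ _ => if tr = t then 1 else 0]
    refine rel_serve h serveInv_start serveInv_start rfl (fun d _ j hf => ?_) (.refl _ _) _ _
      fun _ _ _ _ _ _ => le_rfl
    cases hf
  exact PMF.ext fun t => le_antisymm (key h t) (key h.symm t)

theorem perfectlyOblivious_recursiveORAM : (recursiveORAM F).PerfectlyOblivious 1 := by
  intro A hA R₀ R₁ h
  rcases Nat.le_one_iff_eq_zero_or_eq_one.mp hA with hA | hA
  · obtain rfl := Finset.card_eq_zero.mp hA
    -- Corrupting nobody shows less than corrupting server `0`: forgetting the details of its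
    -- messages maps one view to the other.
    have hv : ∀ R : List (Request D B), (recursiveORAM F).view ∅ R =
        ((recursiveORAM F).view {0} R).map (List.map fun e =>
          e.elim (fun e => Sum.inr (e.server, e.isWrite)) Sum.inr) := by
      intro R
      rw [Scheme.view, Scheme.view, PMF.map_comp]
      congr 1
      funext r
      rw [Function.comp_apply, List.map_map]
      refine List.map_congr_left fun e _ => ?_
      rw [Function.comp_apply, observe, observe]
      split_ifs <;> first | rfl | simp_all
    rw [hv, hv, view_singleton 0 h]
  · obtain ⟨s, rfl⟩ := Finset.card_eq_one.mp hA
    exact view_singleton s h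

end Serve
end RecORAM

theorem mainTheorem6 (D B : ℕ) (F : RecORAM.BlockFormat D B) :
    (RecORAM.recursiveORAM F).PerfectlyOblivious 1 :=
  RecORAM.perfectlyOblivious_recursiveORAM
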